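/- **Model.** Algorithms are deterministic programs for the word RAM: on inputs of size $n$ (number of vertices) a word is an integer of absolute value at most $(n+2)^{\kappa}$ for a constant $\kappa$ of the algorithm (so words have $O(\log n)$ bits); arithmetic, comparison, bitwise and shift operations on words, reads, writes and tests cost one unit of time each. **APSP conjecture.** For every $\varepsilon>0$ there is a constant $c$ such that no algorithm computes all pairwise distances in every $n$-vertex directed graph with integer edge weights in $[-n^{c},n^{c}]$ and without negative cycles in time $O(n^{3-\varepsilon})$. **Partially dynamic APSP in planar graphs.** The vertex set has $N$ elements. A data structure preprocesses an undirected simple planar graph whose edge weights are integers in $\{1,\dots,N^{d}\}$, and then supports an arbitrary sequence of operations: *queries* $(a,b)$, which ask for the distance between $a$ and $b$ in the current graph (or the information that $b$ is unreachable from $a$), and *updates* of one of the following four kinds, fixed in advance: 1. insertion of an edge with a given weight (here the initial graph is edgeless; a data structure that can start from any planar graph is in particular of this form); 2. deletion of an edge; 3. increase of the weight of an edge; 4. decrease of the weight of an edge. After every update the graph must again be planar with weights in $\{1,\dots,N^{d}\}$. The *worst-case* query time $q(N)$ and update time $u(N)$ bound the time of every single query and every single update in every such sequence. **Statement.** Assume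 the APSP conjecture. Let $\varepsilon>0$, let $p\in\mathbb N$, and fix one of the four kinds of updates. Then there is a constant $d$ such that no data structure for the corresponding partially dynamic (incremental or decremental) APSP problem in planar graphs on $N$ vertices with weights in $\{1,\dots,N^{d}\}$ and preprocessing time $O(N^{p})$ has worst-case query time $q(N)$ and worst-case update time $u(N)$ with $$q(N)\cdot u(N)=O\bigl(N^{1-\varepsilon}\bigr).$$ -/

import Mathlib

open scoped Asymptotics

namespace PlanarAPSP

/-! ### Word RAM

Programs are structured word-RAM programs: finitely many registers and finitely many arrays
(the memory), all holding integer words; every elementary operation and every test costs one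
time unit. -/

/-- The memory of the machine: registers and arrays. A program mentions only finitely many
registers and arrays; array cells are addressed indirectly, through the content of registers. -/
structure State where
  reg : ℕ → ℤ
  arr : ℕ → ℤ → ℤ

/-- Overwrite register `r`. -/
def State.setReg (s : State) (r : ℕ) (v : ℤ) : State :=
  { s with reg := Function.update s.reg r v }

/-- Overwrite the cell of array `k` at address `a`. -/
def State.setArr (s : State) (k : ℕ) (a v : ℤ) : State :=
  { s with arr := Function.update s.arr k (Function.update (s.arr k) a v) }

/-- The arithmetic, comparison and bitwise word operations. -/
inductive WordOp where
  | add | sub | mul | div | mod | lt | eq | and | or | xor | shl | shr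

/-- The value of a word operation, before the check that it fits into a word. -/
def WordOp.eval : WordOp → ℤ → ℤ → ℤ
  | .add, x, y => x + y
  | .sub, x, y => x - y
  | .mul, x, y => x * y
  | .div, x, y => x / y
  | .mod, x, y => x % y
  | .lt, x, y => if x < y then 1 else 0
  | .eq, x, y => if x = y then 1 else 0
  | .and, x, y => Int.land x y
  | .or, x, y => Int.lor x y
  | .xor, x, y => Int.xor x y
  | .shl, x, y => x * 2 ^ y.toNat
  | .shr, x, y => x / 2 ^ y.toNat

/-- Programs. -/
inductive Cmd where
  | skip : Cmd
  /-- `reg r := c` -/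
  | const (r : ℕ) (c : ℤ) : Cmd
  /-- `reg r := o (reg a) (reg b)` -/
  | op (o : WordOp) (r a b : ℕ) : Cmd
  /-- `reg r := arr k (reg a)` -/
  | load (r k a : ℕ) : Cmd
  /-- `arr k (reg a) := reg b` -/
  | store (k a b : ℕ) : Cmd
  | seq (c₁ c₂ : Cmd) : Cmd
  /-- if `reg a ≠ 0` then `c₁` else `c₂` -/
  | ite (a : ℕ) (c₁ c₂ : Cmd) : Cmd
  /-- while `reg a ≠ 0` do `c` -/
  | loop (a : ℕ) (c : Cmd) : Cmd

/-- `Exec B c s s' t`: on a machine whose words are the integers of absolute value at most `B`,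
the program `c` started in state `s` halts in state `s'` after exactly `t` time units.
A run that produces a number which does not fit into a word has no result. -/
inductive Exec (B : ℤ) : Cmd → State → State → ℕ → Prop
  | skip (s : State) : Exec B .skip s s 1
  | const (r : ℕ) (c : ℤ) (s : State) (h : |c| ≤ B) :
      Exec B (.const r c) s (s.setReg r c) 1
  | op (o : WordOp) (r a b : ℕ) (s : State) (h : |o.eval (s.reg a) (s.reg b)| ≤ B) :
      Exec B (.op o r a b) s (s.setReg r (o.eval (s.reg a) (s.reg b))) 1
  | load (r k a : ℕ) (s : State) (h : |s.arr k (s.reg a)| ≤ B) :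
      Exec B (.load r k a) s (s.setReg r (s.arr k (s.reg a))) 1
  | store (k a b : ℕ) (s : State) :
      Exec B (.store k a b) s (s.setArr k (s.reg a) (s.reg b)) 1
  | seq {c₁ c₂ : Cmd} {s s' s'' : State} {t t' : ℕ}
      (h₁ : Exec B c₁ s s' t) (h₂ : Exec B c₂ s' s'' t') :
      Exec B (.seq c₁ c₂) s s'' (t + t')
  | ite_true {a : ℕ} {c₁ c₂ : Cmd} {s s' : State} {t : ℕ}
      (ha : s.reg a ≠ 0) (h : Exec B c₁ s s' t) :
      Exec B (.ite a c₁ c₂) s s' (t + 1)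
  | ite_false {a : ℕ} {c₁ c₂ : Cmd} {s s' : State} {t : ℕ}
      (ha : s.reg a = 0) (h : Exec B c₂ s s' t) :
      Exec B (.ite a c₁ c₂) s s' (t + 1)
  | loop_true {a : ℕ} {c : Cmd} {s s' s'' : State} {t t' : ℕ}
      (ha : s.reg a ≠ 0) (h₁ : Exec B c s s' t) (h₂ : Exec B (.loop a c) s' s'' t') :
      Exec B (.loop a c) s s'' (t + t' + 1)
  | loop_false {a : ℕ} {c : Cmd} {s : State} (ha : s.reg a = 0) :
      Exec B (.loop a c) s s 1

/-- The largest word for problem size `n`: words have `O(log n)` bits. -/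
def wordBound (κ n : ℕ) : ℤ := ((n : ℤ) + 2) ^ κ

/-! ### Weighted graphs and distances -/

/-- A directed graph on `n` vertices with integer edge weights; `none` means that there is
no edge. An undirected graph is a symmetric one. -/
abbrev WGraph (n : ℕ) := Fin n → Fin n → Option ℤ

namespace WGraph

variable {n : ℕ}

/-- `G.Walk i j x`: there is a walk from `i` to `j` of total weight `x`. -/
inductive Walk (G : WGraph n) : Fin n → Fin n → ℤ → Prop
  | nil (i : Fin n) : Walk G i i 0
  | cons {i j k : Fin n} {x y : ℤ} (h : G i j = some x) (w : Walk G j k y) :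
      Walk G i k (x + y)

/-- The pair `(flag, value)` is the correct answer to a query for the distance from `i` to `j`:
`flag` says whether `j` can be reached from `i`, and if so `value` is the distance. -/
def IsDistAnswer (G : WGraph n) (i j : Fin n) (flag value : ℤ) : Prop :=
  (flag = 1 ∧ IsLeast {x | G.Walk i j x} value) ∨ (flag = 0 ∧ ∀ x, ¬ G.Walk i j x)

/-- The entry of the weight matrix at address `a = i * n + j`. -/
def cell (G : WGraph n) (a : ℤ) : Option ℤ :=
  if h : 0 ≤ a ∧ a.toNat < n * n then
    G ⟨a.toNat / n, Nat.div_lt_of_lt_mul h.2⟩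
      ⟨a.toNat % n, Nat.mod_lt _ (Nat.pos_of_ne_zero fun hn => by simp [hn] at h)⟩
  else none

/-- The initial memory: `n` in register `0`, the adjacency matrix in array `0`, the weight matrix
in array `1` (row by row), and `0` everywhere else. -/
def input (G : WGraph n) : State where
  reg r := if r = 0 then n else 0
  arr k a :=
    if k = 0 then (if (G.cell a).isSome then 1 else 0)
    else if k = 1 then (G.cell a).getD 0
    else 0

/-- Replace the undirected edge (or non-edge) `{a, b}`. -/
def setEdge (G : WGraph n) (a b : Fin n) (o : Option ℤ) : WGraph n :=
  fun i j => if (i = a ∧ j = b) ∨ (i = b ∧ j = a) then o else G i j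

/-- The underlying undirected simple graph. -/
def toSimpleGraph (G : WGraph n) : SimpleGraph (Fin n) :=
  SimpleGraph.fromRel fun i j => G i j ≠ none

end WGraph

/-! ### The all-pairs shortest paths problem and the conjecture -/

/-- The inputs of static APSP: directed graphs with integer weights in `[-n ^ c, n ^ c]`
and without negative cycles. -/
def IsAPSPInstance (c : ℕ) {n : ℕ} (G : WGraph n) : Prop :=
  (∀ i j x, G i j = some x → |x| ≤ (n : ℤ) ^ c) ∧ ∀ i x, G.Walk i i x → 0 ≤ x

/-- A program solves APSP on `n`-vertex graphs with weights in `[-n ^ c, n ^ c]` in time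
`O(n ^ τ)`, on a word RAM with words of `O(log n)` bits. The answers for the pair `(i, j)` are
left at address `i * n + j` of the arrays `2` and `3`. -/
def APSPSolvableInTime (c : ℕ) (τ : ℝ) : Prop :=
  ∃ (P : Cmd) (κ : ℕ) (K : ℝ), ∀ (n : ℕ), 1 ≤ n → ∀ G : WGraph n, IsAPSPInstance c G →
    ∃ (s : State) (t : ℕ), Exec (wordBound κ n) P G.input s t ∧ (t : ℝ) ≤ K * (n : ℝ) ^ τ ∧
      ∀ i j : Fin n,
        G.IsDistAnswer i j (s.arr 2 ((i : ℤ) * n + j)) (s.arr 3 ((i : ℤ) * n + j))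

/-- The APSP conjecture: for no `ε > 0` can APSP with polynomially bounded integer weights
be solved in time `O(n ^ (3 - ε))`. -/
def APSPConjecture : Prop :=
  ∀ ε : ℝ, 0 < ε → ∃ c : ℕ, ¬ APSPSolvableInTime c (3 - ε)

/-! ### Planar graphs -/

/-- A graph is planar if it can be drawn in the plane: distinct vertices are distinct points,
edges are simple arcs between their end points, and the interior of an arc meets
neither a vertex nor the interior of the arc of another edge. -/
def IsPlanar {V : Type*} (G : SimpleGraph V) : Prop :=
  ∃ (pos : V → ℝ × ℝ) (arc : V → V → ℝ → ℝ × ℝ),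
    Function.Injective pos ∧
    (∀ u v, G.Adj u v →
      ContinuousOn (arc u v) (Set.Icc 0 1) ∧ Set.InjOn (arc u v) (Set.Icc 0 1) ∧
      arc u v 0 = pos u ∧ arc u v 1 = pos v ∧
      ∀ t ∈ Set.Ioo (0 : ℝ) 1, ∀ x, arc u v t ≠ pos x) ∧
    ∀ u v u' v', G.Adj u v → G.Adj u' v' → s(u, v) ≠ s(u', v') →
      ∀ t ∈ Set.Ioo (0 : ℝ) 1, ∀ t' ∈ Set.Ioo (0 : ℝ) 1, arc u v t ≠ arc u' v' t'

/-- An undirected planar graph on `N` vertices, without loops,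
with positive integer weights at most `N ^ d`. -/
def IsPlanarInstance (d : ℕ) {N : ℕ} (G : WGraph N) : Prop :=
  (∀ i j, G i j = G j i) ∧ (∀ i, G i i = none) ∧
  (∀ i j x, G i j = some x → 1 ≤ x ∧ x ≤ (N : ℤ) ^ d) ∧
  IsPlanar G.toSimpleGraph

/-! ### Incremental and decremental APSP in planar graphs -/

/-- The kinds of updates of the four partially dynamic problems: only edge insertions, only edge
deletions, only weight increases, or only weight decreases. -/
inductive UpdateKind where
  | insert | delete | increase | decrease

/-- Graphs from which a data structure has to be able to start. A structure for edge insertions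
is only asked to start from the edgeless graph. -/
def UpdateKind.Initial {N : ℕ} (k : UpdateKind) (G : WGraph N) : Prop :=
  match k with
  | .insert => ∀ i j, G i j = none
  | _ => True

/-- `k.Step G a b x G'`: the update of kind `k` with arguments `a`, `b`, `x` turns `G` into `G'`.
The number `x` is the new weight of the edge `{a, b}`, and `0` for a deletion. -/
def UpdateKind.Step {N : ℕ} (k : UpdateKind) (G : WGraph N) (a b : Fin N) (x : ℤ)
    (G' : WGraph N) : Prop :=
  match k with
  | .insert => G a b = none ∧ G' = G.setEdge a b (some x)
  | .delete => G a b ≠ none ∧ x = 0 ∧ G' = G.setEdge a b none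
  | .increase => (∃ y, G a b = some y ∧ y < x) ∧ G' = G.setEdge a b (some x)
  | .decrease => (∃ y, G a b = some y ∧ x < y) ∧ G' = G.setEdge a b (some x)

/-- A dynamic data structure: programs for preprocessing, for an update and for a query,
which work on the same memory, and the exponent that determines the word length. -/
structure DynAlg where
  prep : Cmd
  upd : Cmd
  qry : Cmd
  wordExp : ℕ

/-- The word bound of the machine on which the data structure runs for `N`-vertex graphs. -/
def DynAlg.bound (D : DynAlg) (N : ℕ) : ℤ := wordBound D.wordExp N

/-- The memory when the update program starts: registers `0`, `1`, `2` hold the arguments. -/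
def updateCall (s : State) (a b : ℕ) (x : ℤ) : State :=
  ((s.setReg 0 a).setReg 1 b).setReg 2 x

/-- The memory when the query program starts: registers `0`, `1` hold the two vertices. -/
def queryCall (s : State) (a b : ℕ) : State :=
  (s.setReg 0 a).setReg 1 b

/-- `D.Reach k d G s`: after preprocessing an admissible graph and then some sequence of
admissible operations, the current graph is `G` and the memory is `s`. -/
inductive DynAlg.Reach (D : DynAlg) (k : UpdateKind) (d : ℕ) {N : ℕ} :
    WGraph N → State → Prop
  | init {G : WGraph N} {s : State} {t : ℕ} (hG : IsPlanarInstance d G) (hk : k.Initial G)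
      (h : Exec (D.bound N) D.prep G.input s t) : DynAlg.Reach D k d G s
  | update {G G' : WGraph N} {s s' : State} {t : ℕ} {a b : Fin N} {x : ℤ}
      (hs : DynAlg.Reach D k d G s) (hstep : k.Step G a b x G') (hG' : IsPlanarInstance d G')
      (h : Exec (D.bound N) D.upd (updateCall s a b x) s' t) : DynAlg.Reach D k d G' s'
  | query {G : WGraph N} {s s' : State} {t : ℕ} {a b : Fin N}
      (hs : DynAlg.Reach D k d G s)
      (h : Exec (D.bound N) D.qry (queryCall s a b) s' t) : DynAlg.Reach D k d G s'

/-- `D` solves the partially dynamic APSP problem with updates of kind `k` in planar graphs on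
`N` vertices with weights at most `N ^ d`: preprocessing takes time `O(N ^ p)`, and in every
sequence of operations every single update takes time at most `u N` and every single query
takes time at most `q N` and is answered correctly (in the registers `0` and `1`). -/
def DynAlg.Solves (D : DynAlg) (k : UpdateKind) (d p : ℕ) (q u : ℕ → ℝ) : Prop :=
  (∃ K : ℝ, ∀ N : ℕ, 1 ≤ N → ∀ G : WGraph N, IsPlanarInstance d G → k.Initial G →
    ∃ (s : State) (t : ℕ), Exec (D.bound N) D.prep G.input s t ∧ (t : ℝ) ≤ K * (N : ℝ) ^ p) ∧
  (∀ N : ℕ, 1 ≤ N → ∀ (G : WGraph N) (s : State), D.Reach k d G s →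
    ∀ (a b : Fin N) (x : ℤ) (G' : WGraph N), k.Step G a b x G' → IsPlanarInstance d G' →
      ∃ (s' : State) (t : ℕ), Exec (D.bound N) D.upd (updateCall s a b x) s' t ∧
        (t : ℝ) ≤ u N) ∧
  (∀ N : ℕ, 1 ≤ N → ∀ (G : WGraph N) (s : State), D.Reach k d G s → ∀ a b : Fin N,
    ∃ (s' : State) (t : ℕ), Exec (D.bound N) D.qry (queryCall s a b) s' t ∧
      (t : ℝ) ≤ q N ∧ G.IsDistAnswer a b (s'.reg 0) (s'.reg 1))

end PlanarAPSP

namespace PlanarAPSP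

/-! ### A small language of terms on top of the word RAM -/

/-! The theorem is a reduction: a fast dynamic structure for planar graphs gives a fast (min,+)
product, and repeated squaring turns a fast product into a fast algorithm for APSP. Only
logarithmically many products of an `n × n` matrix `W` with itself are needed, so it suffices to
gain a power of `n` in each of them.

The right factor is cut into blocks with `m * w = Y` entries, where `Y` is about `n ^ (1/g)`. Each
block is represented by a planar grid on `N` vertices, and `N` is `Y` up to a logarithmic factor.
The left and right parts of the grid have edges so heavy that the best way from the source of column
`k` to row `2 * j` is down the own column and then along the row, and symmetrically on the other
side towards the target. The weights along the rows are chosen such that this costs the same for all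
`j`. The entries of the block are small corrections of the horizontal weights on the right, and they
telescope. Between the two parts, row pair `j` encodes one entry of a row of the left factor in
binary: bit `b` is passed either by a shortcut of weight 1 in the even row or by an edge of weight
`S * 2 ^ b` in the odd row. Hence the distance, divided by `S` and reduced by a known offset, is a
minimum over `j` of sums of two entries. The walk in `Gadget.walkLe` gives the upper bound. The
lower bound comes from a potential that changes by at most the weight along every edge
(`pot_horizontal`, `pot_vertical`, `le_of_walk`). Together they give `Gadget.answer`.

To process one row of the left factor only shortcuts have to be changed. With a single kind of
update they can be switched in one direction only, so all of them start in the position from which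
this kind can move them (`step_shortcut`). For the next row the updates are undone: the data
structure is simulated on a memory with two layers of time-stamped cells, where forgetting the upper
layer takes constant time (`Exec.simulate`, `runs_row`). Rolling back is legitimate because the time
bounds hold for every single operation; amortized bounds would not survive it. A row thus costs
about `m * L` updates and `w` queries, where `L` is the number of bits.

In total there are about `n ^ 2 / Y` blocks with `n` rows each, which gives `n ^ 3 / Y * (m * L * u
+ w * q)`. Choosing the shape of the blocks such that `m * u` and `w * q` are balanced makes the
last factor about the square root of `Y * u * q` (`exists_shape`). As `u * q` is at most `N ^ (1 -
ε)`, a factor of about `n ^ (ε / (2 * g))` is saved, and half of this exponent is given away to the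
logarithmic factors (`Times.grows_apspTime`). The preprocessing of all the blocks is negligible if
`g ≥ 4 * (p + 1)`. Nothing guarantees that the functions `u` and `q` can be computed, so the program
tries all the shapes with doubling time limits (`Prob.runs_product`). Finally, `n` is at most `N ^
g`, so the weights are polynomial in `N`, with exponent `g * (c + 1) + 5` (`heavy_le`); this
determines `d`.

The algorithm is written out as a word-RAM program. `Runs` is a calculus of total correctness with
time bounds for it. Numbers of size `Z` are stored, and words of size `Z ^ 20` leave room for
intermediate results. -/

@[ext] theorem State.ext' {s t : State} (h₁ : s.reg = t.reg) (h₂ : s.arr = t.arr) : s = t := by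
  cases s; cases t; simp_all

@[simp] theorem State.setReg_reg (s : State) (r : ℕ) (v : ℤ) (r' : ℕ) :
    (s.setReg r v).reg r' = if r' = r then v else s.reg r' := by
  simp [State.setReg, Function.update_apply]

@[simp] theorem State.setReg_arr (s : State) (r : ℕ) (v : ℤ) : (s.setReg r v).arr = s.arr := rfl

@[simp] theorem State.setArr_reg (s : State) (k : ℕ) (a v : ℤ) : (s.setArr k a v).reg = s.reg := rfl

@[simp] theorem State.setArr_arr (s : State) (k : ℕ) (a v : ℤ) (k' : ℕ) (a' : ℤ) :
    (s.setArr k a v).arr k' a' = if k' = k ∧ a' = a then v else s.arr k' a' := by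
  by_cases hk : k' = k
  · subst hk; simp [State.setArr, Function.update_apply]
  · simp [State.setArr, hk]

/-- The registers in which terms are evaluated. -/
def IsScratch (r : ℕ) : Prop := 50 ≤ r ∧ r < 100

instance : DecidablePred IsScratch := fun _ => inferInstanceAs (Decidable (_ ∧ _))

/-- `σ` and `s` agree except on the scratch registers. -/
def Agree (σ s : State) : Prop := (∀ r, ¬ IsScratch r → σ.reg r = s.reg r) ∧ σ.arr = s.arr

/-- Integer terms over the memory. -/
inductive Term where
  | lit (z : ℤ) | reg (r : ℕ) | bin (o : WordOp) (x y : Term) | get (k : ℕ) (x : Term)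
  | peek (k r : ℕ) | cond (c x y : Term)

namespace Term

def eval (s : State) : Term → ℤ
  | lit z => z
  | reg r => s.reg r
  | bin o x y => o.eval (x.eval s) (y.eval s)
  | get k x => s.arr k (x.eval s)
  | .peek k r => s.arr k (s.reg r)
  | cond c x y => if c.eval s ≠ 0 then x.eval s else y.eval s

/-- Evaluate a term into register `d`, using the registers from `d` on. -/
def code : Term → ℕ → Cmd
  | lit z, d => .const d z
  | reg r, d => .seq (.const d 0) (.op .add d r d)
  | bin o x y, d => .seq (x.code d) (.seq (y.code (d + 1)) (.op o d d (d + 1)))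
  | get k x, d => .seq (x.code d) (.load d k d)
  | .peek k r, d => .load d k r
  | cond c x y, d => .seq (c.code d) (.ite d (x.code d) (y.code d))

def cost : Term → ℕ
  | lit _ => 1
  | reg _ => 2
  | bin _ x y => x.cost + (y.cost + 1)
  | get _ x => x.cost + 1
  | .peek _ _ => 1
  | cond c x y => c.cost + (max x.cost y.cost + 1)

/-- The number of consecutive scratch registers used by `code`. The second operand of `bin` is
evaluated one register higher, because the first result has to be kept. -/
def depth : Term → ℕ
  | lit _ | reg _ | .peek _ _ => 1
  | bin _ x y => max x.depth (y.depth + 1)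
  | get _ x => x.depth
  | cond c x y => max c.depth (max x.depth y.depth)

/-- The value of a term over numbers of absolute value at most `Z` is at most `Z ^ deg`. -/
def deg : Term → ℕ
  | lit _ | reg _ | .peek _ _ | get _ _ => 1
  | bin .mul x y => x.deg + y.deg
  | bin .div x y => max x.deg y.deg
  | bin .mod x y => max x.deg y.deg
  | bin _ x y => max x.deg y.deg + 1
  | cond _ x y => max x.deg y.deg

/-- The largest degree of a subterm. -/
def height : Term → ℕ
  | lit _ | reg _ | .peek _ _ => 1
  | get _ x => x.height
  | bin o x y => max (deg (bin o x y)) (max x.height y.height)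
  | cond c x y => max c.height (max x.height y.height)

/-- The degree bound `abs_eval_le` is proved for these operations only. Terms need no others; the
programs of the data structure are not translated into terms and may use all of them. -/
def _root_.PlanarAPSP.WordOp.isArith : WordOp → Bool
  | .and | .or | .xor | .shl | .shr => false
  | _ => true

/-- Scratch registers must not occur in a term, since evaluation overwrites them. -/
def ok : Term → Bool
  | lit _ => true
  | reg r => decide (¬ IsScratch r)
  | bin o x y => o.isArith && x.ok && y.ok
  | get _ x => x.ok
  | .peek _ r => decide (¬ IsScratch r)
  | cond c x y => c.ok && x.ok && y.ok

/-- All the numbers read by the term are at most `Z`. -/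
def Small (Z : ℤ) (s : State) : Term → Prop
  | lit z => |z| ≤ Z
  | reg r => |s.reg r| ≤ Z
  | bin _ x y => x.Small Z s ∧ y.Small Z s
  | get k x => x.Small Z s ∧ |s.arr k (x.eval s)| ≤ Z
  | .peek k r => |s.arr k (s.reg r)| ≤ Z
  | cond c x y => c.Small Z s ∧ (c.eval s ≠ 0 → x.Small Z s) ∧ (c.eval s = 0 → y.Small Z s)

theorem one_le_deg : ∀ t : Term, 1 ≤ t.deg
  | lit _ | reg _ | .peek _ _ | get _ _ => le_rfl
  | bin o x y => by
      have := one_le_deg x; have := one_le_deg y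
      cases o <;> simp only [deg] <;> omega
  | cond c x y => by
      have := one_le_deg x
      simp only [deg]; omega

theorem deg_le_height : ∀ t : Term, t.deg ≤ t.height
  | lit _ | reg _ | .peek _ _ => le_rfl
  | get _ x => by
      have := deg_le_height x; have := one_le_deg x
      simp only [deg, height]; omega
  | bin o x y => le_max_left _ _
  | cond c x y => by
      have := deg_le_height x; have := deg_le_height y
      simp only [deg, height]; omega

/-- A sum at most doubles the larger bound, and `2 * Z ^ k ≤ Z ^ (k + 1)` because `Z ≥ 2`. Degrees
add under multiplication. Quotients and remainders are no larger than one of the operands. -/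
theorem abs_eval_le {Z : ℤ} (hZ : 2 ≤ Z) {s : State} :
    ∀ t : Term, t.ok = true → t.Small Z s → |t.eval s| ≤ Z ^ t.deg
  | lit _, _, h => by simpa [deg, eval, Small] using h
  | reg r, h, hs => by simpa [deg, eval, Small] using hs
  | get k x, h, hs => by simpa [deg, eval, Small] using hs.2
  | .peek k r, h, hs => by simpa [deg, eval, Small] using hs
  | cond c x y, h, hs => by
      simp only [ok, Bool.and_eq_true] at h
      have h1 : (1 : ℤ) ≤ Z := by omega
      simp only [eval, deg]
      split_ifs with h0
      · exact (abs_eval_le hZ x h.1.2 (hs.2.1 h0)).trans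
          (pow_le_pow_right₀ h1 (le_max_left _ _))
      · exact (abs_eval_le hZ y h.2 (hs.2.2 (by simpa using h0))).trans
          (pow_le_pow_right₀ h1 (le_max_right _ _))
  | bin o x y, h, hs => by
      simp only [ok, Bool.and_eq_true] at h
      have h1 : (1 : ℤ) ≤ Z := by omega
      have hx := abs_eval_le hZ x h.1.2 hs.1
      have hy := abs_eval_le hZ y h.2 hs.2
      have hx' := hx.trans (pow_le_pow_right₀ h1 (le_max_left x.deg y.deg))
      have hy' := hy.trans (pow_le_pow_right₀ h1 (le_max_right x.deg y.deg))
      have hm : 1 ≤ Z ^ max x.deg y.deg := one_le_pow₀ h1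
      have h2 : 2 * Z ^ max x.deg y.deg ≤ Z ^ (max x.deg y.deg + 1) := by
        rw [pow_succ, mul_comm]; gcongr
      cases o <;> simp only [WordOp.isArith, Bool.false_eq_true, false_and] at h <;>
        simp only [eval, WordOp.eval, deg]
      · exact (abs_add_le _ _).trans (by linarith)
      · exact (abs_sub _ _).trans (by linarith)
      · rw [abs_mul, pow_add]; gcongr
      · refine le_trans ?_ hx'
        exact Int.abs_ediv_le_abs _ _
      -- By convention `x % 0 = x`; this case is bounded by the first operand, the other one by the
      -- divisor.
      · by_cases hy0 : y.eval s = 0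
        · simpa [hy0] using hx'
        · rw [abs_of_nonneg (Int.emod_nonneg _ hy0)]
          exact (Int.emod_lt_abs _ hy0).le.trans hy'
      · split_ifs <;> simp <;> linarith
      · split_ifs <;> simp <;> linarith

end Term

/-- A machine whose words are the integers of absolute value at most `Z ^ K`. -/
structure Machine where
  Z : ℤ
  K : ℕ
  two_le : 2 ≤ Z

theorem Machine.pow_le (μ : Machine) {k : ℕ} (h : k ≤ μ.K) : μ.Z ^ k ≤ μ.Z ^ μ.K :=
  pow_le_pow_right₀ (by linarith [μ.two_le]) h

/-- Evaluation into register `d` touches only scratch registers from `d` on. Therefore the first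
operand of `bin` survives the evaluation of the second, and the memory still agrees with `s` in
between. The bound on the height makes every intermediate value fit into a word. -/
theorem Term.exec_code (μ : Machine) {s : State} : ∀ (t : Term) (d : ℕ) (σ : State),
    t.ok = true → t.Small μ.Z s → t.height ≤ μ.K → 50 ≤ d → d + t.depth ≤ 100 → Agree σ s →
    ∃ (σ' : State) (T : ℕ), Exec (μ.Z ^ μ.K) (t.code d) σ σ' T ∧ T ≤ t.cost ∧
      σ'.reg d = t.eval s ∧ (∀ r, r < d ∨ 100 ≤ r → σ'.reg r = σ.reg r) ∧ σ'.arr = σ.arr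
  | .lit z, d, σ, _, hs, hK, hd, hd', hA => by
      refine ⟨_, _, Exec.const d z σ (hs.trans ?_), le_rfl, by simp [eval], ?_, rfl⟩
      · simpa [height] using μ.pow_le hK
      · intro r hr; simp [depth] at hd'; simp; intro h; omega
  | .reg r, d, σ, h, hs, hK, hd, hd', hA => by
      have hr : ¬ IsScratch r := by simpa [ok] using h
      have hrd : r ≠ d := by
        rintro rfl; exact hr ⟨hd, by simp [depth] at hd'; omega⟩
      have e1 : σ.reg r = s.reg r := hA.1 r hr
      refine ⟨_, _, Exec.seq (Exec.const d 0 σ ?_) (Exec.op .add d r d _ ?_), le_rfl, ?_, ?_, rfl⟩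
      · simpa using pow_nonneg (by linarith [μ.two_le]) _
      · simp only [WordOp.eval, State.setReg_reg, hrd, if_true, if_false, add_zero, e1]
        refine le_trans hs ?_
        simpa [height] using μ.pow_le hK
      · simp [WordOp.eval, hrd, e1, eval]
      · intro r' hr'
        simp [depth] at hd'
        have : r' ≠ d := by omega
        simp [this]
  | .bin o x y, d, σ, h, hs, hK, hd, hd', hA => by
      have hval := abs_eval_le μ.two_le _ h hs
      simp only [ok, Bool.and_eq_true] at h
      simp only [height, max_le_iff] at hK
      simp only [depth] at hd'
      obtain ⟨σ1, T1, E1, c1, v1, f1, a1⟩ :=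
        exec_code μ x d σ h.1.2 hs.1 hK.2.1 hd (by omega) hA
      have hA1 : Agree σ1 s := by
        refine ⟨fun r hr => ?_, a1.trans hA.2⟩
        rw [f1 r, hA.1 r hr]
        by_contra hc
        exact hr ⟨by omega, by omega⟩
      obtain ⟨σ2, T2, E2, c2, v2, f2, a2⟩ :=
        exec_code μ y (d + 1) σ1 h.2 hs.2 hK.2.2 (by omega) (by omega) hA1
      have vd : σ2.reg d = x.eval s := by rw [f2 d (by omega), v1]
      refine ⟨_, _, Exec.seq E1 (Exec.seq E2 (Exec.op o d d (d + 1) σ2 ?_)), ?_, ?_, ?_, ?_⟩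
      · rw [vd, v2]
        exact hval.trans (μ.pow_le hK.1)
      · simp only [cost]; omega
      · simp [vd, v2, eval]
      · intro r hr
        have hy : 1 ≤ y.depth := by
          clear * -
          induction y <;> simp only [depth] <;> omega
        have : r ≠ d := by omega
        simp only [State.setReg_reg, this, if_false]
        rw [f2 r (by omega), f1 r hr]
      · exact a2.trans a1
  | .get k x, d, σ, h, hs, hK, hd, hd', hA => by
      simp only [ok] at h
      simp only [height] at hK
      simp only [depth] at hd'
      obtain ⟨σ1, T1, E1, c1, v1, f1, a1⟩ := exec_code μ x d σ h hs.1 hK hd hd' hA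
      refine ⟨_, _, Exec.seq E1 (Exec.load d k d σ1 ?_), ?_, ?_, ?_, ?_⟩
      · rw [v1, a1, hA.2]
        refine hs.2.trans ?_
        simpa using μ.pow_le ((one_le_deg x).trans ((deg_le_height x).trans hK))
      · simp only [cost]; omega
      · simp [v1, a1, hA.2, eval]
      · intro r hr
        have hy : 1 ≤ x.depth := by
          clear * -
          induction x <;> simp only [depth] <;> omega
        have : r ≠ d := by omega
        simp only [State.setReg_reg, this, if_false]
        exact f1 r hr
      · exact a1
  | .peek k r, d, σ, h, hs, hK, hd, hd', hA => by
      have hr : ¬ IsScratch r := by simpa [ok] using h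
      refine ⟨_, _, Exec.load d k r σ ?_, le_rfl, ?_, ?_, rfl⟩
      · rw [hA.1 r hr, hA.2]
        refine le_trans hs ?_
        simpa [height] using μ.pow_le hK
      · simp [hA.1 r hr, hA.2, eval]
      · intro r' hr'; simp [depth] at hd'; simp; intro h; omega
  | .cond c x y, d, σ, h, hs, hK, hd, hd', hA => by
      simp only [ok, Bool.and_eq_true] at h
      simp only [height, max_le_iff] at hK
      simp only [depth] at hd'
      obtain ⟨σ1, T1, E1, c1, v1, f1, a1⟩ :=
        exec_code μ c d σ h.1.1 hs.1 hK.1 hd (by omega) hA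
      have hA1 : Agree σ1 s := by
        refine ⟨fun r hr => ?_, a1.trans hA.2⟩
        rw [f1 r, hA.1 r hr]
        by_contra hc
        exact hr ⟨by omega, by omega⟩
      by_cases h0 : c.eval s = 0
      · obtain ⟨σ2, T2, E2, c2, v2, f2, a2⟩ :=
          exec_code μ y d σ1 h.2 (hs.2.2 h0) hK.2.2 hd (by omega) hA1
        refine ⟨σ2, _, Exec.seq E1 (Exec.ite_false (by rw [v1, h0]) E2), ?_, ?_, ?_, a2.trans a1⟩
        · simp only [cost]; omega
        · simp [eval, h0, v2]
        · intro r hr; rw [f2 r hr, f1 r hr]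
      · obtain ⟨σ2, T2, E2, c2, v2, f2, a2⟩ :=
          exec_code μ x d σ1 h.1.2 (hs.2.1 h0) hK.2.1 hd (by omega) hA1
        refine ⟨σ2, _, Exec.seq E1 (Exec.ite_true (by rw [v1]; exact h0) E2), ?_, ?_, ?_, a2.trans a1⟩
        · simp only [cost]; omega
        · simp [eval, h0, v2]
        · intro r hr; rw [f2 r hr, f1 r hr]

/-! ### Total correctness with time bounds -/

/-- Started in a state that agrees with `s` off the scratch registers, the program halts
in a state that agrees with some `s'` off the scratch registers, after at most `t` steps,
and `Q s' t` holds. -/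
def Runs (μ : Machine) (c : Cmd) (s : State) (Q : State → ℕ → Prop) : Prop :=
  ∀ σ, Agree σ s → ∃ (σ' s' : State) (T t : ℕ), Exec (μ.Z ^ μ.K) c σ σ' T ∧ T ≤ t ∧
    Agree σ' s' ∧ Q s' t

namespace Runs

variable {μ : Machine} {c c₁ c₂ : Cmd} {s : State} {Q Q' : State → ℕ → Prop}

theorem mono (h : Runs μ c s Q) (hQ : ∀ s t, Q s t → Q' s t) : Runs μ c s Q' := fun σ hσ => by
  obtain ⟨σ', s', T, t, h1, h2, h3, h4⟩ := h σ hσ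
  exact ⟨σ', s', T, t, h1, h2, h3, hQ _ _ h4⟩

/-- The rule is in continuation form: the postcondition of the first program is a statement about
the second. Proofs about programs then follow the text of the program and times add up
automatically. -/
theorem seq (h : Runs μ c₁ s fun s₁ t₁ => Runs μ c₂ s₁ fun s₂ t₂ => Q s₂ (t₁ + t₂)) :
    Runs μ (.seq c₁ c₂) s Q := fun σ hσ => by
  obtain ⟨σ1, s1, T1, t1, E1, l1, A1, h1⟩ := h σ hσ
  obtain ⟨σ2, s2, T2, t2, E2, l2, A2, h2⟩ := h1 σ1 A1
  exact ⟨σ2, s2, _, _, Exec.seq E1 E2, Nat.add_le_add l1 l2, A2, h2⟩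

theorem skip (h : Q s 1) : Runs μ .skip s Q := fun σ hσ => ⟨σ, s, 1, 1, Exec.skip σ, le_rfl, hσ, h⟩

theorem _root_.PlanarAPSP.Agree.setReg {σ s : State} (h : Agree σ s) (r : ℕ) (v : ℤ) :
    Agree (σ.setReg r v) (s.setReg r v) :=
  ⟨fun r' hr' => by simp [h.1 r' hr'], h.2⟩

theorem _root_.PlanarAPSP.Agree.setArr {σ s : State} (h : Agree σ s) (k : ℕ) (a v : ℤ) :
    Agree (σ.setArr k a v) (s.setArr k a v) :=
  ⟨fun r' hr' => by simp [h.1 r' hr'], by simp [State.setArr, h.2]⟩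

theorem const {r : ℕ} {z : ℤ} (hz : |z| ≤ μ.Z ^ μ.K) (h : Q (s.setReg r z) 1) :
    Runs μ (.const r z) s Q := fun σ hσ =>
  ⟨_, _, 1, 1, Exec.const r z σ hz, le_rfl, hσ.setReg r z, h⟩

theorem op {o : WordOp} {r a b : ℕ} (ha : ¬ IsScratch a) (hb : ¬ IsScratch b)
    (hz : |o.eval (s.reg a) (s.reg b)| ≤ μ.Z ^ μ.K)
    (h : Q (s.setReg r (o.eval (s.reg a) (s.reg b))) 1) : Runs μ (.op o r a b) s Q := fun σ hσ =>
  ⟨_, _, 1, 1, Exec.op o r a b σ (by rwa [hσ.1 a ha, hσ.1 b hb]), le_rfl, hσ.setReg r _,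
    by rwa [hσ.1 a ha, hσ.1 b hb]⟩

theorem store {k a b : ℕ} (ha : ¬ IsScratch a) (hb : ¬ IsScratch b)
    (h : Q (s.setArr k (s.reg a) (s.reg b)) 1) : Runs μ (.store k a b) s Q := fun σ hσ =>
  ⟨_, _, 1, 1, Exec.store k a b σ, le_rfl, hσ.setArr k _ _, by rwa [hσ.1 a ha, hσ.1 b hb]⟩

theorem ite {a : ℕ} (ha : ¬ IsScratch a)
    (h1 : s.reg a ≠ 0 → Runs μ c₁ s fun s' t => Q s' (t + 1))
    (h2 : s.reg a = 0 → Runs μ c₂ s fun s' t => Q s' (t + 1)) :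
    Runs μ (.ite a c₁ c₂) s Q := fun σ hσ => by
  by_cases h0 : s.reg a = 0
  · obtain ⟨σ1, s1, T1, t1, E1, l1, A1, q⟩ := h2 h0 σ hσ
    exact ⟨σ1, s1, _, _, Exec.ite_false (by rw [hσ.1 a ha, h0]) E1, by omega, A1, q⟩
  · obtain ⟨σ1, s1, T1, t1, E1, l1, A1, q⟩ := h1 h0 σ hσ
    exact ⟨σ1, s1, _, _, Exec.ite_true (by rwa [hσ.1 a ha]) E1, by omega, A1, q⟩

theorem loop_false {a : ℕ} (ha : ¬ IsScratch a) (h0 : s.reg a = 0) (h : Q s 1) :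
    Runs μ (.loop a c) s Q := fun σ hσ =>
  ⟨σ, s, _, _, Exec.loop_false (by rw [hσ.1 a ha, h0]), le_rfl, hσ, h⟩

end Runs

/-- `reg r := e` -/
def Cmd.set (r : ℕ) (e : Term) : Cmd := .seq (e.code 50) (.seq (.const 51 0) (.op .add r 50 51))

/-- `arr k (e₁) := e₂` -/
def Cmd.put (k : ℕ) (e₁ e₂ : Term) : Cmd :=
  .seq (e₁.code 50) (.seq (e₂.code 51) (.store k 50 51))

def Cmd.iff (e : Term) (c₁ c₂ : Cmd) : Cmd := .seq (e.code 50) (.ite 50 c₁ c₂)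

def Cmd.whileDo (e : Term) (c : Cmd) : Cmd := .seq (e.code 50) (.loop 50 (.seq c (e.code 50)))

/-- The term can be evaluated on the machine. -/
def Term.Good (μ : Machine) (e : Term) : Prop := e.ok = true ∧ e.height ≤ μ.K ∧ e.depth ≤ 49

theorem agree_of_exec_code {s σ σ' : State} {d : ℕ} (hd : 50 ≤ d) (hA : Agree σ s)
    (f : ∀ r, r < d ∨ 100 ≤ r → σ'.reg r = σ.reg r) (a : σ'.arr = σ.arr) : Agree σ' s := by
  refine ⟨fun r hr => ?_, a.trans hA.2⟩
  rw [f r, hA.1 r hr]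
  by_contra hc
  exact hr ⟨by omega, by omega⟩

namespace Runs

variable {μ : Machine} {c c₁ c₂ : Cmd} {s : State} {Q Q' : State → ℕ → Prop} {e e₁ e₂ : Term}

theorem set {r : ℕ} (he : e.Good μ) (hs : e.Small μ.Z s)
    (h : Q (s.setReg r (e.eval s)) (e.cost + 2)) : Runs μ (.set r e) s Q := fun σ hσ => by
  obtain ⟨σ1, T1, E1, c1, v1, f1, a1⟩ :=
    e.exec_code μ 50 σ he.1 hs he.2.1 le_rfl (by have := he.2.2; omega) hσ
  have A1 := agree_of_exec_code le_rfl hσ f1 a1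
  refine ⟨_, _, _, _, Exec.seq E1 (Exec.seq (Exec.const 51 0 σ1 ?_) (Exec.op .add r 50 51 _ ?_)),
    Nat.add_le_add_right c1 2, ?_, h⟩
  · simpa using pow_nonneg (by linarith [μ.two_le]) _
  · simp only [WordOp.eval, State.setReg_reg, if_true, add_zero, v1]
    simpa using (e.abs_eval_le μ.two_le he.1 hs).trans (μ.pow_le (e.deg_le_height.trans he.2.1))
  · refine ⟨fun r' hr' => ?_, A1.2⟩
    have : r' ≠ 51 := by rintro rfl; exact hr' ⟨by omega, by omega⟩
    simp [WordOp.eval, v1, this, A1.1 r' hr']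

theorem put {k : ℕ} (he₁ : e₁.Good μ) (hs₁ : e₁.Small μ.Z s) (he₂ : e₂.Good μ)
    (hs₂ : e₂.Small μ.Z s)
    (h : Q (s.setArr k (e₁.eval s) (e₂.eval s)) (e₁.cost + (e₂.cost + 1))) :
    Runs μ (.put k e₁ e₂) s Q := fun σ hσ => by
  obtain ⟨σ1, T1, E1, c1, v1, f1, a1⟩ :=
    e₁.exec_code μ 50 σ he₁.1 hs₁ he₁.2.1 le_rfl (by have := he₁.2.2; omega) hσ
  have A1 := agree_of_exec_code le_rfl hσ f1 a1
  obtain ⟨σ2, T2, E2, c2, v2, f2, a2⟩ :=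
    e₂.exec_code μ 51 σ1 he₂.1 hs₂ he₂.2.1 (by omega) (by have := he₂.2.2; omega) A1
  have A2 := agree_of_exec_code (by omega) A1 f2 a2
  refine ⟨_, _, _, _, Exec.seq E1 (Exec.seq E2 (Exec.store k 50 51 σ2)), by omega, ?_, h⟩
  rw [v2, f2 50 (by omega), v1]
  exact A2.setArr _ _ _

theorem iff (he : e.Good μ) (hs : e.Small μ.Z s)
    (h1 : e.eval s ≠ 0 → Runs μ c₁ s fun s' t => Q s' (t + e.cost + 1))
    (h2 : e.eval s = 0 → Runs μ c₂ s fun s' t => Q s' (t + e.cost + 1)) :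
    Runs μ (.iff e c₁ c₂) s Q := fun σ hσ => by
  obtain ⟨σ1, T1, E1, l1, v1, f1, a1⟩ :=
    e.exec_code μ 50 σ he.1 hs he.2.1 le_rfl (by have := he.2.2; omega) hσ
  have A1 := agree_of_exec_code le_rfl hσ f1 a1
  by_cases h0 : e.eval s = 0
  · obtain ⟨σ2, s2, T2, t2, E2, l2, A2, q⟩ := h2 h0 σ1 A1
    exact ⟨σ2, s2, _, _, Exec.seq E1 (Exec.ite_false (by rw [v1, h0]) E2), by omega, A2, q⟩
  · obtain ⟨σ2, s2, T2, t2, E2, l2, A2, q⟩ := h1 h0 σ1 A1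
    exact ⟨σ2, s2, _, _, Exec.seq E1 (Exec.ite_true (by rwa [v1]) E2), by omega, A2, q⟩

/-- The rule for loops: `I k s τ` says that at most `k` rounds are left after time `τ`. -/
theorem while_aux (he : e.Good μ) (I : ℕ → State → ℕ → Prop)
    (hs : ∀ k s τ, I k s τ → e.Small μ.Z s)
    (h0 : ∀ s τ, I 0 s τ → e.eval s = 0)
    (hstep : ∀ k s τ, I (k + 1) s τ → e.eval s ≠ 0 →
      Runs μ c s fun s' t => ∃ k' ≤ k, I k' s' (τ + t + e.cost + 1))
    (hQ : ∀ k s τ, I k s τ → e.eval s = 0 → Q s (τ + 1)) :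
    ∀ k s τ τ₀ σ, I k s (τ₀ + τ) → Agree σ s → σ.reg 50 = e.eval s →
      ∃ (σ' s' : State) (T t : ℕ), Exec (μ.Z ^ μ.K) (.loop 50 (.seq c (e.code 50))) σ σ' T ∧
        τ + T ≤ t ∧ Agree σ' s' ∧ Q s' (τ₀ + t) := by
  intro k
  induction k using Nat.strong_induction_on with
  | _ k ih =>
  intro s τ τ₀ σ hI hA hv
  by_cases hz : e.eval s = 0
  · exact ⟨σ, s, 1, τ + 1, Exec.loop_false (by rw [hv, hz]), le_rfl, hA, hQ k s _ hI hz⟩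
  cases k with
  | zero => exact absurd (h0 _ _ hI) hz
  | succ k =>
    obtain ⟨σ1, s1, T1, t1, E1, l1, A1, k', hk', I1⟩ := hstep k s _ hI hz σ hA
    obtain ⟨σ2, T2, E2, l2, v2, f2, a2⟩ :=
      e.exec_code μ 50 σ1 he.1 (hs _ _ _ I1) he.2.1 le_rfl (by have := he.2.2; omega) A1
    have A2 := agree_of_exec_code le_rfl A1 f2 a2
    obtain ⟨σ3, s3, T3, t3, E3, l3, A3, q3⟩ :=
      ih k' (by omega) s1 (τ + t1 + e.cost + 1) τ₀ σ2
        (by rw [show τ₀ + (τ + t1 + e.cost + 1) = τ₀ + τ + t1 + e.cost + 1 by ring]; exact I1) A2 v2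
    exact ⟨σ3, s3, _, t3, Exec.loop_true (by rwa [hv]) (Exec.seq E1 E2) E3, by omega, A3, q3⟩

/-- The test is evaluated once before the loop and then at the end of every round, which is why the
invariant starts at time `e.cost`. Termination comes from the number `k` of remaining rounds. -/
theorem whileDo (he : e.Good μ) (I : ℕ → State → ℕ → Prop) (k : ℕ)
    (hs : ∀ k s τ, I k s τ → e.Small μ.Z s)
    (h0 : ∀ s τ, I 0 s τ → e.eval s = 0)
    (hstep : ∀ k s τ, I (k + 1) s τ → e.eval s ≠ 0 →
      Runs μ c s fun s' t => ∃ k' ≤ k, I k' s' (τ + t + e.cost + 1))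
    (hI : I k s e.cost)
    (hQ : ∀ k s τ, I k s τ → e.eval s = 0 → Q s (τ + 1)) :
    Runs μ (.whileDo e c) s Q := fun σ hσ => by
  obtain ⟨σ1, T1, E1, l1, v1, f1, a1⟩ :=
    e.exec_code μ 50 σ he.1 (hs _ _ _ hI) he.2.1 le_rfl (by have := he.2.2; omega) hσ
  have A1 := agree_of_exec_code le_rfl hσ f1 a1
  obtain ⟨σ2, s2, T2, t2, E2, l2, A2, q⟩ :=
    while_aux he I hs h0 hstep hQ k s 0 e.cost σ1 (by simpa using hI) A1 v1
  exact ⟨σ2, s2, _, e.cost + t2, Exec.seq E1 E2, by omega, A2, q⟩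

end Runs

/-! ### What a program leaves unchanged -/

/-- The registers that a program may overwrite. -/
def Cmd.writes : Cmd → ℕ → Prop
  | .skip, _ => False
  | .const r _, x => x = r
  | .op _ r _ _, x => x = r
  | .load r _ _, x => x = r
  | .store _ _ _, _ => False
  | .seq c₁ c₂, x => c₁.writes x ∨ c₂.writes x
  | .ite _ c₁ c₂, x => c₁.writes x ∨ c₂.writes x
  | .loop _ c, x => c.writes x

/-- The arrays that a program may change. -/
def Cmd.stores : Cmd → ℕ → Prop
  | .skip, _ => False
  | .const _ _, _ => False
  | .op _ _ _ _, _ => False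
  | .load _ _ _, _ => False
  | .store k _ _, x => x = k
  | .seq c₁ c₂, x => c₁.stores x ∨ c₂.stores x
  | .ite _ c₁ c₂, x => c₁.stores x ∨ c₂.stores x
  | .loop _ c, x => c.stores x

theorem Exec.reg_eq {B : ℤ} {c : Cmd} {s s' : State} {t : ℕ} (h : Exec B c s s' t) {r : ℕ}
    (hr : ¬ c.writes r) : s'.reg r = s.reg r := by
  induction h with
  | skip | store => rfl
  | const | op | load => simp only [Cmd.writes] at hr; simp [hr]
  | seq _ _ ih1 ih2 =>
    simp only [Cmd.writes, not_or] at hr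
    rw [ih2 hr.2, ih1 hr.1]
  | ite_true _ _ ih => simp only [Cmd.writes, not_or] at hr; exact ih hr.1
  | ite_false _ _ ih => simp only [Cmd.writes, not_or] at hr; exact ih hr.2
  | loop_true _ _ _ ih1 ih2 => rw [ih2 hr, ih1 hr]
  | loop_false => rfl

theorem Exec.arr_eq {B : ℤ} {c : Cmd} {s s' : State} {t : ℕ} (h : Exec B c s s' t) {k : ℕ}
    (hk : ¬ c.stores k) : s'.arr k = s.arr k := by
  induction h with
  | skip | const | op | load => rfl
  | store k' =>
    simp only [Cmd.stores] at hk
    funext a; simp [hk]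
  | seq _ _ ih1 ih2 =>
    simp only [Cmd.stores, not_or] at hk
    rw [ih2 hk.2, ih1 hk.1]
  | ite_true _ _ ih => simp only [Cmd.stores, not_or] at hk; exact ih hk.1
  | ite_false _ _ ih => simp only [Cmd.stores, not_or] at hk; exact ih hk.2
  | loop_true _ _ _ ih1 ih2 => rw [ih2 hk, ih1 hk]
  | loop_false => rfl

/-- `s'` has the same contents as `s`, where the program `c` does not write. -/
def Frame (c : Cmd) (s s' : State) : Prop :=
  (∀ r, ¬ IsScratch r → ¬ c.writes r → s'.reg r = s.reg r) ∧
  ∀ k, ¬ c.stores k → s'.arr k = s.arr k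

/-- Whatever the text of a program cannot overwrite is preserved. This is added to any postcondition
afterwards, so specifications need not list it. -/
theorem Runs.frame {μ : Machine} {c : Cmd} {s : State} {Q : State → ℕ → Prop} (h : Runs μ c s Q) :
    Runs μ c s fun s' t => Q s' t ∧ Frame c s s' := fun σ hσ => by
  obtain ⟨σ', s', T, t, h1, h2, h3, h4⟩ := h σ hσ
  refine ⟨σ', s', T, t, h1, h2, h3, h4, fun r hr hw => ?_, fun k hk => ?_⟩
  · rw [← h3.1 r hr, h1.reg_eq hw, hσ.1 r hr]
  · rw [← h3.2, h1.arr_eq hk, hσ.2]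

theorem Term.not_writes_code {r : ℕ} (hr : ¬ IsScratch r) : ∀ (e : Term) (d : ℕ), 50 ≤ d →
    d + e.depth ≤ 100 → ¬ (e.code d).writes r := by
  intro e
  have hne : ∀ d, 50 ≤ d → d < 100 → r ≠ d := by
    rintro d h1 h2 rfl; exact hr ⟨h1, h2⟩
  induction e with
  | lit | reg | peek => intro d h1 h2; simp only [depth] at h2; simp [code, Cmd.writes, hne d h1 (by omega)]
  | bin o x y ihx ihy =>
    intro d h1 h2
    simp only [depth] at h2
    simp only [code, Cmd.writes, not_or]
    have hy : 1 ≤ y.depth := by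
      clear * -
      induction y <;> simp only [depth] <;> omega
    exact ⟨ihx d h1 (by omega), ihy (d + 1) (by omega) (by omega), hne d h1 (by omega)⟩
  | get k x ih =>
    intro d h1 h2
    simp only [depth] at h2
    simp only [code, Cmd.writes, not_or]
    have hy : 1 ≤ x.depth := by
      clear * -
      induction x <;> simp only [depth] <;> omega
    exact ⟨ih d h1 (by omega), hne d h1 (by omega)⟩
  | cond c x y ihc ihx ihy =>
    intro d h1 h2
    simp only [depth] at h2
    simp only [code, Cmd.writes, not_or]
    exact ⟨ihc d h1 (by omega), ihx d h1 (by omega), ihy d h1 (by omega)⟩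

theorem Term.not_stores_code (k : ℕ) (e : Term) : ∀ d : ℕ, ¬ (e.code d).stores k := by
  induction e <;> intro d <;> simp_all [code, Cmd.stores]

/-! ### Simulating a data structure, with the possibility to undo changes of its memory

Register `r` of the data structure is kept in register `100 + 2 * r`. Its array `k` is kept in
two layers. The cell `a` of the lower layer is valid if its stamp is the content of register `24`,
the cell `a` of the upper layer is valid if its stamp is the content of register `25`. Increasing
register `25` undoes all the changes in the upper layer. Register `26` counts the
simulated steps. -/

/-- The program mentions only registers below `R`. -/
def Cmd.Below (R : ℕ) : Cmd → Prop
  | .skip => True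
  | .const r _ => r < R
  | .op _ r a b => r < R ∧ a < R ∧ b < R
  | .load r _ a => r < R ∧ a < R
  | .store _ a b => a < R ∧ b < R
  | .seq c₁ c₂ => c₁.Below R ∧ c₂.Below R
  | .ite a c₁ c₂ => a < R ∧ c₁.Below R ∧ c₂.Below R
  | .loop a c => a < R ∧ c.Below R

theorem Cmd.Below.mono {R R' : ℕ} (h : R ≤ R') : ∀ {c : Cmd}, c.Below R → c.Below R'
  | .skip, _ => trivial
  | .const _ _, hc => lt_of_lt_of_le hc h
  | .op _ _ _ _, hc => ⟨hc.1.trans_le h, hc.2.1.trans_le h, hc.2.2.trans_le h⟩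
  | .load _ _ _, hc => ⟨hc.1.trans_le h, hc.2.trans_le h⟩
  | .store _ _ _, hc => ⟨hc.1.trans_le h, hc.2.trans_le h⟩
  | .seq _ _, hc => ⟨hc.1.mono h, hc.2.mono h⟩
  | .ite _ _ _, hc => ⟨hc.1.trans_le h, hc.2.1.mono h, hc.2.2.mono h⟩
  | .loop _ _, hc => ⟨hc.1.trans_le h, hc.2.mono h⟩

theorem Cmd.exists_below (c : Cmd) : ∃ R, c.Below R := by
  induction c with
  | skip => exact ⟨0, trivial⟩
  | const r z => exact ⟨r + 1, Nat.lt_succ_self r⟩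
  | op o r a b => exact ⟨r + a + b + 1, by omega, by omega, by omega⟩
  | load r k a => exact ⟨r + a + 1, by omega, by omega⟩
  | store k a b => exact ⟨a + b + 1, by omega, by omega⟩
  | seq c₁ c₂ h₁ h₂ =>
    obtain ⟨R₁, h₁⟩ := h₁; obtain ⟨R₂, h₂⟩ := h₂
    exact ⟨max R₁ R₂, h₁.mono (le_max_left _ _), h₂.mono (le_max_right _ _)⟩
  | ite a c₁ c₂ h₁ h₂ =>
    obtain ⟨R₁, h₁⟩ := h₁; obtain ⟨R₂, h₂⟩ := h₂
    exact ⟨max (a + 1) (max R₁ R₂), by omega, h₁.mono (by omega), h₂.mono (by omega)⟩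
  | loop a c h =>
    obtain ⟨R, h⟩ := h
    exact ⟨max (a + 1) R, by omega, h.mono (by omega)⟩

/-- The data structure's memory in the lower layer. -/
def baseMem (h : State) (k : ℕ) (a : ℤ) : ℤ :=
  if h.arr (11 + 4 * k) a = h.reg 24 then h.arr (10 + 4 * k) a else 0

/-- The data structure's memory in both layers. -/
def topMem (h : State) (k : ℕ) (a : ℤ) : ℤ :=
  if h.arr (13 + 4 * k) a = h.reg 25 then h.arr (12 + 4 * k) a else baseMem h k a

def layerMem (ov : Bool) (h : State) : ℕ → ℤ → ℤ := if ov then topMem h else baseMem h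

theorem layerMem_false (h : State) : layerMem false h = baseMem h := rfl

theorem layerMem_true (h : State) : layerMem true h = topMem h := rfl

/-- The memory of `h` represents the state `s` of the data structure. -/
def Sim (R : ℕ) (ov : Bool) (h s : State) : Prop :=
  (∀ r < R, h.reg (100 + 2 * r) = s.reg r) ∧ ∀ k a, layerMem ov h k a = s.arr k a

/-- The stamps in use are at most the content of register `25`. -/
def Stamps (Z : ℤ) (h : State) : Prop :=
  0 ≤ h.reg 24 ∧ h.reg 24 ≤ h.reg 25 ∧ h.reg 25 ≤ Z ∧
  ∀ k a, (0 ≤ h.arr (11 + 4 * k) a ∧ h.arr (11 + 4 * k) a ≤ h.reg 25) ∧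
    (0 ≤ h.arr (13 + 4 * k) a ∧ h.arr (13 + 4 * k) a ≤ h.reg 25)

/-- The count of simulated steps is kept inside the machine, because the program has to abandon
computations whose running time it cannot predict. -/
def tick : Cmd := .set 26 (.bin .add (.reg 26) (.lit 1))

/-- A cell is read only if its stamp is current. Otherwise its value is 0, the initial content of
the memory outside the input. -/
def baseTerm (k r : ℕ) : Term :=
  .cond (.bin .eq (.peek (11 + 4 * k) r) (.reg 24)) (.peek (10 + 4 * k) r) (.lit 0)

def topTerm (k r : ℕ) : Term :=
  .cond (.bin .eq (.peek (13 + 4 * k) r) (.reg 25)) (.peek (12 + 4 * k) r) (baseTerm k r)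

def layerStore (ov : Bool) (k a b : ℕ) : Cmd :=
  if ov then .seq (.store (12 + 4 * k) a b) (.store (13 + 4 * k) a 25)
  else .seq (.store (10 + 4 * k) a b) (.store (11 + 4 * k) a 24)

/-- Translation of the programs of the data structure. -/
def Cmd.emb (ov : Bool) : Cmd → Cmd
  | .skip => tick
  | .const r z => .seq (.const (100 + 2 * r) z) tick
  | .op o r a b => .seq (.op o (100 + 2 * r) (100 + 2 * a) (100 + 2 * b)) tick
  | .load r k a => .seq (.set (100 + 2 * r)
      (if ov then topTerm k (100 + 2 * a) else baseTerm k (100 + 2 * a))) tick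
  | .store k a b => .seq (layerStore ov k (100 + 2 * a) (100 + 2 * b)) tick
  | .seq c₁ c₂ => .seq (c₁.emb ov) (c₂.emb ov)
  | .ite a c₁ c₂ => .seq tick (.ite (100 + 2 * a) (c₁.emb ov) (c₂.emb ov))
  | .loop a c => .seq (.loop (100 + 2 * a) (.seq tick (c.emb ov))) tick

theorem not_isScratch_of_le {r : ℕ} (h : 100 ≤ r) : ¬ IsScratch r := fun h' => by
  have := h'.2; omega

theorem not_isScratch_of_lt {r : ℕ} (h : r < 50) : ¬ IsScratch r := fun h' => by
  have := h'.1; omega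

theorem Runs.tick {μ : Machine} (hK : 2 ≤ μ.K) {s : State} {Q : State → ℕ → Prop}
    (h0 : |s.reg 26| ≤ μ.Z) (h : Q (s.setReg 26 (s.reg 26 + 1)) 6) : Runs μ tick s Q := by
  have h2 := μ.two_le
  refine Runs.set ⟨rfl, ?_, by decide⟩ ⟨h0, ?_⟩ h
  · simpa [Term.height, Term.deg] using hK
  · simpa [Term.Small] using by linarith

/-- The translation of a loop ends with a `tick` for the last test. Unrolling one round with this
tail attached matches the induction over `Exec`, where the rest of the loop is again a loop. -/
theorem Runs.seq_loop_true {μ : Machine} {a : ℕ} {c d : Cmd} {s : State} {Q : State → ℕ → Prop}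
    (ha : ¬ IsScratch a) (h0 : s.reg a ≠ 0)
    (h : Runs μ c s fun s₁ t₁ => Runs μ (.seq (.loop a c) d) s₁ fun s₂ t₂ => Q s₂ (t₁ + t₂ + 1)) :
    Runs μ (.seq (.loop a c) d) s Q := fun σ hσ => by
  obtain ⟨σ1, s1, T1, t1, E1, l1, A1, h1⟩ := h σ hσ
  obtain ⟨σ2, s2, T2, t2, E2, l2, A2, h2⟩ := h1 σ1 A1
  cases E2 with
  | seq E3 E4 =>
    exact ⟨σ2, s2, _, _, Exec.seq (Exec.loop_true (by rwa [hσ.1 a ha]) E1 E3) E4, by omega, A2, h2⟩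

theorem Sim.setReg {R : ℕ} {ov : Bool} {h s : State} (H : Sim R ov h s) (r : ℕ) (v : ℤ) :
    Sim R ov (h.setReg (100 + 2 * r) v) (s.setReg r v) := by
  refine ⟨fun r' hr' => ?_, fun k a => ?_⟩
  · have := H.1 r' hr'
    by_cases e : r' = r
    · subst e; simp
    · simp [e, this]
  · rw [State.setReg_arr, ← H.2 k a]
    cases ov <;>
      simp [layerMem, topMem, baseMem, show (24 = 100 + 2 * r) = False by simp; omega,
        show (25 = 100 + 2 * r) = False by simp; omega]

theorem Sim.congr {R : ℕ} {ov : Bool} {h h' s : State} (H : Sim R ov h s)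
    (hr : ∀ r < R, h'.reg (100 + 2 * r) = h.reg (100 + 2 * r)) (h24 : h'.reg 24 = h.reg 24)
    (h25 : h'.reg 25 = h.reg 25) (ha : ∀ k, 10 ≤ k → h'.arr k = h.arr k) : Sim R ov h' s := by
  refine ⟨fun r hr' => (hr r hr').trans (H.1 r hr'), fun k a => ?_⟩
  rw [← H.2 k a]
  cases ov <;> simp [layerMem, topMem, baseMem, h24, h25, ha (10 + 4 * k) (by omega),
    ha (11 + 4 * k) (by omega), ha (12 + 4 * k) (by omega), ha (13 + 4 * k) (by omega)]

theorem Stamps.congr {Z : ℤ} {h h' : State} (H : Stamps Z h) (h24 : h'.reg 24 = h.reg 24)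
    (h25 : h'.reg 25 = h.reg 25) (ha : ∀ k, 10 ≤ k → h'.arr k = h.arr k) : Stamps Z h' := by
  refine ⟨by rw [h24]; exact H.1, by rw [h24, h25]; exact H.2.1, by rw [h25]; exact H.2.2.1,
    fun k a => ?_⟩
  rw [ha (11 + 4 * k) (by omega), ha (13 + 4 * k) (by omega), h25]
  exact H.2.2.2 k a

theorem Sim.count {R : ℕ} {ov : Bool} {h s : State} (H : Sim R ov h s) (v : ℤ) :
    Sim R ov (h.setReg 26 v) s :=
  H.congr (fun r _ => by simp [show ¬ (100 + 2 * r = 26) by omega]) (by simp) (by simp)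
    (fun _ _ => rfl)

theorem Stamps.count {Z : ℤ} {h : State} (H : Stamps Z h) (v : ℤ) : Stamps Z (h.setReg 26 v) :=
  H.congr (by simp) (by simp) (fun _ _ => rfl)

theorem Stamps.setReg {Z : ℤ} {h : State} (H : Stamps Z h) (r : ℕ) (v : ℤ) :
    Stamps Z (h.setReg (100 + 2 * r) v) :=
  H.congr (by simp [show (24 = 100 + 2 * r) = False by simp; omega])
    (by simp [show (25 = 100 + 2 * r) = False by simp; omega]) (fun _ _ => rfl)

/-- Storing a value in one of the layers. -/
theorem Sim.layerStore {μ : Machine} {R : ℕ} {ov : Bool} {h s : State} (H : Sim R ov h s)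
    (hs : Stamps μ.Z h) (k : ℕ) {a b : ℕ} (ha : ¬ IsScratch a) (hb : ¬ IsScratch b) :
    Runs μ (layerStore ov k a b) h fun h' t =>
      Sim R ov h' (s.setArr k (h.reg a) (h.reg b)) ∧ Stamps μ.Z h' ∧ h'.reg = h.reg ∧ t ≤ 2 := by
  obtain ⟨s1, s2, s3, s4⟩ := hs
  cases ov
  · refine Runs.seq (Runs.store ha hb (Runs.store ha (not_isScratch_of_lt (by norm_num)) ?_))
    refine ⟨⟨H.1, fun k' a' => ?_⟩, ⟨s1, s2, s3, fun k' a' => ?_⟩, rfl, by omega⟩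
    · have := H.2 k' a'
      simp only [layerMem_false, baseMem] at this ⊢
      simp only [State.setArr_arr, State.setArr_reg, ← this]
      by_cases e : k' = k <;> by_cases e' : a' = h.reg a <;>
        simp [e, e', show ∀ x y : ℕ, (10 + 4 * x = 11 + 4 * y) = False by intros; simp; omega,
          show ∀ x y : ℕ, (11 + 4 * x = 10 + 4 * y) = False by intros; simp; omega]
    · have := s4 k' a'
      simp only [State.setArr_arr, State.setArr_reg,
        show ∀ x y : ℕ, (11 + 4 * x = 10 + 4 * y) = False by intros; simp; omega,
        show ∀ x y : ℕ, (13 + 4 * x = 10 + 4 * y) = False by intros; simp; omega,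
        show ∀ x y : ℕ, (13 + 4 * x = 11 + 4 * y) = False by intros; simp; omega, false_and,
        if_false]
      split_ifs
      · exact ⟨⟨s1, s2⟩, this.2⟩
      · exact this
  · refine Runs.seq (Runs.store ha hb (Runs.store ha (not_isScratch_of_lt (by norm_num)) ?_))
    refine ⟨⟨H.1, fun k' a' => ?_⟩, ⟨s1, s2, s3, fun k' a' => ?_⟩, rfl, by omega⟩
    · have := H.2 k' a'
      simp only [layerMem_true, topMem, baseMem] at this ⊢
      simp only [State.setArr_arr, State.setArr_reg, ← this]
      by_cases e : k' = k <;> by_cases e' : a' = h.reg a <;>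
        simp [e, e', show ∀ x y : ℕ, (12 + 4 * x = 13 + 4 * y) = False by intros; simp; omega,
          show ∀ x y : ℕ, (13 + 4 * x = 12 + 4 * y) = False by intros; simp; omega,
          show ∀ x y : ℕ, (11 + 4 * x = 12 + 4 * y) = False by intros; simp; omega,
          show ∀ x y : ℕ, (11 + 4 * x = 13 + 4 * y) = False by intros; simp; omega,
          show ∀ x y : ℕ, (10 + 4 * x = 13 + 4 * y) = False by intros; simp; omega,
          show ∀ x y : ℕ, (10 + 4 * x = 12 + 4 * y) = False by intros; simp; omega]
    · have := s4 k' a'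
      simp only [State.setArr_arr, State.setArr_reg,
        show ∀ x y : ℕ, (11 + 4 * x = 12 + 4 * y) = False by intros; simp; omega,
        show ∀ x y : ℕ, (11 + 4 * x = 13 + 4 * y) = False by intros; simp; omega,
        show ∀ x y : ℕ, (13 + 4 * x = 12 + 4 * y) = False by intros; simp; omega, false_and,
        if_false]
      split_ifs
      · exact ⟨this.1, by linarith, le_rfl⟩
      · exact this

/-- Induction over the execution. Each step is translated into at most 20 steps, one `tick`
included, so the clock advances by exactly the simulated time. The bound on the final clock keeps
register `26` within a word throughout. -/
theorem Exec.simulate {μ : Machine} {R : ℕ} {ov : Bool} {B : ℤ} (hB : B ≤ μ.Z) (hK : 2 ≤ μ.K)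
    {c : Cmd} {s s' : State} {t : ℕ} (hE : Exec B c s s' t) : c.Below R →
    ∀ h : State, Sim R ov h s → Stamps μ.Z h → 0 ≤ h.reg 26 → h.reg 26 + t ≤ μ.Z →
    Runs μ (c.emb ov) h fun h' T => Sim R ov h' s' ∧ Stamps μ.Z h' ∧
      h'.reg 26 = h.reg 26 + t ∧ T ≤ 20 * t := by
  have hZ := μ.two_le
  have hBK : B ≤ μ.Z ^ μ.K := hB.trans (by simpa using μ.pow_le (k := 1) (by omega))
  have hdr : ∀ r, ¬ IsScratch (100 + 2 * r) := fun r => not_isScratch_of_le (by omega)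
  have h26 : ∀ r, (26 = 100 + 2 * r) = False := fun r => by simp; omega
  have habs : ∀ h : State, 0 ≤ h.reg 26 → h.reg 26 + 1 ≤ μ.Z → |h.reg 26| ≤ μ.Z :=
    fun h h1 h2 => by rw [abs_of_nonneg h1]; linarith
  induction hE with
  | skip s =>
    intro _ h H S h0 hc
    refine Runs.tick hK (habs h h0 (by simpa using hc)) ⟨H.count _, S.count _, by simp, by omega⟩
  | const r z s hz =>
    intro _ h H S h0 hc
    refine Runs.seq (Runs.const (hz.trans hBK) (Runs.tick hK ?_ ⟨(H.setReg r z).count _,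
      (S.setReg r z).count _, ?_, by omega⟩))
    · simpa [h26] using habs h h0 (by simpa using hc)
    · simp [h26]
  | op o r a b s hz =>
    intro hb h H S h0 hc
    have ea := H.1 a hb.2.1
    have eb := H.1 b hb.2.2
    refine Runs.seq (Runs.op (hdr _) (hdr _) (by rw [ea, eb]; exact hz.trans hBK) ?_)
    rw [ea, eb]
    refine (Runs.tick hK ?_ ⟨(H.setReg r _).count _, (S.setReg r _).count _, ?_, by omega⟩)
    · simpa [h26] using habs h h0 (by simpa using hc)
    · simp [h26]
  | load r k a s hz =>
    intro hb h H S h0 hc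
    have ea := H.1 a hb.2
    have hm := H.2 k (s.reg a)
    obtain ⟨S1, S2, S3, S4⟩ := S
    obtain ⟨⟨S5, S6⟩, S7, S8⟩ := S4 k (s.reg a)
    have n24 : ¬ IsScratch 24 := not_isScratch_of_lt (by norm_num)
    have n25 : ¬ IsScratch 25 := not_isScratch_of_lt (by norm_num)
    refine Runs.seq (Runs.set (e := if ov then topTerm k (100 + 2 * a) else
      baseTerm k (100 + 2 * a)) ?_ ?_ ?_)
    · cases ov
      · refine ⟨by simp [baseTerm, Term.ok, WordOp.isArith, hdr, n24], ?_, by simp [baseTerm, Term.depth]⟩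
        simpa [baseTerm, Term.height, Term.deg] using hK
      · refine ⟨by simp [topTerm, baseTerm, Term.ok, WordOp.isArith, hdr, n24, n25], ?_,
          by simp [topTerm, baseTerm, Term.depth]⟩
        simpa [baseTerm, topTerm, Term.height, Term.deg] using hK
    -- A cell with a stale stamp may contain anything. `Small` restricts only the branch of a
    -- conditional that is taken, and the valid cell is a word of the data structure by the premise
    -- of `Exec.load`.
    · have hbase : baseMem h k (s.reg a) = s.arr k (s.reg a) →
          (baseTerm k (100 + 2 * a)).Small μ.Z h := by
        intro hm
        simp only [baseMem] at hm
        refine ⟨⟨?_, ?_⟩, fun h1 => ?_, fun _ => ?_⟩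
        · simp only [Term.Small]
          rw [ea, abs_of_nonneg S5]; exact S6.trans S3
        · simp only [Term.Small]
          rw [abs_of_nonneg S1]; exact S2.trans S3
        · simp only [Term.Small, ea]
          have h1' : h.arr (11 + 4 * k) (s.reg a) = h.reg 24 := by
            by_contra hne; apply h1
            simp [Term.eval, WordOp.eval, ea, hne]
          rw [if_pos h1'] at hm
          rw [hm]; exact hz.trans hB
        · simp [Term.Small]; linarith
      cases ov
      · exact hbase hm
      · simp only [layerMem_true, topMem] at hm
        refine ⟨⟨?_, ?_⟩, fun h1 => ?_, fun h1 => ?_⟩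
        · simp only [Term.Small]
          rw [ea, abs_of_nonneg S7]; exact S8.trans S3
        · simp only [Term.Small]
          rw [abs_of_nonneg (S1.trans S2)]; exact S3
        · simp only [Term.Small, ea]
          have h1' : h.arr (13 + 4 * k) (s.reg a) = h.reg 25 := by
            by_contra hne; apply h1
            simp [Term.eval, WordOp.eval, ea, hne]
          simp only [if_pos h1'] at hm
          rw [hm]; exact hz.trans hB
        · apply hbase
          have h1' : h.arr (13 + 4 * k) (s.reg a) ≠ h.reg 25 := by
            intro hne
            simp [Term.eval, WordOp.eval, ea, hne] at h1
          simpa [h1'] using hm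
    · have hval : Term.eval h (if ov then topTerm k (100 + 2 * a) else baseTerm k (100 + 2 * a))
          = s.arr k (s.reg a) := by
        rw [← hm]
        cases ov <;> simp [layerMem, topMem, baseMem, topTerm, baseTerm, Term.eval,
          WordOp.eval, ea]
      rw [hval]
      refine Runs.tick hK ?_ ⟨(H.setReg r _).count _, Stamps.count
        (Stamps.setReg ⟨S1, S2, S3, S4⟩ r _) _, ?_, ?_⟩
      · simpa [h26] using habs h h0 (by simpa using hc)
      · simp [h26]
      · cases ov <;> simp [topTerm, baseTerm, Term.cost]
  | store k a b s =>
    intro hb h H S h0 hc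
    refine Runs.seq ((H.layerStore S k (hdr a) (hdr b)).mono ?_)
    rintro h1 t1 ⟨H1, S1, r1, l1⟩
    rw [H.1 a hb.1, H.1 b hb.2] at H1
    refine Runs.tick hK ?_ ⟨H1.count _, S1.count _, ?_, by omega⟩
    · rw [r1]; exact habs h h0 (by simpa using hc)
    · simp [r1]
  | @seq c₁ c₂ s s1 s2 t1 t2 E1 E2 ih1 ih2 =>
    intro hb h H S h0 hc
    push_cast at hc
    refine Runs.seq ((ih1 hb.1 h H S h0 (by linarith [Int.natCast_nonneg t2])).mono ?_)
    rintro h1 T1 ⟨H1, S1, e1, l1⟩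
    refine (ih2 hb.2 h1 H1 S1 (by rw [e1]; positivity) (by rw [e1]; linarith)).mono ?_
    rintro h2 T2 ⟨H2, S2, e2, l2⟩
    exact ⟨H2, S2, by rw [e2, e1]; push_cast; ring, by omega⟩
  | @ite_true a c₁ c₂ s s1 t1 ha E ih =>
    intro hb h H S h0 hc
    push_cast at hc
    have := Int.natCast_nonneg t1
    refine Runs.seq (Runs.tick hK (habs h h0 (by linarith)) (Runs.ite (hdr a) ?_ ?_))
    · intro _
      refine (ih hb.2.1 _ (H.count _) (S.count _) (by simp; linarith) (by simp; linarith)).mono ?_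
      rintro h2 T2 ⟨H2, S2, e2, l2⟩
      exact ⟨H2, S2, by rw [e2]; simp; ring, by omega⟩
    · intro hz
      rw [State.setReg_reg, if_neg (by omega), H.1 a hb.1] at hz
      exact absurd hz ha
  | @ite_false a c₁ c₂ s s1 t1 ha E ih =>
    intro hb h H S h0 hc
    push_cast at hc
    have := Int.natCast_nonneg t1
    refine Runs.seq (Runs.tick hK (habs h h0 (by linarith)) (Runs.ite (hdr a) ?_ ?_))
    · intro hz
      rw [State.setReg_reg, if_neg (by omega), H.1 a hb.1] at hz
      exact absurd ha hz
    · intro _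
      refine (ih hb.2.2 _ (H.count _) (S.count _) (by simp; linarith) (by simp; linarith)).mono ?_
      rintro h2 T2 ⟨H2, S2, e2, l2⟩
      exact ⟨H2, S2, by rw [e2]; simp; ring, by omega⟩
  | @loop_true a c s s1 s2 t1 t2 ha E1 E2 ih1 ih2 =>
    intro hb h H S h0 hc
    push_cast at hc
    have := Int.natCast_nonneg t1
    have := Int.natCast_nonneg t2
    refine Runs.seq_loop_true (hdr a) (by rwa [H.1 a hb.1])
      (Runs.seq (Runs.tick hK (habs h h0 (by linarith)) ?_))
    refine (ih1 hb.2 _ (H.count _) (S.count _) (by simp; linarith) (by simp; linarith)).mono ?_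
    rintro h1 T1 ⟨H1, S1, e1, l1⟩
    simp only [State.setReg_reg, if_true] at e1
    refine (ih2 hb h1 H1 S1 (by rw [e1]; linarith) (by rw [e1]; linarith)).mono ?_
    rintro h2 T2 ⟨H2, S2, e2, l2⟩
    exact ⟨H2, S2, by rw [e2, e1]; push_cast; ring, by omega⟩
  | @loop_false a c s ha =>
    intro hb h H S h0 hc
    refine Runs.seq (Runs.loop_false (hdr a) (by rwa [H.1 a hb.1]) ?_)
    exact Runs.tick hK (habs h h0 (by simpa using hc)) ⟨H.count _, S.count _, by simp, by omega⟩

theorem Cmd.not_writes_set {r x : ℕ} {e : Term} (hx : ¬ IsScratch x) (he : e.depth ≤ 49)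
    (h : x ≠ r) : ¬ (Cmd.set r e).writes x := by
  have h51 : x ≠ 51 := by rintro rfl; exact hx ⟨by omega, by omega⟩
  simp only [Cmd.set, Cmd.writes, not_or]
  exact ⟨e.not_writes_code hx 50 le_rfl (by omega), h51, h⟩

theorem Cmd.not_stores_set {k r : ℕ} {e : Term} : ¬ (Cmd.set r e).stores k := by
  simp only [Cmd.set, Cmd.stores, not_or]
  exact ⟨e.not_stores_code k 50, not_false, not_false⟩

theorem Cmd.not_stores_iff {k : ℕ} {e : Term} {c₁ c₂ : Cmd} (h₁ : ¬ c₁.stores k)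
    (h₂ : ¬ c₂.stores k) : ¬ (Cmd.iff e c₁ c₂).stores k := by
  simp only [Cmd.iff, Cmd.stores, not_or]
  exact ⟨e.not_stores_code k 50, h₁, h₂⟩

theorem Cmd.not_stores_whileDo {k : ℕ} {e : Term} {c : Cmd} (h : ¬ c.stores k) :
    ¬ (Cmd.whileDo e c).stores k := by
  simp only [Cmd.whileDo, Cmd.stores, not_or]
  exact ⟨e.not_stores_code k 50, h, e.not_stores_code k 50⟩

theorem Cmd.not_writes_seq {x : ℕ} {c₁ c₂ : Cmd} (h₁ : ¬ c₁.writes x) (h₂ : ¬ c₂.writes x) :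
    ¬ (Cmd.seq c₁ c₂).writes x := by
  simp only [Cmd.writes, not_or]; exact ⟨h₁, h₂⟩

theorem Cmd.not_stores_seq {k : ℕ} {c₁ c₂ : Cmd} (h₁ : ¬ c₁.stores k) (h₂ : ¬ c₂.stores k) :
    ¬ (Cmd.seq c₁ c₂).stores k := by
  simp only [Cmd.stores, not_or]; exact ⟨h₁, h₂⟩

theorem Cmd.not_writes_emb {R : ℕ} {ov : Bool} {x : ℕ} (hx : ¬ IsScratch x) (h26 : x ≠ 26)
    (hR : ∀ r < R, x ≠ 100 + 2 * r) : ∀ c : Cmd, c.Below R → ¬ (c.emb ov).writes x := by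
  have ht : ¬ tick.writes x := Cmd.not_writes_set hx (by decide) h26
  intro c
  induction c with
  | skip => exact fun _ => ht
  | const r z => exact fun h => Cmd.not_writes_seq (hR r h) ht
  | op o r a b => exact fun h => Cmd.not_writes_seq (hR r h.1) ht
  | load r k a =>
    exact fun h => Cmd.not_writes_seq
      (Cmd.not_writes_set hx (by cases ov <;> simp [topTerm, baseTerm, Term.depth]) (hR r h.1)) ht
  | store k a b =>
    exact fun h => Cmd.not_writes_seq (by cases ov <;> simp [layerStore, Cmd.writes]) ht
  | seq c₁ c₂ h₁ h₂ => exact fun h => Cmd.not_writes_seq (h₁ h.1) (h₂ h.2)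
  | ite a c₁ c₂ h₁ h₂ =>
    intro h
    have := h₁ h.2.1; have := h₂ h.2.2
    simp_all [Cmd.emb, Cmd.writes]
  | loop a c ih =>
    intro h
    have := ih h.2
    simp_all [Cmd.emb, Cmd.writes]

/-- The arrays that belong to a layer. -/
def LayerArr (ov : Bool) (k : ℕ) : Prop :=
  ∃ i, if ov then k = 12 + 4 * i ∨ k = 13 + 4 * i else k = 10 + 4 * i ∨ k = 11 + 4 * i

theorem Cmd.not_stores_layerStore {ov : Bool} {k k' a b : ℕ} (hk : ¬ LayerArr ov k) :
    ¬ (layerStore ov k' a b).stores k := by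
  intro h
  apply hk
  refine ⟨k', ?_⟩
  cases ov <;> simpa [layerStore, Cmd.stores] using h

theorem Cmd.not_stores_emb {ov : Bool} {k : ℕ} (hk : ¬ LayerArr ov k) (c : Cmd) :
    ¬ (c.emb ov).stores k := by
  have ht : ¬ tick.stores k := Cmd.not_stores_set
  induction c with
  | skip => exact ht
  | const | op => exact Cmd.not_stores_seq not_false ht
  | load => exact Cmd.not_stores_seq Cmd.not_stores_set ht
  | store k' a b => exact Cmd.not_stores_seq (Cmd.not_stores_layerStore hk) ht
  | seq c₁ c₂ h₁ h₂ => exact Cmd.not_stores_seq h₁ h₂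
  | ite a c₁ c₂ h₁ h₂ => simp_all [Cmd.emb, Cmd.stores]
  | loop a c ih => simp_all [Cmd.emb, Cmd.stores]

theorem not_layerArr_of_lt {ov : Bool} {k : ℕ} (h : k < 10) : ¬ LayerArr ov k := by
  rintro ⟨i, hi⟩
  cases ov <;> simp at hi <;> omega

/-! ### Subgraphs of the integer grid are planar -/

theorem int_eq_of_add_eq {a b : ℤ} {σ τ : ℝ} (hσ : σ ∈ Set.Ioo (0 : ℝ) 1)
    (hτ : τ ∈ Set.Ioo (0 : ℝ) 1) (h : (a : ℝ) + σ = b + τ) : a = b := by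
  have h1 : ((a : ℝ)) < b + 1 := by linarith [hσ.1, hτ.2]
  have h2 : ((b : ℝ)) < a + 1 := by linarith [hσ.2, hτ.1]
  have h1' : a < b + 1 := by exact_mod_cast h1
  have h2' : b < a + 1 := by exact_mod_cast h2
  omega

theorem int_ne_add {a b : ℤ} {τ : ℝ} (hτ : τ ∈ Set.Ioo (0 : ℝ) 1) : (b : ℝ) + τ ≠ a := fun h => by
  have h1 : (a : ℝ) < b + 1 := by linarith [hτ.2]
  have h2 : (b : ℝ) < a := by linarith [hτ.1]
  have h1' : a < b + 1 := by exact_mod_cast h1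
  have h2' : b < a := by exact_mod_cast h2
  omega

/-- Edges are drawn as unit segments between integer points. An interior point has exactly one
non-integral coordinate; this determines the direction of the segment and its lower or left end
point. Hence interiors of different edges are disjoint and contain no vertices. -/
theorem isPlanar_of_grid {V : Type*} (G : SimpleGraph V) (p q : V → ℤ)
    (hinj : ∀ u v, p u = p v → q u = q v → u = v)
    (hadj : ∀ u v, G.Adj u v → (q u = q v ∧ (p v = p u + 1 ∨ p u = p v + 1)) ∨
      (p u = p v ∧ (q v = q u + 1 ∨ q u = q v + 1))) : IsPlanar G := by
  set arc : V → V → ℝ → ℝ × ℝ := fun u v t =>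
    ((1 - t) * p u + t * p v, (1 - t) * q u + t * q v) with harc
  -- Reversing a segment replaces `t` by `1 - t`, so every edge may be assumed to point to the right
  -- or upwards.
  have key : ∀ u v, G.Adj u v → ∀ t ∈ Set.Ioo (0 : ℝ) 1, ∃ x y : V, s(u, v) = s(x, y) ∧
      ∃ τ ∈ Set.Ioo (0 : ℝ) 1,
        (q y = q x ∧ p y = p x + 1 ∧ arc u v t = ((p x : ℝ) + τ, (q x : ℝ))) ∨
        (p y = p x ∧ q y = q x + 1 ∧ arc u v t = ((p x : ℝ), (q x : ℝ) + τ)) := by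
    intro u v h t ht
    have ht' : 1 - t ∈ Set.Ioo (0 : ℝ) 1 := ⟨by linarith [ht.2], by linarith [ht.1]⟩
    rcases hadj u v h with ⟨h1, h2 | h2⟩ | ⟨h1, h2 | h2⟩
    · exact ⟨u, v, rfl, t, ht, Or.inl ⟨h1.symm, h2, by
        simp only [harc, h2, h1]; push_cast; ext <;> simp <;> ring⟩⟩
    · exact ⟨v, u, Sym2.eq_swap, 1 - t, ht', Or.inl ⟨h1, h2, by
        simp only [harc, h2, h1]; push_cast; ext <;> simp <;> ring⟩⟩
    · exact ⟨u, v, rfl, t, ht, Or.inr ⟨h1.symm, h2, by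
        simp only [harc, h2, h1]; push_cast; ext <;> simp <;> ring⟩⟩
    · exact ⟨v, u, Sym2.eq_swap, 1 - t, ht', Or.inr ⟨h1, h2, by
        simp only [harc, h2, h1]; push_cast; ext <;> simp <;> ring⟩⟩
  refine ⟨fun v => ((p v : ℝ), (q v : ℝ)), arc, ?_, ?_, ?_⟩
  · intro u v h
    simp only [Prod.mk.injEq, Int.cast_inj] at h
    exact hinj u v h.1 h.2
  · intro u v h
    refine ⟨?_, ?_, by simp [harc], by simp [harc], ?_⟩
    · apply Continuous.continuousOn
      simp only [harc]
      fun_prop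
    · intro s _ t _ hst
      simp only [harc, Prod.mk.injEq] at hst
      rcases hadj u v h with ⟨h1, h2 | h2⟩ | ⟨h1, h2 | h2⟩ <;>
        simp only [h2] at hst <;> push_cast at hst
      · linarith [hst.1]
      · linarith [hst.1]
      · linarith [hst.2]
      · linarith [hst.2]
    · intro t ht x hx
      obtain ⟨a, b, _, τ, hτ, ⟨_, _, e⟩ | ⟨_, _, e⟩⟩ := key u v h t ht
      · rw [e, Prod.mk.injEq] at hx
        exact int_ne_add hτ hx.1
      · rw [e, Prod.mk.injEq] at hx
        exact int_ne_add hτ hx.2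
  · intro u v u' v' h h' hne t ht t' ht' heq
    obtain ⟨a, b, e, τ, hτ, H⟩ := key u v h t ht
    obtain ⟨a', b', e', τ', hτ', H'⟩ := key u' v' h' t' ht'
    apply hne
    rw [e, e']
    rcases H with ⟨h1, h2, h3⟩ | ⟨h1, h2, h3⟩ <;> rcases H' with ⟨h1', h2', h3'⟩ | ⟨h1', h2', h3'⟩ <;>
      rw [h3, h3', Prod.mk.injEq] at heq
    · have hp := int_eq_of_add_eq hτ hτ' heq.1
      have hq : q a = q a' := by exact_mod_cast heq.2
      rw [hinj a a' hp hq, hinj b b' (by omega) (by omega)]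
    · exact absurd heq.1 (int_ne_add hτ)
    · exact absurd heq.1.symm (int_ne_add hτ')
    · have hq := int_eq_of_add_eq hτ hτ' heq.2
      have hp : p a = p a' := by exact_mod_cast heq.1
      rw [hinj a a' hp hq, hinj b b' (by omega) (by omega)]

/-! ### Weighted grids -/

/-- The edge weight that is coded by a number; `0` means that there is no edge. -/
def edgeOf (x : ℤ) : Option ℤ := if x = 0 then none else some x

theorem edgeOf_eq_some {x y : ℤ} : edgeOf x = some y ↔ x ≠ 0 ∧ x = y := by
  unfold edgeOf; split_ifs with h <;> simp [h]

theorem edgeOf_zero : edgeOf 0 = none := rfl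

theorem edgeOf_of_ne {x : ℤ} (h : x ≠ 0) : edgeOf x = some x := by simp [edgeOf, h]

/-- The grid with rows of length `C`, whose vertices are numbered row by row. The horizontal edge
`{v, v + 1}` has weight `hw v` and the vertical edge `{v, v + C}` has weight `vw v`. -/
def gridG (N C : ℕ) (hw vw : ℕ → ℤ) : WGraph N := fun i j =>
  if (j : ℕ) = i + 1 then edgeOf (hw i) else if (i : ℕ) = j + 1 then edgeOf (hw j)
  else if (j : ℕ) = i + C then edgeOf (vw i) else if (i : ℕ) = j + C then edgeOf (vw j) else none

section grid

variable {N C : ℕ} {hw vw : ℕ → ℤ}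

/-- With `2 ≤ C` the cases in the definition of `gridG` exclude each other. -/
theorem gridG_symm (hC : 2 ≤ C) (i j : Fin N) : gridG N C hw vw i j = gridG N C hw vw j i := by
  unfold gridG
  split_ifs <;> first | rfl | omega

theorem gridG_self (hC : 2 ≤ C) (i : Fin N) : gridG N C hw vw i i = none := by
  unfold gridG
  split_ifs <;> first | rfl | omega

theorem gridG_horizontal {i j : Fin N} (h : (j : ℕ) = i + 1) :
    gridG N C hw vw i j = edgeOf (hw i) := by
  simp [gridG, h]

theorem gridG_vertical (hC : 2 ≤ C) {i j : Fin N} (h : (j : ℕ) = i + C) :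
    gridG N C hw vw i j = edgeOf (vw i) := by
  unfold gridG
  split_ifs <;> first | rfl | omega

/-- Induction over the edges of a grid. -/
theorem gridG_cases (hC : 2 ≤ C) {P : Fin N → Fin N → ℤ → Prop}
    (hsymm : ∀ i j x, P i j x → P j i x)
    (hh : ∀ i j : Fin N, (j : ℕ) = i + 1 → hw i ≠ 0 → P i j (hw i))
    (hv : ∀ i j : Fin N, (j : ℕ) = i + C → vw i ≠ 0 → P i j (vw i)) {i j : Fin N} {x : ℤ}
    (h : gridG N C hw vw i j = some x) : P i j x := by
  unfold gridG at h
  split_ifs at h with h1 h2 h3 h4 <;> simp only [edgeOf_eq_some] at h <;> obtain ⟨h0, rfl⟩ := h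
  · exact hh _ _ h1 h0
  · exact hsymm _ _ _ (hh _ _ h2 h0)
  · exact hv _ _ h3 h0
  · exact hsymm _ _ _ (hv _ _ h4 h0)

/-- Vertex `v` is placed at the point `(v % C, v / C)`. The condition `hrow` excludes horizontal
edges that would lead from the end of a row to the beginning of the next one. -/
theorem gridG_isPlanarInstance (hC : 2 ≤ C) {d : ℕ} (h0 : ∀ v, 0 ≤ hw v ∧ hw v ≤ (N : ℤ) ^ d)
    (h1 : ∀ v, 0 ≤ vw v ∧ vw v ≤ (N : ℤ) ^ d) (hrow : ∀ v, hw v ≠ 0 → v % C + 1 < C) :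
    IsPlanarInstance d (gridG N C hw vw) := by
  refine ⟨gridG_symm hC, gridG_self hC, fun i j x h => ?_, ?_⟩
  · refine gridG_cases hC (P := fun _ _ x => 1 ≤ x ∧ x ≤ (N : ℤ) ^ d) (fun _ _ _ h => h) ?_ ?_ h
    · intro i j _ hne
      have := h0 i
      exact ⟨by omega, this.2⟩
    · intro i j _ hne
      have := h1 i
      exact ⟨by omega, this.2⟩
  · refine isPlanar_of_grid _ (fun v => ((v : ℕ) % C : ℕ)) (fun v => ((v : ℕ) / C : ℕ)) ?_ ?_
    · intro u v hp hq
      ext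
      rw [← Nat.div_add_mod u C, ← Nat.div_add_mod v C]
      simp only [Nat.cast_inj] at hp hq
      rw [hp, hq]
    · intro u v huv
      simp only [WGraph.toSimpleGraph, SimpleGraph.fromRel_adj] at huv
      have hne : gridG N C hw vw u v ≠ none := by
        rcases huv.2 with h | h
        · exact h
        · rwa [gridG_symm hC]
      obtain ⟨x, hx⟩ := Option.ne_none_iff_exists'.1 hne
      refine gridG_cases hC (P := fun u v _ =>
        ((((u : ℕ) / C : ℕ) : ℤ) = ((v : ℕ) / C : ℕ) ∧ ((((v : ℕ) % C : ℕ) : ℤ) = ((u : ℕ) % C : ℕ) + 1 ∨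
          (((u : ℕ) % C : ℕ) : ℤ) = ((v : ℕ) % C : ℕ) + 1)) ∨
        ((((u : ℕ) % C : ℕ) : ℤ) = ((v : ℕ) % C : ℕ) ∧ ((((v : ℕ) / C : ℕ) : ℤ) = ((u : ℕ) / C : ℕ) + 1 ∨
          (((u : ℕ) / C : ℕ) : ℤ) = ((v : ℕ) / C : ℕ) + 1))) ?_ ?_ ?_ hx
      · rintro i j _ (⟨h, h'⟩ | ⟨h, h'⟩)
        · exact Or.inl ⟨h.symm, h'.symm⟩
        · exact Or.inr ⟨h.symm, h'.symm⟩
      · intro i j hij hne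
        have h2 := hrow i hne
        left
        have e1 : (j : ℕ) / C = i / C := by
          rw [hij, ← Nat.div_add_mod i C]
          rw [add_assoc, Nat.mul_add_div (by omega), Nat.mul_add_div (by omega),
            Nat.div_eq_of_lt h2, Nat.div_eq_of_lt (Nat.mod_lt _ (by omega))]
        have e2 : (j : ℕ) % C = i % C + 1 := by
          rw [hij, Nat.add_mod, Nat.mod_eq_of_lt (show 1 < C by omega), Nat.mod_eq_of_lt h2]
        rw [e1, e2]
        exact ⟨rfl, Or.inl (by push_cast; ring)⟩
      · intro i j hij _
        right
        rw [hij, Nat.add_mod_right, Nat.add_div_right _ (by omega)]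
        exact ⟨rfl, Or.inl (by push_cast; ring)⟩

theorem gridG_setEdge_horizontal (hC : 2 ≤ C) {a b : Fin N} (hab : (b : ℕ) = a + 1) (x : ℤ) :
    (gridG N C hw vw).setEdge a b (edgeOf x) = gridG N C (Function.update hw a x) vw := by
  funext i j
  simp only [WGraph.setEdge, gridG, Function.update_apply, Fin.ext_iff]
  split_ifs <;> first | rfl | omega

theorem gridG_setEdge_vertical (hC : 2 ≤ C) {a b : Fin N} (hab : (b : ℕ) = a + C) (x : ℤ) :
    (gridG N C hw vw).setEdge a b (edgeOf x) = gridG N C hw (Function.update vw a x) := by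
  funext i j
  simp only [WGraph.setEdge, gridG, Function.update_apply, Fin.ext_iff]
  split_ifs <;> first | rfl | omega

theorem gridG_zero : gridG N C (fun _ => 0) (fun _ => 0) = fun _ _ => none := by
  funext i j
  simp [gridG, edgeOf]

end grid

/-! ### Walks -/

namespace WGraph

variable {n : ℕ} {G : WGraph n}

theorem Walk.trans {i j k : Fin n} {x y : ℤ} (h₁ : G.Walk i j x) (h₂ : G.Walk j k y) :
    G.Walk i k (x + y) := by
  induction h₁ with
  | nil => simpa using h₂
  | cons h _ ih => rw [add_assoc]; exact .cons h (ih h₂)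

theorem Walk.single {i j : Fin n} {x : ℤ} (h : G i j = some x) : G.Walk i j x := by
  simpa using Walk.cons h (.nil j)

theorem Walk.symm (hG : ∀ i j, G i j = G j i) {i j : Fin n} {x : ℤ} (h : G.Walk i j x) :
    G.Walk j i x := by
  induction h with
  | nil => exact .nil _
  | cons h _ ih => rw [add_comm]; exact ih.trans (.single (by rwa [hG]))

/-- The differences telescope along the walk. This weak duality is the source of all lower bounds
for distances. -/
theorem Walk.potential_le {π : Fin n → ℤ} (hπ : ∀ i j x, G i j = some x → π j - π i ≤ x)
    {i j : Fin n} {x : ℤ} (h : G.Walk i j x) : π j - π i ≤ x := by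
  induction h with
  | nil => simp
  | cons h _ ih => linarith [hπ _ _ _ h]

/-- There is a walk from `i` to `j` of weight at most `x`. -/
def WalkLe (G : WGraph n) (i j : Fin n) (x : ℤ) : Prop := ∃ y ≤ x, G.Walk i j y

theorem WalkLe.refl (i : Fin n) : G.WalkLe i i 0 := ⟨0, le_rfl, .nil i⟩

theorem WalkLe.mono {i j : Fin n} {x y : ℤ} (h : G.WalkLe i j x) (hxy : x ≤ y) : G.WalkLe i j y :=
  ⟨h.choose, h.choose_spec.1.trans hxy, h.choose_spec.2⟩

theorem WalkLe.trans {i j k : Fin n} {x y : ℤ} (h₁ : G.WalkLe i j x) (h₂ : G.WalkLe j k y) :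
    G.WalkLe i k (x + y) := by
  obtain ⟨a, ha, wa⟩ := h₁
  obtain ⟨b, hb, wb⟩ := h₂
  exact ⟨a + b, by linarith, wa.trans wb⟩

theorem WalkLe.symm (hG : ∀ i j, G i j = G j i) {i j : Fin n} {x : ℤ} (h : G.WalkLe i j x) :
    G.WalkLe j i x := by
  obtain ⟨a, ha, wa⟩ := h
  exact ⟨a, ha, wa.symm hG⟩

theorem WalkLe.single {i j : Fin n} {x : ℤ} (h : G i j = some x) : G.WalkLe i j x :=
  ⟨x, le_rfl, .single h⟩

end WGraph

/-! ### The grid that computes a product of a row vector and a matrix -/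

/-- A potential on a grid with `R` rows and the columns `0, …, w`. It bounds distances from the
vertex in row `0` and column `k`. -/
def corner (M : ℤ) (R w : ℕ) (γ : ℕ → ℕ → ℤ) (k r l : ℕ) : ℤ :=
  if l ≤ k then M * (r * (2 * w - k) + (k - l) * (2 * R - r)) + γ r k - γ r l
  else M * (r * (2 * w - l) + R * (l - k))

section corner

variable {M X : ℤ} {R w k r l : ℕ} {γ : ℕ → ℕ → ℤ}

theorem corner_of_le (h : k ≤ l) :
    corner M R w γ k r l = M * (r * (2 * w - l) + R * (l - k)) := by
  unfold corner
  split_ifs with h'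
  · have : l = k := le_antisymm h' h
    subst this; ring
  · rfl

/-- For `l < k` the potential is the length of the route down column `k` and then along row `r`, and
the estimate is an equality. For `l ≥ k` the difference is only `M * (R - r)`; the remaining `M * R
≥ 4 * X` absorbs the corrections `γ`. -/
theorem abs_corner_horizontal (hX : 0 ≤ X) (hM : 4 * X ≤ M) (hγ : ∀ r l, 0 ≤ γ r l ∧ γ r l ≤ X)
    (hr : r < R) : |corner M R w γ k r (l + 1) - corner M R w γ k r l| ≤
      M * (2 * R - r) + γ r (l + 1) - γ r l := by
  have h1 := hγ r (l + 1)
  have h2 := hγ r l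
  have hRr : (1 : ℤ) ≤ R - r := by omega
  have hR : (1 : ℤ) ≤ R := by omega
  have hM0 : 0 ≤ M := by linarith
  have e1 : M ≤ M * (R - r) := by nlinarith
  have e2 : M ≤ M * R := by nlinarith
  have e3 : M * (2 * R - r) = M * R + M * (R - r) := by ring
  rcases Nat.lt_or_ge l k with h | h
  · rw [corner, corner, if_pos (by omega), if_pos (by omega)]
    have : M * (r * (2 * w - k) + (k - (l + 1 : ℕ)) * (2 * R - r)) + γ r k - γ r (l + 1) -
        (M * (r * (2 * w - k) + (k - l) * (2 * R - r)) + γ r k - γ r l) =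
        -(M * (2 * R - r) + γ r (l + 1) - γ r l) := by push_cast; ring
    rw [this, abs_neg, abs_of_nonneg (by linarith)]
  · rw [corner_of_le (by omega), corner_of_le h]
    have : M * (r * (2 * w - (l + 1 : ℕ)) + R * ((l + 1 : ℕ) - k)) -
        M * (r * (2 * w - l) + R * (l - k)) = M * (R - r) := by push_cast; ring
    rw [this, abs_of_nonneg (by linarith)]
    linarith

/-- For `l ≥ k` there is equality. For `l < k` the difference is `M * (2 * w - 2 * k + l)` up to `2
* X`, which leaves a margin of `2 * M * (k - l)` above and of `M * (4 * w - 2 * k)` below. Both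
margins are at least `2 * M`, and `M ≥ 4 * X`. -/
theorem abs_corner_vertical (hX : 0 ≤ X) (hM : 4 * X ≤ M) (hγ : ∀ r l, 0 ≤ γ r l ∧ γ r l ≤ X)
    (hk : 1 ≤ k) (hkw : k ≤ w) (hl : l ≤ w) :
    |corner M R w γ k (r + 1) l - corner M R w γ k r l| ≤ M * (2 * w - l) := by
  have hM0 : 0 ≤ M := by linarith
  rcases Nat.lt_or_ge l k with h | h
  · rw [corner, corner, if_pos (by omega), if_pos (by omega)]
    have h1 := hγ r k
    have h2 := hγ r l
    have h3 := hγ (r + 1) k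
    have h4 := hγ (r + 1) l
    have e1 : M * 1 ≤ M * ((k : ℤ) - l) := mul_le_mul_of_nonneg_left (by omega) hM0
    have e2 : M * 1 ≤ M * (2 * (w : ℤ) - k) := mul_le_mul_of_nonneg_left (by omega) hM0
    rw [abs_le]
    push_cast
    constructor <;> linarith
  · rw [corner_of_le h, corner_of_le h]
    have : M * ((r + 1 : ℕ) * (2 * w - l) + R * (l - k)) - M * (r * (2 * w - l) + R * (l - k)) =
        M * (2 * w - l) := by push_cast; ring
    rw [this, abs_of_nonneg (mul_nonneg hM0 (by omega))]

end corner

/-- The parameters of the grid: it has `2 * m` rows and `2 * w + L + 3` columns. The middle part of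
the rows `2 * j` and `2 * j + 1` encodes a number with `L` bits. -/
structure Gadget where
  m : ℕ
  w : ℕ
  L : ℕ
  S : ℤ
  M : ℤ
  X : ℤ
  β : ℕ → ℕ → ℤ

namespace Gadget

variable (P : Gadget)

/-- There are `w + 1` columns in the left part, `L + 1` in the middle and `w + 1` in the right part.
-/
def cols : ℕ := 2 * P.w + P.L + 3

/-- Weight of the edge between columns `c` and `c + 1` in row `r`; `sc j b` is the
weight of the shortcut for bit `b` in row `2 * j`. -/
def horizontal (sc : ℕ → ℕ → ℤ) (r c : ℕ) : ℤ :=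
  if r < 2 * P.m then
    if c < P.w then P.S * (P.M * (4 * P.m - r))
    else if c = P.w ∨ c = P.w + 1 + P.L then (if r % 2 = 0 then 1 else 0)
    else if c < P.w + 1 + P.L then
      (if r % 2 = 0 then sc (r / 2) (c - (P.w + 1)) else P.S * 2 ^ (c - (P.w + 1)))
    else if c < 2 * P.w + 2 + P.L then
      P.S * (P.M * (2 * P.m + 1 + r) + P.β r (c - (P.w + 2 + P.L) + 1) -
        P.β r (c - (P.w + 2 + P.L)))
    else 0
  else 0

/-- Weight of the edge between rows `r` and `r + 1` in column `c`. -/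
def vertical (r c : ℕ) : ℤ :=
  if r + 1 < 2 * P.m then
    if c ≤ P.w then P.S * (P.M * (P.w + c))
    else if c ≤ P.w + 1 + P.L then (if r % 2 = 0 then 1 else 0)
    else if c ≤ 2 * P.w + 2 + P.L then P.S * (P.M * (3 * P.w + 2 + P.L - c))
    else 0
  else 0

def hw (sc : ℕ → ℕ → ℤ) (v : ℕ) : ℤ := P.horizontal sc (v / P.cols) (v % P.cols)

def vw (v : ℕ) : ℤ := P.vertical (v / P.cols) (v % P.cols)

def graph (N : ℕ) (sc : ℕ → ℕ → ℤ) : WGraph N := gridG N P.cols (P.hw sc) P.vw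

/-- The number encoded by the first `b` shortcuts of row `2 * j`. -/
def prefixVal (sc : ℕ → ℕ → ℤ) (j b : ℕ) : ℤ :=
  ∑ i ∈ Finset.range b, if sc j i = 1 then 0 else 2 ^ i

/-- The intended walk contains unscaled weights of total at most `3 * L + 2`, so dividing by `S = 3
* L + 3` removes them. `M ≥ 4 * X` prevents the corrections `β` from changing the cheapest route,
and `β r 0 = 0` makes their sum up to column `k` equal to `β r k`. -/
structure Valid : Prop where
  w_pos : 1 ≤ P.w
  S_eq : P.S = 3 * P.L + 3
  X_pos : 1 ≤ P.X
  M_ge : 4 * P.X ≤ P.M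
  beta : ∀ r l, 0 ≤ P.β r l ∧ P.β r l ≤ P.X
  beta_zero : ∀ r, P.β r 0 = 0

/-- The shortcut weights are admissible. -/
def ValidShortcuts (sc : ℕ → ℕ → ℤ) : Prop :=
  ∀ j < P.m, ∀ b < P.L, sc j b = 1 ∨ sc j b = 0 ∨ P.S * 2 ^ b < sc j b

/-- The part of the answer to the query for column `k` that does not depend on the matrix. -/
def offset (k : ℕ) : ℤ := P.M * ((2 * P.m - 1) * (2 * P.w - k) + k * (6 * P.m + 1))

/-- The potential for the query for column `k`. -/
def pot (sc : ℕ → ℕ → ℤ) (k : ℕ) (D : ℤ) (r c : ℕ) : ℤ :=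
  if c ≤ P.w then corner P.M (2 * P.m) P.w (fun _ _ => 0) k r (P.w - c)
  else if c ≤ P.w + 1 + P.L then
    min (corner P.M (2 * P.m) P.w (fun _ _ => 0) k (2 * (r / 2)) 0 +
        prefixVal sc (r / 2) (c - (P.w + 1)))
      (D - corner P.M (2 * P.m) P.w (fun r' => P.β (2 * P.m - 1 - r')) k
        (2 * P.m - 1 - 2 * (r / 2)) 0)
  else D - corner P.M (2 * P.m) P.w (fun r' => P.β (2 * P.m - 1 - r')) k (2 * P.m - 1 - r)
    (c - (P.w + 2 + P.L))

variable {P} {sc : ℕ → ℕ → ℤ} {k : ℕ} {D : ℤ}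

/-- The factors `4 * m - r` on the left and `2 * m + 1 + r` on the right add up to `6 * m + 1`, and
the two vertical parts together pass all the `2 * m` rows. Thus the cost does not depend on `j`,
except for the correction. -/
theorem corner_add_corner (hP : P.Valid) {j : ℕ} (hj : j < P.m) (hk : k ≤ P.w) :
    corner P.M (2 * P.m) P.w (fun _ _ => 0) k (2 * j) 0 +
      corner P.M (2 * P.m) P.w (fun r' => P.β (2 * P.m - 1 - r')) k (2 * P.m - 1 - 2 * j) 0 =
    P.offset k + P.β (2 * j) k := by
  have e : 2 * P.m - 1 - (2 * P.m - 1 - 2 * j) = 2 * j := by omega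
  have e' : ((2 * P.m - 1 - 2 * j : ℕ) : ℤ) = 2 * P.m - 1 - 2 * j := by omega
  rw [corner, corner, if_pos (Nat.zero_le _), if_pos (Nat.zero_le _), offset]
  simp only [e, hP.beta_zero]
  rw [e']
  push_cast
  ring

theorem prefixVal_succ (j b : ℕ) :
    prefixVal sc j (b + 1) = prefixVal sc j b + if sc j b = 1 then 0 else 2 ^ b :=
  Finset.sum_range_succ _ _

theorem prefixVal_mono (j b : ℕ) : prefixVal sc j b ≤ prefixVal sc j (b + 1) := by
  rw [prefixVal_succ]
  split_ifs <;> simp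

/-- Cutting off at a constant does not enlarge increments. -/
theorem abs_min_sub_min_le {a b c x : ℤ} (h1 : a ≤ b) (h2 : b ≤ a + x) :
    |min b c - min a c| ≤ x := by
  rw [abs_of_nonneg (by simp only [sub_nonneg]; exact min_le_min_right _ h1)]
  rcases le_total a c with h | h
  · rw [min_eq_left h]; linarith [min_le_left b c]
  · rw [min_eq_right h]; linarith [min_le_right b c]

/-- From the left the potential measures the distance to the source, from the right it is `D` minus
the distance to the target, and in the middle it is the minimum of both. The hypotheses on `μ` say
that the two descriptions fit together at either end of the middle part. -/
theorem pot_horizontal (hP : P.Valid) (hsc : P.ValidShortcuts sc) (hk : k ≤ P.w)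
    {μ : ℤ} (hD : D = P.offset k + μ) (hμX : P.X ≤ μ)
    (hμ : ∀ j < P.m, μ ≤ prefixVal sc j P.L + P.β (2 * j) k) {r c : ℕ}
    (h0 : P.horizontal sc r c ≠ 0) :
    |P.S * P.pot sc k D r (c + 1) - P.S * P.pot sc k D r c| ≤ P.horizontal sc r c := by
  have hS : 1 ≤ P.S := by rw [hP.S_eq]; omega
  have hS0 : 0 ≤ P.S := by linarith
  have hX0 : 0 ≤ P.X := by linarith [hP.X_pos]
  rw [← mul_sub, abs_mul, abs_of_nonneg hS0]
  unfold horizontal at h0 ⊢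
  split_ifs at h0 ⊢ with h1 h2 h3 h4 h5 h6 h7
  · refine mul_le_mul_of_nonneg_left ?_ hS0
    rw [pot, pot, if_pos (by omega), if_pos (by omega)]
    have e : P.w - c = (P.w - (c + 1)) + 1 := by omega
    rw [e, abs_sub_comm]
    refine (abs_corner_horizontal (X := P.X) hX0 hP.M_ge (fun _ _ => ⟨le_rfl, hX0⟩) h1).trans ?_
    push_cast
    exact le_of_eq (by ring)
  · have hj : r / 2 < P.m := by omega
    have hr : 2 * (r / 2) = r := by omega
    have hs := corner_add_corner hP hj hk
    rw [hr] at hs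
    have hb := hP.beta r k
    -- The connecting edges have weight 1, but potentials are multiplied by `S`, so the potential
    -- must not change at all. At the left end the minimum is the first term because `β ≤ X ≤ μ`; at
    -- the right end it is the second because `μ ≤ prefixVal + β`.
    rcases h3 with h3 | h3
    · rw [pot, pot, if_neg (by omega), if_pos (by omega), if_pos (by omega), hr, h3]
      simp only [Nat.sub_self, show P.w + 1 - (P.w + 1) = 0 by omega]
      rw [show prefixVal sc (r / 2) 0 = 0 from Finset.sum_range_zero _, add_zero,
        min_eq_left (by linarith), sub_self]
      simp
    · rw [pot, pot, if_neg (by omega), if_neg (by omega), if_neg (by omega), if_pos (by omega), hr,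
        h3]
      simp only [show P.w + 1 + P.L + 1 - (P.w + 2 + P.L) = 0 by omega,
        show P.w + 1 + P.L - (P.w + 1) = P.L by omega]
      have := hμ _ hj
      rw [hr] at this
      rw [min_eq_right (by linarith), sub_self]
      simp
  · exact absurd rfl h0
  · have hj : r / 2 < P.m := by omega
    obtain ⟨b, hb⟩ : ∃ b, c = P.w + 1 + b := ⟨c - (P.w + 1), by omega⟩
    subst hb
    rw [pot, pot, if_neg (by omega), if_pos (by omega), if_neg (by omega), if_pos (by omega)]
    simp only [show P.w + 1 + b + 1 - (P.w + 1) = b + 1 by omega,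
      show P.w + 1 + b - (P.w + 1) = b by omega] at h0 ⊢
    have hm := prefixVal_mono (sc := sc) (r / 2) b
    -- An active shortcut has weight 1 and does not change `prefixVal`. Without an edge there is
    -- nothing to show. An inactive shortcut is heavier than `S * 2 ^ b`, the largest possible
    -- increment.
    rcases hsc _ hj b (by omega) with h | h | h
    · rw [h]
      have := abs_min_sub_min_le (x := 0) (c := D - corner P.M (2 * P.m) P.w
        (fun r' => P.β (2 * P.m - 1 - r')) k (2 * P.m - 1 - 2 * (r / 2)) 0)
        (add_le_add_right hm (corner P.M (2 * P.m) P.w (fun _ _ => 0) k (2 * (r / 2)) 0))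
        (by rw [prefixVal_succ, if_pos h]; linarith)
      have h0 := le_antisymm this (abs_nonneg _)
      rw [h0]; simp
    · exact absurd h h0
    · refine le_trans (mul_le_mul_of_nonneg_left (abs_min_sub_min_le (x := 2 ^ b)
        (add_le_add_right hm _) ?_) hS0) h.le
      rw [prefixVal_succ]
      split_ifs
      · have : (0 : ℤ) ≤ 2 ^ b := by positivity
        linarith
      · linarith
  · obtain ⟨b, hb⟩ : ∃ b, c = P.w + 1 + b := ⟨c - (P.w + 1), by omega⟩
    subst hb
    rw [pot, pot, if_neg (by omega), if_pos (by omega), if_neg (by omega), if_pos (by omega)]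
    simp only [show P.w + 1 + b + 1 - (P.w + 1) = b + 1 by omega,
      show P.w + 1 + b - (P.w + 1) = b by omega] at h0 ⊢
    refine (mul_le_mul_of_nonneg_left (abs_min_sub_min_le (x := 2 ^ b)
        (add_le_add_right (prefixVal_mono _ _) _) ?_) hS0)
    rw [prefixVal_succ]
    split_ifs
    · have : (0 : ℤ) ≤ 2 ^ b := by positivity
      linarith
    · linarith
  · refine mul_le_mul_of_nonneg_left ?_ hS0
    rw [pot, pot, if_neg (by omega), if_neg (by omega), if_neg (by omega), if_neg (by omega)]
    have e : c + 1 - (P.w + 2 + P.L) = c - (P.w + 2 + P.L) + 1 := by omega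
    rw [e, sub_sub_sub_cancel_left, abs_sub_comm]
    refine (abs_corner_horizontal (X := P.X) hX0 hP.M_ge (fun _ _ => hP.beta _ _)
      (by omega)).trans ?_
    have e' : ((2 * P.m - 1 - r : ℕ) : ℤ) = 2 * P.m - 1 - r := by omega
    rw [e', show 2 * P.m - 1 - (2 * P.m - 1 - r) = r by omega]
    push_cast
    exact le_of_eq (by ring)
  · exact absurd rfl h0
  · exact absurd rfl h0

/-- In the middle part there are vertical edges only inside a row pair, and the potential depends
only on `r / 2` there. The outer parts are covered by `abs_corner_vertical`. -/
theorem pot_vertical (hP : P.Valid) (hk1 : 1 ≤ k) (hk : k ≤ P.w) {r c : ℕ}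
    (h0 : P.vertical r c ≠ 0) :
    |P.S * P.pot sc k D (r + 1) c - P.S * P.pot sc k D r c| ≤ P.vertical r c := by
  have hS : 1 ≤ P.S := by rw [hP.S_eq]; omega
  have hS0 : 0 ≤ P.S := by linarith
  have hX0 : 0 ≤ P.X := by linarith [hP.X_pos]
  rw [← mul_sub, abs_mul, abs_of_nonneg hS0]
  unfold vertical at h0 ⊢
  split_ifs at h0 ⊢ with h1 h2 h3 h4 h5
  · refine mul_le_mul_of_nonneg_left ?_ hS0
    rw [pot, pot, if_pos h2, if_pos h2]
    refine (abs_corner_vertical (X := P.X) hX0 hP.M_ge (fun _ _ => ⟨le_rfl, hX0⟩) hk1 hk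
      (by omega)).trans ?_
    rw [Nat.cast_sub h2]
    exact le_of_eq (by ring)
  · rw [pot, pot, if_neg h2, if_neg h2, if_pos h3, if_pos h3, show (r + 1) / 2 = r / 2 by omega]
    simp
  · exact absurd rfl h0
  · refine mul_le_mul_of_nonneg_left ?_ hS0
    rw [pot, pot, if_neg h2, if_neg h2, if_neg h3, if_neg h3, sub_sub_sub_cancel_left]
    have e : 2 * P.m - 1 - r = (2 * P.m - 1 - (r + 1)) + 1 := by omega
    rw [e]
    refine (abs_corner_vertical (X := P.X) hX0 hP.M_ge (fun _ _ => hP.beta _ _) hk1 hk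
      (by omega)).trans ?_
    rw [Nat.cast_sub (by omega)]
    push_cast
    exact le_of_eq (by ring)
  · exact absurd rfl h0
  · exact absurd rfl h0

theorem horizontal_ne_zero_lt {r c : ℕ} (h : P.horizontal sc r c ≠ 0) : c + 1 < P.cols := by
  unfold horizontal at h
  unfold cols
  split_ifs at h <;> omega

theorem two_le_cols : 2 ≤ P.cols := by unfold cols; omega

theorem succ_div_mod {v C : ℕ} (h : v % C + 1 < C) :
    (v + 1) / C = v / C ∧ (v + 1) % C = v % C + 1 := by
  have hv := Nat.div_add_mod v C
  have hC : 0 < C := by omega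
  constructor
  · conv_lhs => rw [← hv, add_assoc, Nat.mul_add_div hC, Nat.div_eq_of_lt h, add_zero]
  · rw [Nat.add_mod, Nat.mod_eq_of_lt (show 1 < C by omega), Nat.mod_eq_of_lt h]

/-- The lower bound for the distances in the grid. -/
theorem le_of_walk {N : ℕ} (hP : P.Valid) (hsc : P.ValidShortcuts sc) (hk1 : 1 ≤ k)
    (hk : k ≤ P.w) (hm : 1 ≤ P.m)
    {μ : ℤ} (hμX : P.X ≤ μ) (hμ : ∀ j < P.m, μ ≤ prefixVal sc j P.L + P.β (2 * j) k)
    {a b : Fin N} (ha : (a : ℕ) = P.w - k)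
    (hb : (b : ℕ) = (2 * P.m - 1) * P.cols + (P.w + 2 + P.L + k)) {x : ℤ}
    (hx : (P.graph N sc).Walk a b x) : P.S * (P.offset k + μ) ≤ x := by
  set D := P.offset k + μ with hD
  set π : Fin N → ℤ := fun v => P.S * P.pot sc k D ((v : ℕ) / P.cols) ((v : ℕ) % P.cols) with hπ
  have hC := two_le_cols (P := P)
  have key : ∀ i j x, P.graph N sc i j = some x → |π j - π i| ≤ x := by
    intro i j x h
    refine gridG_cases hC (P := fun i j x => |π j - π i| ≤ x)
      (fun i j x h => by rwa [abs_sub_comm]) ?_ ?_ h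
    · intro i j hij hne
      have := succ_div_mod (horizontal_ne_zero_lt hne)
      simp only [hπ, hij, this.1, this.2]
      exact pot_horizontal hP hsc hk hD hμX hμ hne
    · intro i j hij hne
      simp only [hπ, hij, Nat.add_mod_right, Nat.add_div_right _ (show 0 < P.cols by omega)]
      exact pot_vertical hP hk1 hk hne
  have := hx.potential_le (π := π) (fun i j x h => (le_abs_self _).trans (key i j x h))
  -- Source and target are the corners of the two outer potentials, so the total difference of
  -- potentials is `S * D`.
  have ea : π a = 0 := by
    have h1 : (a : ℕ) < P.cols := by rw [ha]; unfold cols; omega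
    simp only [hπ, Nat.div_eq_of_lt h1, Nat.mod_eq_of_lt h1]
    rw [pot, if_pos (by omega), ha, show P.w - (P.w - k) = k by omega, corner_of_le le_rfl]
    simp
  have hlt : P.w + 2 + P.L + k < P.cols := by unfold cols; omega
  have eb : π b = P.S * D := by
    have h1 : (b : ℕ) / P.cols = 2 * P.m - 1 := by
      rw [hb, mul_comm, Nat.mul_add_div (by omega), Nat.div_eq_of_lt hlt, add_zero]
    have h2 : (b : ℕ) % P.cols = P.w + 2 + P.L + k := by
      rw [hb, mul_comm, Nat.mul_add_mod, Nat.mod_eq_of_lt hlt]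
    simp only [hπ, h1, h2]
    rw [pot, if_neg (by omega), if_neg (by omega), Nat.sub_self,
      show P.w + 2 + P.L + k - (P.w + 2 + P.L) = k by omega, corner_of_le le_rfl]
    simp
  rw [ea, eb, sub_zero] at this
  exact this

/-- There is a walk of weight at most `x` between the vertices with the numbers `a` and `b`. -/
def _root_.PlanarAPSP.WGraph.NumWalkLe {N : ℕ} (G : WGraph N) (a b : ℕ) (x : ℤ) : Prop :=
  ∃ (ha : a < N) (hb : b < N), G.WalkLe ⟨a, ha⟩ ⟨b, hb⟩ x

/-! ### Upper bound for distances in the grid: the intended walk -/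

section upper

variable {N : ℕ}

theorem _root_.PlanarAPSP.WGraph.NumWalkLe.trans {G : WGraph N} {a b c : ℕ} {x y : ℤ}
    (h₁ : G.NumWalkLe a b x) (h₂ : G.NumWalkLe b c y) : G.NumWalkLe a c (x + y) := by
  obtain ⟨ha, hb, h⟩ := h₁
  obtain ⟨_, hc, h'⟩ := h₂
  exact ⟨ha, hc, h.trans h'⟩

theorem _root_.PlanarAPSP.WGraph.NumWalkLe.mono {G : WGraph N} {a b : ℕ} {x y : ℤ}
    (h : G.NumWalkLe a b x) (hxy : x ≤ y) : G.NumWalkLe a b y := by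
  obtain ⟨ha, hb, h⟩ := h
  exact ⟨ha, hb, h.mono hxy⟩

/-- For straight pieces of a walk. Weights are given as differences of `f`, so that no sums have to
be evaluated. -/
theorem _root_.PlanarAPSP.WGraph.NumWalkLe.telescope {G : WGraph N} {p : ℕ → ℕ} {f : ℕ → ℤ}
    {i j : ℕ} (hij : i ≤ j) (hi : p i < N)
    (h : ∀ l, i ≤ l → l < j → G.NumWalkLe (p l) (p (l + 1)) (f (l + 1) - f l)) :
    G.NumWalkLe (p i) (p j) (f j - f i) := by
  induction j, hij using Nat.le_induction with
  | base => exact ⟨hi, hi, by rw [sub_self]; exact WGraph.WalkLe.refl _⟩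
  | succ j hij ih =>
    have := (ih fun l h1 h2 => h l h1 (by omega)).trans (h j hij (by omega))
    exact this.mono (by linarith)

theorem div_mod_eq {r c C : ℕ} (hc : c < C) : (r * C + c) / C = r ∧ (r * C + c) % C = c := by
  rw [mul_comm, Nat.mul_add_div (by omega), Nat.div_eq_of_lt hc, add_zero, Nat.mul_add_mod,
    Nat.mod_eq_of_lt hc]
  exact ⟨rfl, rfl⟩

theorem index_lt {m C r c : ℕ} (hN : 2 * m * C ≤ N) (hr : r < 2 * m) (hc : c < C) :
    r * C + c < N := by
  have : (r + 1) * C ≤ 2 * m * C := Nat.mul_le_mul_right _ hr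
  linarith [add_mul r 1 C]

theorem walk_horizontal (hN : 2 * P.m * P.cols ≤ N) {r c : ℕ} {x : ℤ}
    (h : P.horizontal sc r c = x) (h0 : x ≠ 0) :
    (P.graph N sc).NumWalkLe (r * P.cols + c) (r * P.cols + (c + 1)) x := by
  subst h
  have hc := horizontal_ne_zero_lt h0
  have hr : r < 2 * P.m := by
    by_contra hr
    exact h0 (by simp [horizontal, hr])
  refine ⟨index_lt hN hr (by omega), index_lt hN hr (by omega), WGraph.WalkLe.single ?_⟩
  rw [graph, gridG_horizontal (by simp; ring)]
  have := div_mod_eq (r := r) (show c < P.cols by omega)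
  simp only [hw, this.1, this.2]
  exact edgeOf_of_ne h0

theorem walk_vertical (hN : 2 * P.m * P.cols ≤ N) {r c : ℕ} (hc : c < P.cols) {x : ℤ}
    (h : P.vertical r c = x) (h0 : x ≠ 0) :
    (P.graph N sc).NumWalkLe (r * P.cols + c) ((r + 1) * P.cols + c) x := by
  subst h
  have hr : r + 1 < 2 * P.m := by
    by_contra hr
    exact h0 (by simp [vertical, hr])
  refine ⟨index_lt hN (by omega) hc, index_lt hN hr hc, WGraph.WalkLe.single ?_⟩
  rw [graph, gridG_vertical two_le_cols (by simp; ring)]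
  have := div_mod_eq (r := r) hc
  simp only [vw, this.1, this.2]
  exact edgeOf_of_ne h0

theorem _root_.PlanarAPSP.WGraph.NumWalkLe.symm {G : WGraph N} (hG : ∀ i j, G i j = G j i)
    {a b : ℕ} {x : ℤ} (h : G.NumWalkLe a b x) : G.NumWalkLe b a x := by
  obtain ⟨ha, hb, h⟩ := h
  exact ⟨hb, ha, h.symm hG⟩

/-- The middle part of a row. -/
theorem walk_middle (hP : P.Valid) (hsc : P.ValidShortcuts sc) (hN : 2 * P.m * P.cols ≤ N)
    {j : ℕ} (hj : j < P.m) :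
    (P.graph N sc).NumWalkLe (2 * j * P.cols + (P.w + 1)) (2 * j * P.cols + (P.w + 1 + P.L))
      (P.S * prefixVal sc j P.L + 3 * P.L) := by
  have hS : 1 ≤ P.S := by rw [hP.S_eq]; omega
  have hcols : P.w + 1 + P.L < P.cols := by unfold cols; omega
  have := WGraph.NumWalkLe.telescope (G := P.graph N sc)
    (p := fun b => 2 * j * P.cols + (P.w + 1 + b))
    (f := fun b => P.S * prefixVal sc j b + 3 * b) (Nat.zero_le P.L)
    (index_lt hN (by omega) (by omega)) fun b _ hb => by
      have hsym : ∀ i i', P.graph N sc i i' = P.graph N sc i' i := gridG_symm two_le_cols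
      have hval : P.horizontal sc (2 * j) (P.w + 1 + b) = sc j b := by
        simp only [horizontal]
        rw [if_pos (by omega), if_neg (by omega), if_neg (by omega), if_pos (by omega),
          if_pos (by omega), show 2 * j / 2 = j by omega,
          show P.w + 1 + b - (P.w + 1) = b by omega]
      -- Each bit may cost 3 in addition to its scaled value: an active shortcut costs 1, and
      -- otherwise the detour through the odd row costs `S * 2 ^ b` and two vertical edges of weight
      -- 1.
      by_cases h1 : sc j b = 1
      · refine (walk_horizontal hN hval (by omega)).mono ?_
        rw [prefixVal_succ, if_pos h1, h1]
        push_cast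
        linarith
      · have v0 : ∀ c, P.w < c → c ≤ P.w + 1 + P.L → P.vertical (2 * j) c = 1 := by
          intro c h2 h3
          simp only [vertical]
          rw [if_pos (by omega), if_neg (by omega), if_pos (by omega), if_pos (by omega)]
        have h2 : P.horizontal sc (2 * j + 1) (P.w + 1 + b) = P.S * 2 ^ b := by
          simp only [horizontal]
          rw [if_pos (by omega), if_neg (by omega), if_neg (by omega), if_pos (by omega),
            if_neg (by omega), show P.w + 1 + b - (P.w + 1) = b by omega]
        have w1 := walk_vertical (sc := sc) hN (by omega)
          (v0 (P.w + 1 + b) (by omega) (by omega)) one_ne_zero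
        have w2 := walk_horizontal hN h2 (by positivity)
        have w3 := (walk_vertical (sc := sc) hN (by omega)
          (v0 (P.w + 1 + b + 1) (by omega) (by omega)) one_ne_zero).symm hsym
        refine ((w1.trans w2).trans w3).mono ?_
        rw [prefixVal_succ, if_neg h1]
        push_cast
        linarith
  refine this.mono ?_
  simp [prefixVal]

/-- The upper bound for the distances in the grid. -/
theorem walkLe (hP : P.Valid) (hsc : P.ValidShortcuts sc) (hN : 2 * P.m * P.cols ≤ N)
    (hk1 : 1 ≤ k) (hk : k ≤ P.w) {j : ℕ} (hj : j < P.m) :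
    (P.graph N sc).NumWalkLe (P.w - k) ((2 * P.m - 1) * P.cols + (P.w + 2 + P.L + k))
      (P.S * (P.offset k + (prefixVal sc j P.L + P.β (2 * j) k)) + (P.S - 1)) := by
  have hS : 1 ≤ P.S := by rw [hP.S_eq]; omega
  have hX := hP.X_pos
  have hM1 := hP.M_ge
  have hM : 1 ≤ P.M := by linarith
  have hcols : 2 * P.w + P.L + 2 < P.cols := by unfold cols; omega
  have hw := hP.w_pos
  -- The walk goes down column `w - k` to row `2 * j`, along this row through the middle part to
  -- column `w + 2 + L + k`, and down this column to the last row.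
  have w1 := WGraph.NumWalkLe.telescope (G := P.graph N sc) (p := fun r => r * P.cols + (P.w - k))
    (f := fun r => r * (P.S * (P.M * (2 * P.w - k)))) (Nat.zero_le (2 * j))
    (index_lt hN (by omega) (by omega)) fun r _ hr => by
      have h2 : P.vertical r (P.w - k) = P.S * (P.M * (2 * P.w - k)) := by
        simp only [vertical]
        rw [if_pos (by omega), if_pos (by omega), Nat.cast_sub hk]
        ring
      refine (walk_vertical hN (by omega) h2 ?_).mono (by push_cast; linarith)
      have : (0 : ℤ) < 2 * P.w - k := by omega
      positivity
  have w2 := WGraph.NumWalkLe.telescope (G := P.graph N sc) (p := fun c => 2 * j * P.cols + c)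
    (f := fun c => c * (P.S * (P.M * (4 * P.m - 2 * j)))) (show P.w - k ≤ P.w by omega)
    (index_lt hN (by omega) (by omega)) fun c _ hc => by
      have h2 : P.horizontal sc (2 * j) c = P.S * (P.M * (4 * P.m - 2 * j)) := by
        simp only [horizontal]
        rw [if_pos (by omega), if_pos (by omega)]
        push_cast; ring
      refine (walk_horizontal hN h2 ?_).mono (by push_cast; linarith)
      have : (0 : ℤ) < 4 * P.m - 2 * j := by omega
      positivity
  have h3 : P.horizontal sc (2 * j) P.w = 1 := by
    simp only [horizontal]
    rw [if_pos (by omega), if_neg (lt_irrefl _), if_pos (Or.inl trivial), if_pos (by omega)]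
  have w3 := walk_horizontal hN h3 one_ne_zero
  have w4 := walk_middle hP hsc hN hj
  have h5 : P.horizontal sc (2 * j) (P.w + 1 + P.L) = 1 := by
    simp only [horizontal]
    rw [if_pos (by omega), if_neg (by omega), if_pos (Or.inr trivial), if_pos (by omega)]
  have w5 := walk_horizontal hN h5 one_ne_zero
  have w6 := WGraph.NumWalkLe.telescope (G := P.graph N sc)
    (p := fun l => 2 * j * P.cols + (P.w + 2 + P.L + l))
    (f := fun l => P.S * (l * (P.M * (2 * P.m + 1 + 2 * j)) + P.β (2 * j) l)) (Nat.zero_le k)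
    (index_lt hN (by omega) (by omega)) fun l _ hl => by
      have h2 : P.horizontal sc (2 * j) (P.w + 2 + P.L + l) =
          P.S * (P.M * (2 * P.m + 1 + 2 * j) + P.β (2 * j) (l + 1) - P.β (2 * j) l) := by
        simp only [horizontal]
        rw [if_pos (by omega), if_neg (by omega), if_neg (by omega), if_neg (by omega),
          if_pos (by omega), show P.w + 2 + P.L + l - (P.w + 2 + P.L) = l by omega]
        push_cast; ring
      refine (walk_horizontal hN h2 ?_).mono (by push_cast; linarith)
      have h3 := hP.beta (2 * j) (l + 1)
      have h4 := hP.beta (2 * j) l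
      have h5 : P.M * 1 ≤ P.M * (2 * P.m + 1 + 2 * j) :=
        mul_le_mul_of_nonneg_left (by omega) (by linarith)
      have : 0 < P.M * (2 * P.m + 1 + 2 * j) + P.β (2 * j) (l + 1) - P.β (2 * j) l := by linarith
      positivity
  have w7 := WGraph.NumWalkLe.telescope (G := P.graph N sc)
    (p := fun r => r * P.cols + (P.w + 2 + P.L + k))
    (f := fun r => r * (P.S * (P.M * (2 * P.w - k)))) (show 2 * j ≤ 2 * P.m - 1 by omega)
    (index_lt hN (by omega) (by omega)) fun r _ hr => by
      have h2 : P.vertical r (P.w + 2 + P.L + k) = P.S * (P.M * (2 * P.w - k)) := by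
        simp only [vertical]
        rw [if_pos (by omega), if_neg (by omega), if_neg (by omega), if_pos (by omega)]
        push_cast; ring
      refine (walk_vertical hN (by omega) h2 ?_).mono (by push_cast; linarith)
      have : (0 : ℤ) < 2 * P.w - k := by omega
      positivity
  rw [show 2 * j * P.cols + (P.w + 1 + P.L + 1) = 2 * j * P.cols + (P.w + 2 + P.L + 0) by ring]
    at w5
  simp only [zero_mul, zero_add] at w1
  refine ((((((w1.trans w2).trans w3).trans w4).trans w5).trans w6).trans w7).mono ?_
  rw [hP.beta_zero, offset, Nat.cast_sub hk, Nat.cast_sub (show 1 ≤ 2 * P.m by omega)]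
  -- The unscaled part is at most `3 * L` in the middle plus the two connecting edges, which is `S -
  -- 1`.
  have := hP.S_eq
  push_cast
  linarith

end upper

/-- The answer of a query determines an entry of the product. -/
theorem answer {N : ℕ} (hP : P.Valid) (hsc : P.ValidShortcuts sc) (hN : 2 * P.m * P.cols ≤ N)
    (hm : 1 ≤ P.m) (hk1 : 1 ≤ k) (hk : k ≤ P.w)
    (hA : ∀ j < P.m, P.X ≤ prefixVal sc j P.L) {a b : Fin N} (ha : (a : ℕ) = P.w - k)
    (hb : (b : ℕ) = (2 * P.m - 1) * P.cols + (P.w + 2 + P.L + k)) {flag val : ℤ}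
    (h : (P.graph N sc).IsDistAnswer a b flag val) :
    (∀ j < P.m, val / P.S - P.offset k ≤ prefixVal sc j P.L + P.β (2 * j) k) ∧
    ∃ j < P.m, val / P.S - P.offset k = prefixVal sc j P.L + P.β (2 * j) k := by
  have hS : 1 ≤ P.S := by rw [hP.S_eq]; omega
  obtain ⟨j₀, hj₀, hmin⟩ := Finset.exists_min_image (Finset.range P.m)
    (fun j => prefixVal sc j P.L + P.β (2 * j) k) ⟨0, Finset.mem_range.2 hm⟩
  simp only [Finset.mem_range] at hj₀ hmin
  have up : ∀ j < P.m, (P.graph N sc).WalkLe a b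
      (P.S * (P.offset k + (prefixVal sc j P.L + P.β (2 * j) k)) + (P.S - 1)) := by
    intro j hj
    obtain ⟨ha', hb', h'⟩ := walkLe (sc := sc) hP hsc hN hk1 hk hj
    have ea : a = ⟨_, ha'⟩ := Fin.ext ha
    have eb : b = ⟨_, hb'⟩ := Fin.ext hb
    rw [ea, eb]; exact h'
  have hv : IsLeast {x | (P.graph N sc).Walk a b x} val := by
    rcases h with h | h
    · exact h.2
    · obtain ⟨y, _, hy⟩ := up j₀ hj₀
      exact absurd hy (h.2 y)
  have h1 : P.S * (P.offset k + (prefixVal sc j₀ P.L + P.β (2 * j₀) k)) ≤ val :=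
    le_of_walk hP hsc hk1 hk hm (by linarith [hA j₀ hj₀, (hP.beta (2 * j₀) k).1]) hmin ha hb hv.1
  have h2 : ∀ j < P.m, val ≤
      P.S * (P.offset k + (prefixVal sc j P.L + P.β (2 * j) k)) + (P.S - 1) := by
    intro j hj
    obtain ⟨y, hy, hw⟩ := up j hj
    exact (hv.2 hw).trans hy
  -- The bounds `h1` and `h2` differ by less than `S` at the minimizing index, hence the integer
  -- quotient is exactly the minimum.
  have h3 : ∀ j < P.m, val / P.S ≤ P.offset k + (prefixVal sc j P.L + P.β (2 * j) k) := by
    intro j hj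
    rw [← Int.lt_add_one_iff, Int.ediv_lt_iff_lt_mul (by linarith)]
    linarith [h2 j hj]
  have h4 : P.offset k + (prefixVal sc j₀ P.L + P.β (2 * j₀) k) ≤ val / P.S := by
    rw [Int.le_ediv_iff_mul_le (by linarith)]
    linarith
  exact ⟨fun j hj => by linarith [h3 j hj], j₀, hj₀, by linarith [h3 j₀ hj₀]⟩

end Gadget

/-! ### Terms over the program variables -/

namespace Term

instance : Add Term := ⟨bin .add⟩
instance : Sub Term := ⟨bin .sub⟩
instance : Mul Term := ⟨bin .mul⟩
instance : Div Term := ⟨bin .div⟩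
instance : Mod Term := ⟨bin .mod⟩

/-- `1` if `x < y`, and `0` otherwise -/
def less (x y : Term) : Term := bin .lt x y

/-- `1` if `x = y`, and `0` otherwise -/
def equal (x y : Term) : Term := bin .eq x y

variable (s : State) (x y c : Term)

@[simp] theorem eval_add : (x + y).eval s = x.eval s + y.eval s := rfl
@[simp] theorem eval_sub : (x - y).eval s = x.eval s - y.eval s := rfl
@[simp] theorem eval_mul : (x * y).eval s = x.eval s * y.eval s := rfl
@[simp] theorem eval_div : (x / y).eval s = x.eval s / y.eval s := rfl
@[simp] theorem eval_mod : (x % y).eval s = x.eval s % y.eval s := rfl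
@[simp] theorem eval_less : (less x y).eval s = if x.eval s < y.eval s then 1 else 0 := rfl
@[simp] theorem eval_equal : (equal x y).eval s = if x.eval s = y.eval s then 1 else 0 := rfl
@[simp] theorem eval_reg (r : ℕ) : (reg r).eval s = s.reg r := rfl
@[simp] theorem eval_lit (z : ℤ) : (lit z).eval s = z := rfl
@[simp] theorem eval_get (k : ℕ) : (get k x).eval s = s.arr k (x.eval s) := rfl
@[simp] theorem eval_cond :
    (cond c x y).eval s = if c.eval s ≠ 0 then x.eval s else y.eval s := rfl

/-- The term uses only registers below `50` and arrays below `10`. -/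
def IsProg : Term → Bool
  | lit z => decide (|z| ≤ 2)
  | reg r => decide (r < 50)
  | bin o x y => o.isArith && x.IsProg && y.IsProg
  | get k x => decide (k < 10) && x.IsProg
  | peek _ _ => false
  | cond c x y => c.IsProg && x.IsProg && y.IsProg

/-- A decidable condition that ensures that the term can be evaluated. -/
def Fits (e : Term) : Bool := e.IsProg && decide (e.height ≤ 20) && decide (e.depth ≤ 49)

end Term

/-- The program variables are at most `Z`. -/
def Bounded (Z : ℤ) (s : State) : Prop :=
  (∀ r < 50, |s.reg r| ≤ Z) ∧ ∀ k < 10, ∀ a, |s.arr k a| ≤ Z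

theorem Bounded.setReg {Z : ℤ} {s : State} (h : Bounded Z s) (r : ℕ) {v : ℤ} (hv : |v| ≤ Z) :
    Bounded Z (s.setReg r v) := by
  refine ⟨fun r' hr' => ?_, h.2⟩
  rw [State.setReg_reg]
  split_ifs
  · exact hv
  · exact h.1 r' hr'

theorem Bounded.setReg_of_le {Z : ℤ} {s : State} (h : Bounded Z s) {r : ℕ} (hr : 50 ≤ r) (v : ℤ) :
    Bounded Z (s.setReg r v) := by
  refine ⟨fun r' hr' => ?_, h.2⟩
  rw [State.setReg_reg, if_neg (by omega)]
  exact h.1 r' hr'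

theorem Bounded.setArr {Z : ℤ} {s : State} (h : Bounded Z s) (k : ℕ) (a : ℤ) {v : ℤ}
    (hv : |v| ≤ Z) : Bounded Z (s.setArr k a v) := by
  refine ⟨h.1, fun k' hk a' => ?_⟩
  rw [State.setArr_arr]
  split_ifs
  · exact hv
  · exact h.2 k' hk a'

theorem Term.IsProg.ok : ∀ {e : Term}, e.IsProg = true → e.ok = true
  | .lit _, _ => rfl
  | .reg r, h => by
      simp only [IsProg, decide_eq_true_eq] at h
      simp [Term.ok, not_isScratch_of_lt h]
  | .bin o x y, h => by
      simp only [IsProg, Bool.and_eq_true] at h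
      simp [Term.ok, h.1.1, IsProg.ok h.1.2, IsProg.ok h.2]
  | .get k x, h => by
      simp only [IsProg, Bool.and_eq_true] at h
      exact IsProg.ok (e := x) h.2
  | .peek _ _, h => by simp [IsProg] at h
  | .cond c x y, h => by
      simp only [IsProg, Bool.and_eq_true] at h
      simp [Term.ok, IsProg.ok h.1.1, IsProg.ok h.1.2, IsProg.ok h.2]

theorem Term.IsProg.small {Z : ℤ} (hZ : 2 ≤ Z) {s : State} (hs : Bounded Z s) :
    ∀ {e : Term}, e.IsProg = true → e.Small Z s
  | .lit z, h => by
      simp only [IsProg, decide_eq_true_eq] at h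
      exact h.trans hZ
  | .reg r, h => hs.1 r (by simpa [IsProg] using h)
  | .bin o x y, h => by
      simp only [IsProg, Bool.and_eq_true] at h
      exact ⟨IsProg.small hZ hs h.1.2, IsProg.small hZ hs h.2⟩
  | .get k x, h => by
      simp only [IsProg, Bool.and_eq_true, decide_eq_true_eq] at h
      exact ⟨IsProg.small hZ hs h.2, hs.2 k h.1 _⟩
  | .peek _ _, h => by simp [IsProg] at h
  | .cond c x y, h => by
      simp only [IsProg, Bool.and_eq_true] at h
      exact ⟨IsProg.small hZ hs h.1.1, fun _ => IsProg.small hZ hs h.1.2,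
        fun _ => IsProg.small hZ hs h.2⟩

theorem Term.Fits.good {e : Term} (h : e.Fits = true) {μ : Machine} (hK : 20 ≤ μ.K) :
    e.Good μ := by
  simp only [Term.Fits, Bool.and_eq_true, decide_eq_true_eq] at h
  exact ⟨Term.IsProg.ok h.1.1, h.1.2.trans hK, h.2⟩

theorem Term.Fits.small {e : Term} (h : e.Fits = true) {Z : ℤ} (hZ : 2 ≤ Z) {s : State}
    (hs : Bounded Z s) : e.Small Z s := by
  simp only [Term.Fits, Bool.and_eq_true] at h
  exact Term.IsProg.small hZ hs h.1.1

namespace Runs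

variable {μ : Machine} {s : State} {Q : State → ℕ → Prop} {c c₁ c₂ : Cmd}

theorem assign (hK : 20 ≤ μ.K) {r : ℕ} {e : Term} (he : e.Fits = true) (hs : Bounded μ.Z s)
    (h : Q (s.setReg r (e.eval s)) (e.cost + 2)) : Runs μ (.set r e) s Q :=
  Runs.set (Term.Fits.good he hK) (Term.Fits.small he μ.two_le hs) h

theorem write (hK : 20 ≤ μ.K) {k : ℕ} {e₁ e₂ : Term} (he₁ : e₁.Fits = true)
    (he₂ : e₂.Fits = true) (hs : Bounded μ.Z s)
    (h : Q (s.setArr k (e₁.eval s) (e₂.eval s)) (e₁.cost + (e₂.cost + 1))) :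
    Runs μ (.put k e₁ e₂) s Q :=
  Runs.put (Term.Fits.good he₁ hK) (Term.Fits.small he₁ μ.two_le hs) (Term.Fits.good he₂ hK) (Term.Fits.small he₂ μ.two_le hs) h

theorem test (hK : 20 ≤ μ.K) {e : Term} (he : e.Fits = true) (hs : Bounded μ.Z s)
    (h1 : e.eval s ≠ 0 → Runs μ c₁ s fun s' t => Q s' (t + e.cost + 1))
    (h2 : e.eval s = 0 → Runs μ c₂ s fun s' t => Q s' (t + e.cost + 1)) :
    Runs μ (.iff e c₁ c₂) s Q :=
  Runs.iff (Term.Fits.good he hK) (Term.Fits.small he μ.two_le hs) h1 h2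

end Runs

open Term in
/-- `for r := 0; r < reg b; r := r + e do c` -/
def Cmd.forStep (r b : ℕ) (e : Term) (c : Cmd) : Cmd :=
  .seq (.set r (lit 0)) (.whileDo (less (reg r) (reg b)) (.seq c (.set r (reg r + e))))

/-- `for r := 0; r < reg b; r := r + 1 do c` -/
def Cmd.forTo (r b : ℕ) (c : Cmd) : Cmd := .forStep r b (.lit 1) c

/-- Here `i` counts the rounds and the counter is `i * σ`. The 8 units at the start are the
initialization and the first test. The 11 units per round, besides `e.cost`, are the increment and
the next test. -/
theorem Runs.forStep {μ : Machine} (hK : 20 ≤ μ.K) {r b : ℕ} {e : Term} {c : Cmd} {s : State}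
    {Q : State → ℕ → Prop} (hr : r < 50) (hb : b < 50) (he : (Term.reg r + e).Fits = true)
    {N σ : ℕ} (hσ : 1 ≤ σ) (I : ℕ → State → ℕ → Prop)
    (hI : ∀ i s τ, I i s τ → s.reg r = i * σ ∧ s.reg b = N ∧ Bounded μ.Z s)
    (hstep : ∀ i, i * σ < N → ∀ s τ, I i s τ → Runs μ c s fun s' t =>
      s'.reg r = i * σ ∧ e.eval s' = σ ∧ Bounded μ.Z s' ∧
      I (i + 1) (s'.setReg r ((i + 1 : ℕ) * σ)) (τ + t + e.cost + 11))
    (hbd : Bounded μ.Z s) (h0 : I 0 (s.setReg r 0) 8)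
    (hQ : ∀ i s τ, N ≤ i * σ → I i s τ → Q s (τ + 1)) : Runs μ (.forStep r b e c) s Q := by
  have hlt : (Term.less (Term.reg r) (Term.reg b)).Fits = true := by
    simp [Term.Fits, Term.less, Term.IsProg, hr, hb, WordOp.isArith, Term.height, Term.deg,
      Term.depth]
  have hlit : (Term.lit 0).Fits = true := by decide
  have hev : ∀ i s τ, I i s τ →
      ((Term.less (Term.reg r) (Term.reg b)).eval s = 0 ↔ N ≤ i * σ) := by
    intro i s τ h
    obtain ⟨h1, h2, _⟩ := hI i s τ h
    have h3 : ((i : ℤ) * σ < N) ↔ i * σ < N := by norm_cast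
    by_cases h : i * σ < N
    · simp [h1, h2, h3, h]
    · simp [h1, h2, h3, h, not_lt.1 h]
  -- As `σ ≥ 1`, after `N` rounds the counter has reached `N`.
  refine Runs.seq (Runs.assign hK hlit hbd (Runs.whileDo (Term.Fits.good hlt hK)
    (fun k s τ => ∃ i, (N ≤ i * σ ∨ N ≤ (i + k) * σ) ∧ I i s (3 + τ)) N ?_ ?_ ?_ ?_ ?_))
  · rintro k s τ ⟨i, _, h⟩
    exact Term.Fits.small hlt μ.two_le (hI i s _ h).2.2
  · rintro s τ ⟨i, hi, h⟩
    exact (hev i s _ h).2 (by simpa using hi)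
  · rintro k s τ ⟨i, hi, h⟩ hne
    have hi' : i * σ < N := by
      by_contra hc
      exact hne ((hev i s _ h).2 (by omega))
    refine Runs.seq ((hstep i hi' s _ h).mono ?_)
    rintro s' t ⟨h1, h2, h3, h4⟩
    refine Runs.assign hK he h3 ⟨k, le_rfl, i + 1, ?_, ?_⟩
    · right
      rcases hi with hi | hi
      · omega
      · rwa [show i + 1 + k = i + (k + 1) by ring]
    · have e1 : (Term.reg r + e).eval s' = (i + 1 : ℕ) * σ := by
        simp [h1, h2]; ring
      rw [e1]
      have e2 : (Term.reg r + e).cost = 2 + (e.cost + 1) := rfl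
      have e3 : (Term.less (Term.reg r) (Term.reg b)).cost = 5 := rfl
      rw [e2, e3]
      convert h4 using 1
      ring
  · refine ⟨0, Or.inr ?_, h0⟩
    rw [zero_add]
    exact Nat.le_mul_of_pos_right N hσ
  · rintro k s τ ⟨i, _, h⟩ hz
    have := hQ i s _ ((hev i s _ h).1 hz) h
    have e3 : (Term.lit 0).cost + 2 + (τ + 1) = 3 + τ + 1 := by
      simp only [Term.cost]; ring
    rwa [e3]

theorem Runs.forTo {μ : Machine} (hK : 20 ≤ μ.K) {r b : ℕ} {c : Cmd} {s : State}
    {Q : State → ℕ → Prop} (hr : r < 50) (hb : b < 50)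
    {N : ℕ} (I : ℕ → State → ℕ → Prop)
    (hI : ∀ i s τ, I i s τ → s.reg r = i ∧ s.reg b = N ∧ Bounded μ.Z s)
    (hstep : ∀ i < N, ∀ s τ, I i s τ → Runs μ c s fun s' t =>
      s'.reg r = i ∧ Bounded μ.Z s' ∧ I (i + 1) (s'.setReg r (i + 1 : ℕ)) (τ + t + 12))
    (hbd : Bounded μ.Z s) (h0 : I 0 (s.setReg r 0) 8)
    (hQ : ∀ s τ, I N s τ → Q s (τ + 1)) : Runs μ (.forTo r b c) s Q := by
  refine Runs.forStep hK hr hb ?_ (N := N) (σ := 1) le_rfl (fun i s τ => i ≤ N ∧ I i s τ)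
    (fun i s τ h => by simpa using hI i s τ h.2) ?_ hbd ⟨Nat.zero_le _, h0⟩ ?_
  · change Term.Fits (Term.bin .add (Term.reg r) (Term.lit 1)) = true
    simp [Term.Fits, Term.IsProg, hr, WordOp.isArith, Term.height, Term.deg, Term.depth]
  · intro i hi s τ h
    rw [mul_one] at hi
    refine (hstep i hi s τ h.2).mono ?_
    rintro s' t ⟨h1, h2, h3⟩
    refine ⟨by simpa using h1, rfl, h2, by omega, ?_⟩
    simpa [Term.cost, add_assoc] using h3
  · rintro i s τ h1 ⟨h2, h3⟩
    have : i = N := by omega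
    subst this
    exact hQ s τ h3

/-! ### Calls of a data structure -/

/-- What is known about a data structure on `N` vertices: the preprocessing takes time at most
`p`, updates take time at most `u`, and queries take time at most `q`. -/
structure DynAlg.SolvesAt (D : DynAlg) (k : UpdateKind) (d N p u q : ℕ) : Prop where
  prep : ∀ G : WGraph N, IsPlanarInstance d G → k.Initial G →
    ∃ (s : State) (t : ℕ), Exec (D.bound N) D.prep G.input s t ∧ t ≤ p
  upd : ∀ (G : WGraph N) (s : State), D.Reach k d G s →
    ∀ (a b : Fin N) (x : ℤ) (G' : WGraph N), k.Step G a b x G' → IsPlanarInstance d G' →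
      ∃ (s' : State) (t : ℕ), Exec (D.bound N) D.upd (updateCall s a b x) s' t ∧ t ≤ u
  qry : ∀ (G : WGraph N) (s : State), D.Reach k d G s → ∀ a b : Fin N,
    ∃ (s' : State) (t : ℕ), Exec (D.bound N) D.qry (queryCall s a b) s' t ∧
      t ≤ q ∧ G.IsDistAnswer a b (s'.reg 0) (s'.reg 1)

theorem Exec.abs_reg_le {B Z : ℤ} (hB : B ≤ Z) {c : Cmd} {s s' : State} {t : ℕ}
    (h : Exec B c s s' t) (hs : ∀ r, |s.reg r| ≤ Z) : ∀ r, |s'.reg r| ≤ Z := by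
  induction h with
  | skip | store | loop_false => exact hs
  | const r c s h | op o r a b s h | load r k a s h =>
    intro r'
    rw [State.setReg_reg]
    split_ifs
    · exact h.trans hB
    · exact hs r'
  | seq _ _ ih1 ih2 => exact ih2 (ih1 hs)
  | ite_true _ _ ih => exact ih hs
  | ite_false _ _ ih => exact ih hs
  | loop_true _ _ _ ih1 ih2 => exact ih2 (ih1 hs)

/-- `h` holds the data structure in a state for the graph `G`. -/
def Holds (D : DynAlg) (k : UpdateKind) (d R : ℕ) (Z : ℤ) (ov : Bool) {N : ℕ} (h : State)
    (G : WGraph N) : Prop :=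
  ∃ s, D.Reach k d G s ∧ Sim R ov h s ∧ ∀ r, |s.reg r| ≤ Z

section calls

variable {μ : Machine} {D : DynAlg} {k : UpdateKind} {d R N p u q : ℕ} {ov : Bool}

/-- The registers after a call differ only in the counter and the registers of the data
structure. -/
def CallFrame (ov : Bool) (R : ℕ) (h h' : State) : Prop :=
  (∀ r, ¬ IsScratch r → r ≠ 26 → (∀ i < R, r ≠ 100 + 2 * i) → h'.reg r = h.reg r) ∧
  ∀ i, ¬ LayerArr ov i → h'.arr i = h.arr i

theorem Exec.simulate' (hB : D.bound N ≤ μ.Z) (hK : 20 ≤ μ.K) {c : Cmd} {s s' : State} {t : ℕ}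
    (hE : Exec (D.bound N) c s s' t) (hc : c.Below R) {h : State} (H : Sim R ov h s)
    (S : Stamps μ.Z h) (h0 : 0 ≤ h.reg 26) (ht : h.reg 26 + t ≤ μ.Z) :
    Runs μ (c.emb ov) h fun h' T => (Sim R ov h' s' ∧ Stamps μ.Z h' ∧
      h'.reg 26 = h.reg 26 + t ∧ T ≤ 20 * t) ∧ CallFrame ov R h h' := by
  refine (hE.simulate hB (by omega) hc h H S h0 ht).frame.mono ?_
  rintro h' T ⟨h1, h2⟩
  exact ⟨h1, fun r hr h26 hi => h2.1 r hr (Cmd.not_writes_emb hr h26 hi c hc),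
    fun i hi => h2.2 i (Cmd.not_stores_emb hi c)⟩

/-- The arguments are put into the images of the registers 0, 1 and 2. The new state is again
reachable in the sense of `DynAlg.Reach`, so the guarantees of the data structure apply to the next
call as well. -/
theorem Holds.update (hS : D.SolvesAt k d N p u q) (hR : D.upd.Below R)
    (hB : D.bound N ≤ μ.Z) (hK : 20 ≤ μ.K) {h : State} {G G' : WGraph N}
    (H : Holds D k d R μ.Z ov h G) (S : Stamps μ.Z h) (h0 : 0 ≤ h.reg 26)
    (hu : h.reg 26 + u ≤ μ.Z) {a b : Fin N} {x : ℤ} (hN : (N : ℤ) ≤ μ.Z) (hx : |x| ≤ μ.Z)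
    (hstep : k.Step G a b x G') (hG' : IsPlanarInstance d G') :
    Runs μ (D.upd.emb ov) (((h.setReg 100 (a : ℕ)).setReg 102 (b : ℕ)).setReg 104 x)
      fun h' T => Holds D k d R μ.Z ov h' G' ∧ Stamps μ.Z h' ∧
        (∃ t : ℕ, h'.reg 26 = h.reg 26 + t ∧ t ≤ u ∧ T ≤ 20 * t) ∧ 
        CallFrame ov R (((h.setReg 100 (a : ℕ)).setReg 102 (b : ℕ)).setReg 104 x) h' := by
  obtain ⟨s, hs, hsim, hreg⟩ := H
  obtain ⟨s', t, hE, ht⟩ := hS.upd G s hs a b x G' hstep hG'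
  have hsim' := ((hsim.setReg 0 (a : ℕ)).setReg 1 (b : ℕ)).setReg 2 x
  have S' := ((S.setReg 0 (a : ℕ)).setReg 1 (b : ℕ)).setReg 2 x
  refine (hE.simulate' hB hK hR hsim' S' (by simpa using h0) ?_).mono ?_
  · simp
    have : (t : ℤ) ≤ u := by exact_mod_cast ht
    linarith
  · rintro h' T ⟨⟨h1, h2, h3, h4⟩, h5⟩
    have ha : |((a : ℕ) : ℤ)| ≤ μ.Z := by
      have := a.2
      rw [abs_of_nonneg (by positivity)]; omega
    have hb : |((b : ℕ) : ℤ)| ≤ μ.Z := by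
      have := b.2
      rw [abs_of_nonneg (by positivity)]; omega
    refine ⟨⟨s', hs.update hstep hG' hE, h1, hE.abs_reg_le hB ?_⟩, h2,
      ⟨t, by simpa using h3, ht, h4⟩, h5⟩
    intro r
    simp only [updateCall, State.setReg_reg]
    split_ifs
    · exact hx
    · exact hb
    · exact ha
    · exact hreg r

theorem Holds.query (hS : D.SolvesAt k d N p u q) (hR : D.qry.Below R) (hR2 : 2 ≤ R)
    (hB : D.bound N ≤ μ.Z) (hK : 20 ≤ μ.K) {h : State} {G : WGraph N}
    (H : Holds D k d R μ.Z ov h G) (S : Stamps μ.Z h) (h0 : 0 ≤ h.reg 26)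
    (hu : h.reg 26 + q ≤ μ.Z) {a b : Fin N} (hN : (N : ℤ) ≤ μ.Z) :
    Runs μ (D.qry.emb ov) ((h.setReg 100 (a : ℕ)).setReg 102 (b : ℕ))
      fun h' T => Holds D k d R μ.Z ov h' G ∧ Stamps μ.Z h' ∧
        (∃ t : ℕ, h'.reg 26 = h.reg 26 + t ∧ t ≤ q ∧ T ≤ 20 * t) ∧ 
        G.IsDistAnswer a b (h'.reg 100) (h'.reg 102) ∧ |h'.reg 102| ≤ μ.Z ∧
        CallFrame ov R ((h.setReg 100 (a : ℕ)).setReg 102 (b : ℕ)) h' := by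
  obtain ⟨s, hs, hsim, hreg⟩ := H
  obtain ⟨s', t, hE, ht, hans⟩ := hS.qry G s hs a b
  have hsim' := (hsim.setReg 0 (a : ℕ)).setReg 1 (b : ℕ)
  have S' := (S.setReg 0 (a : ℕ)).setReg 1 (b : ℕ)
  refine (hE.simulate' hB hK hR hsim' S' (by simpa using h0) ?_).mono ?_
  · simp
    have : (t : ℤ) ≤ q := by exact_mod_cast ht
    linarith
  · rintro h' T ⟨⟨h1, h2, h3, h4⟩, h5⟩
    have ha : |((a : ℕ) : ℤ)| ≤ μ.Z := by
      have := a.2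
      rw [abs_of_nonneg (by positivity)]; omega
    have hb : |((b : ℕ) : ℤ)| ≤ μ.Z := by
      have := b.2
      rw [abs_of_nonneg (by positivity)]; omega
    have hreg' : ∀ r, |s'.reg r| ≤ μ.Z := hE.abs_reg_le hB fun r => by
      simp only [queryCall, State.setReg_reg]
      split_ifs
      · exact hb
      · exact ha
      · exact hreg r
    have e0 : h'.reg 100 = s'.reg 0 := h1.1 0 (by omega)
    have e1 : h'.reg 102 = s'.reg 1 := h1.1 1 (by omega)
    refine ⟨⟨s', hs.query hE, h1, hreg'⟩, h2, ⟨t, by simpa using h3, ht, h4⟩, ?_, ?_, h5⟩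
    · rw [e0, e1]; exact hans
    · rw [e1]; exact hreg' 1

theorem CallFrame.bounded {h h' : State} (H : CallFrame ov R h h') (hb : Bounded μ.Z h)
    (h26 : |h'.reg 26| ≤ μ.Z) : Bounded μ.Z h' := by
  refine ⟨fun r hr => ?_, fun k hk a => ?_⟩
  · by_cases e : r = 26
    · rw [e]; exact h26
    · rw [H.1 r (not_isScratch_of_lt hr) e (fun i _ => by omega)]
      exact hb.1 r hr
  · rw [H.2 k (not_layerArr_of_lt hk)]
    exact hb.2 k hk a

theorem CallFrame.reg_eq {h h' : State} (H : CallFrame ov R h h') {r : ℕ} (hr : r < 50)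
    (h26 : r ≠ 26) : h'.reg r = h.reg r :=
  H.1 r (not_isScratch_of_lt hr) h26 (fun i _ => by omega)

theorem CallFrame.arr_eq {h h' : State} (H : CallFrame ov R h h') {k : ℕ} (hk : k < 10) :
    h'.arr k = h.arr k :=
  H.2 k (not_layerArr_of_lt hk)

end calls

/-! ### Saving and restoring the registers of the data structure -/

-- The number of registers is a constant of the data structure, so they can be copied. Its arrays
-- cannot, and are restored by means of the stamps.
open Term in
def saveRegs : ℕ → Cmd
  | 0 => .skip
  | R + 1 => .seq (saveRegs R) (.set (101 + 2 * R) (reg (100 + 2 * R)))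

open Term in
def restoreRegs : ℕ → Cmd
  | 0 => .skip
  | R + 1 => .seq (restoreRegs R) (.set (100 + 2 * R) (reg (101 + 2 * R)))

def zeroRegs : ℕ → Cmd
  | 0 => .skip
  | R + 1 => .seq (zeroRegs R) (.const (100 + 2 * R) 0)

section regs

variable {μ : Machine} {s : State}

theorem runs_saveRegs (hK : 20 ≤ μ.K) (R : ℕ) (hs : ∀ r < R, |s.reg (100 + 2 * r)| ≤ μ.Z) :
    Runs μ (saveRegs R) s fun s' t => t ≤ 4 * R + 1 ∧ s'.arr = s.arr ∧
      (∀ r < R, s'.reg (101 + 2 * r) = s.reg (100 + 2 * r)) ∧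
      ∀ r, (∀ i < R, r ≠ 101 + 2 * i) → s'.reg r = s.reg r := by
  induction R with
  | zero => exact Runs.skip ⟨le_rfl, rfl, by simp, fun r _ => rfl⟩
  | succ R ih =>
    refine Runs.seq ((ih fun r hr => hs r (by omega)).mono ?_)
    rintro s1 t1 ⟨h1, h2, h3, h4⟩
    have e : s1.reg (100 + 2 * R) = s.reg (100 + 2 * R) := h4 _ (fun i _ => by omega)
    refine Runs.set ⟨by simp [Term.ok, not_isScratch_of_le (show 100 ≤ 100 + 2 * R by omega)],
      ?_, by simp [Term.depth]⟩ ?_ ?_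
    · simp only [Term.height]; omega
    · simp only [Term.Small, e]; exact hs R (by omega)
    · refine ⟨by simp only [Term.cost]; omega, h2, fun r hr => ?_, fun r hr => ?_⟩
      · simp only [State.setReg_reg, Term.eval_reg, e]
        split_ifs with h
        · rw [show r = R by omega]
        · exact h3 r (by omega)
      · rw [State.setReg_reg, if_neg (hr R (by omega))]
        exact h4 r fun i hi => hr i (by omega)

theorem runs_restoreRegs (hK : 20 ≤ μ.K) (R : ℕ) (hs : ∀ r < R, |s.reg (101 + 2 * r)| ≤ μ.Z) :
    Runs μ (restoreRegs R) s fun s' t => t ≤ 4 * R + 1 ∧ s'.arr = s.arr ∧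
      (∀ r < R, s'.reg (100 + 2 * r) = s.reg (101 + 2 * r)) ∧
      ∀ r, (∀ i < R, r ≠ 100 + 2 * i) → s'.reg r = s.reg r := by
  induction R with
  | zero => exact Runs.skip ⟨le_rfl, rfl, by simp, fun r _ => rfl⟩
  | succ R ih =>
    refine Runs.seq ((ih fun r hr => hs r (by omega)).mono ?_)
    rintro s1 t1 ⟨h1, h2, h3, h4⟩
    have e : s1.reg (101 + 2 * R) = s.reg (101 + 2 * R) := h4 _ (fun i _ => by omega)
    refine Runs.set ⟨by simp [Term.ok, not_isScratch_of_le (show 100 ≤ 101 + 2 * R by omega)],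
      ?_, by simp [Term.depth]⟩ ?_ ?_
    · simp only [Term.height]; omega
    · simp only [Term.Small, e]; exact hs R (by omega)
    · refine ⟨by simp only [Term.cost]; omega, h2, fun r hr => ?_, fun r hr => ?_⟩
      · simp only [State.setReg_reg, Term.eval_reg, e]
        split_ifs with h
        · rw [show r = R by omega]
        · exact h3 r (by omega)
      · rw [State.setReg_reg, if_neg (hr R (by omega))]
        exact h4 r fun i hi => hr i (by omega)

theorem runs_zeroRegs (R : ℕ) :
    Runs μ (zeroRegs R) s fun s' t => t ≤ 4 * R + 1 ∧ s'.arr = s.arr ∧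
      (∀ r < R, s'.reg (100 + 2 * r) = 0) ∧
      ∀ r, (∀ i < R, r ≠ 100 + 2 * i) → s'.reg r = s.reg r := by
  induction R with
  | zero => exact Runs.skip ⟨le_rfl, rfl, by simp, fun r _ => rfl⟩
  | succ R ih =>
    refine Runs.seq (ih.mono ?_)
    rintro s1 t1 ⟨h1, h2, h3, h4⟩
    refine Runs.const ?_ ⟨by omega, h2, fun r hr => ?_, fun r hr => ?_⟩
    · simpa using pow_nonneg (by linarith [μ.two_le]) _
    · rw [State.setReg_reg]
      split_ifs with h
      · rfl
      · exact h3 r (by omega)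
    · rw [State.setReg_reg, if_neg (hr R (by omega))]
      exact h4 r fun i hi => hr i (by omega)

end regs

/-! ### Shortcuts and updates -/

namespace UpdateKind

/-- The updates of kind `k` set bits to this value. -/
def bit : UpdateKind → ℕ
  | .insert | .decrease => 0
  | .delete | .increase => 1

/-- The weight of a shortcut that is not to be used. -/
def inactive (k : UpdateKind) (S : ℤ) (b : ℕ) : ℤ :=
  match k with
  | .insert | .delete => 0
  | .increase | .decrease => S * 2 ^ b + 1

/-- The weight of the shortcut for bit number `b` with value `e`. -/
def shortcut (k : UpdateKind) (S : ℤ) (e b : ℕ) : ℤ := if e = 1 then k.inactive S b else 1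

/-- Each kind moves a shortcut from its initial position `1 - bit` to `bit`, and this is the only
direction needed. For changes of weights the point is that `S * 2 ^ b + 1 > 1`. -/
theorem step_shortcut (k : UpdateKind) {S : ℤ} (hS : 1 ≤ S) {N b : ℕ} {G : WGraph N} {i j : Fin N}
    (h : G i j = edgeOf (k.shortcut S (1 - k.bit) b)) :
    k.Step G i j (k.shortcut S k.bit b) (G.setEdge i j (edgeOf (k.shortcut S k.bit b))) := by
  have h2 : 0 < S * 2 ^ b := by positivity
  have h3 : edgeOf (S * 2 ^ b + 1) = some (S * 2 ^ b + 1) := edgeOf_of_ne (by omega)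
  cases k <;>
    simp only [Step, shortcut, bit, inactive, Nat.sub_zero, if_true, Nat.sub_self,
      show (0 : ℕ) ≠ 1 from zero_ne_one, if_false, edgeOf_zero, h3, edgeOf_of_ne one_ne_zero] at h ⊢
  · exact ⟨h, trivial⟩
  · simp [h]
  · exact ⟨⟨1, h, by omega⟩, trivial⟩
  · exact ⟨⟨_, h, by omega⟩, trivial⟩

end UpdateKind

theorem sum_bits (a L : ℕ) : ∑ b ∈ Finset.range L, (a / 2 ^ b % 2) * 2 ^ b = a % 2 ^ L := by
  induction L with
  | zero => simp [Nat.mod_one]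
  | succ L ih =>
    rw [Finset.sum_range_succ, ih, pow_succ, Nat.mod_mul]
    ring

namespace Gadget

variable {P : Gadget}

/-- Change one shortcut. -/
def setShortcut (sc : ℕ → ℕ → ℤ) (j b : ℕ) (x : ℤ) : ℕ → ℕ → ℤ :=
  fun j' b' => if j' = j ∧ b' = b then x else sc j' b'

theorem update_hw {sc : ℕ → ℕ → ℤ} {j b : ℕ} (hj : j < P.m) (hb : b < P.L) (x : ℤ) :
    Function.update (P.hw sc) (2 * j * P.cols + (P.w + 1 + b)) x = P.hw (setShortcut sc j b x) := by
  have hc : P.w + 1 + b < P.cols := by unfold cols; omega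
  have hdm := div_mod_eq (r := 2 * j) hc
  funext u
  by_cases hu : u = 2 * j * P.cols + (P.w + 1 + b)
  · rw [hu, Function.update_self, hw, hdm.1, hdm.2]
    simp only [horizontal]
    rw [if_pos (by omega), if_neg (by omega), if_neg (by omega), if_pos (by omega),
      if_pos (by omega), show 2 * j / 2 = j by omega, show P.w + 1 + b - (P.w + 1) = b by omega]
    simp [setShortcut]
  · rw [Function.update_of_ne hu]
    simp only [hw, horizontal]
    split_ifs with h1 h2 h3 h4 h5 h6 <;> try rfl
    rw [setShortcut, if_neg]
    rintro ⟨e1, e2⟩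
    apply hu
    rw [← Nat.div_add_mod u P.cols, show u / P.cols = 2 * j by omega,
      show u % P.cols = P.w + 1 + b by omega, mul_comm]

theorem hw_shortcut {sc : ℕ → ℕ → ℤ} {j b : ℕ} (hj : j < P.m) (hb : b < P.L) :
    P.hw sc (2 * j * P.cols + (P.w + 1 + b)) = sc j b := by
  have hc : P.w + 1 + b < P.cols := by unfold cols; omega
  have hdm := div_mod_eq (r := 2 * j) hc
  rw [hw, hdm.1, hdm.2]
  simp only [horizontal]
  rw [if_pos (by omega), if_neg (by omega), if_neg (by omega), if_pos (by omega),
    if_pos (by omega), show 2 * j / 2 = j by omega, show P.w + 1 + b - (P.w + 1) = b by omega]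

/-- A bound for the weights. -/
def heavy (P : Gadget) : ℤ := P.S * P.M * (4 * P.m + 3 * P.w + P.L + 4) + 1

theorem S_pos (hP : P.Valid) : 1 ≤ P.S := by rw [hP.S_eq]; omega

theorem M_pos (hP : P.Valid) : 1 ≤ P.M := by linarith [hP.M_ge, hP.X_pos]

/-- Every scaled weight is `S * x` with `x` at most a small multiple of `M`; the summand 1 leaves
room for inactive shortcuts. -/
theorem le_heavy (hP : P.Valid) {x y : ℤ} (hx : x ≤ P.M * y + P.M)
    (hy : y + 1 ≤ 4 * P.m + 3 * P.w + P.L + 4) : P.S * x + 1 ≤ P.heavy := by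
  have h1 := S_pos hP
  have h2 := M_pos hP
  have : P.S * x ≤ P.S * (P.M * (4 * P.m + 3 * P.w + P.L + 4)) := by
    refine mul_le_mul_of_nonneg_left (hx.trans ?_) (by linarith)
    rw [show P.M * y + P.M = P.M * (y + 1) by ring]
    exact mul_le_mul_of_nonneg_left hy (by linarith)
  unfold heavy
  linarith

theorem horizontal_mem (hP : P.Valid) (hL : (2 : ℤ) ^ P.L ≤ P.M) {sc : ℕ → ℕ → ℤ}
    (hsc : ∀ j b, b < P.L → 0 ≤ sc j b ∧ sc j b ≤ P.heavy) (r c : ℕ) :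
    0 ≤ P.horizontal sc r c ∧ P.horizontal sc r c ≤ P.heavy := by
  have h1 := S_pos hP
  have h2 := M_pos hP
  have h3 := hP.M_ge
  have h4 := hP.X_pos
  have h0 : 0 ≤ P.heavy := by
    unfold heavy; positivity
  have h5 : 1 ≤ P.heavy := by
    have := le_heavy (x := 0) (y := 0) hP (by linarith) (by omega)
    linarith
  unfold horizontal
  split_ifs with c1 c2 c3 c4 c5 c6 c7
  · have : (0 : ℤ) ≤ 4 * P.m - r := by omega
    refine ⟨by positivity, ?_⟩
    have := le_heavy (x := P.M * (4 * P.m - r)) (y := 4 * P.m - r) hP (by linarith) (by omega)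
    linarith
  · exact ⟨by norm_num, h5⟩
  · exact ⟨le_rfl, h0⟩
  · exact hsc _ _ (by omega)
  · refine ⟨by positivity, ?_⟩
    have e : (2 : ℤ) ^ (c - (P.w + 1)) ≤ 2 ^ P.L := pow_le_pow_right₀ (by norm_num) (by omega)
    have := le_heavy (x := 2 ^ (c - (P.w + 1))) (y := 0) hP (by linarith) (by omega)
    linarith
  · have b1 := hP.beta r (c - (P.w + 2 + P.L) + 1)
    have b2 := hP.beta r (c - (P.w + 2 + P.L))
    have e : P.M * 1 ≤ P.M * (2 * P.m + 1 + r) :=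
      mul_le_mul_of_nonneg_left (by omega) (by linarith)
    refine ⟨mul_nonneg (by linarith) (by linarith), ?_⟩
    have := le_heavy (x := P.M * (2 * P.m + 1 + r) + P.β r (c - (P.w + 2 + P.L) + 1) -
        P.β r (c - (P.w + 2 + P.L))) (y := 2 * P.m + 1 + r) hP (by linarith) (by omega)
    linarith
  · exact ⟨le_rfl, h0⟩
  · exact ⟨le_rfl, h0⟩

theorem vertical_mem (hP : P.Valid) (r c : ℕ) :
    0 ≤ P.vertical r c ∧ P.vertical r c ≤ P.heavy := by
  have h1 := S_pos hP
  have h2 := M_pos hP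
  have h0 : 0 ≤ P.heavy := by
    unfold heavy; positivity
  have h5 : 1 ≤ P.heavy := by
    have := le_heavy (x := 0) (y := 0) hP (by linarith) (by omega)
    linarith
  unfold vertical
  split_ifs with c1 c2 c3 c4 c5
  · refine ⟨by positivity, ?_⟩
    have := le_heavy (x := P.M * (P.w + c)) (y := P.w + c) hP (by linarith) (by omega)
    linarith
  · exact ⟨by norm_num, h5⟩
  · exact ⟨le_rfl, h0⟩
  · have : (0 : ℤ) ≤ 3 * P.w + 2 + P.L - c := by omega
    refine ⟨by positivity, ?_⟩
    have := le_heavy (x := P.M * (3 * P.w + 2 + P.L - c)) (y := 3 * P.w + 2 + P.L - c) hP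
      (by linarith) (by omega)
    linarith
  · exact ⟨le_rfl, h0⟩
  · exact ⟨le_rfl, h0⟩

theorem shortcut_mem (hP : P.Valid) (hL : (2 : ℤ) ^ P.L ≤ P.M) (k : UpdateKind) (e : ℕ) {b : ℕ}
    (hb : b < P.L) : 0 ≤ k.shortcut P.S e b ∧ k.shortcut P.S e b ≤ P.heavy := by
  have h1 := S_pos hP
  have e1 : (2 : ℤ) ^ b ≤ 2 ^ P.L := pow_le_pow_right₀ (by norm_num) (by omega)
  have := le_heavy (x := 2 ^ b) (y := 0) hP (by linarith) (by omega)
  have e2 : 0 < P.S * 2 ^ b := by positivity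
  unfold UpdateKind.shortcut UpdateKind.inactive
  split_ifs
  · cases k <;> simp only <;> constructor <;> linarith
  · constructor <;> linarith

theorem validShortcuts {k : UpdateKind} {f : ℕ → ℕ → ℕ} {sc : ℕ → ℕ → ℤ}
    (h : ∀ j < P.m, ∀ b < P.L, sc j b = k.shortcut P.S (f j b) b) : P.ValidShortcuts sc := by
  intro j hj b hb
  rw [h j hj b hb]
  unfold UpdateKind.shortcut UpdateKind.inactive
  split_ifs
  · cases k <;> simp
  · simp

/-- A bit 0 is an active shortcut and contributes nothing; a bit 1 forces the detour of cost `2 ^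
b`. What remains is the binary expansion. -/
theorem prefixVal_eq (hP : P.Valid) {k : UpdateKind} {a : ℕ} {sc : ℕ → ℕ → ℤ} {j : ℕ}
    (h : ∀ b < P.L, sc j b = k.shortcut P.S (a / 2 ^ b % 2) b) (ha : a < 2 ^ P.L) :
    prefixVal sc j P.L = a := by
  have h1 := S_pos hP
  have e : prefixVal sc j P.L = ((∑ b ∈ Finset.range P.L, (a / 2 ^ b % 2) * 2 ^ b : ℕ) : ℤ) := by
    unfold prefixVal
    push_cast
    refine Finset.sum_congr rfl fun b hb => ?_
    rw [h b (Finset.mem_range.1 hb)]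
    have e2 : 0 < P.S * 2 ^ b := by positivity
    rcases Nat.mod_two_eq_zero_or_one (a / 2 ^ b) with h0 | h0
    · have : ((a : ℤ) / 2 ^ b) % 2 = 0 := by exact_mod_cast h0
      simp [UpdateKind.shortcut, h0, this]
    · have : ((a : ℤ) / 2 ^ b) % 2 = 1 := by exact_mod_cast h0
      rw [this, if_neg]
      · ring
      · simp only [UpdateKind.shortcut, h0, if_true, UpdateKind.inactive]
        cases k <;> simp only <;> omega
  rw [e, sum_bits, Nat.mod_eq_of_lt ha]

theorem graph_isPlanarInstance (hP : P.Valid) (hL : (2 : ℤ) ^ P.L ≤ P.M) {N d : ℕ}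
    (hd : P.heavy ≤ (N : ℤ) ^ d) {sc : ℕ → ℕ → ℤ}
    (hsc : ∀ j b, b < P.L → 0 ≤ sc j b ∧ sc j b ≤ P.heavy) :
    IsPlanarInstance d (P.graph N sc) := by
  refine gridG_isPlanarInstance two_le_cols (fun v => ?_) (fun v => ?_)
    (fun v hv => horizontal_ne_zero_lt hv)
  · have := horizontal_mem hP hL hsc (v / P.cols) (v % P.cols)
    exact ⟨this.1, this.2.trans hd⟩
  · have := vertical_mem hP (v / P.cols) (v % P.cols)
    exact ⟨this.1, this.2.trans hd⟩

end Gadget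

/-! ### Jobs -/

/-- The part of a matrix product that is computed with one data structure: the rows `j₀, …` and
the columns `k₀, …` of the right factor. Both factors are the `n × n` matrix `W`. -/
structure Job where
  n : ℕ
  X : ℕ
  L : ℕ
  N : ℕ
  m : ℕ
  w : ℕ
  j₀ : ℕ
  k₀ : ℕ
  W : ℕ → ℕ → ℕ

namespace Job

variable (J : Job)

/-- Column 0 of `β` is reserved for the normalization, so column `l` stands for column `k₀ + (l -
1)` of the matrix. Positions outside the matrix get the value `X`, which acts as infinity; thus `n`
need not be divisible by `m` or `w`. -/
def gadget : Gadget where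
  m := J.m
  w := J.w
  L := J.L
  S := 3 * J.L + 3
  M := 4 * J.X
  X := J.X
  β r l := if l = 0 then 0
    else if J.j₀ + r / 2 < J.n ∧ J.k₀ + (l - 1) < J.n then J.W (J.j₀ + r / 2) (J.k₀ + (l - 1))
    else J.X

/-- `lt_pow` makes room for the largest code `2 * X`, and `pow_le` keeps the weights for the bits
below `S * M`, which `heavy` bounds. -/
structure Valid : Prop where
  n_pos : 1 ≤ J.n
  X_pos : 1 ≤ J.X
  m_pos : 1 ≤ J.m
  w_pos : 1 ≤ J.w
  W_le : ∀ i k, J.W i k ≤ J.X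
  lt_pow : 2 * J.X < 2 ^ J.L
  pow_le : 2 ^ J.L ≤ 4 * J.X
  size : 2 * J.m * J.gadget.cols ≤ J.N

/-- The number that is encoded in the rows `2 * j` and `2 * j + 1` for row `i` of the product. -/
def code (i j : ℕ) : ℕ := if J.j₀ + j < J.n then J.W i (J.j₀ + j) + J.X else 2 * J.X

/-- The shortcuts when the bits `b` in row pair `j`, with `(j, b)` lexicographically below
`(j', b')`, have been set for row `i`. -/
def partialSc (k : UpdateKind) (i j' b' : ℕ) : ℕ → ℕ → ℤ := fun j b =>
  k.shortcut J.gadget.S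
    (if j < j' ∨ (j = j' ∧ b < b') then J.code i j / 2 ^ b % 2 else 1 - k.bit) b

/-- The graph from which the row phases start. -/
def start (k : UpdateKind) : WGraph J.N := J.gadget.graph J.N fun _ b =>
  k.shortcut J.gadget.S (1 - k.bit) b

variable {J}

theorem gadget_valid (hJ : J.Valid) : J.gadget.Valid where
  w_pos := hJ.w_pos
  S_eq := rfl
  X_pos := by have := hJ.X_pos; simp only [gadget]; omega
  M_ge := le_rfl
  beta r l := by
    simp only [gadget]
    split_ifs
    · simp
    · have := hJ.W_le (J.j₀ + r / 2) (J.k₀ + (l - 1))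
      exact ⟨by positivity, by exact_mod_cast this⟩
    · simp
  beta_zero r := by simp [gadget]

theorem pow_le_M (hJ : J.Valid) : (2 : ℤ) ^ J.gadget.L ≤ J.gadget.M := by
  have := hJ.pow_le
  simp only [gadget]
  exact_mod_cast this

theorem partialSc_zero (k : UpdateKind) (i : ℕ) :
    J.partialSc k i 0 0 = fun _ b => k.shortcut J.gadget.S (1 - k.bit) b := by
  funext j b
  simp [partialSc]

theorem partialSc_succ (k : UpdateKind) (i j' b' : ℕ) :
    J.partialSc k i j' (b' + 1) = Gadget.setShortcut (J.partialSc k i j' b') j' b'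
      (k.shortcut J.gadget.S (J.code i j' / 2 ^ b' % 2) b') := by
  funext j b
  simp only [partialSc, Gadget.setShortcut]
  by_cases h : j = j' ∧ b = b'
  · obtain ⟨rfl, rfl⟩ := h
    simp
  · rw [if_neg h]
    have : (j < j' ∨ j = j' ∧ b < b' + 1) ↔ (j < j' ∨ j = j' ∧ b < b') := by omega
    simp only [this]

/-- Having set all `L` bits of pair `j'` and none of the next one are two descriptions of the same
grid; only bits below `L` occur in it. -/
theorem graph_partialSc_row (k : UpdateKind) (i j' : ℕ) :
    J.gadget.graph J.N (J.partialSc k i (j' + 1) 0) =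
      J.gadget.graph J.N (J.partialSc k i j' J.L) := by
  unfold Gadget.graph
  congr 1
  funext v
  simp only [Gadget.hw, Gadget.horizontal]
  split_ifs with h1 h2 h3 h4 h5 <;> try rfl
  simp only [partialSc]
  congr 1
  have : v % J.gadget.cols - (J.gadget.w + 1) < J.L := by
    have : J.gadget.L = J.L := rfl
    omega
  have e : (v / J.gadget.cols / 2 < j' + 1 ∨ v / J.gadget.cols / 2 = j' + 1 ∧
    v % J.gadget.cols - (J.gadget.w + 1) < 0) ↔ (v / J.gadget.cols / 2 < j' ∨
    v / J.gadget.cols / 2 = j' ∧ v % J.gadget.cols - (J.gadget.w + 1) < J.L) := by omega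
  simp only [e]

theorem partialSc_mem (hJ : J.Valid) (k : UpdateKind) (i j' b' j b : ℕ) (hb : b < J.L) :
    0 ≤ J.partialSc k i j' b' j b ∧ J.partialSc k i j' b' j b ≤ J.gadget.heavy :=
  Gadget.shortcut_mem (gadget_valid hJ) (pow_le_M hJ) k _ hb

theorem partialSc_isPlanarInstance (hJ : J.Valid) {d : ℕ} (hd : J.gadget.heavy ≤ (J.N : ℤ) ^ d)
    (k : UpdateKind) (i j' b' : ℕ) :
    IsPlanarInstance d (J.gadget.graph J.N (J.partialSc k i j' b')) :=
  Gadget.graph_isPlanarInstance (gadget_valid hJ) (pow_le_M hJ) hd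
    fun j b hb => partialSc_mem hJ k i j' b' j b hb

theorem code_lt (hJ : J.Valid) (i j : ℕ) : J.code i j < 2 ^ J.L := by
  have := hJ.lt_pow
  have := hJ.W_le i (J.j₀ + j)
  unfold code
  split_ifs <;> omega

/-- This is the reason for the summand `X` in `code`: the minimum is then at least `X`, as the
potential requires where the middle part begins. -/
theorem le_code (i j : ℕ) : J.X ≤ J.code i j := by
  unfold code
  split_ifs <;> omega

/-- What the answer of a query says about the product. -/
theorem answer (hJ : J.Valid) (k : UpdateKind) (i : ℕ) {l : ℕ} (hl : l < J.w)
    (hkl : J.k₀ + l < J.n) {a b : Fin J.N} (ha : (a : ℕ) = J.w - (l + 1))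
    (hb : (b : ℕ) = (2 * J.m - 1) * J.gadget.cols + (J.w + 2 + J.L + (l + 1))) {flag val : ℤ}
    (h : (J.gadget.graph J.N (J.partialSc k i J.m 0)).IsDistAnswer a b flag val) :
    (∀ j < J.m, J.j₀ + j < J.n → val / J.gadget.S - J.gadget.offset (l + 1) - J.X ≤
        J.W i (J.j₀ + j) + J.W (J.j₀ + j) (J.k₀ + l)) ∧
    0 ≤ val / J.gadget.S - J.gadget.offset (l + 1) - J.X ∧
    (val / J.gadget.S - J.gadget.offset (l + 1) - J.X < J.X → ∃ j < J.n,
      val / J.gadget.S - J.gadget.offset (l + 1) - J.X = J.W i j + J.W j (J.k₀ + l)) := by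
  have hP := gadget_valid hJ
  have hp : ∀ j < J.m, Gadget.prefixVal (J.partialSc k i J.m 0) j J.L = J.code i j := by
    intro j hj
    refine Gadget.prefixVal_eq hP (k := k) (a := J.code i j) (fun b hb => ?_) (code_lt hJ i j)
    simp [partialSc, hj]
  have hβ : ∀ j, J.j₀ + j < J.n → J.gadget.β (2 * j) (l + 1) = J.W (J.j₀ + j) (J.k₀ + l) := by
    intro j hj
    simp only [gadget, Nat.add_sub_cancel, show 2 * j / 2 = j by omega, hj, hkl, and_self, if_true]
    rw [if_neg (by omega)]
  have := Gadget.answer (sc := J.partialSc k i J.m 0) (k := l + 1) hP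
    (Gadget.validShortcuts (k := k)
      (f := fun j b => if j < J.m ∨ (j = J.m ∧ b < 0) then J.code i j / 2 ^ b % 2 else 1 - k.bit)
      fun j _ b _ => rfl) hJ.size hJ.m_pos (by omega) hl (fun j hj => by
      change (J.X : ℤ) ≤ Gadget.prefixVal _ j J.L
      rw [hp j hj]; exact_mod_cast le_code i j) ha hb h
  obtain ⟨h1, j₁, hj₁, h2⟩ := this
  change ∀ j < J.m, _ ≤ Gadget.prefixVal _ j J.L + _ at h1
  change _ = Gadget.prefixVal _ j₁ J.L + _ at h2
  have hb1 := (hP.beta (2 * j₁) (l + 1)).1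
  have hc1 := le_code (J := J) i j₁
  rw [hp j₁ hj₁] at h2
  refine ⟨fun j hj hjn => ?_, ?_, fun hlt => ?_⟩
  · have := h1 j hj
    rw [hp j hj, hβ j hjn, code, if_pos hjn] at this
    push_cast at this
    linarith
  · have : (J.X : ℤ) ≤ J.code i j₁ := by exact_mod_cast hc1
    linarith
  -- Row pairs outside the matrix carry the code `2 * X`, so their sums are at least `X` after the
  -- subtraction of `X`.
  · have hjn : J.j₀ + j₁ < J.n := by
      by_contra hc
      rw [code, if_neg hc] at h2
      push_cast at h2
      linarith
    refine ⟨J.j₀ + j₁, hjn, ?_⟩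
    rw [hβ j₁ hjn, code, if_pos hjn] at h2
    push_cast at h2
    linarith

end Job

/-! ### Processing one row of the left factor

The program variables are: `0` size `n`, `1` bound `X`, `3` block area `Y`, `4` number `L` of bits,
`5` scale `S`, `6` scale `M`, `7` number `N` of vertices, `8` length of the walks, `9` and `10`
block size `m × w`, `12` row length of the grid, `13` time limit, `14` flag, `15` and `16` block
position, `17` row, `18` to `23` and `27` to `34` local variables, `24` and `25` the stamps, `26` the
clock. Array `4` is the matrix, array `5` the product, array `6` contains powers of two. -/

section programs

open Term

/-- The argument of an update of bit number `reg 19`. -/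
def updateTerm : UpdateKind → Term
  | .insert | .decrease => lit 1
  | .delete => lit 0
  | .increase => reg 5 * get 6 (reg 19) + lit 1

def bitTerm (k : UpdateKind) : Term :=
  equal (reg 21 % lit 2) (match k with
    | .insert | .decrease => lit 0
    | .delete | .increase => lit 1)

/-- Update the shortcut at vertex `reg 22` if the last bit of `reg 21` requires it. -/
def toggleCode (D : DynAlg) (k : UpdateKind) : Cmd :=
  .iff (bitTerm k)
    (.seq (.set 100 (reg 22)) (.seq (.set 102 (reg 22 + lit 1)) (.seq (.set 104 (updateTerm k))
      (D.upd.emb true)))) .skip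

def bitsCode (D : DynAlg) (k : UpdateKind) : Cmd :=
  .forTo 19 4 (.seq (toggleCode D k) (.seq (.set 21 (reg 21 / lit 2))
    (.seq (.set 22 (reg 22 + lit 1)) tick)))

/-- The number to be encoded in row pair `reg 18`. -/
def codeTerm : Term :=
  cond (less (reg 15 + reg 18) (reg 0)) (get 4 (reg 17 * reg 0 + (reg 15 + reg 18)) + reg 1)
    (lit 2 * reg 1)

def encodeCode (D : DynAlg) (k : UpdateKind) : Cmd :=
  .forTo 18 9 (.seq (.set 21 codeTerm) (.seq (.set 22 (lit 2 * reg 18 * reg 12 + (reg 10 + lit 1)))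
    (.seq (bitsCode D k) tick)))

/-- Literals in terms are restricted to absolute value 2, so that they are at most `Z` on every
machine. Larger constants are spelled out as sums. -/
def offsetTerm : Term :=
  reg 6 * ((lit 2 * reg 9 - lit 1) * (lit 2 * reg 10 - (reg 20 + lit 1)) +
    (reg 20 + lit 1) * (lit 2 * reg 9 + (lit 2 * reg 9 + lit 2 * reg 9) + lit 1))

def cellTerm : Term := reg 17 * reg 0 + (reg 16 + reg 20)

def queryCode (D : DynAlg) : Cmd :=
  .forTo 20 10 (.seq (.iff (less (reg 16 + reg 20) (reg 0))
    (.seq (.set 100 (reg 10 - (reg 20 + lit 1)))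
    (.seq (.set 102 ((lit 2 * reg 9 - lit 1) * reg 12 +
      (reg 10 + lit 2 + reg 4 + (reg 20 + lit 1))))
    (.seq (D.qry.emb true)
    (.seq (.set 31 (reg 102 / reg 5 - offsetTerm - reg 1))
      (.iff (less (reg 31) (get 5 cellTerm)) (.put 5 cellTerm (reg 31)) .skip))))) .skip) tick)

/-- Process row `reg 17`. -/
def rowCode (D : DynAlg) (k : UpdateKind) (R : ℕ) : Cmd :=
  .seq (.set 25 (reg 25 + lit 1)) (.seq (restoreRegs R) (.seq (encodeCode D k) (queryCode D)))

end programs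

/-- The hypotheses on the data structure and on the machine for the job `J`. -/
structure Ctx (μ : Machine) (D : DynAlg) (k : UpdateKind) (d R p u q : ℕ) (J : Job) : Prop where
  K_ge : 20 ≤ μ.K
  solves : D.SolvesAt k d J.N p u q
  prep_below : D.prep.Below R
  upd_below : D.upd.Below R
  qry_below : D.qry.Below R
  R_ge : 3 ≤ R
  bound_le : D.bound J.N ≤ μ.Z
  valid : J.Valid
  heavy_le_pow : J.gadget.heavy ≤ (J.N : ℤ) ^ d
  heavy_le : J.gadget.heavy ≤ μ.Z
  N_le : (J.N : ℤ) ≤ μ.Z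
  sq_le : (J.N : ℤ) * J.N ≤ μ.Z
  X_le : 4 * (J.X : ℤ) ≤ μ.Z

/-- The program variables contain the parameters of the job. -/
structure JobRegs (J : Job) (s : State) : Prop where
  r0 : s.reg 0 = J.n
  r1 : s.reg 1 = J.X
  r4 : s.reg 4 = J.L
  r5 : s.reg 5 = J.gadget.S
  r6 : s.reg 6 = J.gadget.M
  r7 : s.reg 7 = J.N
  r9 : s.reg 9 = J.m
  r10 : s.reg 10 = J.w
  r12 : s.reg 12 = J.gadget.cols
  r15 : s.reg 15 = J.j₀
  r16 : s.reg 16 = J.k₀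
  a4 : ∀ i < J.n, ∀ l < J.n, s.arr 4 ((i : ℤ) * J.n + l) = J.W i l
  a6 : ∀ b < J.L, s.arr 6 b = 2 ^ b

theorem JobRegs.congr {J : Job} {s s' : State} (h : JobRegs J s)
    (hr : ∀ r < 17, s'.reg r = s.reg r) (h4 : s'.arr 4 = s.arr 4) (h6 : s'.arr 6 = s.arr 6) :
    JobRegs J s' := by
  obtain ⟨a, b, c, d, e, f, g, i, j, l, m, n, o⟩ := h
  constructor <;> first
    | (rw [hr _ (by norm_num)]; assumption)
    | (rw [h4]; assumption)
    | (rw [h6]; assumption)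

/-- The state `s'` differs from `s` only in the counter, the data structure and one of the layers. -/
def CallSame (ov : Bool) (s s' : State) : Prop :=
  (∀ r, ¬ IsScratch r → r ≠ 26 → (r < 100 ∨ r % 2 = 1) → s'.reg r = s.reg r) ∧
  ∀ i, ¬ LayerArr ov i → s'.arr i = s.arr i

theorem CallSame.refl {ov : Bool} (s : State) : CallSame ov s s :=
  ⟨fun _ _ _ _ => rfl, fun _ _ => rfl⟩

theorem CallSame.trans {ov : Bool} {s s' s'' : State} (h : CallSame ov s s')
    (h' : CallSame ov s' s'') : CallSame ov s s'' :=
  ⟨fun r h1 h2 h3 => (h'.1 r h1 h2 h3).trans (h.1 r h1 h2 h3),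
    fun i hi => (h'.2 i hi).trans (h.2 i hi)⟩

theorem CallSame.setReg {ov : Bool} (s : State) (r : ℕ) (v : ℤ) :
    CallSame ov s (s.setReg (100 + 2 * r) v) :=
  ⟨fun r' _ _ h => by rw [State.setReg_reg, if_neg (by omega)], fun _ _ => rfl⟩

theorem CallFrame.callSame {ov : Bool} {R : ℕ} {s s' : State} (h : CallFrame ov R s s') :
    CallSame ov s s' :=
  ⟨fun r h1 h2 h3 => h.1 r h1 h2 (fun i _ => by omega), h.2⟩

theorem CallSame.reg {ov : Bool} {s s' : State} (h : CallSame ov s s') {r : ℕ} (hr : r < 50)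
    (h26 : r ≠ 26) : s'.reg r = s.reg r :=
  h.1 r (not_isScratch_of_lt hr) h26 (by omega)

/-- What is not changed while a row is processed. -/
def RowSame (s₁ s : State) : Prop :=
  (∀ r, r < 18 ∨ r = 24 ∨ r = 25 ∨ (100 ≤ r ∧ r % 2 = 1) → s.reg r = s₁.reg r) ∧
  ∀ i, ¬ LayerArr true i → i ≠ 5 → s.arr i = s₁.arr i

theorem RowSame.call {s₁ s s' : State} (h : RowSame s₁ s) (h' : CallSame true s s') :
    RowSame s₁ s' := by
  refine ⟨fun r hr => ?_, fun i hi h5 => (h'.2 i hi).trans (h.2 i hi h5)⟩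
  rw [h'.1 r ?_ (by omega) (by omega), h.1 r hr]
  intro hsc
  have := hsc.1; have := hsc.2
  omega

theorem RowSame.setReg {s₁ s : State} (h : RowSame s₁ s) {r : ℕ} (hr : 18 ≤ r)
    (h24 : r ≠ 24) (h25 : r ≠ 25) (h100 : r < 100 ∨ r % 2 = 0) (v : ℤ) :
    RowSame s₁ (s.setReg r v) :=
  ⟨fun r' hr' => by rw [State.setReg_reg, if_neg (by omega), h.1 r' hr'], h.2⟩

theorem RowSame.jobRegs {J : Job} {s₁ s : State} (h : RowSame s₁ s) (hJ : JobRegs J s₁) :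
    JobRegs J s :=
  hJ.congr (fun r hr => h.1 r (by omega))
    (h.2 4 (not_layerArr_of_lt (by norm_num)) (by norm_num))
    (h.2 6 (not_layerArr_of_lt (by norm_num)) (by norm_num))

theorem Stamps.setReg' {Z : ℤ} {h : State} (H : Stamps Z h) {r : ℕ} (v : ℤ) (h24 : r ≠ 24)
    (h25 : r ≠ 25) : Stamps Z (h.setReg r v) :=
  H.congr (by simp [h24.symm]) (by simp [h25.symm]) fun _ _ => rfl

theorem Holds.setReg {D : DynAlg} {k : UpdateKind} {d R : ℕ} {Z : ℤ} {ov : Bool} {N : ℕ}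
    {h : State} {G : WGraph N} (H : Holds D k d R Z ov h G) {r : ℕ} (v : ℤ) (hr : r < 50)
    (h24 : r ≠ 24) (h25 : r ≠ 25) : Holds D k d R Z ov (h.setReg r v) G := by
  obtain ⟨s, h1, h2, h3⟩ := H
  exact ⟨s, h1, h2.congr (fun i _ => by rw [State.setReg_reg, if_neg (by omega)])
    (by simp [h24.symm]) (by simp [h25.symm]) fun _ _ => rfl, h3⟩

/-- The invariant of the programs that process a row. -/
structure RowInv (μ : Machine) (s₁ s : State) : Prop where
  same : RowSame s₁ s
  bounded : Bounded μ.Z s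
  stamps : Stamps μ.Z s

theorem RowInv.setReg {μ : Machine} {s₁ s : State} (h : RowInv μ s₁ s) {r : ℕ} {v : ℤ}
    (hr : 18 ≤ r) (h50 : r < 50) (h24 : r ≠ 24) (h25 : r ≠ 25) (hv : |v| ≤ μ.Z) :
    RowInv μ s₁ (s.setReg r v) :=
  ⟨h.same.setReg hr h24 h25 (by omega) v, h.bounded.setReg r hv, h.stamps.setReg' v h24 h25⟩

theorem abs_natCast_le {a : ℕ} {Z : ℤ} (h : (a : ℤ) ≤ Z) : |(a : ℤ)| ≤ Z := by
  rwa [abs_of_nonneg (Int.natCast_nonneg a)]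

section row

variable {μ : Machine} {D : DynAlg} {k : UpdateKind} {d R p u q : ℕ} {J : Job}

theorem updateTerm_fits (k : UpdateKind) : (updateTerm k).Fits = true := by cases k <;> decide

theorem bitTerm_fits (k : UpdateKind) : (bitTerm k).Fits = true := by cases k <;> decide

theorem updateTerm_cost (k : UpdateKind) : (updateTerm k).cost ≤ 8 := by cases k <;> decide

theorem bitTerm_cost (k : UpdateKind) : (bitTerm k).cost ≤ 6 := by cases k <;> decide

theorem eval_updateTerm {s : State} (hs : JobRegs J s) {b : ℕ} (hb : b < J.L)
    (h19 : s.reg 19 = b) : (updateTerm k).eval s = k.shortcut J.gadget.S k.bit b := by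
  cases k <;> simp [updateTerm, UpdateKind.shortcut, UpdateKind.bit, UpdateKind.inactive, h19,
    hs.r5, hs.a6 b hb]

theorem eval_bitTerm {s : State} {a : ℕ} (h21 : s.reg 21 = a) :
    (bitTerm k).eval s = if a % 2 = k.bit then 1 else 0 := by
  have h0 : ((a : ℤ) % 2 = 0) ↔ a % 2 = 0 := by omega
  have h1 : ((a : ℤ) % 2 = 1) ↔ a % 2 = 1 := by omega
  cases k <;> simp only [bitTerm, UpdateKind.bit, Term.eval_equal, Term.eval_mod, Term.eval_reg,
    Term.eval_lit, h21, h0, h1] <;> split_ifs <;> simp [*]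

theorem bit_eq_or (k : UpdateKind) : k.bit = 0 ∨ k.bit = 1 := by
  cases k <;> simp [UpdateKind.bit]

theorem vertex_lt (hJ : J.Valid) {j b : ℕ} (hj : j < J.m) (hb : b < J.L) :
    2 * j * J.gadget.cols + (J.w + 1 + b) + 1 < J.N := by
  have h1 : 2 * j + 1 < 2 * J.m := by omega
  have hc : J.w + 1 + b + 1 < J.gadget.cols := by
    change _ < 2 * J.w + J.L + 3
    omega
  exact Gadget.index_lt (m := J.m) (r := 2 * j) hJ.size (by omega) hc

/-- The shortcut is still in its initial position. An update is issued exactly if the bit has the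
value `k.bit`; otherwise the shortcut is already right and `partialSc` does not change. -/
theorem runs_toggle (C : Ctx μ D k d R p u q J) {i j b a : ℕ} {s : State} (hs : JobRegs J s)
    (hbd : Bounded μ.Z s) (hst : Stamps μ.Z s) (hj : j < J.m) (hb : b < J.L)
    (h19 : s.reg 19 = b) (h21 : s.reg 21 = a) (ha : a = J.code i j / 2 ^ b)
    (h22 : s.reg 22 = (2 * j * J.gadget.cols + (J.w + 1 + b) : ℕ))
    (hH : Holds D k d R μ.Z true s (J.gadget.graph J.N (J.partialSc k i j b)))
    (h0 : 0 ≤ s.reg 26) (hu : s.reg 26 + u ≤ μ.Z) :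
    Runs μ (toggleCode D k) s fun s' t =>
      Holds D k d R μ.Z true s' (J.gadget.graph J.N (J.partialSc k i j (b + 1))) ∧
      Stamps μ.Z s' ∧ Bounded μ.Z s' ∧ CallSame true s s' ∧
      ∃ x : ℕ, s'.reg 26 = s.reg 26 + x ∧ x ≤ u ∧ t ≤ 20 * x + 30 := by
  have hK := C.K_ge
  have hJ := C.valid
  have hv := vertex_lt hJ hj hb
  set v := 2 * j * J.gadget.cols + (J.w + 1 + b) with hvdef
  have hbit := bit_eq_or k
  have hinit : J.partialSc k i j b j b = k.shortcut J.gadget.S (1 - k.bit) b := by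
    simp [Job.partialSc]
  have hcost := bitTerm_cost k
  have hcost' := updateTerm_cost k
  refine Runs.test hK (bitTerm_fits k) hbd (fun hne => ?_) (fun he => ?_)
  · have hbit' : a % 2 = k.bit := by
      by_contra hc
      exact hne (by rw [eval_bitTerm h21, if_neg hc])
    have hx := Gadget.shortcut_mem (Job.gadget_valid hJ) (Job.pow_le_M hJ) k k.bit hb
    have hxZ : |k.shortcut J.gadget.S k.bit b| ≤ μ.Z := by
      rw [abs_of_nonneg hx.1]; exact hx.2.trans C.heavy_le
    refine Runs.seq (Runs.assign hK (by decide) hbd (Runs.seq (Runs.assign hK (by decide)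
      (hbd.setReg_of_le (by norm_num) _) (Runs.seq (Runs.assign hK (updateTerm_fits k)
      ((hbd.setReg_of_le (by norm_num) _).setReg_of_le (by norm_num) _) ?_)))))
    have e104 : ∀ x y : ℤ, (updateTerm k).eval ((s.setReg 100 x).setReg 102 y) =
        k.shortcut J.gadget.S k.bit b := fun x y =>
      eval_updateTerm (s := (s.setReg 100 x).setReg 102 y)
        (hs.congr (fun r hr => by
          rw [State.setReg_reg, if_neg (by omega), State.setReg_reg, if_neg (by omega)]) rfl rfl)
        hb (by simpa using h19)
    rw [e104]
    have e22 : s.reg 22 = ((⟨v, by omega⟩ : Fin J.N) : ℕ) := h22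
    have e23 : s.reg 22 + 1 = ((⟨v + 1, hv⟩ : Fin J.N) : ℕ) := by rw [h22]; push_cast; ring
    simp only [Term.eval_reg, Term.eval_add, Term.eval_lit, State.setReg_reg,
      show (22 = 100) = False by simp, if_false, e23]
    rw [e22]
    have hedge : J.gadget.graph J.N (J.partialSc k i j b) ⟨v, by omega⟩ ⟨v + 1, hv⟩ =
        edgeOf (k.shortcut J.gadget.S (1 - k.bit) b) := by
      rw [Gadget.graph, gridG_horizontal rfl, ← hinit]
      exact congrArg edgeOf (Gadget.hw_shortcut (P := J.gadget) hj hb)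
    have hstep := k.step_shortcut (Gadget.S_pos (Job.gadget_valid hJ)) hedge
    have hG : (J.gadget.graph J.N (J.partialSc k i j b)).setEdge ⟨v, by omega⟩ ⟨v + 1, hv⟩
        (edgeOf (k.shortcut J.gadget.S k.bit b)) =
        J.gadget.graph J.N (J.partialSc k i j (b + 1)) := by
      rw [Job.partialSc_succ, ← ha, hbit', Gadget.graph,
        gridG_setEdge_horizontal Gadget.two_le_cols rfl]
      exact congrArg (fun f => gridG J.N J.gadget.cols f J.gadget.vw)
        (Gadget.update_hw (P := J.gadget) hj hb _)
    rw [hG] at hstep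
    refine (hH.update C.solves C.upd_below C.bound_le hK hst h0 hu C.N_le hxZ hstep
      (Job.partialSc_isPlanarInstance hJ C.heavy_le_pow k i j (b + 1))).mono ?_
    rintro s' T ⟨g1, g2, ⟨t, g3, g4, g5⟩, g6⟩
    have hb1 : Bounded μ.Z (((s.setReg 100 ((⟨v, by omega⟩ : Fin J.N) : ℕ)).setReg 102
        ((⟨v + 1, hv⟩ : Fin J.N) : ℕ)).setReg 104 (k.shortcut J.gadget.S k.bit b)) :=
      ((hbd.setReg_of_le (by norm_num) _).setReg_of_le (by norm_num) _).setReg_of_le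
        (by norm_num) _
    have g26 : |s'.reg 26| ≤ μ.Z := by
      rw [g3, abs_of_nonneg (by positivity)]
      have : (t : ℤ) ≤ u := by exact_mod_cast g4
      linarith
    refine ⟨g1, g2, g6.bounded hb1 g26, ?_, t, g3, g4, ?_⟩
    · exact (((CallSame.setReg s 0 _).trans (CallSame.setReg _ 1 _)).trans
        (CallSame.setReg _ 2 _)).trans g6.callSame
    · have c1 : (Term.reg 22).cost = 2 := rfl
      have c2 : (Term.reg 22 + Term.lit 1).cost = 4 := rfl
      rw [c1, c2]
      omega
  · have hbit' : a % 2 = 1 - k.bit := by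
      rw [eval_bitTerm h21] at he
      have : a % 2 ≠ k.bit := fun h => by rw [if_pos h] at he; exact one_ne_zero he
      omega
    have hsame : J.partialSc k i j (b + 1) = J.partialSc k i j b := by
      rw [Job.partialSc_succ, ← ha, hbit', ← hinit]
      funext j' b'
      simp only [Gadget.setShortcut]
      split_ifs with h
      · rw [h.1, h.2]
      · rfl
    rw [hsame]
    exact Runs.skip ⟨hH, hst, hbd, CallSame.refl s, 0, by simp, Nat.zero_le _, by omega⟩

/-- The additional `tick` in each round charges the overhead of the loop to the clock, even if no
update takes place. So the running time is proportional to the progress of the clock, up to a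
constant. -/
theorem runs_bits (C : Ctx μ D k d R p u q J) {i j : ℕ} {s₁ s : State} (hs₁ : JobRegs J s₁)
    (hinv : RowInv μ s₁ s) (hj : j < J.m) (h18 : s.reg 18 = j)
    (h21 : s.reg 21 = J.code i j)
    (h22 : s.reg 22 = (2 * j * J.gadget.cols + (J.w + 1) : ℕ))
    (hH : Holds D k d R μ.Z true s (J.gadget.graph J.N (J.partialSc k i j 0)))
    (h0 : 0 ≤ s.reg 26) (hu : s.reg 26 + J.L * (u + 1) ≤ μ.Z) :
    Runs μ (bitsCode D k) s fun s' t => RowInv μ s₁ s' ∧ s'.reg 18 = j ∧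
      Holds D k d R μ.Z true s' (J.gadget.graph J.N (J.partialSc k i j J.L)) ∧
      ∃ x : ℕ, s'.reg 26 = s.reg 26 + x ∧ x ≤ J.L * (u + 1) ∧ t ≤ 100 * x + 9 := by
  have hK := C.K_ge
  have hJ := C.valid
  have hZ := μ.two_le
  have hL : (J.L : ℤ) ≤ μ.Z := by
    have h1 := (hinv.same.jobRegs hs₁).r4
    rw [← h1]
    exact (le_abs_self _).trans (hinv.bounded.1 4 (by norm_num))
  refine Runs.forTo hK (by norm_num) (by norm_num) (N := J.L) (fun b s' τ => RowInv μ s₁ s' ∧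
    s'.reg 18 = j ∧ s'.reg 19 = b ∧ s'.reg 21 = (J.code i j / 2 ^ b : ℕ) ∧
    s'.reg 22 = (2 * j * J.gadget.cols + (J.w + 1 + b) : ℕ) ∧
    Holds D k d R μ.Z true s' (J.gadget.graph J.N (J.partialSc k i j b)) ∧
    ∃ x : ℕ, s'.reg 26 = s.reg 26 + x ∧ x ≤ b * (u + 1) ∧ τ ≤ 100 * x + 8) ?_ ?_ hinv.bounded ?_ ?_
  · rintro b s' τ ⟨H, -, h19, -⟩
    exact ⟨h19, (H.same.jobRegs hs₁).r4, H.bounded⟩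
  · rintro b hb s' τ ⟨H, g18, g19, g21, g22, gH, x, gx, gx', gτ⟩
    have hxu : (x : ℤ) + (u + 1) ≤ J.L * (u + 1) := by
      have : x + (u + 1) ≤ J.L * (u + 1) := by
        calc x + (u + 1) ≤ b * (u + 1) + (u + 1) := by omega
          _ = (b + 1) * (u + 1) := by ring
          _ ≤ _ := Nat.mul_le_mul_right _ hb
      exact_mod_cast this
    refine Runs.seq ((runs_toggle C (H.same.jobRegs hs₁) H.bounded H.stamps hj hb g19 g21 rfl g22 gH
      (by rw [gx]; positivity) (by rw [gx]; linarith)).mono ?_)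
    rintro s2 t2 ⟨e1, e2, e3, e4, y, e5, e6, e7⟩
    have H2 : RowInv μ s₁ s2 := ⟨H.same.call e4, e3, e2⟩
    have f21 : s2.reg 21 = (J.code i j / 2 ^ b : ℕ) := by rw [e4.reg (by norm_num) (by norm_num), g21]
    have f22 : s2.reg 22 = (2 * j * J.gadget.cols + (J.w + 1 + b) : ℕ) := by
      rw [e4.reg (by norm_num) (by norm_num), g22]
    have v21 : (Term.reg 21 / Term.lit 2).eval s2 = (J.code i j / 2 ^ (b + 1) : ℕ) := by
      simp only [Term.eval_div, Term.eval_reg, Term.eval_lit, f21]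
      rw [pow_succ, ← Nat.div_div_eq_div_mul]
      norm_cast
    have b21 : |((J.code i j / 2 ^ (b + 1) : ℕ) : ℤ)| ≤ μ.Z := by
      refine abs_natCast_le (le_trans ?_ C.X_le)
      have h1 := Nat.div_le_self (J.code i j) (2 ^ (b + 1))
      have h2 := Job.code_lt hJ i j
      have h3 := hJ.pow_le
      omega
    have H3 := H2.setReg (r := 21) (by norm_num) (by norm_num) (by norm_num) (by norm_num) b21
    refine Runs.seq (Runs.assign hK (by decide) e3 ?_)
    rw [v21]
    refine Runs.seq (Runs.assign hK (by decide) H3.bounded ?_)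
    have v22 : ∀ z : ℤ, (Term.reg 22 + Term.lit 1).eval (s2.setReg 21 z) =
        (2 * j * J.gadget.cols + (J.w + 1 + (b + 1)) : ℕ) := by
      intro z
      simp [f22]
      ring
    rw [v22]
    have b22 : |((2 * j * J.gadget.cols + (J.w + 1 + (b + 1)) : ℕ) : ℤ)| ≤ μ.Z := by
      refine abs_natCast_le (le_trans ?_ C.N_le)
      have := vertex_lt hJ hj hb
      omega
    have H4 := H3.setReg (r := 22) (by norm_num) (by norm_num) (by norm_num) (by norm_num) b22
    refine Runs.tick (by omega) (H4.bounded.1 26 (by norm_num)) ?_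
    have hy : (y : ℤ) ≤ u := by exact_mod_cast e6
    have v26 : s2.reg 26 + 1 = s.reg 26 + (x + y + 1 : ℕ) := by
      rw [e5, gx]; push_cast; ring
    have b26 : |s.reg 26 + (x + y + 1 : ℕ)| ≤ μ.Z := by
      rw [abs_of_nonneg (by positivity)]
      push_cast
      linarith
    simp only [State.setReg_reg, show (26 = 22) = False by simp, show (26 = 21) = False by simp,
      if_false, v26]
    have H5 := H4.setReg (r := 26) (by norm_num) (by norm_num) (by norm_num) (by norm_num) b26
    have f19 : s2.reg 19 = b := by rw [e4.reg (by norm_num) (by norm_num), g19]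
    have b19 : |((b + 1 : ℕ) : ℤ)| ≤ μ.Z := abs_natCast_le (by push_cast; omega)
    have H6 := H5.setReg (r := 19) (by norm_num) (by norm_num) (by norm_num) (by norm_num) b19
    refine ⟨by simp [f19], H5.bounded, H6, ?_, by simp, ?_, ?_, ?_, x + y + 1, by simp, ?_, ?_⟩
    · simp [e4.reg (show 18 < 50 by norm_num) (by norm_num), g18]
    · simp
    · simp
    · exact ((((e1.setReg _ (by norm_num) (by norm_num) (by norm_num)).setReg _ (by norm_num)
        (by norm_num) (by norm_num)).setReg _ (by norm_num) (by norm_num) (by norm_num))).setReg _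
        (by norm_num) (by norm_num) (by norm_num)
    · calc x + y + 1 ≤ b * (u + 1) + (u + 1) := by omega
        _ = (b + 1) * (u + 1) := by ring
    · have c1 : (Term.reg 21 / Term.lit 2).cost = 4 := rfl
      have c2 : (Term.reg 22 + Term.lit 1).cost = 4 := rfl
      rw [c1, c2]
      omega
  · refine ⟨hinv.setReg (by norm_num) (by norm_num) (by norm_num) (by norm_num) (by simp; omega),
      by simpa using h18, by simp, by simp [h21], by simpa using h22,
      hH.setReg _ (by norm_num) (by norm_num) (by norm_num), 0, by simp, Nat.zero_le _, le_rfl⟩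
  · rintro s' τ ⟨H, g18, g19, g21, g22, gH, x, gx, gx', gτ⟩
    exact ⟨H, g18, gH, x, gx, gx', by omega⟩

end row

/-! ### Queries and the partial minima in the product -/

/-- The cells of `f'` are cells of `f` or contain sums that contribute to the product. -/
def Refines (n : ℕ) (W : ℕ → ℕ → ℕ) (f f' : ℤ → ℤ) : Prop :=
  ∀ a, f' a ≤ f a ∧ (f' a = f a ∨ ∃ i < n, ∃ j < n, ∃ l < n, a = i * n + l ∧
    f' a = W i j + W j l)

theorem Refines.refl {n : ℕ} {W : ℕ → ℕ → ℕ} (f : ℤ → ℤ) : Refines n W f f :=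
  fun _ => ⟨le_rfl, Or.inl rfl⟩

theorem Refines.trans {n : ℕ} {W : ℕ → ℕ → ℕ} {f g h : ℤ → ℤ} (h1 : Refines n W f g)
    (h2 : Refines n W g h) : Refines n W f h := by
  refine fun a => ⟨(h2 a).1.trans (h1 a).1, ?_⟩
  rcases (h2 a).2 with e | e
  · rw [e]; exact (h1 a).2
  · exact Or.inr e

theorem Refines.mem {n : ℕ} {W : ℕ → ℕ → ℕ} {f g : ℤ → ℤ} {X : ℤ} (h : Refines n W f g)
    (hf : ∀ a, 0 ≤ f a ∧ f a ≤ X) (a : ℤ) : 0 ≤ g a ∧ g a ≤ X := by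
  refine ⟨?_, (h a).1.trans (hf a).2⟩
  rcases (h a).2 with e | ⟨i, -, j, -, l, -, -, e⟩
  · rw [e]; exact (hf a).1
  · rw [e]; positivity

/-- The memory contains a copy of the data structure for `G`, which can be restored. -/
def Stored (D : DynAlg) (k : UpdateKind) (d R : ℕ) (Z : ℤ) {N : ℕ} (h : State)
    (G : WGraph N) : Prop :=
  ∃ s, D.Reach k d G s ∧ (∀ r < R, h.reg (101 + 2 * r) = s.reg r) ∧
    (∀ i a, baseMem h i a = s.arr i a) ∧ ∀ r, |s.reg r| ≤ Z

theorem Stored.congr {D : DynAlg} {k : UpdateKind} {d R : ℕ} {Z : ℤ} {N : ℕ} {h h' : State}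
    {G : WGraph N} (H : Stored D k d R Z h G) (hr : ∀ r < R, h'.reg (101 + 2 * r) =
      h.reg (101 + 2 * r)) (h24 : h'.reg 24 = h.reg 24)
    (ha : ∀ i, 10 ≤ i → ¬ LayerArr true i → h'.arr i = h.arr i) : Stored D k d R Z h' G := by
  obtain ⟨s, h1, h2, h3, h4⟩ := H
  refine ⟨s, h1, fun r hr' => (hr r hr').trans (h2 r hr'), fun i a => ?_, h4⟩
  rw [← h3 i a, baseMem, baseMem, h24, ha (10 + 4 * i) (by omega), ha (11 + 4 * i) (by omega)]
  · rintro ⟨i', h⟩; simp at h; omega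
  · rintro ⟨i', h⟩; simp at h; omega

theorem RowSame.stored {D : DynAlg} {k : UpdateKind} {d R : ℕ} {Z : ℤ} {N : ℕ} {h h' : State}
    {G : WGraph N} (hs : RowSame h h') (H : Stored D k d R Z h G) : Stored D k d R Z h' G :=
  H.congr (fun r _ => hs.1 _ (by omega)) (hs.1 24 (by omega))
    fun i hi hl => hs.2 i hl (by omega)

theorem RowInv.setArr {μ : Machine} {s₁ s : State} (h : RowInv μ s₁ s) {a v : ℤ}
    (hv : |v| ≤ μ.Z) : RowInv μ s₁ (s.setArr 5 a v) := by
  refine ⟨⟨fun r hr => h.same.1 r hr, fun i hi h5 => ?_⟩, h.bounded.setArr 5 a hv,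
    h.stamps.congr rfl rfl fun i hi => ?_⟩
  · rw [← h.same.2 i hi h5]
    funext b
    simp [h5]
  · funext b
    simp [show i ≠ 5 by omega]

theorem Holds.setArr {D : DynAlg} {k : UpdateKind} {d R : ℕ} {Z : ℤ} {ov : Bool} {N : ℕ}
    {h : State} {G : WGraph N} (H : Holds D k d R Z ov h G) {i : ℕ} (hi : i < 10) (a v : ℤ) :
    Holds D k d R Z ov (h.setArr i a v) G := by
  obtain ⟨s, h1, h2, h3⟩ := H
  refine ⟨s, h1, h2.congr (fun i _ => rfl) rfl rfl fun i' hi' => ?_, h3⟩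
  funext b
  simp [show i' ≠ i by omega]

section row

variable {μ : Machine} {D : DynAlg} {k : UpdateKind} {d R p u q : ℕ} {J : Job}

theorem eval_codeTerm {s : State} (hs : JobRegs J s) {i j : ℕ} (hi : i < J.n)
    (h17 : s.reg 17 = i) (h18 : s.reg 18 = j) : codeTerm.eval s = J.code i j := by
  have h : ((J.j₀ : ℤ) + j < J.n) ↔ J.j₀ + j < J.n := by norm_cast
  simp only [codeTerm, Term.eval_cond, Term.eval_less, Term.eval_add, Term.eval_mul, Term.eval_get,
    Term.eval_reg, Term.eval_lit, hs.r15, hs.r0, hs.r1, h17, h18, h, Job.code]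
  by_cases hc : J.j₀ + j < J.n
  · have := hs.a4 i hi _ hc
    push_cast at this
    simp [hc, this]
  · simp [hc]

theorem runs_encode (C : Ctx μ D k d R p u q J) {i : ℕ} {s₁ s : State} (hs₁ : JobRegs J s₁)
    (hinv : RowInv μ s₁ s) (hi : i < J.n) (h17 : s₁.reg 17 = i)
    (hH : Holds D k d R μ.Z true s (J.gadget.graph J.N (J.partialSc k i 0 0)))
    (h0 : 0 ≤ s.reg 26) (hu : s.reg 26 + J.m * (J.L * (u + 1) + 1) ≤ μ.Z) :
    Runs μ (encodeCode D k) s fun s' t => RowInv μ s₁ s' ∧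
      Holds D k d R μ.Z true s' (J.gadget.graph J.N (J.partialSc k i J.m 0)) ∧
      s'.arr 5 = s.arr 5 ∧
      ∃ x : ℕ, s'.reg 26 = s.reg 26 + x ∧ x ≤ J.m * (J.L * (u + 1) + 1) ∧ t ≤ 100 * x + 9 := by
  have hK := C.K_ge
  have hJ := C.valid
  have hZ := μ.two_le
  have hm : (J.m : ℤ) ≤ μ.Z := by
    have h1 := (hinv.same.jobRegs hs₁).r9
    rw [← h1]
    exact (le_abs_self _).trans (hinv.bounded.1 9 (by norm_num))
  have hfr : ∀ {c : Cmd} {s : State} {Q : State → ℕ → Prop}, ¬ c.stores 5 → Runs μ c s Q →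
      Runs μ c s fun s' t => Q s' t ∧ s'.arr 5 = s.arr 5 :=
    fun hc h => h.frame.mono fun s' t h => ⟨h.1, h.2.2 5 hc⟩
  refine Runs.forTo hK (by norm_num) (by norm_num) (N := J.m) (fun j s' τ => RowInv μ s₁ s' ∧
    s'.reg 18 = j ∧ Holds D k d R μ.Z true s' (J.gadget.graph J.N (J.partialSc k i j 0)) ∧
    s'.arr 5 = s.arr 5 ∧
    ∃ x : ℕ, s'.reg 26 = s.reg 26 + x ∧ x ≤ j * (J.L * (u + 1) + 1) ∧ τ ≤ 100 * x + 8)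
    ?_ ?_ hinv.bounded ?_ ?_
  · rintro j s' τ ⟨H, h18, -⟩
    exact ⟨h18, (H.same.jobRegs hs₁).r9, H.bounded⟩
  · rintro j hj s' τ ⟨H, g18, gH, g5, x, gx, gx', gτ⟩
    have hxu : (x : ℤ) + (J.L * (u + 1) + 1) ≤ J.m * (J.L * (u + 1) + 1) := by
      have : x + (J.L * (u + 1) + 1) ≤ J.m * (J.L * (u + 1) + 1) := by
        calc x + (J.L * (u + 1) + 1) ≤ j * (J.L * (u + 1) + 1) + (J.L * (u + 1) + 1) := by omega
          _ = (j + 1) * (J.L * (u + 1) + 1) := by ring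
          _ ≤ _ := Nat.mul_le_mul_right _ hj
      exact_mod_cast this
    have hr := H.same.jobRegs hs₁
    have g17 : s'.reg 17 = i := (H.same.1 17 (by omega)).trans h17
    refine Runs.seq (Runs.assign hK (by decide) H.bounded ?_)
    rw [eval_codeTerm hr hi g17 g18]
    have b21 : |((J.code i j : ℕ) : ℤ)| ≤ μ.Z := by
      refine abs_natCast_le (le_trans ?_ C.X_le)
      have h2 := Job.code_lt hJ i j
      have h3 := hJ.pow_le
      omega
    have H1 := H.setReg (r := 21) (by norm_num) (by norm_num) (by norm_num) (by norm_num) b21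
    refine Runs.seq (Runs.assign hK (by decide) H1.bounded ?_)
    have v22 : ∀ z : ℤ, (Term.lit 2 * Term.reg 18 * Term.reg 12 +
        (Term.reg 10 + Term.lit 1)).eval (s'.setReg 21 z) =
        (2 * j * J.gadget.cols + (J.w + 1) : ℕ) := by
      intro z
      simp [g18, hr.r12, hr.r10]
    rw [v22]
    have b22 : |((2 * j * J.gadget.cols + (J.w + 1) : ℕ) : ℤ)| ≤ μ.Z := by
      refine abs_natCast_le (le_trans ?_ C.N_le)
      have h1 : J.w + 1 < J.gadget.cols := by
        change _ < 2 * J.w + J.L + 3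
        omega
      have := Gadget.index_lt (m := J.m) (r := 2 * j) hJ.size (by omega) h1
      omega
    have H2 := H1.setReg (r := 22) (by norm_num) (by norm_num) (by norm_num) (by norm_num) b22
    have gH2 := (gH.setReg (r := 21) (J.code i j : ℕ) (by norm_num) (by norm_num)
      (by norm_num)).setReg (r := 22) ((2 * j * J.gadget.cols + (J.w + 1) : ℕ) : ℤ)
      (by norm_num) (by norm_num) (by norm_num)
    have hns : ¬ (bitsCode D k).stores 5 := by
      have h5 : ¬ LayerArr true 5 := not_layerArr_of_lt (by norm_num)
      exact Cmd.not_stores_seq Cmd.not_stores_set (Cmd.not_stores_whileDo (Cmd.not_stores_seq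
        (Cmd.not_stores_seq (Cmd.not_stores_iff (Cmd.not_stores_seq Cmd.not_stores_set
          (Cmd.not_stores_seq Cmd.not_stores_set (Cmd.not_stores_seq Cmd.not_stores_set
            (Cmd.not_stores_emb h5 _)))) not_false) (Cmd.not_stores_seq Cmd.not_stores_set
          (Cmd.not_stores_seq Cmd.not_stores_set Cmd.not_stores_set))) Cmd.not_stores_set))
    refine Runs.seq ((hfr hns (runs_bits C hs₁ H2 hj (by simpa using g18) (by simp)
      (by simp) gH2 (by simp only [State.setReg_reg]; simp [gx]; positivity)
      (by simp [gx]; linarith))).mono ?_)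
    rintro s2 t2 ⟨⟨e1, e2, e3, y, e5, e6, e7⟩, e8⟩
    refine Runs.tick (by omega) (e1.bounded.1 26 (by norm_num)) ?_
    have hy : (y : ℤ) ≤ J.L * (u + 1) := by exact_mod_cast e6
    have v26 : s2.reg 26 + 1 = s.reg 26 + (x + y + 1 : ℕ) := by
      rw [e5]; simp [gx]; ring
    have b26 : |s.reg 26 + (x + y + 1 : ℕ)| ≤ μ.Z := by
      rw [abs_of_nonneg (by positivity)]
      push_cast
      linarith
    rw [v26]
    have H5 := e1.setReg (r := 26) (by norm_num) (by norm_num) (by norm_num) (by norm_num) b26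
    have b18 : |((j + 1 : ℕ) : ℤ)| ≤ μ.Z := abs_natCast_le (by push_cast; omega)
    have H6 := H5.setReg (r := 18) (by norm_num) (by norm_num) (by norm_num) (by norm_num) b18
    refine ⟨by simp [e2], H5.bounded, H6, by simp, ?_, by simp [e8, g5], x + y + 1, by simp, ?_, ?_⟩
    · rw [Job.graph_partialSc_row]
      exact (e3.setReg _ (by norm_num) (by norm_num) (by norm_num)).setReg _ (by norm_num)
        (by norm_num) (by norm_num)
    · calc x + y + 1 ≤ j * (J.L * (u + 1) + 1) + (J.L * (u + 1) + 1) := by omega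
        _ = (j + 1) * (J.L * (u + 1) + 1) := by ring
    · have c1 : codeTerm.cost = 24 := rfl
      have c2 : (Term.lit 2 * Term.reg 18 * Term.reg 12 +
        (Term.reg 10 + Term.lit 1)).cost = 12 := rfl
      rw [c1, c2]
      omega
  · refine ⟨hinv.setReg (by norm_num) (by norm_num) (by norm_num) (by norm_num) (by simp; omega),
      by simp, hH.setReg _ (by norm_num) (by norm_num) (by norm_num), rfl, 0, by simp,
      Nat.zero_le _, le_rfl⟩
  · rintro s' τ ⟨H, g18, gH, g5, x, gx, gx', gτ⟩
    exact ⟨H, gH, g5, x, gx, gx', by omega⟩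

/-- The cells of row `i` of the product that belong to the columns `k₀, …, k₀ + l - 1` are at most
the sums that are taken into account by the job. -/
def Job.Covers (J : Job) (i l : ℕ) (f : ℤ → ℤ) : Prop :=
  ∀ jj < J.m, J.j₀ + jj < J.n → ∀ l' < l, J.k₀ + l' < J.n →
    f (i * J.n + (J.k₀ + l' : ℕ)) ≤ J.W i (J.j₀ + jj) + J.W (J.j₀ + jj) (J.k₀ + l')

/-- Correctness is split into two monotone properties. `Refines` says that entries only decrease and
that every changed entry is a genuine sum; `Covers` says that they are at most all the sums treated
so far. Both persist under later decreases, so blocks can be processed one after the other. -/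
theorem runs_query (C : Ctx μ D k d R p u q J) (hj₀ : J.j₀ < J.n) {i : ℕ} {s₁ s : State}
    (hs₁ : JobRegs J s₁) (hinv : RowInv μ s₁ s) (hi : i < J.n) (h17 : s₁.reg 17 = i)
    (hH : Holds D k d R μ.Z true s (J.gadget.graph J.N (J.partialSc k i J.m 0)))
    (h5 : ∀ a, 0 ≤ s.arr 5 a ∧ s.arr 5 a ≤ J.X)
    (h0 : 0 ≤ s.reg 26) (hu : s.reg 26 + J.w * (q + 1) ≤ μ.Z) :
    Runs μ (queryCode D) s fun s' t => RowInv μ s₁ s' ∧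
      Refines J.n J.W (s.arr 5) (s'.arr 5) ∧ J.Covers i J.w (s'.arr 5) ∧
      ∃ x : ℕ, s'.reg 26 = s.reg 26 + x ∧ x ≤ J.w * (q + 1) ∧ t ≤ 200 * x + 9 := by
  have hK := C.K_ge
  have hJ := C.valid
  have hZ := μ.two_le
  have hw : (J.w : ℤ) ≤ μ.Z := by
    have h1 := (hinv.same.jobRegs hs₁).r10
    rw [← h1]
    exact (le_abs_self _).trans (hinv.bounded.1 10 (by norm_num))
  have hXZ := C.X_le
  have hm1 := hJ.m_pos
  refine Runs.forTo hK (by norm_num) (by norm_num) (N := J.w) (fun l s' τ => RowInv μ s₁ s' ∧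
    s'.reg 20 = l ∧ Holds D k d R μ.Z true s' (J.gadget.graph J.N (J.partialSc k i J.m 0)) ∧
    Refines J.n J.W (s.arr 5) (s'.arr 5) ∧ J.Covers i l (s'.arr 5) ∧
    ∃ x : ℕ, s'.reg 26 = s.reg 26 + x ∧ x ≤ l * (q + 1) ∧ τ ≤ 200 * x + 8)
    ?_ ?_ hinv.bounded ?_ ?_
  · rintro j s' τ ⟨H, h20, -⟩
    exact ⟨h20, (H.same.jobRegs hs₁).r10, H.bounded⟩
  · rintro l hl s' τ ⟨H, g20, gH, g5, gc, x, gx, gx', gτ⟩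
    have hxu : (x : ℤ) + (q + 1) ≤ J.w * (q + 1) := by
      have : x + (q + 1) ≤ J.w * (q + 1) := by
        calc x + (q + 1) ≤ l * (q + 1) + (q + 1) := by omega
          _ = (l + 1) * (q + 1) := by ring
          _ ≤ _ := Nat.mul_le_mul_right _ hl
      exact_mod_cast this
    have hr := H.same.jobRegs hs₁
    have g17 : s'.reg 17 = i := (H.same.1 17 (by omega)).trans h17
    -- the end of the round
    have finish : ∀ (s2 : State) (y : ℕ), RowInv μ s₁ s2 → s2.reg 20 = l →
        Holds D k d R μ.Z true s2 (J.gadget.graph J.N (J.partialSc k i J.m 0)) →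
        Refines J.n J.W (s.arr 5) (s2.arr 5) → J.Covers i (l + 1) (s2.arr 5) →
        s2.reg 26 = s'.reg 26 + y → y ≤ q →
        Runs μ tick s2 fun s3 t3 => s3.reg 20 = l ∧ Bounded μ.Z s3 ∧
          (RowInv μ s₁ (s3.setReg 20 (l + 1 : ℕ)) ∧ ((s3.setReg 20 (l + 1 : ℕ)).reg 20 = (l + 1 : ℕ)) ∧
          Holds D k d R μ.Z true (s3.setReg 20 (l + 1 : ℕ))
            (J.gadget.graph J.N (J.partialSc k i J.m 0)) ∧
          Refines J.n J.W (s.arr 5) ((s3.setReg 20 (l + 1 : ℕ)).arr 5) ∧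
          J.Covers i (l + 1) ((s3.setReg 20 (l + 1 : ℕ)).arr 5) ∧
          ∃ x : ℕ, (s3.setReg 20 (l + 1 : ℕ)).reg 26 = s.reg 26 + x ∧ x ≤ (l + 1) * (q + 1) ∧
            τ + (20 * y + 130 + t3) + 12 ≤ 200 * x + 8) := by
      intro s2 y e1 e2 e3 e4 e5 e6 e7
      have hy : (y : ℤ) ≤ q := by exact_mod_cast e7
      refine Runs.tick (by omega) (e1.bounded.1 26 (by norm_num)) ?_
      have v26 : s2.reg 26 + 1 = s.reg 26 + (x + y + 1 : ℕ) := by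
        rw [e6, gx]; push_cast; ring
      have b26 : |s.reg 26 + (x + y + 1 : ℕ)| ≤ μ.Z := by
        rw [abs_of_nonneg (by positivity)]
        push_cast
        linarith
      rw [v26]
      have H5 := e1.setReg (r := 26) (by norm_num) (by norm_num) (by norm_num) (by norm_num) b26
      have b20 : |((l + 1 : ℕ) : ℤ)| ≤ μ.Z := abs_natCast_le (by push_cast; omega)
      have H6 := H5.setReg (r := 20) (by norm_num) (by norm_num) (by norm_num) (by norm_num) b20
      refine ⟨by simp [e2], H5.bounded, H6, by simp, ?_, by simpa using e4, by simpa using e5,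
        x + y + 1, by simp, ?_, by omega⟩
      · exact (e3.setReg _ (by norm_num) (by norm_num) (by norm_num)).setReg _ (by norm_num)
          (by norm_num) (by norm_num)
      · calc x + y + 1 ≤ l * (q + 1) + (q + 1) := by omega
          _ = (l + 1) * (q + 1) := by ring
    have hcond : ((J.k₀ : ℤ) + l < J.n) ↔ J.k₀ + l < J.n := by norm_cast
    refine Runs.seq (Runs.test hK (by decide) H.bounded (fun hne => ?_) (fun he => ?_))
    · have hkl : J.k₀ + l < J.n := by
        by_contra hc
        apply hne
        simp only [Term.eval_less, Term.eval_add, Term.eval_reg, hr.r16, g20, hr.r0, hcond, hc,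
          if_false]
      have hcol : J.w + 2 + J.L + (l + 1) < J.gadget.cols := by
        change _ < 2 * J.w + J.L + 3
        omega
      have hbN : (2 * J.m - 1) * J.gadget.cols + (J.w + 2 + J.L + (l + 1)) < J.N :=
        Gadget.index_lt (m := J.m) (r := 2 * J.m - 1) hJ.size (by omega) hcol
      have haN : J.w - (l + 1) < J.N := by omega
      refine Runs.seq (Runs.assign hK (by decide) H.bounded (Runs.seq (Runs.assign hK (by decide)
        (H.bounded.setReg_of_le (by norm_num) _) ?_)))
      have e100 : (Term.reg 10 - (Term.reg 20 + Term.lit 1)).eval s' =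
          ((⟨J.w - (l + 1), haN⟩ : Fin J.N) : ℕ) := by
        simp only [Term.eval_sub, Term.eval_add, Term.eval_reg, Term.eval_lit, hr.r10, g20]
        omega
      have e102 : ∀ z : ℤ, ((Term.lit 2 * Term.reg 9 - Term.lit 1) * Term.reg 12 +
          (Term.reg 10 + Term.lit 2 + Term.reg 4 + (Term.reg 20 + Term.lit 1))).eval
            (s'.setReg 100 z) = ((⟨_, hbN⟩ : Fin J.N) : ℕ) := by
        intro z
        have : ((2 * J.m - 1 : ℕ) : ℤ) = 2 * J.m - 1 := by omega
        simp [hr.r9, hr.r12, hr.r10, hr.r4, g20, this]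
      rw [e100, e102]
      refine Runs.seq ((gH.query C.solves C.qry_below (by have := C.R_ge; omega) C.bound_le hK
        H.stamps (by rw [gx]; positivity) (by rw [gx]; linarith) C.N_le).mono ?_)
      rintro s2 T ⟨f1, f2, ⟨y, f3, f4, f5⟩, f6, f7, f8⟩
      have hb1 : Bounded μ.Z ((s'.setReg 100 ((⟨J.w - (l + 1), haN⟩ : Fin J.N) : ℕ)).setReg 102
          ((⟨_, hbN⟩ : Fin J.N) : ℕ)) :=
        (H.bounded.setReg_of_le (by norm_num) _).setReg_of_le (by norm_num) _
      have hy : (y : ℤ) ≤ q := by exact_mod_cast f4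
      have g26 : |s2.reg 26| ≤ μ.Z := by
        rw [f3, gx, abs_of_nonneg (by positivity)]
        linarith
      have f9 : CallSame true s' s2 :=
        ((CallSame.setReg s' 0 _).trans (CallSame.setReg _ 1 _)).trans f8.callSame
      have H2 : RowInv μ s₁ s2 := ⟨H.same.call f9, f8.bounded hb1 g26, f2⟩
      have hr2 := H2.same.jobRegs hs₁
      have q17 : s2.reg 17 = i := (H2.same.1 17 (by omega)).trans h17
      have q20 : s2.reg 20 = l := (f9.reg (by norm_num) (by norm_num)).trans g20
      have q5 : s2.arr 5 = s'.arr 5 := f9.2 5 (not_layerArr_of_lt (by norm_num))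
      obtain ⟨A1, A2, A3⟩ := Job.answer hJ k i hl hkl rfl rfl f6
      set v := s2.reg 102 / J.gadget.S - J.gadget.offset (l + 1) - J.X with hv
      -- The row `j₀` belongs to the matrix by `hj₀`, so at least one genuine sum bounds the value.
      have hvle : v ≤ 4 * J.X := by
        refine (A1 0 (by omega) (by omega)).trans ?_
        have h1 := hJ.W_le i (J.j₀ + 0)
        have h2 := hJ.W_le (J.j₀ + 0) (J.k₀ + l)
        omega
      have b31 : |v| ≤ μ.Z := by rw [abs_of_nonneg A2]; linarith
      have hoff : offsetTerm.Fits = true := by decide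
      have e31 : (Term.reg 102 / Term.reg 5 - offsetTerm - Term.reg 1).eval s2 = v := by
        simp only [offsetTerm, Term.eval_sub, Term.eval_div, Term.eval_mul, Term.eval_add,
          Term.eval_reg, Term.eval_lit, hr2.r5, hr2.r6, hr2.r9, hr2.r10, hr2.r1, q20, hv,
          Gadget.offset]
        simp only [Job.gadget]
        push_cast
        ring
      refine Runs.seq (Runs.set (e := Term.reg 102 / Term.reg 5 - offsetTerm - Term.reg 1)
        ⟨by decide, le_trans (by decide) hK, by decide⟩
        ⟨⟨⟨f7, H2.bounded.1 5 (by norm_num)⟩, Term.Fits.small hoff hZ H2.bounded⟩,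
          H2.bounded.1 1 (by norm_num)⟩ ?_)
      rw [e31]
      have H3 := H2.setReg (r := 31) (by norm_num) (by norm_num) (by norm_num) (by norm_num) b31
      have f1' := f1.setReg (r := 31) v (by norm_num) (by norm_num) (by norm_num)
      have ecell : ∀ z : ℤ, cellTerm.eval (s2.setReg 31 z) = i * J.n + (J.k₀ + l : ℕ) := by
        intro z
        simp [cellTerm, hr2.r0, hr2.r16, q17, q20]
      have cost1 : (Term.reg 10 - (Term.reg 20 + Term.lit 1)).cost = 7 := rfl
      have cost2 : ((Term.lit 2 * Term.reg 9 - Term.lit 1) * Term.reg 12 +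
          (Term.reg 10 + Term.lit 2 + Term.reg 4 + (Term.reg 20 + Term.lit 1))).cost = 22 := rfl
      have cost3 : (Term.reg 102 / Term.reg 5 - offsetTerm - Term.reg 1).cost = 50 := rfl
      have cost4 : (Term.less (Term.reg 31) (Term.get 5 cellTerm)).cost = 15 := rfl
      have cost5 : cellTerm.cost = 11 := rfl
      have cost6 : (Term.reg 31).cost = 2 := rfl
      have cost7 : (Term.less (Term.reg 16 + Term.reg 20) (Term.reg 0)).cost = 8 := rfl
      rw [cost1, cost2, cost3, cost7]
      have hcov : ∀ f : ℤ → ℤ, (∀ a, f a ≤ s'.arr 5 a) → f (i * J.n + (J.k₀ + l : ℕ)) ≤ v →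
          J.Covers i (l + 1) f := by
        intro f hf hfv jj hjj hjn l' hl' hkl'
        rcases Nat.lt_succ_iff_lt_or_eq.1 hl' with hlt | rfl
        · exact (hf _).trans (gc jj hjj hjn l' hlt hkl')
        · exact hfv.trans (A1 jj hjj hjn)
      refine Runs.test hK (by decide) H3.bounded (fun h => ?_) (fun h => ?_)
      · have hlt : v < s'.arr 5 (i * J.n + (J.k₀ + l : ℕ)) := by
          by_contra hc
          apply h
          simp only [Term.eval_less, Term.eval_get, ecell, Term.eval_reg]
          simp only [State.setReg_reg, State.setReg_arr, q5, if_true]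
          rw [if_neg hc]
        refine Runs.write hK (by decide) (by decide) H3.bounded ?_
        simp only [ecell, Term.eval_reg, State.setReg_reg, if_true]
        have h5' := (g5.mem h5 (i * J.n + (J.k₀ + l : ℕ))).2
        -- A value is written only if it is below the present entry, hence below `X`; such a value
        -- comes from an index inside the matrix.
        obtain ⟨j, hj, hjv⟩ := A3 (by linarith)
        rw [cost4, cost5, cost6]
        refine (finish _ y (H3.setArr b31) (by simpa using q20) (f1'.setArr (by norm_num) _ _)
          (g5.trans fun a => ?_) (hcov _ (fun a => ?_) ?_) (by simpa using f3) f4).mono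
          fun s3 t3 ⟨k1, k2, k3, k4, k5, k6, k7, x', k8, k9, k10⟩ =>
            ⟨k1, k2, k3, by simp, k5, k6, k7, x', k8, k9, by omega⟩
        · by_cases ha : a = i * J.n + (J.k₀ + l : ℕ)
          · rw [ha]
            refine ⟨by simpa using hlt.le, Or.inr ⟨i, hi, j, hj, J.k₀ + l, hkl, rfl, ?_⟩⟩
            simpa using hjv
          · have ha' : ¬ a = i * J.n + (J.k₀ + l) := by push_cast at ha; exact ha
            simp [ha', q5]
        · simp only [State.setArr_arr, State.setReg_arr, q5, true_and]
          split_ifs with ha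
          · rw [ha]; exact hlt.le
          · exact le_rfl
        · simp
      · have hle : s'.arr 5 (i * J.n + (J.k₀ + l : ℕ)) ≤ v := by
          by_contra hc
          have : (Term.less (Term.reg 31) (Term.get 5 cellTerm)).eval (s2.setReg 31 v) = 1 := by
            simp only [Term.eval_less, Term.eval_get, ecell, Term.eval_reg]
            simp only [State.setReg_reg, State.setReg_arr, q5, if_true]
            rw [if_pos (not_le.1 hc)]
          rw [this] at h
          exact one_ne_zero h
        rw [cost4]
        refine Runs.skip ((finish _ y H3 (by simpa using q20) f1' ?_ ?_ (by simpa using f3) f4).mono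
          fun s3 t3 ⟨k1, k2, k3, k4, k5, k6, k7, x', k8, k9, k10⟩ =>
            ⟨k1, k2, k3, k4, k5, k6, k7, x', k8, k9, by omega⟩)
        · rw [State.setReg_arr, q5]; exact g5
        · rw [State.setReg_arr, q5]
          exact hcov _ (fun _ => le_rfl) hle
    · have hkl : ¬ J.k₀ + l < J.n := by
        intro hc
        simp only [Term.eval_less, Term.eval_add, Term.eval_reg, hr.r16, g20, hr.r0, hcond, hc,
          if_true] at he
        exact one_ne_zero he
      have cost7 : (Term.less (Term.reg 16 + Term.reg 20) (Term.reg 0)).cost = 8 := rfl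
      rw [cost7]
      refine Runs.skip ((finish _ 0 H g20 gH g5 ?_ (by simp) (Nat.zero_le _)).mono
        fun s3 t3 ⟨k1, k2, k3, k4, k5, k6, k7, x', k8, k9, k10⟩ =>
          ⟨k1, k2, k3, k4, k5, k6, k7, x', k8, k9, by omega⟩)
      intro jj hjj hjn l' hl' hkl'
      rcases Nat.lt_succ_iff_lt_or_eq.1 hl' with hlt | rfl
      · exact gc jj hjj hjn l' hlt hkl'
      · exact absurd hkl' hkl
  · refine ⟨hinv.setReg (by norm_num) (by norm_num) (by norm_num) (by norm_num) (by simp; omega),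
      by simp, hH.setReg _ (by norm_num) (by norm_num) (by norm_num), Refines.refl _,
      fun jj _ _ l' hl' => absurd hl' (by omega), 0, by simp, Nat.zero_le _, le_rfl⟩
  · rintro s' τ ⟨H, g18, gH, g5, gc, x, gx, gx', gτ⟩
    exact ⟨H, g5, gc, x, gx, gx', by omega⟩

/-- The new content of register `25` exceeds all stamps, so the upper layer is forgotten in one
step, and the saved registers are copied back. Every row starts from the state stored for the block,
whatever the previous rows have done to it. -/
theorem runs_row (C : Ctx μ D k d R p u q J) (hj₀ : J.j₀ < J.n) {i : ℕ} {s : State}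
    (hs : JobRegs J s) (hbd : Bounded μ.Z s) (hst : Stamps μ.Z s) (h25 : s.reg 25 + 1 ≤ μ.Z)
    (hi : i < J.n) (h17 : s.reg 17 = i) (hS : Stored D k d R μ.Z s (J.start k))
    (h5 : ∀ a, 0 ≤ s.arr 5 a ∧ s.arr 5 a ≤ J.X) (h0 : 0 ≤ s.reg 26)
    (hu : s.reg 26 + (J.m * (J.L * (u + 1) + 1) + J.w * (q + 1)) ≤ μ.Z) :
    Runs μ (rowCode D k R) s fun s' t => RowSame (s.setReg 25 (s.reg 25 + 1)) s' ∧
      Bounded μ.Z s' ∧ Stamps μ.Z s' ∧ Refines J.n J.W (s.arr 5) (s'.arr 5) ∧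
      J.Covers i J.w (s'.arr 5) ∧ ∃ x : ℕ, s'.reg 26 = s.reg 26 + x ∧
        x ≤ J.m * (J.L * (u + 1) + 1) + J.w * (q + 1) ∧ t ≤ 200 * x + (4 * R + 30) := by
  have hK := C.K_ge
  obtain ⟨S1, S2, S3, S4⟩ := hst
  have b25 : |s.reg 25 + 1| ≤ μ.Z := by rw [abs_of_nonneg (by linarith)]; exact h25
  obtain ⟨σ, q1, q2, q3, q4⟩ := hS
  refine Runs.seq (Runs.assign hK (by decide) hbd ?_)
  have e25 : (Term.reg 25 + Term.lit 1).eval s = s.reg 25 + 1 := rfl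
  rw [e25]
  set s₁ := s.setReg 25 (s.reg 25 + 1) with hs₁
  have hJ1 : JobRegs J s₁ := hs.congr (fun r hr => by simp [hs₁]; omega) rfl rfl
  have hst1 : Stamps μ.Z s₁ := by
    refine ⟨by simpa [hs₁] using S1, by simp [hs₁]; linarith, by simpa [hs₁] using h25,
      fun k a => ?_⟩
    have := S4 k a
    simp only [hs₁, State.setReg_reg, State.setReg_arr, if_true]
    exact ⟨⟨this.1.1, by linarith [this.1.2]⟩, this.2.1, by linarith [this.2.2]⟩
  have hbd1 : Bounded μ.Z s₁ := hbd.setReg 25 b25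
  have hodd : ∀ r, s₁.reg (101 + 2 * r) = s.reg (101 + 2 * r) := fun r => by
    simp [hs₁]; omega
  refine Runs.seq ((runs_restoreRegs hK R fun r hr => by
    rw [hodd, q2 r hr]; exact q4 r).mono ?_)
  rintro s2 t2 ⟨f1, f2, f3, f4⟩
  have hreg : ∀ r, (r < 100 ∨ r % 2 = 1) → s2.reg r = s₁.reg r := fun r hr =>
    f4 r fun i _ => by omega
  have H2 : RowInv μ s₁ s2 := by
    refine ⟨⟨fun r hr => hreg r (by omega), fun i _ _ => by rw [f2]⟩, ⟨fun r hr => ?_, ?_⟩, ?_⟩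
    · rw [hreg r (by omega)]; exact hbd1.1 r hr
    · rw [f2]; exact hbd1.2
    · exact hst1.congr (hreg 24 (by omega)) (hreg 25 (by omega)) fun _ _ => by rw [f2]
  have hH : Holds D k d R μ.Z true s2 (J.gadget.graph J.N (J.partialSc k i 0 0)) := by
    rw [Job.partialSc_zero]
    refine ⟨σ, q1, ⟨fun r hr => ?_, fun i a => ?_⟩, q4⟩
    · rw [f3 r hr, hodd, q2 r hr]
    -- No cell of the upper layer has the new stamp, so all reads fall through to the lower layer.
    · rw [← q3 i a, layerMem_true, topMem, if_neg]
      · simp only [baseMem, f2, hreg 24 (by omega)]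
        simp [hs₁]
      · rw [f2, hreg 25 (by omega)]
        have := (S4 i a).2.2
        simp only [hs₁, State.setReg_reg, State.setReg_arr, if_true]
        omega
  have e26 : s2.reg 26 = s.reg 26 := by rw [hreg 26 (by omega)]; simp [hs₁]
  have e5 : s2.arr 5 = s.arr 5 := by rw [f2]; rfl
  have hmu : (0 : ℤ) ≤ J.m * (J.L * (u + 1) + 1) := by positivity
  have hwq : (0 : ℤ) ≤ J.w * (q + 1) := by positivity
  have h17' : s₁.reg 17 = i := by simpa [hs₁] using h17
  refine Runs.seq ((runs_encode C hJ1 H2 hi h17' hH (by rw [e26]; exact h0)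
    (by rw [e26]; linarith)).mono ?_)
  rintro s3 t3 ⟨g1, g2, g3, x, g4, g5, g6⟩
  have hx : (x : ℤ) ≤ J.m * (J.L * (u + 1) + 1) := by exact_mod_cast g5
  refine (runs_query C hj₀ hJ1 g1 hi h17' g2 (by rw [g3, e5]; exact h5)
    (by rw [g4, e26]; positivity) (by rw [g4, e26]; linarith)).mono ?_
  rintro s4 t4 ⟨k1, k2, k3, y, k4, k5, k6⟩
  refine ⟨k1.same, k1.bounded, k1.stamps, by rwa [g3, e5] at k2, k3, x + y, ?_, by omega, ?_⟩
  · rw [k4, g4, e26]; push_cast; ring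
  · have c : (Term.reg 25 + Term.lit 1).cost = 4 := rfl
    rw [c]
    omega

end row

/-! ### Building the grid -/

theorem WGraph.cell_setEdge {n : ℕ} (G : WGraph n) (a b : Fin n) (o : Option ℤ) (c : ℤ) :
    (G.setEdge a b o).cell c = if c = (a : ℤ) * n + b ∨ c = (b : ℤ) * n + a then o else G.cell c := by
  have hlt : ∀ x y : Fin n, (x : ℕ) * n + y < n * n := fun x y => by
    have h1 : ((x : ℕ) + 1) * n ≤ n * n := Nat.mul_le_mul_right n x.2
    have h2 := y.2
    rw [add_mul] at h1
    omega
  unfold WGraph.cell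
  by_cases h : 0 ≤ c ∧ c.toNat < n * n
  · obtain ⟨m, rfl⟩ := Int.eq_ofNat_of_zero_le h.1
    have hn : 0 < n := Nat.pos_of_ne_zero fun hn => by simp [hn] at h
    have key : ∀ x y : Fin n, (m / n = x ∧ m % n = y) ↔ (m : ℤ) = (x : ℤ) * n + y := by
      intro x y
      have e : ((m : ℤ) = (x : ℤ) * n + y) ↔ m = (x : ℕ) * n + y := by norm_cast
      rw [e]
      constructor
      · rintro ⟨h1, h2⟩
        rw [← h1, ← h2, mul_comm, Nat.div_add_mod]
      · rintro rfl
        rw [Nat.add_comm, Nat.add_mul_div_right _ _ hn, Nat.add_mul_mod_self_right,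
          Nat.div_eq_of_lt y.2, Nat.mod_eq_of_lt y.2]
        simp
    have h' : 0 ≤ (m : ℤ) ∧ m < n * n := by simpa using h
    simp only [Int.toNat_natCast, dif_pos h', WGraph.setEdge, Fin.ext_iff, key]
  · rw [dif_neg h, dif_neg h, if_neg]
    rintro (rfl | rfl)
    · exact h ⟨by positivity, by have := hlt a b; omega⟩
    · exact h ⟨by positivity, by have := hlt b a; omega⟩

/-- Only four cells change. So an input can be produced edge by edge from empty memory, just like a
sequence of insertions. -/
theorem WGraph.input_setEdge {n : ℕ} (G : WGraph n) (a b : Fin n) (x : ℤ) :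
    (G.setEdge a b (some x)).input =
      (((G.input.setArr 0 ((a : ℤ) * n + b) 1).setArr 1 ((a : ℤ) * n + b) x).setArr 0
        ((b : ℤ) * n + a) 1).setArr 1 ((b : ℤ) * n + a) x := by
  refine State.ext' rfl ?_
  funext k c
  simp only [State.setArr_arr]
  simp only [WGraph.input, WGraph.cell_setEdge]
  by_cases h1 : c = (a : ℤ) * n + b <;> by_cases h2 : c = (b : ℤ) * n + a <;>
    by_cases h3 : k = 0 <;> by_cases h4 : k = 1 <;> simp [h1, h2, h3, h4]

/-- The first `v` values of a sequence, followed by zeros. -/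
def cut (f : ℕ → ℤ) (v : ℕ) : ℕ → ℤ := fun u => if u < v then f u else 0

theorem cut_zero (f : ℕ → ℤ) : cut f 0 = fun _ => 0 := by
  funext u
  simp [cut]

theorem update_cut (f : ℕ → ℤ) (v : ℕ) : Function.update (cut f v) v (f v) = cut f (v + 1) := by
  funext u
  by_cases h : u = v
  · subst h; simp [cut]
  · simp only [Function.update_of_ne h, cut]
    have : u < v + 1 ↔ u < v := by omega
    simp only [this]

theorem cut_succ_of_zero {f : ℕ → ℤ} {v : ℕ} (h : f v = 0) : cut f (v + 1) = cut f v := by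
  rw [← update_cut, h, Function.update_eq_self_iff]
  simp [cut]

theorem gridG_cut (N C : ℕ) (f g : ℕ → ℤ) : gridG N C (cut f N) (cut g N) = gridG N C f g := by
  funext i j
  have hi := i.2
  have hj := j.2
  simp only [gridG, cut, hi, hj, if_true]

/-- Insertions need admissible graphs at every intermediate stage, so the partially built grids have
to be planar instances, too. -/
theorem gridG_cut_isPlanarInstance {N C d : ℕ} (hC : 2 ≤ C) {f g : ℕ → ℤ}
    (h0 : ∀ v, 0 ≤ f v ∧ f v ≤ (N : ℤ) ^ d) (h1 : ∀ v, 0 ≤ g v ∧ g v ≤ (N : ℤ) ^ d)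
    (hrow : ∀ v, f v ≠ 0 → v % C + 1 < C) (v w : ℕ) :
    IsPlanarInstance d (gridG N C (cut f v) (cut g w)) := by
  have h : (0 : ℤ) ≤ (N : ℤ) ^ d := by positivity
  refine gridG_isPlanarInstance hC (fun u => ?_) (fun u => ?_) (fun u hu => hrow u ?_)
  · unfold cut
    split_ifs
    exacts [h0 u, ⟨le_rfl, h⟩]
  · unfold cut
    split_ifs
    exacts [h1 u, ⟨le_rfl, h⟩]
  · unfold cut at hu
    split_ifs at hu
    · exact hu
    · exact absurd rfl hu

section programs

open Term

def betaTerm (e : Term) : Term :=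
  cond e (cond (less (reg 15 + reg 18 / lit 2) (reg 0)) (cond (less (reg 16 + (e - lit 1)) (reg 0))
    (get 4 ((reg 15 + reg 18 / lit 2) * reg 0 + (reg 16 + (e - lit 1)))) (reg 1)) (reg 1)) (lit 0)

def startTerm : UpdateKind → Term
  | .insert => lit 0
  | .delete | .increase => lit 1
  | .decrease => reg 5 * get 6 (reg 19 - (reg 10 + lit 1)) + lit 1

/-- The weight of the edge between columns `reg 19` and `reg 19 + 1` in row `reg 18`. -/
def horizontalTerm (k : UpdateKind) : Term :=
  cond (less (reg 18) (lit 2 * reg 9))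
    (cond (less (reg 19) (reg 10)) (reg 5 * (reg 6 * (lit 2 * (lit 2 * reg 9) - reg 18)))
    (cond (equal (reg 19) (reg 10) + equal (reg 19) (reg 10 + lit 1 + reg 4))
      (lit 1 - reg 18 % lit 2)
    (cond (less (reg 19) (reg 10 + lit 1 + reg 4))
      (cond (reg 18 % lit 2) (reg 5 * get 6 (reg 19 - (reg 10 + lit 1))) (startTerm k))
    (cond (less (reg 19) (lit 2 * reg 10 + lit 2 + reg 4))
      (reg 5 * (reg 6 * (lit 2 * reg 9 + lit 1 + reg 18) +
        betaTerm (reg 19 - (reg 10 + lit 2 + reg 4) + lit 1) -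
        betaTerm (reg 19 - (reg 10 + lit 2 + reg 4)))) (lit 0))))) (lit 0)

/-- The weight of the edge between rows `reg 18` and `reg 18 + 1` in column `reg 19`. -/
def verticalTerm : Term :=
  cond (less (reg 18 + lit 1) (lit 2 * reg 9))
    (cond (less (reg 19) (reg 10 + lit 1)) (reg 5 * (reg 6 * (reg 10 + reg 19)))
    (cond (less (reg 19) (reg 10 + lit 2 + reg 4)) (lit 1 - reg 18 % lit 2)
    (cond (less (reg 19) (lit 2 * reg 10 + lit 2 + reg 4 + lit 1))
      (reg 5 * (reg 6 * (lit 2 * reg 10 + reg 10 + lit 2 + reg 4 - reg 19))) (lit 0)))) (lit 0)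

/-- Put the edge `{reg 22, reg 23}` of weight `reg 31` into the input of the preprocessing. -/
def writeEdge : Cmd :=
  .seq (.set 32 (lit 1)) (.seq (.set 34 (reg 22 * reg 7 + reg 23)) (.seq (layerStore false 0 34 32)
    (.seq (layerStore false 1 34 31) (.seq (.set 34 (reg 23 * reg 7 + reg 22))
    (.seq (layerStore false 0 34 32) (layerStore false 1 34 31))))))

/-- Insert the edge `{reg 22, reg 23}` of weight `reg 31`. -/
def insertEdge (D : DynAlg) : Cmd :=
  .seq (.set 100 (reg 22)) (.seq (.set 102 (reg 23)) (.seq (.set 104 (reg 31)) (D.upd.emb false)))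

/-- Apply the program `E` to all the edges of the grid. -/
def edgesCode (k : UpdateKind) (E : Cmd) : Cmd :=
  .forTo 22 7 (.seq (.set 18 (reg 22 / reg 12)) (.seq (.set 19 (reg 22 % reg 12))
    (.seq (.set 31 (horizontalTerm k)) (.seq
    (.iff (reg 31) (.seq (.set 23 (reg 22 + lit 1)) E) .skip) (.seq (.set 31 verticalTerm)
    (.iff (reg 31) (.seq (.set 23 (reg 22 + reg 12)) E) .skip))))))

/-- A structure for insertions need not accept anything but the edgeless graph. It is preprocessed
first and the grid is then inserted by updates; the other kinds receive the grid as their input. -/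
def initCode (D : DynAlg) (k : UpdateKind) : Cmd :=
  match k with
  | .insert => .seq (D.prep.emb false) (edgesCode k (insertEdge D))
  | _ => .seq (edgesCode k writeEdge) (D.prep.emb false)

/-- Build the data structure for a block. -/
def blockCode (D : DynAlg) (k : UpdateKind) (R : ℕ) : Cmd :=
  .seq (.set 25 (reg 25 + lit 1)) (.seq (.set 24 (reg 25)) (.seq (.set 33 (reg 26))
    (.seq (.set 26 (lit 0)) (.seq (zeroRegs R) (.seq (.set 100 (reg 7)) (.seq (initCode D k)
    (.seq (saveRegs R) (.set 26 (reg 33)))))))))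

end programs

section terms

variable {J : Job} {s : State} {r c : ℕ}

theorem eval_betaTerm (hs : JobRegs J s) (h18 : s.reg 18 = r) {e : Term} {l : ℕ}
    (he : e.eval s = l) : (betaTerm e).eval s = J.gadget.β r l := by
  simp only [betaTerm, Term.eval_cond, Term.eval_less, Term.eval_add, Term.eval_mul, Term.eval_get,
    Term.eval_reg, Term.eval_lit, Term.eval_sub, Term.eval_div, hs.r15, hs.r0, hs.r1, hs.r16, h18,
    he, Job.gadget]
  by_cases hl : l = 0
  · simp [hl]
  · have e1 : (l : ℤ) - 1 = ((l - 1 : ℕ) : ℤ) := by omega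
    have e2 : ((J.j₀ : ℤ) + (r : ℤ) / 2 < J.n) ↔ J.j₀ + r / 2 < J.n := by norm_cast
    have e3 : ((J.k₀ : ℤ) + ((l - 1 : ℕ) : ℤ) < J.n) ↔ J.k₀ + (l - 1) < J.n := by norm_cast
    rw [e1]
    simp only [e2, e3]
    by_cases h1 : J.j₀ + r / 2 < J.n <;> by_cases h2 : J.k₀ + (l - 1) < J.n <;>
      simp [hl, h1, h2]
    have := hs.a4 _ h1 _ h2
    push_cast [Nat.cast_div] at this
    simpa using this

theorem eval_startTerm (k : UpdateKind) (hs : JobRegs J s) {b : ℕ} (hb : b < J.L)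
    (h19 : s.reg 19 = (J.w + 1 + b : ℕ)) :
    (startTerm k).eval s = k.shortcut J.gadget.S (1 - k.bit) b := by
  have e : (J.w : ℤ) + 1 + b - (J.w + 1) = b := by ring
  cases k <;> simp [startTerm, UpdateKind.shortcut, UpdateKind.bit, UpdateKind.inactive, h19,
    hs.r5, hs.r10, e, hs.a6 b hb]

theorem eval_horizontalTerm (k : UpdateKind) (hs : JobRegs J s) (h18 : s.reg 18 = r)
    (h19 : s.reg 19 = c) : (horizontalTerm k).eval s =
      J.gadget.horizontal (fun _ b => k.shortcut J.gadget.S (1 - k.bit) b) r c := by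
  have em : J.gadget.m = J.m := rfl
  have ew : J.gadget.w = J.w := rfl
  have eL : J.gadget.L = J.L := rfl
  simp only [horizontalTerm, Gadget.horizontal, Term.eval_cond, Term.eval_less, Term.eval_equal,
    Term.eval_add, Term.eval_mul, Term.eval_get, Term.eval_reg, Term.eval_lit, Term.eval_sub,
    Term.eval_mod, hs.r4, hs.r5, hs.r6, hs.r9, hs.r10, h18, h19, em, ew, eL]
  by_cases h1 : r < 2 * J.m
  swap
  · rw [if_neg h1, if_neg (by simp; omega)]
  rw [if_pos h1, if_pos (by simp; omega)]
  by_cases h2 : c < J.w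
  · rw [if_pos h2, if_pos (by simp; omega)]
    ring
  rw [if_neg h2, if_neg (by simp; omega)]
  by_cases h3 : c = J.w ∨ c = J.w + 1 + J.L
  · rw [if_pos h3, if_pos]
    · rcases Nat.mod_two_eq_zero_or_one r with h | h
      · rw [if_pos h, show (r : ℤ) % 2 = 0 by omega]; rfl
      · rw [if_neg (by omega), show (r : ℤ) % 2 = 1 by omega]; rfl
    · split_ifs <;> omega
  rw [if_neg h3, if_neg]
  swap
  · rw [if_neg (by omega), if_neg (by omega)]; simp
  by_cases h4 : c < J.w + 1 + J.L
  · rw [if_pos h4, if_pos (by simp; omega)]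
    have e1 : (c : ℤ) - (J.w + 1) = ((c - (J.w + 1) : ℕ) : ℤ) := by omega
    rcases Nat.mod_two_eq_zero_or_one r with h | h
    · rw [if_pos h, if_neg (by omega)]
      exact eval_startTerm k hs (by omega) (by rw [h19]; congr 1; omega)
    · rw [if_neg (show ¬ r % 2 = 0 by omega), if_pos (show (r : ℤ) % 2 ≠ 0 by omega), e1,
        hs.a6 _ (by omega)]
  rw [if_neg h4, if_neg (by simp; omega)]
  by_cases h5 : c < 2 * J.w + 2 + J.L
  · have e1 : (c : ℤ) - (J.w + 2 + J.L) = ((c - (J.w + 2 + J.L) : ℕ) : ℤ) := by omega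
    rw [if_pos h5, if_pos (by simp; omega), eval_betaTerm hs h18 (l := c - (J.w + 2 + J.L) + 1),
      eval_betaTerm hs h18 (l := c - (J.w + 2 + J.L))]
    · simp [hs.r4, hs.r10, h19, e1]
    · simp [hs.r4, hs.r10, h19, e1]
  · rw [if_neg h5, if_neg (by simp; omega)]

theorem eval_verticalTerm (hs : JobRegs J s) (h18 : s.reg 18 = r) (h19 : s.reg 19 = c) :
    verticalTerm.eval s = J.gadget.vertical r c := by
  have em : J.gadget.m = J.m := rfl
  have ew : J.gadget.w = J.w := rfl
  have eL : J.gadget.L = J.L := rfl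
  simp only [verticalTerm, Gadget.vertical, Term.eval_cond, Term.eval_less,
    Term.eval_add, Term.eval_mul, Term.eval_reg, Term.eval_lit, Term.eval_sub,
    Term.eval_mod, hs.r4, hs.r5, hs.r6, hs.r9, hs.r10, h18, h19, em, ew, eL]
  by_cases h1 : r + 1 < 2 * J.m
  swap
  · rw [if_neg h1, if_neg (by simp; omega)]
  rw [if_pos h1, if_pos (by simp; omega)]
  by_cases h2 : c ≤ J.w
  · rw [if_pos h2, if_pos (by simp; omega)]
  rw [if_neg h2, if_neg (by simp; omega)]
  by_cases h3 : c ≤ J.w + 1 + J.L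
  · rw [if_pos h3, if_pos (by simp; omega)]
    rcases Nat.mod_two_eq_zero_or_one r with h | h
    · rw [if_pos h, show (r : ℤ) % 2 = 0 by omega]; rfl
    · rw [if_neg (by omega), show (r : ℤ) % 2 = 1 by omega]; rfl
  rw [if_neg h3, if_neg (by simp; omega)]
  by_cases h4 : c ≤ 2 * J.w + 2 + J.L
  · rw [if_pos h4, if_pos (by simp; omega)]
    ring
  · rw [if_neg h4, if_neg (by simp; omega)]

theorem horizontalTerm_fits (k : UpdateKind) : (horizontalTerm k).Fits = true := by
  cases k <;> decide

theorem horizontalTerm_cost (k : UpdateKind) : (horizontalTerm k).cost ≤ 400 := by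
  cases k <;> decide

theorem verticalTerm_cost : verticalTerm.cost ≤ 400 := by decide

end terms

/-- The invariant of the programs that build a grid. -/
structure BuildInv (μ : Machine) (s₁ s : State) : Prop where
  regs : ∀ r, r < 18 ∨ r = 24 ∨ r = 25 ∨ r = 33 → s.reg r = s₁.reg r
  arrs : ∀ i < 10, s.arr i = s₁.arr i
  bounded : Bounded μ.Z s
  stamps : Stamps μ.Z s

theorem BuildInv.jobRegs {μ : Machine} {J : Job} {s₁ s : State} (h : BuildInv μ s₁ s)
    (hJ : JobRegs J s₁) : JobRegs J s :=
  hJ.congr (fun r hr => h.regs r (by omega)) (h.arrs 4 (by norm_num)) (h.arrs 6 (by norm_num))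

theorem BuildInv.setReg {μ : Machine} {s₁ s : State} (h : BuildInv μ s₁ s) {r : ℕ} {v : ℤ}
    (hr : 18 ≤ r) (h50 : r < 50) (h24 : r ≠ 24) (h25 : r ≠ 25) (h33 : r ≠ 33) (hv : |v| ≤ μ.Z) :
    BuildInv μ s₁ (s.setReg r v) :=
  ⟨fun r' hr' => by rw [State.setReg_reg, if_neg (by omega), h.regs r' hr'], h.arrs,
    h.bounded.setReg r hv, h.stamps.setReg' v h24 h25⟩

section build

variable {μ : Machine} {D : DynAlg} {k : UpdateKind} {d R p u q : ℕ} {J : Job}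

/-- The specification of a program that adds the edge `{reg 22, reg 23}` of weight `reg 31`. -/
def AddsEdge (μ : Machine) (d u N : ℕ) (s₁ : State) (E : Cmd)
    (I : State → WGraph N → Prop) : Prop :=
  ∀ (h : State) (G : WGraph N) (a b : Fin N) (x : ℤ), BuildInv μ s₁ h → I h G →
    h.reg 22 = (a : ℕ) → h.reg 23 = (b : ℕ) → h.reg 31 = x → x ≠ 0 → G a b = none →
    IsPlanarInstance d (G.setEdge a b (edgeOf x)) → 0 ≤ h.reg 26 → h.reg 26 + u ≤ μ.Z →
    Runs μ E h fun h' t => I h' (G.setEdge a b (edgeOf x)) ∧ BuildInv μ s₁ h' ∧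
      (∀ r < 31, r ≠ 26 → h'.reg r = h.reg r) ∧
      (∃ y : ℕ, h'.reg 26 = h.reg 26 + y ∧ y ≤ u) ∧ t ≤ 20 * u + 60

theorem addsEdge_writeEdge (C : Ctx μ D k d R p u q J) {s₁ : State} (hs₁ : JobRegs J s₁) :
    AddsEdge μ d u J.N s₁ writeEdge fun h G => Sim R false h G.input := by
  intro h G a b x H hI h22 h23 h31 hx _ _ h0 hu
  have hK := C.K_ge
  have ha := a.2
  have hb := b.2
  have hr := H.jobRegs hs₁
  have hle : ∀ y z : Fin J.N, |((y : ℕ) : ℤ) * J.N + (z : ℕ)| ≤ μ.Z := by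
    intro y z
    rw [abs_of_nonneg (by positivity)]
    refine le_trans ?_ C.sq_le
    have h1 : ((y : ℕ) + 1) * J.N ≤ J.N * J.N := Nat.mul_le_mul_right _ y.2
    have h2 := z.2
    rw [add_mul] at h1
    have : (y : ℕ) * J.N + (z : ℕ) ≤ J.N * J.N := by omega
    exact_mod_cast this
  have hL : ∀ {Q : State → ℕ → Prop} {c : Cmd} {s : State}, (∀ i < 10, ¬ c.stores i) → Runs μ c s Q →
      Runs μ c s fun s' t => Q s' t ∧ ∀ i < 10, s'.arr i = s.arr i :=
    fun hc h => h.frame.mono fun s' t h => ⟨h.1, fun i hi => h.2.2 i (hc i hi)⟩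
  have hls : ∀ i a b, ∀ j < 10, ¬ (layerStore false i a b).stores j := fun i a b j hj =>
    Cmd.not_stores_layerStore (not_layerArr_of_lt hj)
  have step : ∀ (i r₁ : ℕ) (s : State) (σ : State), r₁ < 50 → BuildInv μ s₁ s → Sim R false s σ →
      Runs μ (layerStore false i 34 r₁) s fun s' t =>
        Sim R false s' (σ.setArr i (s.reg 34) (s.reg r₁)) ∧ BuildInv μ s₁ s' ∧
          s'.reg = s.reg ∧ t ≤ 2 := by
    intro i r₁ s σ hr₁ hs hσ
    refine (hL (hls i 34 r₁) (hσ.layerStore hs.stamps i (not_isScratch_of_lt (by norm_num))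
      (not_isScratch_of_lt hr₁))).mono ?_
    rintro s' t ⟨⟨e1, e2, e3, e4⟩, e5⟩
    refine ⟨e1, ⟨fun r hr => by rw [e3]; exact hs.regs r hr,
      fun i hi => (e5 i hi).trans (hs.arrs i hi), ⟨fun r hr => ?_, fun i hi a => ?_⟩, e2⟩, e3, e4⟩
    · rw [e3]; exact hs.bounded.1 r hr
    · rw [e5 i hi]; exact hs.bounded.2 i hi a
  have keep : ∀ (r : ℕ) (v : ℤ) (s σ : State), r < 50 → r ≠ 24 → r ≠ 25 → Sim R false s σ →
      Sim R false (s.setReg r v) σ := fun r v s σ h1 h2 h3 H =>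
    H.congr (fun i _ => by rw [State.setReg_reg, if_neg (by omega)]) (by simp [h2.symm])
      (by simp [h3.symm]) fun _ _ => rfl
  have hone : |(1 : ℤ)| ≤ μ.Z := by have := μ.two_le; simp; linarith
  refine Runs.seq (Runs.assign hK (by decide) H.bounded ?_)
  have H1 := H.setReg (r := 32) (v := 1) (by norm_num) (by norm_num) (by norm_num) (by norm_num)
    (by norm_num) hone
  have I1 := keep 32 1 _ _ (by norm_num) (by norm_num) (by norm_num) hI
  refine Runs.seq (Runs.assign hK (by decide) H1.bounded ?_)
  have e34 : (Term.reg 22 * Term.reg 7 + Term.reg 23).eval (h.setReg 32 1) =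
      ((a : ℕ) : ℤ) * J.N + (b : ℕ) := by
    simp [h22, h23, hr.r7]
  simp only [Term.eval_lit]
  rw [e34]
  have H2 := H1.setReg (r := 34) (by norm_num) (by norm_num) (by norm_num) (by norm_num)
    (by norm_num) (hle a b)
  have I2 := keep 34 (((a : ℕ) : ℤ) * J.N + (b : ℕ)) _ _ (by norm_num) (by norm_num)
    (by norm_num) I1
  refine Runs.seq ((step 0 32 _ _ (by norm_num) H2 I2).mono ?_)
  rintro s2 t2 ⟨I3, H3, r3, l3⟩
  refine Runs.seq ((step 1 31 _ _ (by norm_num) H3 I3).mono ?_)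
  rintro s3 t3 ⟨I4, H4, r4, l4⟩
  refine Runs.seq (Runs.assign hK (by decide) H4.bounded ?_)
  have e34' : (Term.reg 23 * Term.reg 7 + Term.reg 22).eval s3 =
      ((b : ℕ) : ℤ) * J.N + (a : ℕ) := by
    simp [r4, r3, h22, h23, hr.r7]
  rw [e34']
  have H5 := H4.setReg (r := 34) (by norm_num) (by norm_num) (by norm_num) (by norm_num)
    (by norm_num) (hle b a)
  have I5 := keep 34 (((b : ℕ) : ℤ) * J.N + (a : ℕ)) _ _ (by norm_num) (by norm_num)
    (by norm_num) I4
  refine Runs.seq ((step 0 32 _ _ (by norm_num) H5 I5).mono ?_)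
  rintro s4 t4 ⟨I6, H6, r6, l6⟩
  refine (step 1 31 _ _ (by norm_num) H6 I6).mono ?_
  rintro s5 t5 ⟨I7, H7, r7, l7⟩
  refine ⟨?_, H7, fun r hr h26 => ?_, ⟨0, ?_, Nat.zero_le _⟩, ?_⟩
  · rw [edgeOf_of_ne hx, WGraph.input_setEdge]
    simpa [r6, r4, r3, h31] using I7
  · simp [r7, r6, r4, r3, show r ≠ 34 by omega, show r ≠ 32 by omega]
  · simp [r7, r6, r4, r3]
  · have c1 : (Term.reg 22 * Term.reg 7 + Term.reg 23).cost = 8 := rfl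
    have c2 : (Term.reg 23 * Term.reg 7 + Term.reg 22).cost = 8 := rfl
    have c3 : (Term.lit 1).cost = 1 := rfl
    rw [c1, c2, c3]
    omega

theorem addsEdge_insertEdge (C : Ctx μ D .insert d R p u q J) {s₁ : State} :
    AddsEdge μ d u J.N s₁ (insertEdge D) (Holds D .insert d R μ.Z false) := by
  intro h G a b x H hI h22 h23 h31 hx hab hG h0 hu
  have hK := C.K_ge
  have hxZ : |x| ≤ μ.Z := by rw [← h31]; exact H.bounded.1 31 (by norm_num)
  have hb1 := (H.bounded.setReg_of_le (show 50 ≤ 100 by norm_num) (a : ℕ))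
  have hb2 := (hb1.setReg_of_le (show 50 ≤ 102 by norm_num) (b : ℕ))
  have hb3 := (hb2.setReg_of_le (show 50 ≤ 104 by norm_num) x)
  refine Runs.seq (Runs.assign hK (by decide) H.bounded ?_)
  rw [Term.eval_reg, h22]
  refine Runs.seq (Runs.assign hK (by decide) hb1 ?_)
  have e1 : (Term.reg 23).eval (h.setReg 100 (a : ℕ)) = (b : ℕ) := by simpa using h23
  rw [e1]
  refine Runs.seq (Runs.assign hK (by decide) hb2 ?_)
  have e2 : (Term.reg 31).eval ((h.setReg 100 (a : ℕ)).setReg 102 (b : ℕ)) = x := by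
    simpa using h31
  rw [e2]
  have hstep : UpdateKind.insert.Step G a b x (G.setEdge a b (edgeOf x)) :=
    ⟨hab, by rw [edgeOf_of_ne hx]⟩
  refine (hI.update C.solves C.upd_below C.bound_le hK H.stamps h0 hu C.N_le hxZ hstep hG).mono ?_
  rintro s' T ⟨g1, g2, ⟨t, g3, g4, g5⟩, g6⟩
  have ht : (t : ℤ) ≤ u := by exact_mod_cast g4
  have g26 : |s'.reg 26| ≤ μ.Z := by
    rw [g3, abs_of_nonneg (by positivity)]
    linarith
  have g7 : ∀ r < 50, r ≠ 26 → s'.reg r = h.reg r := fun r hr h26 => by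
    rw [g6.reg_eq hr h26]
    simp [show r ≠ 100 by omega, show r ≠ 102 by omega, show r ≠ 104 by omega]
  refine ⟨g1, ⟨fun r hr => ?_, fun i hi => ?_, g6.bounded hb3 g26, g2⟩, fun r hr h26 =>
    g7 r (by omega) h26, ⟨t, g3, g4⟩, ?_⟩
  · rw [g7 r (by omega) (by omega)]
    exact H.regs r hr
  · rw [g6.arr_eq hi]
    exact H.arrs i hi
  · have c1 : (Term.reg 22).cost = 2 := rfl
    have c2 : (Term.reg 23).cost = 2 := rfl
    have c3 : (Term.reg 31).cost = 2 := rfl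
    rw [c1, c2, c3]
    omega

end build

theorem Gadget.vertical_ne_zero_lt {P : Gadget} {r c : ℕ} (h : P.vertical r c ≠ 0) :
    r + 1 < 2 * P.m := by
  unfold Gadget.vertical at h
  by_contra hc
  exact h (if_neg hc)

section build

variable {μ : Machine} {D : DynAlg} {k : UpdateKind} {d R p u q : ℕ} {J : Job}

theorem AddsEdge.runs {N : ℕ} {s₁ : State} {E : Cmd} {I : State → WGraph N → Prop}
    (hE : AddsEdge μ d u N s₁ E I) (hK : 20 ≤ μ.K) (hN : (N : ℤ) ≤ μ.Z)
    (hI : ∀ h G r v, I h G → r < 50 → r ≠ 24 → r ≠ 25 → I (h.setReg r v) G) {h : State}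
    {G G' : WGraph N} {a : Fin N} {x : ℤ} {e : Term} (he : e.Fits = true) (hc : e.cost ≤ 6)
    (H : BuildInv μ s₁ h) (h1 : I h G) (h22 : h.reg 22 = (a : ℕ)) (h31 : h.reg 31 = x)
    (h0 : x = 0 → G' = G)
    (hx : x ≠ 0 → ∃ b : Fin N, e.eval h = (b : ℕ) ∧ G a b = none ∧ G.setEdge a b (edgeOf x) = G' ∧
      IsPlanarInstance d G') (h26 : 0 ≤ h.reg 26) (hu : h.reg 26 + u ≤ μ.Z) :
    Runs μ (.iff (.reg 31) (.seq (.set 23 e) E) .skip) h fun h' t => I h' G' ∧ BuildInv μ s₁ h' ∧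
      (∀ r < 31, r ≠ 26 → r ≠ 23 → h'.reg r = h.reg r) ∧
      (∃ y : ℕ, h'.reg 26 = h.reg 26 + y ∧ y ≤ u) ∧ t ≤ 20 * u + 80 := by
  have c31 : (Term.reg 31).cost = 2 := rfl
  refine Runs.test hK (by decide) H.bounded (fun hne => ?_) (fun he0 => ?_)
  · rw [Term.eval_reg, h31] at hne
    obtain ⟨b, hb, hab, rfl, hp⟩ := hx hne
    refine Runs.seq (Runs.assign hK he H.bounded ?_)
    rw [hb]
    have hbZ : |((b : ℕ) : ℤ)| ≤ μ.Z := by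
      have := b.2
      rw [abs_of_nonneg (by positivity)]; omega
    refine (hE _ G a b x (H.setReg (by norm_num) (by norm_num) (by norm_num) (by norm_num)
      (by norm_num) hbZ) (hI _ _ _ _ h1 (by norm_num) (by norm_num) (by norm_num))
      (by simpa using h22) (by simp) (by simpa using h31) hne hab hp (by simpa using h26)
      (by simpa using hu)).mono ?_
    rintro s' t ⟨g1, g2, g3, ⟨y, g4, g5⟩, g6⟩
    refine ⟨g1, g2, fun r hr hr26 hr23 => ?_, ⟨y, by simpa using g4, g5⟩, by omega⟩
    rw [g3 r hr hr26]
    simp [hr23]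
  · rw [Term.eval_reg, h31] at he0
    rw [h0 he0]
    exact Runs.skip ⟨h1, H, fun _ _ _ _ => rfl, ⟨0, by simp, Nat.zero_le _⟩, by omega⟩

/-- One loop serves both for writing an input and for insertions; the difference is hidden in `E`
and `I`. At vertex `v` the edge to the right and then the edge to the next row are added, and `cut`
describes what has been built. -/
theorem runs_edges (C : Ctx μ D k d R p u q J) {s₁ : State} (hs₁ : JobRegs J s₁) {E : Cmd}
    {I : State → WGraph J.N → Prop} (hE : AddsEdge μ d u J.N s₁ E I)
    (hI : ∀ h G r v, I h G → r < 50 → r ≠ 24 → r ≠ 25 → I (h.setReg r v) G) {s : State}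
    (hs : BuildInv μ s₁ s) (h1 : I s fun _ _ => none) (h0 : 0 ≤ s.reg 26)
    (hu : s.reg 26 + (J.N * (2 * u) : ℕ) ≤ μ.Z) :
    Runs μ (edgesCode k E) s fun s' t => I s' (J.start k) ∧ BuildInv μ s₁ s' ∧
      (∃ y : ℕ, s'.reg 26 = s.reg 26 + y ∧ y ≤ J.N * (2 * u)) ∧
      t ≤ J.N * (40 * u + 1200) + 9 := by
  have hK := C.K_ge
  have hJ := C.valid
  have hZ := μ.two_le
  have hP := Job.gadget_valid hJ
  have hL := Job.pow_le_M hJ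
  have hC : 2 ≤ J.gadget.cols := Gadget.two_le_cols
  set sc : ℕ → ℕ → ℤ := fun _ b => k.shortcut J.gadget.S (1 - k.bit) b with hsc
  have hscm : ∀ j b, b < J.gadget.L → 0 ≤ sc j b ∧ sc j b ≤ J.gadget.heavy := fun j b hb =>
    Gadget.shortcut_mem hP hL k _ hb
  have mh : ∀ v, 0 ≤ J.gadget.hw sc v ∧ J.gadget.hw sc v ≤ J.gadget.heavy := fun v =>
    Gadget.horizontal_mem hP hL hscm _ _
  have mv : ∀ v, 0 ≤ J.gadget.vw v ∧ J.gadget.vw v ≤ J.gadget.heavy := fun v =>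
    Gadget.vertical_mem hP _ _
  have hplan : ∀ v w, IsPlanarInstance d
      (gridG J.N J.gadget.cols (cut (J.gadget.hw sc) v) (cut J.gadget.vw w)) :=
    gridG_cut_isPlanarInstance hC (fun v => ⟨(mh v).1, (mh v).2.trans C.heavy_le_pow⟩)
      (fun v => ⟨(mv v).1, (mv v).2.trans C.heavy_le_pow⟩)
      fun v hv => Gadget.horizontal_ne_zero_lt hv
  refine Runs.forTo hK (by norm_num) (by norm_num) (N := J.N) (fun v s' τ => BuildInv μ s₁ s' ∧
    s'.reg 22 = v ∧ I s' (gridG J.N J.gadget.cols (cut (J.gadget.hw sc) v) (cut J.gadget.vw v)) ∧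
    (∃ y : ℕ, s'.reg 26 = s.reg 26 + y ∧ y ≤ v * (2 * u)) ∧ τ ≤ v * (40 * u + 1200) + 8)
    ?_ ?_ hs.bounded ?_ ?_
  · rintro v s' τ ⟨H, h22, -⟩
    exact ⟨h22, (H.jobRegs hs₁).r7, H.bounded⟩
  · rintro v hv s' τ ⟨H, g22, gI, ⟨y, gy, gy'⟩, gτ⟩
    have hr := H.jobRegs hs₁
    have hyu : (y : ℤ) + 2 * u ≤ (J.N * (2 * u) : ℕ) := by
      have : y + 2 * u ≤ J.N * (2 * u) := by
        calc y + 2 * u ≤ v * (2 * u) + 2 * u := by omega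
          _ = (v + 1) * (2 * u) := by ring
          _ ≤ _ := Nat.mul_le_mul_right _ hv
      exact_mod_cast this
    have hvZ : (v : ℤ) ≤ μ.Z := by have := C.N_le; omega
    have hdm := Nat.div_add_mod v J.gadget.cols
    refine Runs.seq (Runs.assign hK (by decide) H.bounded ?_)
    have e18 : (Term.reg 22 / Term.reg 12).eval s' = (v / J.gadget.cols : ℕ) := by
      simp [g22, hr.r12]
    rw [e18]
    have b18 : |((v / J.gadget.cols : ℕ) : ℤ)| ≤ μ.Z := abs_natCast_le (by
      have := Nat.div_le_self v J.gadget.cols; omega)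
    have H1 := H.setReg (r := 18) (by norm_num) (by norm_num) (by norm_num) (by norm_num)
      (by norm_num) b18
    refine Runs.seq (Runs.assign hK (by decide) H1.bounded ?_)
    have e19 : ∀ z : ℤ, (Term.reg 22 % Term.reg 12).eval (s'.setReg 18 z) =
        (v % J.gadget.cols : ℕ) := fun z => by
      simp [g22, hr.r12]
    rw [e19]
    have b19 : |((v % J.gadget.cols : ℕ) : ℤ)| ≤ μ.Z := abs_natCast_le (by
      have := Nat.mod_le v J.gadget.cols; omega)
    have H2 := H1.setReg (r := 19) (by norm_num) (by norm_num) (by norm_num) (by norm_num)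
      (by norm_num) b19
    refine Runs.seq (Runs.assign hK (horizontalTerm_fits k) H2.bounded ?_)
    rw [eval_horizontalTerm k (H2.jobRegs hs₁) (r := v / J.gadget.cols) (c := v % J.gadget.cols)
      (by simp) (by simp)]
    change Runs μ _ (State.setReg _ 31 (J.gadget.hw sc v)) _
    have b31 : |J.gadget.hw sc v| ≤ μ.Z := by
      rw [abs_of_nonneg (mh v).1]; exact (mh v).2.trans C.heavy_le
    have H3 := H2.setReg (r := 31) (by norm_num) (by norm_num) (by norm_num) (by norm_num)
      (by norm_num) b31
    have I3 := hI _ _ 31 (J.gadget.hw sc v) (hI _ _ 19 (v % J.gadget.cols : ℕ)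
      (hI _ _ 18 (v / J.gadget.cols : ℕ) gI (by norm_num) (by norm_num) (by norm_num))
      (by norm_num) (by norm_num) (by norm_num)) (by norm_num) (by norm_num) (by norm_num)
    refine Runs.seq ((hE.runs hK C.N_le hI (a := ⟨v, hv⟩) (x := J.gadget.hw sc v)
      (e := Term.reg 22 + Term.lit 1)
      (G' := gridG J.N J.gadget.cols (cut (J.gadget.hw sc) (v + 1)) (cut J.gadget.vw v))
      (by decide) (by decide) H3 I3 (by simpa using g22) (by simp)
      (fun h => by rw [cut_succ_of_zero h]) (fun hne => ?_) (by simp [gy]; positivity)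
      (by simp [gy]; linarith)).mono ?_)
    · have hc1 : v % J.gadget.cols + 1 < J.gadget.cols := Gadget.horizontal_ne_zero_lt hne
      have hr1 : v / J.gadget.cols < 2 * J.m := by
        by_contra hc
        apply hne
        simp only [Gadget.hw, Gadget.horizontal]
        exact if_neg hc
      have hN : v + 1 < J.N := by
        have := Gadget.index_lt (m := J.m) (r := v / J.gadget.cols) hJ.size hr1 hc1
        rw [mul_comm] at this
        omega
      refine ⟨⟨v + 1, hN⟩, by simp [g22], ?_, ?_, hplan _ _⟩
      · rw [gridG_horizontal rfl]; simp [cut, edgeOf]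
      · rw [gridG_setEdge_horizontal hC rfl, update_cut]
    rintro s4 t4 ⟨I4, H4, f4, ⟨y4, q4, q4'⟩, l4⟩
    have q4z : (y4 : ℤ) ≤ u := by exact_mod_cast q4'
    have f18 : s4.reg 18 = (v / J.gadget.cols : ℕ) := by
      rw [f4 18 (by norm_num) (by norm_num) (by norm_num)]; simp
    have f19 : s4.reg 19 = (v % J.gadget.cols : ℕ) := by
      rw [f4 19 (by norm_num) (by norm_num) (by norm_num)]; simp
    have f22 : s4.reg 22 = v := by
      rw [f4 22 (by norm_num) (by norm_num) (by norm_num)]; simpa using g22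
    have f26 : s4.reg 26 = s.reg 26 + (y + y4 : ℕ) := by
      rw [q4]; simp [gy]; ring
    refine Runs.seq (Runs.assign hK (by decide) H4.bounded ?_)
    rw [eval_verticalTerm (H4.jobRegs hs₁) f18 f19]
    change Runs μ _ (State.setReg _ 31 (J.gadget.vw v)) _
    have b31' : |J.gadget.vw v| ≤ μ.Z := by
      rw [abs_of_nonneg (mv v).1]; exact (mv v).2.trans C.heavy_le
    have H5 := H4.setReg (r := 31) (by norm_num) (by norm_num) (by norm_num) (by norm_num)
      (by norm_num) b31'
    have I5 := hI _ _ 31 (J.gadget.vw v) I4 (by norm_num) (by norm_num) (by norm_num)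
    refine (hE.runs hK C.N_le hI (a := ⟨v, hv⟩) (x := J.gadget.vw v)
      (e := Term.reg 22 + Term.reg 12)
      (G' := gridG J.N J.gadget.cols (cut (J.gadget.hw sc) (v + 1)) (cut J.gadget.vw (v + 1)))
      (by decide) (by decide) H5 I5 (by simpa using f22) (by simp)
      (fun h => by rw [cut_succ_of_zero h]) (fun hne => ?_)
      (by rw [State.setReg_reg, if_neg (by norm_num), f26]; positivity)
      (by rw [State.setReg_reg, if_neg (by norm_num), f26]; push_cast; linarith)).mono ?_
    · have hr1 : v / J.gadget.cols + 1 < 2 * J.m := Gadget.vertical_ne_zero_lt hne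
      have hN : v + J.gadget.cols < J.N := by
        have := Gadget.index_lt (m := J.m) (r := v / J.gadget.cols + 1) hJ.size hr1
          (Nat.mod_lt v (show 0 < J.gadget.cols by omega))
        rw [add_mul, mul_comm] at this
        change J.gadget.cols * (v / J.gadget.cols) + 1 * J.gadget.cols + v % J.gadget.cols < _ at this
        omega
      refine ⟨⟨v + J.gadget.cols, hN⟩, ?_, ?_, ?_, hplan _ _⟩
      · have := (H4.jobRegs hs₁).r12
        simp [f22, this]
      · rw [gridG_vertical hC rfl]; simp [cut, edgeOf]
      · rw [gridG_setEdge_vertical hC rfl, update_cut]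
    rintro s6 t6 ⟨I6, H6, f6, ⟨y6, q6, q6'⟩, l6⟩
    have f22' : s6.reg 22 = v := by
      rw [f6 22 (by norm_num) (by norm_num) (by norm_num)]; simpa using f22
    have b22 : |((v + 1 : ℕ) : ℤ)| ≤ μ.Z := abs_natCast_le (by have := C.N_le; omega)
    refine ⟨f22', H6.bounded, H6.setReg (by norm_num) (by norm_num) (by norm_num) (by norm_num)
      (by norm_num) b22, by simp, hI _ _ _ _ I6 (by norm_num) (by norm_num) (by norm_num),
      ⟨y + y4 + y6, ?_, ?_⟩, ?_⟩
    · rw [State.setReg_reg, if_neg (by norm_num), q6, State.setReg_reg, if_neg (by norm_num), f26]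
      push_cast; ring
    · rw [add_mul]; omega
    · have c1 := horizontalTerm_cost k
      have c2 := verticalTerm_cost
      have c3 : (Term.reg 22 / Term.reg 12).cost = 5 := rfl
      have c4 : (Term.reg 22 % Term.reg 12).cost = 5 := rfl
      rw [c3, c4, add_mul]
      omega
  · refine ⟨hs.setReg (by norm_num) (by norm_num) (by norm_num) (by norm_num)
      (by norm_num) (by simp; omega), by simp, ?_, ⟨0, by simp, by simp⟩, by simp⟩
    rw [cut_zero, cut_zero, gridG_zero]
    exact hI _ _ _ _ h1 (by norm_num) (by norm_num) (by norm_num)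
  · rintro s' τ ⟨H, g22, gI, gy, gτ⟩
    refine ⟨?_, H, gy, by omega⟩
    rw [gridG_cut] at gI
    exact gI

/-- The initialization of the data structure, in the lower layer. -/
theorem runs_initCode (C : Ctx μ D k d R p u q J) {s₁ s : State} (hs₁ : JobRegs J s₁)
    (hs : BuildInv μ s₁ s) (hsim : Sim R false s (WGraph.input (n := J.N) fun _ _ => none))
    (h0 : s.reg 26 = 0) (hu : ((p + J.N * (2 * u) : ℕ) : ℤ) ≤ μ.Z) :
    Runs μ (initCode D k) s fun s' t => Holds D k d R μ.Z false s' (J.start k) ∧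
      BuildInv μ s₁ s' ∧ t ≤ 20 * p + J.N * (40 * u + 1200) + 9 := by
  have hK := C.K_ge
  have hJ := C.valid
  have hP := Job.gadget_valid hJ
  have hL := Job.pow_le_M hJ
  have hplan : IsPlanarInstance d (J.start k) := by
    have := Job.partialSc_isPlanarInstance hJ C.heavy_le_pow k 0 0 0
    rwa [Job.partialSc_zero] at this
  have hempty : IsPlanarInstance d (fun _ _ => none : WGraph J.N) := by
    have := gridG_isPlanarInstance (N := J.N) (C := 2) (d := d) le_rfl (hw := fun _ => 0)
      (vw := fun _ => 0) (fun v => ⟨le_rfl, by positivity⟩) (fun v => ⟨le_rfl, by positivity⟩)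
      (fun v hv => absurd rfl hv)
    rwa [gridG_zero] at this
  push_cast at hu
  have hprep : ∀ (G : WGraph J.N) (s : State), IsPlanarInstance d G → k.Initial G →
      BuildInv μ s₁ s → Sim R false s G.input → 0 ≤ s.reg 26 → s.reg 26 + p ≤ μ.Z →
      Runs μ (D.prep.emb false) s fun s' t => Holds D k d R μ.Z false s' G ∧ BuildInv μ s₁ s' ∧
        (∃ y : ℕ, s'.reg 26 = s.reg 26 + y ∧ y ≤ p) ∧ t ≤ 20 * p := by
    intro G s hG hini hs hsim h0 hu
    obtain ⟨σ, t, hE, ht⟩ := C.solves.prep G hG hini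
    have htz : (t : ℤ) ≤ p := by exact_mod_cast ht
    refine (hE.simulate' C.bound_le hK C.prep_below hsim hs.stamps h0 (by linarith)).mono ?_
    rintro s' T ⟨⟨g1, g2, g3, g4⟩, g5⟩
    have g26 : |s'.reg 26| ≤ μ.Z := by
      rw [g3, abs_of_nonneg (by positivity)]; linarith
    refine ⟨⟨σ, .init hG hini hE, g1, hE.abs_reg_le C.bound_le fun r => ?_⟩, ⟨fun r hr => ?_,
      fun i hi => (g5.arr_eq hi).trans (hs.arrs i hi), g5.bounded hs.bounded g26, g2⟩,
      ⟨t, g3, ht⟩, by omega⟩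
    · have := C.N_le
      simp only [WGraph.input]
      split_ifs
      · exact abs_natCast_le this
      · simp; linarith [μ.two_le]
    · rw [g5.reg_eq (by omega) (by omega)]
      exact hs.regs r hr
  have hwrite : ∀ (hini : k.Initial (J.start k)),
      Runs μ (.seq (edgesCode k writeEdge) (D.prep.emb false)) s fun s' t =>
        Holds D k d R μ.Z false s' (J.start k) ∧
        BuildInv μ s₁ s' ∧ t ≤ 20 * p + J.N * (40 * u + 1200) + 9 := by
    intro hini
    refine Runs.seq ((runs_edges C hs₁ (addsEdge_writeEdge C hs₁) (fun h G r v hh h1 h2 h3 =>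
      hh.congr (fun i _ => by rw [State.setReg_reg, if_neg (by omega)]) (by simp [h2.symm])
        (by simp [h3.symm]) fun _ _ => rfl) hs hsim h0.ge
        (by rw [h0]; push_cast; linarith [Int.natCast_nonneg p])).mono ?_)
    rintro s2 t2 ⟨g1, g2, ⟨y, g3, g4⟩, g5⟩
    have hy : (y : ℤ) ≤ J.N * (2 * u) := by exact_mod_cast g4
    refine (hprep _ s2 hplan hini g2 g1 (by rw [g3, h0]; positivity)
      (by rw [g3, h0]; linarith)).mono ?_
    rintro s3 t3 ⟨e1, e2, -, e4⟩
    exact ⟨e1, e2, by omega⟩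
  cases k with
  | insert =>
    refine Runs.seq ((hprep _ s hempty (fun _ _ => rfl) hs hsim h0.ge
      (by rw [h0]; nlinarith [Int.natCast_nonneg (J.N * u), Int.natCast_mul J.N u])).mono ?_)
    rintro s2 t2 ⟨g1, g2, ⟨y, g3, g4⟩, g5⟩
    have hy : (y : ℤ) ≤ p := by exact_mod_cast g4
    refine (runs_edges C hs₁ (addsEdge_insertEdge C) (fun h G r v hh h1 h2 h3 =>
      hh.setReg v h1 h2 h3) g2 g1 (by rw [g3, h0]; positivity)
      (by rw [g3, h0]; push_cast; linarith)).mono ?_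
    rintro s3 t3 ⟨e1, e2, -, e4⟩
    exact ⟨e1, e2, by omega⟩
  | delete => exact hwrite trivial
  | increase => exact hwrite trivial
  | decrease => exact hwrite trivial

/-- Both stamp registers get a fresh value, which empties both layers. The clock is parked in
register `33` and restored at the end: the construction of a block does not count towards the time
limit of an attempt. -/
theorem runs_block (C : Ctx μ D k d R p u q J) {s : State} (hs : JobRegs J s)
    (hbd : Bounded μ.Z s) (hst : Stamps μ.Z s) (h25 : s.reg 25 + 1 ≤ μ.Z)
    (hu : ((p + J.N * (2 * u) : ℕ) : ℤ) ≤ μ.Z) :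
    Runs μ (blockCode D k R) s fun s' t => Stored D k d R μ.Z s' (J.start k) ∧
      (∀ r < 18, s'.reg r = s.reg r) ∧ (∀ i < 10, s'.arr i = s.arr i) ∧ s'.reg 26 = s.reg 26 ∧
      s'.reg 25 = s.reg 25 + 1 ∧ Bounded μ.Z s' ∧ Stamps μ.Z s' ∧
      t ≤ 20 * p + J.N * (40 * u + 1200) + 8 * R + 50 := by
  have hK := C.K_ge
  have hZ := μ.two_le
  obtain ⟨S1, S2, S3, S4⟩ := hst
  have b25 : |s.reg 25 + 1| ≤ μ.Z := by rw [abs_of_nonneg (by linarith)]; exact h25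
  have b26 := hbd.1 26 (by norm_num)
  have c25 : (Term.reg 25 + Term.lit 1).cost = 4 := rfl
  have c2 : ∀ r, (Term.reg r).cost = 2 := fun r => rfl
  have c1 : (Term.lit 0).cost = 1 := rfl
  refine Runs.seq (Runs.assign hK (by decide) hbd ?_)
  have e25 : (Term.reg 25 + Term.lit 1).eval s = s.reg 25 + 1 := rfl
  rw [e25]
  refine Runs.seq (Runs.assign hK (by decide) (hbd.setReg 25 b25) ?_)
  have e24 : (Term.reg 25).eval (s.setReg 25 (s.reg 25 + 1)) = s.reg 25 + 1 := by simp
  rw [e24]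
  refine Runs.seq (Runs.assign hK (by decide) ((hbd.setReg 25 b25).setReg 24 b25) ?_)
  have e33 : (Term.reg 26).eval ((s.setReg 25 (s.reg 25 + 1)).setReg 24 (s.reg 25 + 1)) =
      s.reg 26 := by simp
  rw [e33]
  refine Runs.seq (Runs.assign hK (by decide)
    (((hbd.setReg 25 b25).setReg 24 b25).setReg 33 b26) ?_)
  rw [Term.eval_lit]
  set s₁ := (((s.setReg 25 (s.reg 25 + 1)).setReg 24 (s.reg 25 + 1)).setReg 33 (s.reg 26)).setReg
    26 0 with hs₁
  have hb1 : Bounded μ.Z s₁ :=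
    (((hbd.setReg 25 b25).setReg 24 b25).setReg 33 b26).setReg 26 (by simp; linarith)
  have hlow : ∀ r < 18, s₁.reg r = s.reg r := fun r hr => by
    simp [hs₁, show r ≠ 25 by omega, show r ≠ 24 by omega, show r ≠ 33 by omega,
      show r ≠ 26 by omega]
  have hJ1 : JobRegs J s₁ := hs.congr (fun r hr => hlow r (by omega)) rfl rfl
  have f24 : s₁.reg 24 = s.reg 25 + 1 := by simp [hs₁]
  have f25 : s₁.reg 25 = s.reg 25 + 1 := by simp [hs₁]
  have hst1 : Stamps μ.Z s₁ := by
    refine ⟨by rw [f24]; linarith, by rw [f24, f25], by rw [f25]; exact h25, fun k a => ?_⟩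
    have := S4 k a
    rw [f25]
    exact ⟨⟨this.1.1, by change s.arr _ _ ≤ _; linarith [this.1.2]⟩, this.2.1,
      by change s.arr _ _ ≤ _; linarith [this.2.2]⟩
  refine Runs.seq ((runs_zeroRegs (μ := μ) R).mono ?_)
  rintro s2 t2 ⟨l2, a2, z2, r2⟩
  have g2 : ∀ r < 100, s2.reg r = s₁.reg r := fun r hr => r2 r fun i _ => by omega
  have hb2 : Bounded μ.Z s2 := ⟨fun r hr => by rw [g2 r (by omega)]; exact hb1.1 r hr,
    by rw [a2]; exact hb1.2⟩
  refine Runs.seq (Runs.assign hK (by decide) hb2 ?_)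
  have e7 : (Term.reg 7).eval s2 = J.N := by
    rw [Term.eval_reg, g2 7 (by norm_num)]; exact hJ1.r7
  rw [e7]
  have H3 : BuildInv μ s₁ (s2.setReg 100 J.N) := by
    refine ⟨fun r hr => ?_, fun i _ => by rw [State.setReg_arr, a2],
      hb2.setReg_of_le (by norm_num) _, hst1.congr ?_ ?_ fun _ _ => ?_⟩
    · rw [State.setReg_reg, if_neg (by omega), g2 r (by omega)]
    · rw [State.setReg_reg, if_neg (by omega), g2 _ (by omega)]
    · rw [State.setReg_reg, if_neg (by omega), g2 _ (by omega)]
    · rw [State.setReg_arr, a2]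
  have hsim : Sim R false (s2.setReg 100 J.N) (WGraph.input (n := J.N) fun _ _ => none) := by
    refine ⟨fun r hr => ?_, fun i a => ?_⟩
    · by_cases h : r = 0
      · subst h; simp [WGraph.input]
      · rw [State.setReg_reg, if_neg (by omega), z2 r hr]
        simp [WGraph.input, h]
    · have hcell : ∀ c, WGraph.cell (n := J.N) (fun _ _ => none) c = none := fun c => by
        unfold WGraph.cell; split_ifs <;> rfl
      rw [layerMem_false, baseMem, if_neg]
      · simp [WGraph.input, hcell]
      · rw [State.setReg_arr, a2, State.setReg_reg, if_neg (by norm_num), g2 24 (by norm_num), f24]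
        have := (S4 i a).1.2
        change s.arr _ _ ≠ _
        omega
  refine Runs.seq ((runs_initCode C hJ1 H3 hsim (by simp [g2, hs₁]) hu).mono ?_)
  rintro s4 t4 ⟨⟨σ, hσ, hsim4, hreg⟩, H4, l4⟩
  refine Runs.seq ((runs_saveRegs hK R fun r hr => by
    rw [hsim4.1 r hr]; exact hreg r).mono ?_)
  rintro s5 t5 ⟨l5, a5, v5, r5⟩
  have g5 : ∀ r < 100, s5.reg r = s4.reg r := fun r hr => r5 r fun i _ => by omega
  have hb5 : Bounded μ.Z s5 := ⟨fun r hr => by rw [g5 r (by omega)]; exact H4.bounded.1 r hr,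
    by rw [a5]; exact H4.bounded.2⟩
  refine Runs.assign hK (by decide) hb5 ?_
  have e26 : (Term.reg 33).eval s5 = s.reg 26 := by
    rw [Term.eval_reg, g5 33 (by norm_num), H4.regs 33 (by omega)]
    simp [hs₁]
  rw [e26]
  have h25' : s5.reg 25 = s.reg 25 + 1 := by
    rw [g5 25 (by norm_num), H4.regs 25 (by omega), f25]
  refine ⟨⟨σ, hσ, fun r hr => ?_, fun i a => ?_, hreg⟩, fun r hr => ?_, fun i hi => ?_, by simp,
    by simpa using h25', hb5.setReg 26 b26, ?_, ?_⟩
  · rw [State.setReg_reg, if_neg (by omega), v5 r hr, hsim4.1 r hr]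
  · rw [← hsim4.2 i a, layerMem_false]
    simp [baseMem, a5, g5 24 (by norm_num)]
  · rw [State.setReg_reg, if_neg (by omega), g5 r (by omega), H4.regs r (by omega), hlow r hr]
  · rw [State.setReg_arr, a5, H4.arrs i hi]
    rfl
  · refine H4.stamps.congr ?_ ?_ fun _ _ => ?_
    · simp [g5 24 (by norm_num)]
    · simp [g5 25 (by norm_num)]
    · rw [State.setReg_arr, a5]
  · rw [c25, c2, c2, c2, c1, c2]
    omega

end build

/-! ### One attempt to compute a product -/

section programs

open Term

def rowsCode (D : DynAlg) (k : UpdateKind) (R : ℕ) : Cmd :=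
  .forTo 17 0 (.iff (less (reg 13) (reg 26)) .skip (rowCode D k R))

def stripCode (D : DynAlg) (k : UpdateKind) (R : ℕ) : Cmd :=
  .forStep 16 0 (reg 10) (.seq (blockCode D k R) (rowsCode D k R))

def gridCode (D : DynAlg) (k : UpdateKind) (R : ℕ) : Cmd :=
  .forStep 15 0 (reg 9) (stripCode D k R)

/-- Set the entries of the `n × n` matrix in array `k`. -/
def mapCode (k : ℕ) (e : Term) : Cmd :=
  .seq (.set 27 (reg 0 * reg 0)) (.forTo 28 27 (.put k (reg 28) e))

/-- Compute the product with blocks of height `reg 9`, and give up when the clock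
exceeds `reg 13`. -/
def attemptCode (D : DynAlg) (k : UpdateKind) (R : ℕ) : Cmd :=
  .seq (.set 10 (reg 3 / reg 9)) (.seq (.set 12 (lit 2 * reg 10 + reg 4 + (lit 1 + lit 2)))
    (.seq (mapCode 5 (reg 1)) (.seq (.set 26 (lit 0)) (.seq (gridCode D k R)
      (.iff (less (reg 13) (reg 26)) .skip (.set 14 (lit 0)))))))

end programs

/-- The program has proceeded from state `s` to `s'` within time `t`. Only the registers from `ℓ`
on and the product have been changed, at most `a` rows have been processed,
and the stamps have been increased by at most `b`. -/
structure Adv (μ : Machine) (n : ℕ) (W : ℕ → ℕ → ℕ) (T ρ ℓ : ℕ) (s s' : State) (a b c t : ℕ) :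
    Prop where
  regs : ∀ r < ℓ, s'.reg r = s.reg r
  arrs : ∀ i < 10, i ≠ 5 → s'.arr i = s.arr i
  bounded : Bounded μ.Z s'
  stamps : Stamps μ.Z s'
  refines : Refines n W (s.arr 5) (s'.arr 5)
  mono : s.reg 26 ≤ s'.reg 26
  clock : s'.reg 26 ≤ T + ρ
  clock_rows : s'.reg 26 ≤ s.reg 26 + a * ρ
  phase : s'.reg 25 ≤ s.reg 25 + b
  time : (t : ℤ) ≤ 200 * (s'.reg 26 - s.reg 26) + c

section adv

variable {μ : Machine} {n : ℕ} {W : ℕ → ℕ → ℕ} {T ρ ℓ : ℕ} {s s' s'' : State}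
  {a b c t a' b' c' t' : ℕ}

theorem Adv.trans (h : Adv μ n W T ρ ℓ s s' a b c t) (h' : Adv μ n W T ρ ℓ s' s'' a' b' c' t') :
    Adv μ n W T ρ ℓ s s'' (a + a') (b + b') (c + c') (t + t') where
  regs r hr := (h'.regs r hr).trans (h.regs r hr)
  arrs i hi h5 := (h'.arrs i hi h5).trans (h.arrs i hi h5)
  bounded := h'.bounded
  stamps := h'.stamps
  refines := h.refines.trans h'.refines
  mono := h.mono.trans h'.mono
  clock := h'.clock
  clock_rows := by
    have := h.clock_rows; have := h'.clock_rows
    push_cast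
    linarith
  phase := by
    have := h.phase; have := h'.phase
    push_cast
    linarith
  time := by
    have := h.time; have := h'.time
    push_cast
    linarith

theorem Adv.weaken (h : Adv μ n W T ρ ℓ s s' a b c t) {ℓ' : ℕ} (hℓ : ℓ' ≤ ℓ) (hb : b ≤ b')
    (hc : c + t' ≤ c' + t) : Adv μ n W T ρ ℓ' s s' a b' c' t' where
  regs r hr := h.regs r (by omega)
  arrs := h.arrs
  bounded := h.bounded
  stamps := h.stamps
  refines := h.refines
  mono := h.mono
  clock := h.clock
  clock_rows := h.clock_rows
  phase := by
    have := h.phase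
    have : (b : ℤ) ≤ b' := by exact_mod_cast hb
    linarith
  time := by
    have := h.time
    have : (c : ℤ) + t' ≤ c' + t := by exact_mod_cast hc
    linarith

theorem Adv.le (h : Adv μ n W T ρ ℓ s s' a b c t) (ha : a ≤ a') (hb : b ≤ b') (hc : c ≤ c') :
    Adv μ n W T ρ ℓ s s' a' b' c' t where
  regs := h.regs
  arrs := h.arrs
  bounded := h.bounded
  stamps := h.stamps
  refines := h.refines
  mono := h.mono
  clock := h.clock
  clock_rows := h.clock_rows.trans (by gcongr)
  phase := h.phase.trans (by gcongr)
  time := h.time.trans (by gcongr)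

theorem Adv.setReg (h : Adv μ n W T ρ ℓ s s' a b c t) {r : ℕ} {v : ℤ} (hr : ℓ ≤ r)
    (h24 : r ≠ 24) (h25 : r ≠ 25) (h26 : r ≠ 26) (hv : |v| ≤ μ.Z) :
    Adv μ n W T ρ ℓ s (s'.setReg r v) a b c t where
  regs r' hr' := by rw [State.setReg_reg, if_neg (by omega)]; exact h.regs r' hr'
  arrs := h.arrs
  bounded := h.bounded.setReg r hv
  stamps := h.stamps.setReg' v h24 h25
  refines := h.refines
  mono := by simpa [h26.symm] using h.mono
  clock := by simpa [h26.symm] using h.clock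
  clock_rows := by simpa [h26.symm] using h.clock_rows
  phase := by simpa [h25.symm] using h.phase
  time := by simpa [h26.symm] using h.time

theorem Adv.refl (hb : Bounded μ.Z s) (hs : Stamps μ.Z s) (h : s.reg 26 ≤ T + ρ) (c : ℕ) :
    Adv μ n W T ρ ℓ s s 0 0 c c where
  regs _ _ := rfl
  arrs _ _ _ := rfl
  bounded := hb
  stamps := hs
  refines := Refines.refl _
  mono := le_rfl
  clock := h
  clock_rows := by simp
  phase := by simp
  time := by simp

end adv

theorem Job.Covers.mono {J : Job} {i l : ℕ} {f g : ℤ → ℤ} (h : J.Covers i l f)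
    (hg : ∀ a, g a ≤ f a) : J.Covers i l g :=
  fun jj h1 h2 l' h3 h4 => (hg _).trans (h jj h1 h2 l' h3 h4)

/-- A bound for the time to process a row. -/
def Job.rowTime (J : Job) (u q : ℕ) : ℕ := J.m * (J.L * (u + 1) + 1) + J.w * (q + 1)

section attempt

variable {μ : Machine} {D : DynAlg} {k : UpdateKind} {d R p u q T : ℕ}

/-- The limit is tested only before each row, so the clock exceeds `T` by at most the time of one
row. As the clock never decreases, a final value of at most `T` means that no row has been skipped.
-/
theorem runs_rows {J : Job} (C : Ctx μ D k d R p u q J) (hj₀ : J.j₀ < J.n) {s : State}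
    (hs : JobRegs J s) (h13 : s.reg 13 = T) (hbd : Bounded μ.Z s) (hst : Stamps μ.Z s)
    (hS : Stored D k d R μ.Z s (J.start k)) (h5 : ∀ a, 0 ≤ s.arr 5 a ∧ s.arr 5 a ≤ J.X)
    (h0 : 0 ≤ s.reg 26) (h26 : s.reg 26 ≤ T + J.rowTime u q)
    (hT : ((T + J.rowTime u q : ℕ) : ℤ) ≤ μ.Z) (h25 : s.reg 25 + J.n ≤ μ.Z) :
    Runs μ (rowsCode D k R) s fun s' t =>
      Adv μ J.n J.W T (J.rowTime u q) 17 s s' J.n J.n (J.n * (4 * R + 60) + 9) t ∧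
      (s'.reg 26 ≤ T → ∀ i < J.n, J.Covers i J.w (s'.arr 5)) := by
  have hK := C.K_ge
  have hn : (J.n : ℤ) ≤ μ.Z := by
    rw [← hs.r0]; exact (le_abs_self _).trans (hbd.1 0 (by norm_num))
  push_cast at hT
  refine Runs.forTo hK (by norm_num) (by norm_num) (N := J.n) (fun i s' τ =>
    Adv μ J.n J.W T (J.rowTime u q) 17 s s' i i (i * (4 * R + 60) + 8) τ ∧ s'.reg 17 = i ∧
    Stored D k d R μ.Z s' (J.start k) ∧
    (s'.reg 26 ≤ T → ∀ i' < i, J.Covers i' J.w (s'.arr 5))) ?_ ?_ hbd ?_ ?_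
  · rintro i s' τ ⟨H, h17, -⟩
    exact ⟨h17, by rw [H.regs 0 (by norm_num)]; exact hs.r0, H.bounded⟩
  · rintro i hi s' τ ⟨H, h17, hS', hcov⟩
    have hr : JobRegs J s' := hs.congr H.regs (H.arrs 4 (by norm_num) (by norm_num))
      (H.arrs 6 (by norm_num) (by norm_num))
    have g13 : s'.reg 13 = T := by rw [H.regs 13 (by norm_num)]; exact h13
    have bi : |((i + 1 : ℕ) : ℤ)| ≤ μ.Z := abs_natCast_le (by push_cast; omega)
    have ct : (Term.less (Term.reg 13) (Term.reg 26)).cost = 5 := rfl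
    refine Runs.test hK (by decide) H.bounded (fun hne => Runs.skip ?_) (fun he => ?_)
    · have hgt : (T : ℤ) < s'.reg 26 := by
        by_contra hc
        apply hne
        simp [g13, hc]
      refine ⟨h17, H.bounded, ?_, by simp, ?_, fun h => ?_⟩
      · have A := (H.trans (Adv.refl (n := J.n) (W := J.W) (T := T) (ρ := J.rowTime u q) (ℓ := 17)
          H.bounded H.stamps H.clock (1 + (Term.less (Term.reg 13) (Term.reg 26)).cost + 1 + 12)))
        refine Adv.setReg ⟨A.regs, A.arrs, A.bounded, A.stamps, A.refines, A.mono, A.clock, ?_, ?_,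
          ?_⟩ (by norm_num) (by norm_num) (by norm_num) (by norm_num) bi
        · have := A.clock_rows
          push_cast at this ⊢
          have h1 : (0 : ℤ) ≤ J.rowTime u q := by positivity
          linarith
        · have := A.phase
          push_cast at this ⊢
          linarith
        · have := A.time
          rw [ct] at this ⊢
          push_cast at this ⊢
          linarith
      · exact hS'.congr (fun r _ => by rw [State.setReg_reg, if_neg (by omega)]) (by simp)
          fun _ _ _ => rfl
      · simp only [State.setReg_reg, show (26 = 17) = False by simp, if_false] at h
        omega
    · have hle : s'.reg 26 ≤ T := by
        by_contra hc
        simp [g13, not_le.1 hc] at he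
      have hph := H.phase
      have h26' : 0 ≤ s'.reg 26 := h0.trans H.mono
      refine (runs_row C hj₀ hr H.bounded H.stamps (by omega) hi h17 hS'
        (H.refines.mem h5) h26' ?_).mono ?_
      · have := hT
        unfold Job.rowTime at this
        push_cast at this
        linarith
      rintro s2 t2 ⟨e1, e2, e3, e4, e5, x, e6, e7, e8⟩
      have e7' : (x : ℤ) ≤ J.rowTime u q := by exact_mod_cast e7
      have g17 : s2.reg 17 = i := by rw [e1.1 17 (by omega)]; simpa using h17
      have hx0 : (0 : ℤ) ≤ x := by positivity
      have A : Adv μ J.n J.W T (J.rowTime u q) 17 s' s2 1 1 (4 * R + 60)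
          (t2 + (Term.less (Term.reg 13) (Term.reg 26)).cost + 1 + 12) := by
        refine ⟨fun r hr => ?_, fun i hi h5 => ?_, e2, e3, e4, ?_, ?_, ?_, ?_, ?_⟩
        · rw [e1.1 r (by omega), State.setReg_reg, if_neg (by omega)]
        · rw [e1.2 i (not_layerArr_of_lt hi) h5]; rfl
        · rw [e6]; linarith
        · rw [e6]; linarith
        · rw [e6]; push_cast; linarith
        · rw [e1.1 25 (by omega)]; simp
        · rw [e6, ct]; push_cast
          have : (t2 : ℤ) ≤ 200 * x + (4 * R + 30) := by exact_mod_cast e8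
          linarith
      refine ⟨g17, e2, ?_, by simp, ?_, fun h => ?_⟩
      · have B := (H.trans A).setReg (r := 17) le_rfl (by norm_num) (by norm_num) (by norm_num) bi
        exact B.weaken le_rfl le_rfl (by rw [add_mul]; omega)
      · refine (e1.stored (hS'.congr (fun r _ => ?_) ?_ fun _ _ _ => rfl)).congr (fun r _ => ?_)
          ?_ fun _ _ _ => rfl
        · rw [State.setReg_reg, if_neg (by omega)]
        · simp
        · rw [State.setReg_reg, if_neg (by omega)]
        · simp
      · intro i' hi'
        rcases Nat.lt_succ_iff_lt_or_eq.1 hi' with hlt | rfl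
        · exact (hcov hle i' hlt).mono fun a => (e4 a).1
        · exact e5
  · refine ⟨(Adv.refl hbd hst h26 8).setReg le_rfl (by norm_num) (by norm_num) (by norm_num)
      (by simp; linarith [μ.two_le]) |>.weaken le_rfl le_rfl (by omega), by simp, ?_,
      fun _ i' hi' => absurd hi' (by omega)⟩
    exact hS.congr (fun r _ => by rw [State.setReg_reg, if_neg (by omega)]) (by simp)
      fun _ _ _ => rfl
  · rintro s' τ ⟨H, -, -, hcov⟩
    exact ⟨H.weaken le_rfl le_rfl (by omega), hcov⟩

/-- A bound for the time for a block, without the time to process the rows. -/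
def Job.blockTime (J : Job) (R p u : ℕ) : ℕ :=
  20 * p + J.N * (40 * u + 1200) + J.n * (4 * R + 60) + 8 * R + 80

theorem runs_block_rows {J : Job} (C : Ctx μ D k d R p u q J) (hj₀ : J.j₀ < J.n) {s : State}
    (hs : JobRegs J s) (h13 : s.reg 13 = T) (hbd : Bounded μ.Z s) (hst : Stamps μ.Z s)
    (h5 : ∀ a, 0 ≤ s.arr 5 a ∧ s.arr 5 a ≤ J.X)
    (h0 : 0 ≤ s.reg 26) (h26 : s.reg 26 ≤ T + J.rowTime u q)
    (hT : ((T + J.rowTime u q : ℕ) : ℤ) ≤ μ.Z) (h25 : s.reg 25 + (J.n + 1) ≤ μ.Z)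
    (hu : ((p + J.N * (2 * u) : ℕ) : ℤ) ≤ μ.Z) :
    Runs μ (.seq (blockCode D k R) (rowsCode D k R)) s fun s' t =>
      Adv μ J.n J.W T (J.rowTime u q) 17 s s' J.n (J.n + 1) (J.blockTime R p u) (t + 15) ∧
      (s'.reg 26 ≤ T → ∀ i < J.n, J.Covers i J.w (s'.arr 5)) := by
  refine Runs.seq ((runs_block C hs hbd hst (by linarith [Int.natCast_nonneg J.n]) hu).mono ?_)
  rintro s2 t2 ⟨e1, e2, e3, e4, e5, e6, e7, e8⟩
  have f5 : s2.arr 5 = s.arr 5 := e3 5 (by norm_num)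
  refine (runs_rows C hj₀ (hs.congr (fun r hr => e2 r (by omega)) (e3 4 (by norm_num))
    (e3 6 (by norm_num))) (by rw [e2 13 (by norm_num)]; exact h13) e6 e7 e1 (by rw [f5]; exact h5)
    (by rw [e4]; exact h0) (by rw [e4]; exact h26) hT (by rw [e5]; linarith)).mono ?_
  rintro s3 t3 ⟨A, hcov⟩
  refine ⟨?_, hcov⟩
  have B : Adv μ J.n J.W T (J.rowTime u q) 17 s s2 0 1
      (20 * p + J.N * (40 * u + 1200) + 8 * R + 50) t2 := by
    refine ⟨fun r hr => e2 r (by omega), fun i hi _ => e3 i hi, e6, e7, ?_, e4.ge, by rw [e4]; exact h26,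
      by rw [e4]; simp, by rw [e5]; simp, ?_⟩
    · rw [f5]; exact Refines.refl _
    · rw [e4]; simpa using (by exact_mod_cast e8 : (t2 : ℤ) ≤ _)
  have E := B.trans A
  rw [zero_add] at E
  refine E.weaken le_rfl (by omega) ?_
  unfold Job.blockTime
  omega

end attempt

/-! ### The product, block by block -/

/-- The data for a product: the matrix `W`, and the parameters of the grids. -/
structure Prob where
  n : ℕ
  X : ℕ
  Y : ℕ
  L : ℕ
  N : ℕ
  W : ℕ → ℕ → ℕ

namespace Prob

variable (P : Prob)

def job (m w j₀ k₀ : ℕ) : Job := ⟨P.n, P.X, P.L, P.N, m, w, j₀, k₀, P.W⟩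

/-- The program variables contain the parameters. -/
structure Regs (s : State) : Prop where
  r0 : s.reg 0 = P.n
  r1 : s.reg 1 = P.X
  r3 : s.reg 3 = P.Y
  r4 : s.reg 4 = P.L
  r5 : s.reg 5 = 3 * P.L + 3
  r6 : s.reg 6 = 4 * P.X
  r7 : s.reg 7 = P.N
  a4 : ∀ i < P.n, ∀ l < P.n, s.arr 4 ((i : ℤ) * P.n + l) = P.W i l
  a6 : ∀ b < P.L, s.arr 6 b = 2 ^ b

theorem Regs.congr {P : Prob} {s s' : State} (h : P.Regs s) (hr : ∀ r < 8, s'.reg r = s.reg r)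
    (h4 : s'.arr 4 = s.arr 4) (h6 : s'.arr 6 = s.arr 6) : P.Regs s' := by
  obtain ⟨a, b, c, d, e, f, g, i, j⟩ := h
  constructor <;> first
    | (rw [hr _ (by norm_num)]; assumption)
    | (rw [h4]; assumption)
    | (rw [h6]; assumption)

/-- The hypotheses for all the blocks. -/
structure Ctx (μ : Machine) (D : DynAlg) (k : UpdateKind) (d R p u q : ℕ) : Prop where
  job : ∀ m w j₀ k₀, 1 ≤ m → 1 ≤ w → m * w = P.Y →
    PlanarAPSP.Ctx μ D k d R p u q (P.job m w j₀ k₀)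
  K_ge : 20 ≤ μ.K
  prep_le : ((p + P.N * (2 * u) : ℕ) : ℤ) ≤ μ.Z
  n_pos : 1 ≤ P.n
  n_le : 2 * ((P.n : ℤ) * P.n) ≤ μ.Z
  Y_le : P.Y ≤ P.n
  W_le : ∀ i j, P.W i j ≤ P.X
  X_le : (P.X : ℤ) ≤ μ.Z

/-- The registers contain the parameters of the attempt. -/
structure Shape (m w T : ℕ) (s : State) : Prop extends P.Regs s where
  r9 : s.reg 9 = m
  r10 : s.reg 10 = w
  r12 : s.reg 12 = (2 * w + P.L + 3 : ℕ)
  r13 : s.reg 13 = T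

theorem Shape.congr {P : Prob} {m w T : ℕ} {s s' : State} (h : P.Shape m w T s)
    (hr : ∀ r < 15, s'.reg r = s.reg r) (h4 : s'.arr 4 = s.arr 4) (h6 : s'.arr 6 = s.arr 6) :
    P.Shape m w T s' :=
  ⟨h.toRegs.congr (fun r _ => hr r (by omega)) h4 h6, by rw [hr _ (by norm_num)]; exact h.r9,
    by rw [hr _ (by norm_num)]; exact h.r10, by rw [hr _ (by norm_num)]; exact h.r12,
    by rw [hr _ (by norm_num)]; exact h.r13⟩

theorem Shape.jobRegs {P : Prob} {m w T : ℕ} {s : State} (h : P.Shape m w T s) {j₀ k₀ : ℕ}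
    (h15 : s.reg 15 = j₀) (h16 : s.reg 16 = k₀) : JobRegs (P.job m w j₀ k₀) s :=
  ⟨h.r0, h.r1, h.r4, h.r5, h.r6, h.r7, h.r9, h.r10, h.r12, h15, h16, h.a4, h.a6⟩

/-- A bound for the number of blocks of length `m`. -/
def parts (m : ℕ) : ℕ := P.n / m + 1

def rowTime (u q m w : ℕ) : ℕ := m * (P.L * (u + 1) + 1) + w * (q + 1)

def blockTime (R p u : ℕ) : ℕ :=
  20 * p + P.N * (40 * u + 1200) + P.n * (4 * R + 60) + 8 * R + 80

variable {P} {μ : Machine} {D : DynAlg} {k : UpdateKind} {d R p u q m w T : ℕ}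

theorem lt_parts {i : ℕ} (hm : 1 ≤ m) (h : i * m < P.n) : i < P.parts m := by
  unfold parts
  have := (Nat.le_div_iff_mul_le hm).2 h.le
  omega

/-- Sums with middle index in the range of `m` indices from `j₀` are treated, for all columns in
steps of `w`. Coverage survives the later blocks because entries only decrease. -/
theorem runs_strip (C : P.Ctx μ D k d R p u q) (hm : 1 ≤ m) (hw : 1 ≤ w) (hmw : m * w = P.Y)
    {j₀ : ℕ} (hj₀ : j₀ < P.n) {s : State} (hs : P.Shape m w T s) (h15 : s.reg 15 = j₀)
    (hbd : Bounded μ.Z s) (hst : Stamps μ.Z s)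
    (h5 : ∀ a, 0 ≤ s.arr 5 a ∧ s.arr 5 a ≤ P.X)
    (h0 : 0 ≤ s.reg 26) (h26 : s.reg 26 ≤ T + P.rowTime u q m w)
    (hT : ((T + P.rowTime u q m w : ℕ) : ℤ) ≤ μ.Z)
    (h25 : s.reg 25 + (P.parts w * (P.n + 1) : ℕ) ≤ μ.Z) :
    Runs μ (stripCode D k R) s fun s' t =>
      Adv μ P.n P.W T (P.rowTime u q m w) 16 s s' (P.parts w * P.n) (P.parts w * (P.n + 1))
        (P.parts w * P.blockTime R p u + 9) t ∧
      (s'.reg 26 ≤ T → ∀ i < P.n, ∀ j < P.n, ∀ l < P.n, j₀ ≤ j → j < j₀ + m →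
        s'.arr 5 (i * P.n + l) ≤ P.W i j + P.W j l) := by
  have hK := C.K_ge
  have hwY : w ≤ P.n := by
    refine le_trans ?_ C.Y_le
    rw [← hmw]; exact Nat.le_mul_of_pos_left w hm
  refine Runs.forStep hK (by norm_num) (by norm_num) (by decide) (N := P.n) (σ := w) hw
    (fun b s' τ => Adv μ P.n P.W T (P.rowTime u q m w) 16 s s' (b * P.n) (b * (P.n + 1))
        (b * P.blockTime R p u + 8) τ ∧ s'.reg 16 = b * w ∧ b ≤ P.parts w ∧
      (s'.reg 26 ≤ T → ∀ i < P.n, ∀ j < P.n, ∀ l < P.n, j₀ ≤ j → j < j₀ + m → l < b * w →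
        s'.arr 5 (i * P.n + l) ≤ P.W i j + P.W j l)) ?_ ?_ hbd ?_ ?_
  · rintro b s' τ ⟨H, h16, -⟩
    exact ⟨h16, by rw [H.regs 0 (by norm_num)]; exact hs.r0, H.bounded⟩
  · rintro b hb s' τ ⟨H, h16, -, hcov⟩
    have hr : P.Shape m w T s' := hs.congr (fun r hr => H.regs r (by omega))
      (H.arrs 4 (by norm_num) (by norm_num)) (H.arrs 6 (by norm_num) (by norm_num))
    have g15 : s'.reg 15 = j₀ := by rw [H.regs 15 (by norm_num)]; exact h15
    have hlt := lt_parts hw hb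
    have hph := H.phase
    have hb1 : (b + 1) * (P.n + 1) ≤ P.parts w * (P.n + 1) := Nat.mul_le_mul_right _ hlt
    have hb1' : (b : ℤ) * (P.n + 1) + (P.n + 1) ≤ (P.parts w * (P.n + 1) : ℕ) := by
      rw [add_mul] at hb1
      have h2 : b * (P.n + 1) + (P.n + 1) ≤ P.parts w * (P.n + 1) := by omega
      exact_mod_cast h2
    push_cast at hph
    refine (runs_block_rows (C.job m w j₀ (b * w) hm hw hmw) hj₀
      (hr.jobRegs g15 (by rw [h16]; push_cast; ring)) hr.r13 H.bounded H.stamps (H.refines.mem h5)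
      (h0.trans H.mono) H.clock hT (by change s'.reg 25 + ((P.n : ℤ) + 1) ≤ _; linarith)
      C.prep_le).mono ?_
    rintro s2 t2 ⟨A, hcov2⟩
    change Adv μ P.n P.W T (P.rowTime u q m w) 17 s' s2 P.n (P.n + 1) (P.blockTime R p u) (t2 + 15)
      at A
    have bz : |((b + 1 : ℕ) : ℤ) * w| ≤ μ.Z := by
      have h1 : (b + 1) * w ≤ 2 * (P.n * P.n) := by
        have := Nat.le_mul_of_pos_left P.n C.n_pos
        rw [add_mul]; omega
      have h2 : (((b + 1) * w : ℕ) : ℤ) ≤ μ.Z := by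
        refine le_trans ?_ C.n_le
        exact_mod_cast h1
      exact_mod_cast abs_natCast_le h2
    refine ⟨by rw [A.regs 16 (by norm_num)]; exact h16, ?_, A.bounded, ?_, by simp, hlt, ?_⟩
    · rw [Term.eval_reg, A.regs 10 (by norm_num)]; exact hr.r10
    · have c1 : (Term.reg 10).cost = 2 := rfl
      have B := H.trans (A.weaken (show 16 ≤ 17 by norm_num) le_rfl le_rfl)
      rw [c1]
      have e1 : (b + 1) * P.n = b * P.n + P.n := by ring
      rw [e1]
      exact (B.weaken le_rfl (by rw [add_mul]; omega) (by rw [add_mul]; omega)).setReg le_rfl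
        (by norm_num) (by norm_num) (by norm_num) bz
    · intro h i hi j hj l hl hj1 hj2 hlb
      simp only [State.setReg_reg, show (26 = 16) = False by simp, if_false] at h
      rw [State.setReg_arr]
      by_cases hl' : l < b * w
      · refine ((A.refines _).1).trans (hcov (A.mono.trans h) i hi j hj l hl hj1 hj2 hl')
      · have := hcov2 h i hi (j - j₀) (by change _ < m; omega)
          (by change j₀ + (j - j₀) < P.n; omega) (l - b * w)
          (by change _ < w; rw [add_mul] at hlb; omega)
          (by change b * w + (l - b * w) < P.n; omega)
        change s2.arr 5 ((i : ℤ) * P.n + (b * w + (l - b * w) : ℕ)) ≤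
          P.W i (j₀ + (j - j₀)) + P.W (j₀ + (j - j₀)) (b * w + (l - b * w)) at this
        rwa [show b * w + (l - b * w) = l by omega, show j₀ + (j - j₀) = j by omega] at this
  · refine ⟨?_, by simp, Nat.zero_le _, fun _ i _ j _ l _ _ _ hl => absurd hl (by omega)⟩
    simp only [zero_mul, zero_add]
    exact (Adv.refl hbd hst h26 8).setReg le_rfl (by norm_num) (by norm_num) (by norm_num)
      (by simp; linarith [μ.two_le])
  · rintro b s' τ hN ⟨H, -, hb, hcov⟩
    exact ⟨(H.le (Nat.mul_le_mul_right _ hb) (Nat.mul_le_mul_right _ hb)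
      (Nat.add_le_add_right (Nat.mul_le_mul_right _ hb) 8)).weaken le_rfl le_rfl (by omega),
      fun h i hi j hj l hl h1 h2 => hcov h i hi j hj l hl h1 h2 (by omega)⟩

end Prob

/-! ### The search for a good shape of the blocks -/

section programs

open Term

/-- Compute the product. All the shapes of the blocks are tried, with increasing time limits. -/
def productCode (D : DynAlg) (k : UpdateKind) (R : ℕ) : Cmd :=
  .seq (.set 13 (lit 1)) (.seq (.set 14 (lit 1)) (.whileDo (reg 14)
    (.seq (.set 13 (lit 2 * reg 13)) (.seq (.set 9 (lit 1)) (.whileDo (less (reg 9) (reg 3 + lit 1))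
      (.seq (.iff (reg 14) (attemptCode D k R) .skip) (.set 9 (lit 2 * reg 9))))))))

end programs

/-- The array contains the `(min, +)` product of `W` with itself, where numbers larger than `X` are
replaced by `X`. -/
def IsProduct (n X : ℕ) (W : ℕ → ℕ → ℕ) (f : ℤ → ℤ) : Prop :=
  ∀ i < n, ∀ l < n, (∀ j < n, f (i * n + l) ≤ W i j + W j l) ∧
    (f (i * n + l) = X ∨ ∃ j < n, f (i * n + l) = W i j + W j l)

/-- The hypothesis on `e` does not allow it to depend on the array that is being written. Addresses
outside the matrix keep their values, since invariants on array `5` refer to all addresses. -/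
theorem runs_map {μ : Machine} (hK : 20 ≤ μ.K) {k : ℕ} {e : Term} (hk : k < 10)
    (he : e.Fits = true) {n : ℕ} {s : State} (h0 : s.reg 0 = n) (hn : ((n * n : ℕ) : ℤ) ≤ μ.Z)
    (hbd : Bounded μ.Z s) {f : ℕ → ℤ} (hf : ∀ v < n * n, |f v| ≤ μ.Z)
    (hev : ∀ v < n * n, ∀ s' : State, s'.reg 28 = v →
      (∀ r, r ≠ 27 → r ≠ 28 → s'.reg r = s.reg r) → (∀ i ≠ k, s'.arr i = s.arr i) →
      e.eval s' = f v) :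
    Runs μ (mapCode k e) s fun s' t => (∀ v < n * n, s'.arr k v = f v) ∧
      (∀ a : ℤ, (∀ v < n * n, a ≠ (v : ℕ)) → s'.arr k a = s.arr k a) ∧
      (∀ r, r ≠ 27 → r ≠ 28 → s'.reg r = s.reg r) ∧
      (∀ i ≠ k, s'.arr i = s.arr i) ∧ Bounded μ.Z s' ∧ t ≤ n * n * (e.cost + 18) + 20 := by
  refine Runs.seq (Runs.assign hK (by decide) hbd ?_)
  have e27 : (Term.reg 0 * Term.reg 0).eval s = (n * n : ℕ) := by simp [h0]
  rw [e27]
  have b27 := hbd.setReg 27 (abs_natCast_le hn)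
  have c1 : (Term.reg 0 * Term.reg 0).cost = 5 := rfl
  refine Runs.forTo hK (by norm_num) (by norm_num) (N := n * n) (fun v s' τ =>
    s'.reg 28 = v ∧ (∀ v' < v, s'.arr k v' = f v') ∧
    (∀ a : ℤ, (∀ v < n * n, a ≠ (v : ℕ)) → s'.arr k a = s.arr k a) ∧
    (∀ r, r ≠ 28 → s'.reg r = (s.setReg 27 (n * n : ℕ)).reg r) ∧
    (∀ i ≠ k, s'.arr i = s.arr i) ∧ Bounded μ.Z s' ∧ τ ≤ v * (e.cost + 18) + 8) ?_ ?_ b27 ?_ ?_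
  · rintro v s' τ ⟨h1, h2, h3, h4, h5, h6, h7⟩
    exact ⟨h1, by rw [h4 27 (by norm_num)]; simp, h6⟩
  · rintro v hv s' τ ⟨h1, h2, h3, h4, h5, h6, h7⟩
    refine Runs.write hK (by decide) he h6 ?_
    rw [hev v hv s' h1 (fun r h27 h28 => by
      rw [h4 r h28, State.setReg_reg, if_neg h27]) h5, Term.eval_reg, h1]
    have bv : |((v + 1 : ℕ) : ℤ)| ≤ μ.Z := abs_natCast_le (by omega)
    refine ⟨h1, h6.setArr _ _ (hf v hv), by simp, fun v' hv' => ?_, fun a ha => ?_,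
      fun r hr => ?_, fun i hi => ?_, (h6.setArr _ _ (hf v hv)).setReg _ bv, ?_⟩
    · rw [State.setReg_arr, State.setArr_arr]
      rcases Nat.lt_succ_iff_lt_or_eq.1 hv' with hlt | rfl
      · rw [if_neg (fun h => by have := h.2; omega)]
        exact h2 v' hlt
      · simp
    · rw [State.setReg_arr, State.setArr_arr, if_neg (fun h => ha v hv h.2)]
      exact h3 a ha
    · rw [State.setReg_reg, if_neg hr]; exact h4 r hr
    · funext a
      rw [State.setReg_arr, State.setArr_arr, if_neg (fun h => hi h.1), h5 i hi]
    · have c1 : (Term.reg 28).cost = 2 := rfl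
      rw [c1, add_mul]
      omega
  · exact ⟨by simp, fun v' hv' => absurd hv' (by omega), fun _ _ => rfl, fun r hr => by
      rw [State.setReg_reg, if_neg hr], fun _ _ => rfl,
      b27.setReg _ (by simp; linarith [μ.two_le]), by simp⟩
  · rintro s' τ ⟨h1, h2, h3, h4, h5, h6, h7⟩
    refine ⟨h2, h3, fun r h27 h28 => ?_, h5, h6, by rw [c1]; omega⟩
    rw [h4 r h28, State.setReg_reg, if_neg h27]

namespace Prob

variable {P : Prob} {μ : Machine} {D : DynAlg} {k : UpdateKind} {d R p u q m w T : ℕ}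

theorem runs_grid (C : P.Ctx μ D k d R p u q) (hm : 1 ≤ m) (hw : 1 ≤ w) (hmw : m * w = P.Y)
    {s : State} (hs : P.Shape m w T s)
    (hbd : Bounded μ.Z s) (hst : Stamps μ.Z s)
    (h5 : ∀ a, 0 ≤ s.arr 5 a ∧ s.arr 5 a ≤ P.X)
    (h0 : 0 ≤ s.reg 26) (h26 : s.reg 26 ≤ T + P.rowTime u q m w)
    (hT : ((T + P.rowTime u q m w : ℕ) : ℤ) ≤ μ.Z)
    (h25 : s.reg 25 + (P.parts m * (P.parts w * (P.n + 1)) : ℕ) ≤ μ.Z) :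
    Runs μ (gridCode D k R) s fun s' t =>
      Adv μ P.n P.W T (P.rowTime u q m w) 15 s s' (P.parts m * (P.parts w * P.n))
        (P.parts m * (P.parts w * (P.n + 1)))
        (P.parts m * (P.parts w * P.blockTime R p u + 30) + 9) t ∧
      (s'.reg 26 ≤ T → ∀ i < P.n, ∀ j < P.n, ∀ l < P.n,
        s'.arr 5 (i * P.n + l) ≤ P.W i j + P.W j l) := by
  have hK := C.K_ge
  have hmY : m ≤ P.n := by
    refine le_trans ?_ C.Y_le
    rw [← hmw]; exact Nat.le_mul_of_pos_right m hw
  refine Runs.forStep hK (by norm_num) (by norm_num) (by decide) (N := P.n) (σ := m) hm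
    (fun a s' τ => Adv μ P.n P.W T (P.rowTime u q m w) 15 s s' (a * (P.parts w * P.n))
        (a * (P.parts w * (P.n + 1))) (a * (P.parts w * P.blockTime R p u + 30) + 8) τ ∧
      s'.reg 15 = a * m ∧ a ≤ P.parts m ∧
      (s'.reg 26 ≤ T → ∀ i < P.n, ∀ j < P.n, ∀ l < P.n, j < a * m →
        s'.arr 5 (i * P.n + l) ≤ P.W i j + P.W j l)) ?_ ?_ hbd ?_ ?_
  · rintro b s' τ ⟨H, h16, -⟩
    exact ⟨h16, by rw [H.regs 0 (by norm_num)]; exact hs.r0, H.bounded⟩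
  · rintro b hb s' τ ⟨H, h15, -, hcov⟩
    have hr : P.Shape m w T s' := hs.congr H.regs
      (H.arrs 4 (by norm_num) (by norm_num)) (H.arrs 6 (by norm_num) (by norm_num))
    have hlt := lt_parts hm hb
    have hph := H.phase
    have hb1' : (b : ℤ) * (P.parts w * (P.n + 1)) + (P.parts w * (P.n + 1)) ≤
        (P.parts m * (P.parts w * (P.n + 1)) : ℕ) := by
      have h2 : (b + 1) * (P.parts w * (P.n + 1)) ≤ P.parts m * (P.parts w * (P.n + 1)) :=
        Nat.mul_le_mul_right _ hlt
      rw [add_mul, one_mul] at h2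
      exact_mod_cast h2
    push_cast at hph
    refine (runs_strip C hm hw hmw (j₀ := b * m) hb hr (by rw [h15]; push_cast; ring)
      H.bounded H.stamps (H.refines.mem h5)
      (h0.trans H.mono) H.clock hT (by push_cast at hb1' h25 ⊢; linarith)).mono ?_
    rintro s2 t2 ⟨A, hcov2⟩
    have bz : |((b + 1 : ℕ) : ℤ) * m| ≤ μ.Z := by
      have h1 : (b + 1) * m ≤ 2 * (P.n * P.n) := by
        have := Nat.le_mul_of_pos_left P.n C.n_pos
        rw [add_mul]; omega
      have h2 : (((b + 1) * m : ℕ) : ℤ) ≤ μ.Z := by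
        refine le_trans ?_ C.n_le
        exact_mod_cast h1
      exact_mod_cast abs_natCast_le h2
    refine ⟨by rw [A.regs 15 (by norm_num)]; exact h15, ?_, A.bounded, ?_, by simp, hlt, ?_⟩
    · rw [Term.eval_reg, A.regs 9 (by norm_num)]; exact hr.r9
    · have c1 : (Term.reg 9).cost = 2 := rfl
      have B := H.trans (A.weaken (ℓ' := 15) (show 15 ≤ 16 by norm_num) le_rfl le_rfl)
      rw [c1]
      have e1 : (b + 1) * (P.parts w * P.n) = b * (P.parts w * P.n) + P.parts w * P.n := by ring
      rw [e1]
      exact (B.weaken le_rfl (by rw [add_mul, one_mul])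
        (by rw [add_mul, one_mul]; omega)).setReg le_rfl
        (by norm_num) (by norm_num) (by norm_num) bz
    · intro h i hi j hj l hl hjb
      simp only [State.setReg_reg, show (26 = 15) = False by simp, if_false] at h
      rw [State.setReg_arr]
      by_cases hl' : j < b * m
      · exact ((A.refines _).1).trans (hcov (A.mono.trans h) i hi j hj l hl hl')
      · exact hcov2 h i hi j hj l hl (by omega) (by rw [add_mul] at hjb; omega)
  · refine ⟨?_, by simp, Nat.zero_le _, fun _ i _ j _ l _ hl => absurd hl (by omega)⟩
    simp only [zero_mul, zero_add]
    exact (Adv.refl hbd hst h26 8).setReg le_rfl (by norm_num) (by norm_num) (by norm_num)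
      (by simp; linarith [μ.two_le])
  · rintro b s' τ hN ⟨H, -, hb, hcov⟩
    exact ⟨(H.le (Nat.mul_le_mul_right _ hb) (Nat.mul_le_mul_right _ hb)
      (Nat.add_le_add_right (Nat.mul_le_mul_right _ hb) 8)).weaken le_rfl le_rfl (by omega),
      fun h i hi j hj l hl => hcov h i hi j hj l hl (by omega)⟩

theorem runs_fill (C : P.Ctx μ D k d R p u q) {s : State} (hs : P.Regs s) (hbd : Bounded μ.Z s)
    (h5 : ∀ a, 0 ≤ s.arr 5 a ∧ s.arr 5 a ≤ P.X) :
    Runs μ (mapCode 5 (.reg 1)) s fun s' t => (∀ v < P.n * P.n, s'.arr 5 v = P.X) ∧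
      (∀ a, 0 ≤ s'.arr 5 a ∧ s'.arr 5 a ≤ P.X) ∧ (∀ r, r ≠ 27 → r ≠ 28 → s'.reg r = s.reg r) ∧
      (∀ i ≠ 5, s'.arr i = s.arr i) ∧ Bounded μ.Z s' ∧ t ≤ P.n * P.n * 20 + 20 := by
  have hn2 : ((P.n * P.n : ℕ) : ℤ) ≤ μ.Z := by
    have := C.n_le
    push_cast
    nlinarith [Int.natCast_nonneg P.n]
  refine (runs_map C.K_ge (by norm_num) (by decide) hs.r0 hn2 hbd (f := fun _ => P.X)
    (fun _ _ => abs_natCast_le C.X_le) fun v _ s' _ hr _ => ?_).mono ?_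
  · rw [Term.eval_reg, hr 1 (by norm_num) (by norm_num), hs.r1]
  · rintro s' t ⟨h1, h2, h3, h4, h5', h6⟩
    refine ⟨h1, fun a => ?_, h3, h4, h5', h6.trans (by simp [Term.cost])⟩
    by_cases ha : ∃ v < P.n * P.n, a = (v : ℕ)
    · obtain ⟨v, hv, rfl⟩ := ha
      rw [h1 v hv]; exact ⟨by positivity, le_rfl⟩
    · rw [h2 a fun v hv e => ha ⟨v, hv, e⟩]
      exact h5 a

/-- A bound for the number of blocks. -/
def numBlocks (P : Prob) : ℕ := 4 * (P.n * P.n) / P.Y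

/-- Since `m` and `w` are at most `n`, rounding up loses at most a factor of 2 in each direction. -/
theorem parts_mul_parts_le (hYn : P.Y ≤ P.n) (hm : 1 ≤ m) (hw : 1 ≤ w)
    (hmw : m * w = P.Y) : P.parts m * P.parts w ≤ P.numBlocks := by
  have hY : 0 < P.Y := by rw [← hmw]; positivity
  have hwY : w ≤ P.n := by
    refine le_trans ?_ hYn
    rw [← hmw]; exact Nat.le_mul_of_pos_left w hm
  have hmY : m ≤ P.n := by
    refine le_trans ?_ hYn
    rw [← hmw]; exact Nat.le_mul_of_pos_right m hw
  have h1 : P.parts m * m ≤ 2 * P.n := by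
    unfold parts
    have := Nat.div_mul_le_self P.n m
    rw [add_mul]; omega
  have h2 : P.parts w * w ≤ 2 * P.n := by
    unfold parts
    have := Nat.div_mul_le_self P.n w
    rw [add_mul]; omega
  unfold numBlocks
  rw [Nat.le_div_iff_mul_le hY, ← hmw]
  calc P.parts m * P.parts w * (m * w) = (P.parts m * m) * (P.parts w * w) := by ring
    _ ≤ (2 * P.n) * (2 * P.n) := Nat.mul_le_mul h1 h2
    _ = _ := by ring

/-- A bound for the time to process a row, for all shapes of blocks. -/
def maxRowTime (P : Prob) (u q : ℕ) : ℕ := P.n * (P.L * (u + 1) + 1) + P.n * (q + 1)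

theorem rowTime_le (hYn : P.Y ≤ P.n) (hm : 1 ≤ m) (hw : 1 ≤ w)
    (hmw : m * w = P.Y) : P.rowTime u q m w ≤ P.maxRowTime u q := by
  have hwY : w ≤ P.n := by
    refine le_trans ?_ hYn
    rw [← hmw]; exact Nat.le_mul_of_pos_left w hm
  have hmY : m ≤ P.n := by
    refine le_trans ?_ hYn
    rw [← hmw]; exact Nat.le_mul_of_pos_right m hw
  exact Nat.add_le_add (Nat.mul_le_mul_right _ hmY) (Nat.mul_le_mul_right _ hwY)

/-- A bound for the time of an attempt with time limit `T`. -/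
def attemptTime (P : Prob) (R p u q T : ℕ) : ℕ :=
  200 * (T + P.maxRowTime u q) + P.numBlocks * (P.blockTime R p u + 30) + P.n * P.n * 20 + 100

/-- The effect of some attempts. -/
structure Race (P : Prob) (μ : Machine) (Φ : ℕ) (s s' : State) : Prop where
  regs : ∀ r < 9, s'.reg r = s.reg r
  arrs : ∀ i < 10, i ≠ 5 → s'.arr i = s.arr i
  bounded : Bounded μ.Z s'
  stamps : Stamps μ.Z s'
  phase : s'.reg 25 ≤ s.reg 25 + Φ
  mem : ∀ a, 0 ≤ s'.arr 5 a ∧ s'.arr 5 a ≤ P.X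
  result : s'.reg 14 = 1 ∨ (s'.reg 14 = 0 ∧ IsProduct P.n P.X P.W (s'.arr 5))

/-- The effect of an attempt. -/
structure Attempt (P : Prob) (μ : Machine) (Φ : ℕ) (s s' : State) : Prop
    extends P.Race μ Φ s s' where
  r9 : s'.reg 9 = s.reg 9
  r13 : s'.reg 13 = s.reg 13

/-- The product array is refilled with `X` and the clock is reset, so abandoned attempts leave no
trace in the result. Success is recorded only if the clock is still within the limit, that is, if
everything has been covered. -/
theorem runs_attempt (C : P.Ctx μ D k d R p u q) (hm : 1 ≤ m) (hw : 1 ≤ w) (hmw : m * w = P.Y)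
    {s : State} (hs : P.Regs s) (h9 : s.reg 9 = m) (h13 : s.reg 13 = T) (h14 : s.reg 14 = 1)
    (hbd : Bounded μ.Z s) (hst : Stamps μ.Z s)
    (h5 : ∀ a, 0 ≤ s.arr 5 a ∧ s.arr 5 a ≤ P.X)
    (hT : ((T + P.maxRowTime u q : ℕ) : ℤ) ≤ μ.Z)
    (h25 : s.reg 25 + (P.numBlocks * (P.n + 1) : ℕ) ≤ μ.Z) :
    Runs μ (attemptCode D k R) s fun s' t => P.Attempt μ (P.numBlocks * (P.n + 1)) s s' ∧
      (P.parts m * (P.parts w * P.n) * P.rowTime u q m w ≤ T → s'.reg 14 = 0) ∧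
      t ≤ P.attemptTime R p u q T := by
  have hK := C.K_ge
  have hZ := μ.two_le
  have hrow := rowTime_le (u := u) (q := q) C.Y_le hm hw hmw
  have hpart := parts_mul_parts_le C.Y_le hm hw hmw
  have hJ := C.job m w 0 0 hm hw hmw
  refine Runs.seq (Runs.assign hK (by decide) hbd ?_)
  have e10 : (Term.reg 3 / Term.reg 9).eval s = w := by
    simp only [Term.eval_div, Term.eval_reg, hs.r3, h9, ← hmw]
    rw [Nat.cast_mul, Int.mul_ediv_cancel_left]
    omega
  rw [e10]
  have hcols : 2 * w + P.L + 3 ≤ P.N := by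
    have h1 := hJ.valid.size
    change 2 * m * (2 * w + P.L + 3) ≤ P.N at h1
    refine le_trans ?_ h1
    exact Nat.le_mul_of_pos_left _ (by omega)
  have hNZ : (P.N : ℤ) ≤ μ.Z := hJ.N_le
  have b10 := hbd.setReg 10 (abs_natCast_le (show (w : ℤ) ≤ μ.Z by omega))
  refine Runs.seq (Runs.assign hK (by decide) b10 ?_)
  have e12 : (Term.lit 2 * Term.reg 10 + Term.reg 4 + (Term.lit 1 + Term.lit 2)).eval
      (s.setReg 10 w) = (2 * w + P.L + 3 : ℕ) := by
    simp [hs.r4]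
  rw [e12]
  have b12 := b10.setReg 12 (abs_natCast_le (show ((2 * w + P.L + 3 : ℕ) : ℤ) ≤ μ.Z by omega))
  have hs12 : P.Regs ((s.setReg 10 w).setReg 12 (2 * w + P.L + 3 : ℕ)) :=
    hs.congr (fun r hr => by simp [show r ≠ 12 by omega, show r ≠ 10 by omega]) rfl rfl
  refine Runs.seq ((runs_fill C hs12 b12 h5).mono ?_)
  rintro s2 t2 ⟨f1, f2, f3, f4, f5, f6⟩
  refine Runs.seq (Runs.assign hK (by decide) f5 ?_)
  rw [Term.eval_lit]
  set s3 := s2.setReg 26 0 with hs3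
  have g3 : ∀ r, r ≠ 27 → r ≠ 28 → r ≠ 26 → r ≠ 10 → r ≠ 12 → s3.reg r = s.reg r := by
    intro r h1 h2 h3 h4 h5
    rw [hs3, State.setReg_reg, if_neg h3, f3 r h1 h2]
    simp [h4, h5]
  have b3 : Bounded μ.Z s3 := f5.setReg 26 (by simp; linarith)
  have hsh : P.Shape m w T s3 := by
    refine ⟨hs.congr (fun r hr => g3 r (by omega) (by omega) (by omega) (by omega) (by omega))
      (f4 4 (by norm_num)) (f4 6 (by norm_num)), ?_, ?_, ?_, ?_⟩
    · rw [g3 9 (by norm_num) (by norm_num) (by norm_num) (by norm_num) (by norm_num)]; exact h9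
    · rw [hs3, State.setReg_reg, if_neg (by norm_num), f3 10 (by norm_num) (by norm_num)]; simp
    · rw [hs3, State.setReg_reg, if_neg (by norm_num), f3 12 (by norm_num) (by norm_num)]; simp
    · rw [g3 13 (by norm_num) (by norm_num) (by norm_num) (by norm_num) (by norm_num)]; exact h13
  have hst3 : Stamps μ.Z s3 := by
    refine hst.congr ?_ ?_ fun i hi => ?_
    · exact g3 24 (by norm_num) (by norm_num) (by norm_num) (by norm_num) (by norm_num)
    · exact g3 25 (by norm_num) (by norm_num) (by norm_num) (by norm_num) (by norm_num)
    · exact f4 i (by omega)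
  have g25 : s3.reg 25 = s.reg 25 :=
    g3 25 (by norm_num) (by norm_num) (by norm_num) (by norm_num) (by norm_num)
  have g26 : s3.reg 26 = 0 := by simp [hs3]
  have hT' : ((T + P.rowTime u q m w : ℕ) : ℤ) ≤ μ.Z := by
    refine le_trans ?_ hT
    exact_mod_cast Nat.add_le_add_left hrow T
  have hph : P.parts m * (P.parts w * (P.n + 1)) ≤ P.numBlocks * (P.n + 1) := by
    rw [← mul_assoc]; exact Nat.mul_le_mul_right _ hpart
  have hph' : ((P.parts m * (P.parts w * (P.n + 1)) : ℕ) : ℤ) ≤ (P.numBlocks * (P.n + 1) : ℕ) := by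
    exact_mod_cast hph
  refine Runs.seq ((runs_grid C hm hw hmw hsh b3 hst3 f2 g26.ge (by rw [g26]; positivity) hT'
    (by rw [g25]; linarith)).mono ?_)
  rintro s4 t4 ⟨A, hcov⟩
  have c1 : (Term.reg 3 / Term.reg 9).cost = 5 := rfl
  have c2 : (Term.lit 2 * Term.reg 10 + Term.reg 4 + (Term.lit 1 + Term.lit 2)).cost = 11 := rfl
  have c3 : (Term.lit 0).cost = 1 := rfl
  have c4 : (Term.less (Term.reg 13) (Term.reg 26)).cost = 5 := rfl
  have r4 : ∀ r < 15, r ≠ 10 → r ≠ 12 → s4.reg r = s.reg r := fun r hr h1 h2 => by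
    rw [A.regs r hr, g3 r (by omega) (by omega) (by omega) h1 h2]
  have hmem := A.refines.mem f2
  have htime : t4 ≤ 200 * (T + P.maxRowTime u q) + P.numBlocks * (P.blockTime R p u + 30) + 9 := by
    have h1 := A.time
    have h2 := A.clock
    rw [g26] at h1
    have h3 : (t4 : ℤ) ≤ 200 * (T + P.rowTime u q m w) +
        (P.parts m * (P.parts w * P.blockTime R p u + 30) + 9 : ℕ) := by linarith
    have h4 : t4 ≤ 200 * (T + P.rowTime u q m w) +
        (P.parts m * (P.parts w * P.blockTime R p u + 30) + 9) := by exact_mod_cast h3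
    have h5 : P.parts m * (P.parts w * P.blockTime R p u + 30) ≤
        P.numBlocks * (P.blockTime R p u + 30) := by
      refine le_trans ?_ (Nat.mul_le_mul_right _ hpart)
      rw [mul_assoc]
      refine Nat.mul_le_mul_left _ ?_
      have : 1 ≤ P.parts w := Nat.le_add_left 1 _
      rw [mul_add]
      have : 30 ≤ P.parts w * 30 := Nat.le_mul_of_pos_left 30 this
      omega
    omega
  have hres : ∀ v : ℤ, |v| ≤ μ.Z →
      (v = 1 ∨ (v = 0 ∧ IsProduct P.n P.X P.W (s4.arr 5))) → s4.reg 25 ≤ s.reg 25 + (P.numBlocks * (P.n + 1) : ℕ) →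
      P.Attempt μ (P.numBlocks * (P.n + 1)) s (s4.setReg 14 v) := by
    intro v hv hv' hph
    refine ⟨⟨fun r hr => ?_, fun i hi h5 => ?_, A.bounded.setReg 14 hv,
      A.stamps.setReg' _ (by norm_num) (by norm_num), by simpa using hph, hmem,
      by simpa using hv'⟩, ?_, ?_⟩
    · rw [State.setReg_reg, if_neg (by omega), r4 r (by omega) (by omega) (by omega)]
    · rw [State.setReg_arr, A.arrs i hi h5]; exact f4 i h5
    · rw [State.setReg_reg, if_neg (by omega), r4 9 (by omega) (by omega) (by omega)]
    · rw [State.setReg_reg, if_neg (by omega), r4 13 (by omega) (by omega) (by omega)]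
  have h25' : s4.reg 25 ≤ s.reg 25 + (P.numBlocks * (P.n + 1) : ℕ) := by
    have := A.phase
    rw [g25] at this
    linarith
  have g13 : s4.reg 13 = T := by rw [r4 13 (by norm_num) (by norm_num) (by norm_num)]; exact h13
  have g14 : s4.reg 14 = 1 := by rw [r4 14 (by norm_num) (by norm_num) (by norm_num)]; exact h14
  refine Runs.test hK (by decide) A.bounded (fun hne => Runs.skip ?_) (fun he => ?_)
  · have hgt : (T : ℤ) < s4.reg 26 := by
      by_contra hc
      apply hne
      simp [g13, hc]
    have hself : s4.setReg 14 1 = s4 := by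
      refine State.ext' ?_ rfl
      funext r
      rw [State.setReg_reg]
      split_ifs with h
      · rw [h, g14]
      · rfl
    refine ⟨?_, fun h => ?_, ?_⟩
    · rw [← hself]
      exact hres 1 (by simp; linarith) (Or.inl rfl) h25'
    -- Each processed row advances the clock by at most `rowTime`, so a limit for all the rows
    -- cannot have been exceeded.
    · exfalso
      have h1 := A.clock_rows
      rw [g26, zero_add] at h1
      have h2 : ((P.parts m * (P.parts w * P.n) * P.rowTime u q m w : ℕ) : ℤ) ≤ T := by
        exact_mod_cast h
      push_cast at h1 h2
      linarith
    · unfold attemptTime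
      rw [c1, c2, c3, c4]
      omega
  · have hle : s4.reg 26 ≤ T := by
      by_contra hc
      simp [g13, not_le.1 hc] at he
    refine Runs.assign hK (by decide) A.bounded ⟨hres 0 (by simp; linarith) (Or.inr ⟨rfl, ?_⟩) h25',
      fun _ => by simp, ?_⟩
    · intro i hi l hl
      refine ⟨fun j hj => hcov hle i hi j hj l hl, ?_⟩
      rcases (A.refines (i * P.n + l)).2 with h | ⟨i', hi', j, hj, l', hl', h1, h2⟩
      · left
        rw [h]
        have hlt : i * P.n + l < P.n * P.n := by
          have h1 : (i + 1) * P.n ≤ P.n * P.n := Nat.mul_le_mul_right _ hi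
          rw [add_mul] at h1
          omega
        have := f1 (i * P.n + l) hlt
        push_cast at this
        exact this
      · right
        have h1' : i * P.n + l = i' * P.n + l' := by exact_mod_cast h1
        have hn := C.n_pos
        have e1 : l = l' := by
          have := congrArg (· % P.n) h1'
          simpa [Nat.mul_add_mod_of_lt, Nat.mod_eq_of_lt hl, Nat.mod_eq_of_lt hl',
            Nat.add_mod, Nat.mul_mod_left] using this
        subst e1
        have e2 : i = i' := Nat.eq_of_mul_eq_mul_right hn (by omega)
        subst e2
        exact ⟨j, hj, h2⟩
    · unfold attemptTime
      rw [c1, c2, c3, c4]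
      omega

end Prob

namespace Prob

variable {P : Prob} {μ : Machine} {D : DynAlg} {k : UpdateKind} {d R p u q T ℓ : ℕ}

theorem Race.trans {Φ Φ' : ℕ} {s s' s'' : State} (h : P.Race μ Φ s s') (h' : P.Race μ Φ' s' s'') :
    P.Race μ (Φ + Φ') s s'' where
  regs r hr := (h'.regs r hr).trans (h.regs r hr)
  arrs i hi h5 := (h'.arrs i hi h5).trans (h.arrs i hi h5)
  bounded := h'.bounded
  stamps := h'.stamps
  phase := by
    have := h.phase; have := h'.phase
    push_cast; linarith
  mem := h'.mem
  result := h'.result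

theorem Race.setReg {Φ : ℕ} {s s' : State} (h : P.Race μ Φ s s') {r : ℕ} {v : ℤ} (hr : 9 ≤ r)
    (h14 : r ≠ 14) (h24 : r ≠ 24) (h25 : r ≠ 25) (hv : |v| ≤ μ.Z) :
    P.Race μ Φ s (s'.setReg r v) where
  regs r' hr' := by rw [State.setReg_reg, if_neg (by omega)]; exact h.regs r' hr'
  arrs := h.arrs
  bounded := h.bounded.setReg r hv
  stamps := h.stamps.setReg' v h24 h25
  phase := by simpa [h25.symm] using h.phase
  mem := h.mem
  result := by simpa [h14.symm] using h.result

theorem Race.le {Φ Φ' : ℕ} {s s' : State} (h : P.Race μ Φ s s') (hΦ : Φ ≤ Φ') :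
    P.Race μ Φ' s s' :=
  ⟨h.regs, h.arrs, h.bounded, h.stamps, h.phase.trans (by gcongr), h.mem, h.result⟩

theorem Race.problemRegs {Φ : ℕ} {s s' : State} (h : P.Race μ Φ s s') (hs : P.Regs s) : P.Regs s' :=
  hs.congr (fun r hr => h.regs r (by omega)) (h.arrs 4 (by norm_num) (by norm_num))
    (h.arrs 6 (by norm_num) (by norm_num))

/-- The time limit `T` is sufficient for blocks of height `2 ^ a`. -/
def Sufficient (P : Prob) (u q ℓ T a : ℕ) : Prop :=
  P.parts (2 ^ a) * (P.parts (2 ^ (ℓ - a)) * P.n) * P.rowTime u q (2 ^ a) (2 ^ (ℓ - a)) ≤ T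

/-- All the heights `2 ^ a` are tried with the same limit. After a success the flag in register `14`
makes the remaining rounds trivial, and the result is kept. -/
theorem runs_shapes (C : P.Ctx μ D k d R p u q) (hY : P.Y = 2 ^ ℓ) {s : State} (hs : P.Regs s)
    (h9 : s.reg 9 = 1) (h13 : s.reg 13 = T) (h14 : s.reg 14 = 1)
    (hbd : Bounded μ.Z s) (hst : Stamps μ.Z s)
    (h5 : ∀ a, 0 ≤ s.arr 5 a ∧ s.arr 5 a ≤ P.X)
    (hT : ((T + P.maxRowTime u q : ℕ) : ℤ) ≤ μ.Z)
    (h25 : s.reg 25 + ((ℓ + 1) * (P.numBlocks * (P.n + 1)) : ℕ) ≤ μ.Z) :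
    Runs μ (.whileDo (.less (.reg 9) (.reg 3 + .lit 1))
      (.seq (.iff (.reg 14) (attemptCode D k R) .skip) (.set 9 (.lit 2 * .reg 9)))) s fun s' t =>
      P.Race μ ((ℓ + 1) * (P.numBlocks * (P.n + 1))) s s' ∧ s'.reg 13 = T ∧
      (∀ a ≤ ℓ, P.Sufficient u q ℓ T a → s'.reg 14 = 0) ∧
      t ≤ (ℓ + 1) * (P.attemptTime R p u q T + 30) + 10 := by
  have hK := C.K_ge
  have hZ := μ.two_le
  set Φ := P.numBlocks * (P.n + 1) with hΦ
  have hev : ∀ (j : ℕ) (s' : State), s'.reg 9 = 2 ^ j → s'.reg 3 = P.Y →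
      ((Term.less (.reg 9) (.reg 3 + .lit 1)).eval s' = 0 ↔ ℓ < j) := by
    intro j s' h1 h2
    have h3 : ((2 : ℤ) ^ j < 2 ^ ℓ + 1) ↔ j ≤ ℓ := by
      rw [Int.lt_add_one_iff]
      exact pow_le_pow_iff_right₀ (by norm_num)
    by_cases h : j ≤ ℓ
    · simp [h1, h2, hY, h3, h]
    · simp [h1, h2, hY, h3, h, not_le.1 h]
  have c0 : (Term.less (.reg 9) (.reg 3 + .lit 1)).cost = 7 := rfl
  have c1 : (Term.reg 14).cost = 2 := rfl
  have c2 : (Term.lit 2 * Term.reg 9).cost = 4 := rfl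
  refine Runs.whileDo (Term.Fits.good (by decide) hK) (fun k s' τ => ∃ j, j + k = ℓ + 1 ∧
    P.Race μ (j * Φ) s s' ∧ s'.reg 9 = 2 ^ j ∧ s'.reg 13 = T ∧
    (∀ a < j, P.Sufficient u q ℓ T a → s'.reg 14 = 0) ∧
    τ ≤ j * (P.attemptTime R p u q T + 30) + 7) (ℓ + 1) ?_ ?_ ?_ ?_ ?_
  · rintro k s' τ ⟨j, -, H, -⟩
    exact Term.Fits.small (by decide) hZ H.bounded
  · rintro s' τ ⟨j, hj, H, h9, -⟩
    exact (hev j s' h9 ((H.regs 3 (by norm_num)).trans hs.r3)).2 (by omega)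
  · rintro k s' τ ⟨j, hj, H, g9, g13, hsuf, hτ⟩ hne
    have hr := H.problemRegs hs
    have hjℓ : j ≤ ℓ := by
      by_contra hc
      exact hne ((hev j s' g9 hr.r3).2 (by omega))
    have hz : ∀ s2 : State, s2.reg 9 = 2 ^ j →
        (Term.lit 2 * Term.reg 9).eval s2 = 2 ^ (j + 1) := by
      intro s2 h; simp [h, pow_succ]; ring
    have bz : |(2 : ℤ) ^ (j + 1)| ≤ μ.Z := by
      rw [abs_of_nonneg (by positivity)]
      have h1 : 2 ^ j ≤ P.n := by
        refine le_trans ?_ C.Y_le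
        rw [hY]; exact Nat.pow_le_pow_right (by norm_num) hjℓ
      have h2 : 2 * P.n ≤ 2 * (P.n * P.n) :=
        Nat.mul_le_mul_left 2 (Nat.le_mul_of_pos_left _ C.n_pos)
      have h3 : 2 ^ (j + 1) ≤ 2 * (P.n * P.n) := by rw [pow_succ]; omega
      refine le_trans ?_ C.n_le
      exact_mod_cast h3
    refine Runs.seq (Runs.test hK (by decide) H.bounded (fun h14' => ?_) (fun h14' => ?_))
    · have h14' : s'.reg 14 ≠ 0 := h14'
      have g14 : s'.reg 14 = 1 := H.result.resolve_right fun h => h14' h.1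
      have hph := H.phase
      have hle : ((j * Φ : ℕ) : ℤ) + Φ ≤ ((ℓ + 1) * Φ : ℕ) := by
        have : (j + 1) * Φ ≤ (ℓ + 1) * Φ := Nat.mul_le_mul_right _ (by omega)
        rw [add_mul, one_mul] at this
        exact_mod_cast this
      refine (runs_attempt C (m := 2 ^ j) (w := 2 ^ (ℓ - j)) Nat.one_le_two_pow Nat.one_le_two_pow
        (by rw [← pow_add, hY]; congr 1; omega) hr (by rw [g9]; simp) g13 g14 H.bounded H.stamps
        H.mem hT (by rw [← hΦ]; linarith)).mono ?_
      rintro s2 t2 ⟨A, hA, ht2⟩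
      refine Runs.assign hK (by decide) A.bounded ?_
      rw [hz s2 (A.r9.trans g9)]
      refine ⟨k, le_rfl, j + 1, by omega, ?_, by simp, by simpa using A.r13.trans g13, ?_, ?_⟩
      · have := H.trans A.toRace
        rw [← hΦ] at this
        rw [add_mul, one_mul]
        exact this.setReg (by norm_num) (by norm_num) (by norm_num) (by norm_num) bz
      · intro a ha h
        simp only [State.setReg_reg, show (14 = 9) = False by simp, if_false]
        rcases Nat.lt_succ_iff_lt_or_eq.1 ha with hlt | rfl
        · exact absurd (hsuf a hlt h) h14'
        · exact hA h
      · rw [c0, c1, c2, add_mul]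
        omega
    · have g14 : s'.reg 14 = 0 := h14'
      refine Runs.skip (Runs.assign hK (by decide) H.bounded ?_)
      rw [hz s' g9]
      refine ⟨k, le_rfl, j + 1, by omega, ?_, by simp, by simpa using g13, fun _ _ _ => by simpa using g14, ?_⟩
      · exact (H.setReg (by norm_num) (by norm_num) (by norm_num) (by norm_num) bz).le
          (Nat.mul_le_mul_right _ (by omega))
      · rw [c0, c1, c2, add_mul]
        omega
  · refine ⟨0, by omega, ⟨fun _ _ => rfl, fun _ _ _ => rfl, hbd, hst, by simp, h5, Or.inl h14⟩,
      by simpa using h9, h13, fun a ha => absurd ha (by omega), by rw [c0]; omega⟩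
  · rintro k s' τ ⟨j, hj, H, g9, g13, hsuf, hτ⟩ hz
    have hjℓ : ℓ < j := (hev j s' g9 ((H.regs 3 (by norm_num)).trans hs.r3)).1 hz
    have hj' : j = ℓ + 1 := by omega
    subst hj'
    exact ⟨H, g13, fun a ha => hsuf a (by omega), by omega⟩

theorem attemptTime_mono {T T' : ℕ} (h : T ≤ T') :
    P.attemptTime R p u q T ≤ P.attemptTime R p u q T' := by
  unfold attemptTime
  omega

/-- A bound for the time to compute the product. -/
def productTime (P : Prob) (R p u q ℓ e : ℕ) : ℕ :=
  e * ((ℓ + 1) * (P.attemptTime R p u q (2 ^ e) + 30) + 30) + 20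

/-- The program does not know the time bounds of the data structure, hence not the best shape
either. It suffices that some shape is good for the limit `2 ^ e`: the search ends at this limit at
the latest. Charging every limit like the last one costs a factor `e`, which is logarithmic. -/
theorem runs_product (C : P.Ctx μ D k d R p u q) (hY : P.Y = 2 ^ ℓ) {s : State} (hs : P.Regs s)
    {e a : ℕ} (he : 1 ≤ e) (ha : a ≤ ℓ) (hsuf : P.Sufficient u q ℓ (2 ^ e) a)
    (hbd : Bounded μ.Z s) (hst : Stamps μ.Z s)
    (h5 : ∀ a, 0 ≤ s.arr 5 a ∧ s.arr 5 a ≤ P.X)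
    (hT : ((2 ^ e + P.maxRowTime u q : ℕ) : ℤ) ≤ μ.Z)
    (h25 : s.reg 25 + (e * ((ℓ + 1) * (P.numBlocks * (P.n + 1))) : ℕ) ≤ μ.Z) :
    Runs μ (productCode D k R) s fun s' t =>
      P.Race μ (e * ((ℓ + 1) * (P.numBlocks * (P.n + 1)))) s s' ∧
      IsProduct P.n P.X P.W (s'.arr 5) ∧ t ≤ P.productTime R p u q ℓ e := by
  have hK := C.K_ge
  have hZ := μ.two_le
  set Φ := (ℓ + 1) * (P.numBlocks * (P.n + 1)) with hΦ
  have b1 : |(1 : ℤ)| ≤ μ.Z := by simp; linarith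
  have c1 : (Term.lit 1).cost = 1 := rfl
  have c2 : (Term.reg 14).cost = 2 := rfl
  have c3 : (Term.lit 2 * Term.reg 13).cost = 4 := rfl
  refine Runs.seq (Runs.assign hK (by decide) hbd ?_)
  rw [Term.eval_lit]
  refine Runs.seq (Runs.assign hK (by decide) (hbd.setReg _ b1) ?_)
  rw [Term.eval_lit]
  set τ₀ := (fun k : ℕ => k * ((ℓ + 1) * (P.attemptTime R p u q (2 ^ e) + 30) + 30)) with hτ₀
  refine Runs.whileDo (Term.Fits.good (by decide) hK) (fun k s' τ => ∃ j, j + k = e ∧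
    P.Race μ (j * Φ) s s' ∧ s'.reg 13 = 2 ^ j ∧ (j = e → s'.reg 14 = 0) ∧ τ ≤ τ₀ j + 2) e
    ?_ ?_ ?_ ?_ ?_
  · rintro k s' τ ⟨j, -, H, -⟩
    exact Term.Fits.small (by decide) hZ H.bounded
  · rintro s' τ ⟨j, hj, H, -, h, -⟩
    exact h (by omega)
  · rintro k s' τ ⟨j, hj, H, g13, hlast, hτ⟩ h14
    have h14 : s'.reg 14 ≠ 0 := h14
    have g14 : s'.reg 14 = 1 := H.result.resolve_right fun h => h14 h.1
    have hje : j + 1 ≤ e := by omega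
    have hpow : 2 ^ (j + 1) ≤ 2 ^ e := Nat.pow_le_pow_right (by norm_num) hje
    have hT' : ((2 ^ (j + 1) + P.maxRowTime u q : ℕ) : ℤ) ≤ μ.Z := by
      refine le_trans ?_ hT
      exact_mod_cast Nat.add_le_add_right hpow _
    have bz : |(2 : ℤ) ^ (j + 1)| ≤ μ.Z := by
      rw [abs_of_nonneg (by positivity)]
      push_cast at hT'
      have : (0 : ℤ) ≤ P.maxRowTime u q := by positivity
      linarith
    have e13 : (Term.lit 2 * Term.reg 13).eval s' = 2 ^ (j + 1) := by
      simp [g13, pow_succ]; ring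
    refine Runs.seq (Runs.assign hK (by decide) H.bounded ?_)
    rw [e13]
    have H1 := H.setReg (r := 13) (by norm_num) (by norm_num) (by norm_num) (by norm_num) bz
    refine Runs.seq (Runs.assign hK (by decide) H1.bounded ?_)
    rw [Term.eval_lit]
    have H2 := H1.setReg (r := 9) (by norm_num) (by norm_num) (by norm_num) (by norm_num) b1
    have hph := H.phase
    have hle : ((j * Φ : ℕ) : ℤ) + Φ ≤ (e * Φ : ℕ) := by
      have : (j + 1) * Φ ≤ e * Φ := Nat.mul_le_mul_right _ hje
      rw [add_mul, one_mul] at this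
      exact_mod_cast this
    refine (runs_shapes C hY (T := 2 ^ (j + 1)) (H2.problemRegs hs) (by simp) (by simp)
      (by simpa using g14) H2.bounded H2.stamps H2.mem hT' (by simp; linarith)).mono ?_
    rintro s2 t2 ⟨A, hA13, hA, ht2⟩
    refine ⟨k, le_rfl, j + 1, by omega, ?_, by rw [hA13]; simp, fun hj => ?_, ?_⟩
    · rw [add_mul, one_mul]
      exact H2.trans A
    · rw [hj] at hA
      exact hA a ha hsuf
    · have h1 := attemptTime_mono (P := P) (R := R) (p := p) (u := u) (q := q) hpow
      have h2 : (ℓ + 1) * (P.attemptTime R p u q (2 ^ (j + 1)) + 30) ≤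
        (ℓ + 1) * (P.attemptTime R p u q (2 ^ e) + 30) := Nat.mul_le_mul_left _ (by omega)
      have h3 : τ₀ (j + 1) = τ₀ j + ((ℓ + 1) * (P.attemptTime R p u q (2 ^ e) + 30) + 30) := by
        rw [hτ₀]; ring
      rw [c1, c2, c3]
      omega
  · refine ⟨0, by omega, ?_, by simp, fun h => absurd h (by omega), by rw [c2]; omega⟩
    refine ⟨fun r hr => ?_, fun _ _ _ => rfl, (hbd.setReg _ b1).setReg _ b1,
      (hst.setReg' _ (by norm_num) (by norm_num)).setReg' _ (by norm_num) (by norm_num), by simp,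
      h5, Or.inl (by simp)⟩
    rw [State.setReg_reg, if_neg (by omega), State.setReg_reg, if_neg (by omega)]
  · rintro k s' τ ⟨j, hj, H, g13, hlast, hτ⟩ hz
    have hz : s'.reg 14 = 0 := hz
    have h3 : τ₀ j ≤ τ₀ e := Nat.mul_le_mul_right _ (by omega)
    refine ⟨H.le (Nat.mul_le_mul_right _ (by omega)), ?_, ?_⟩
    · exact (H.result.resolve_left fun h => by rw [hz] at h; norm_num at h).2
    · rw [c1]
      unfold productTime
      change _ ≤ τ₀ e + 20
      omega

end Prob

/-! ### Shortest paths by repeated squaring -/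

namespace WGraph

variable {n : ℕ} {G : WGraph n}

/-- `G.Steps k i j x`: there is a walk from `i` to `j` with `k` edges of total weight `x`. -/
inductive Steps (G : WGraph n) : ℕ → Fin n → Fin n → ℤ → Prop
  | nil (i : Fin n) : Steps G 0 i i 0
  | cons {k : ℕ} {i j l : Fin n} {x y : ℤ} (h : G i j = some x) (w : Steps G k j l y) :
      Steps G (k + 1) i l (x + y)

theorem Steps.walk {k : ℕ} {i j : Fin n} {x : ℤ} (h : G.Steps k i j x) : G.Walk i j x := by
  induction h with
  | nil i => exact .nil i
  | cons h _ ih => exact .cons h ih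

theorem Walk.steps {i j : Fin n} {x : ℤ} (h : G.Walk i j x) : ∃ k, G.Steps k i j x := by
  induction h with
  | nil i => exact ⟨0, .nil i⟩
  | cons h _ ih => exact ⟨_, .cons h ih.choose_spec⟩

theorem Steps.trans {k k' : ℕ} {i j l : Fin n} {x y : ℤ} (h : G.Steps k i j x)
    (h' : G.Steps k' j l y) : G.Steps (k + k') i l (x + y) := by
  induction h with
  | nil i => simpa using h'
  | @cons k i j l x z h _ ih =>
    rw [show k + 1 + k' = k + k' + 1 by ring, add_assoc x]
    exact .cons h (ih h')

/-- Vertices and partial weights as sequences, which makes it possible to cut a walk at arbitrary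
positions. -/
theorem Steps.exists_path {k : ℕ} {i l : Fin n} {z : ℤ} (h : G.Steps k i l z) :
    ∃ (v : ℕ → Fin n) (f : ℕ → ℤ), v 0 = i ∧ v k = l ∧ f 0 = 0 ∧ f k = z ∧
      ∀ a b, a ≤ b → b ≤ k → G.Steps (b - a) (v a) (v b) (f b - f a) := by
  induction h with
  | nil i =>
    refine ⟨fun _ => i, fun _ => 0, rfl, rfl, rfl, rfl, fun a b hab hb => ?_⟩
    rw [show b - a = 0 by omega]
    exact .nil i
  | @cons k i j l x y h _ ih =>
    obtain ⟨v, f, rfl, rfl, f0, rfl, H⟩ := ih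
    refine ⟨fun a => a.casesOn i v, fun a => a.casesOn 0 fun a => x + f a, rfl, rfl, rfl, rfl,
      fun a b hab hb => ?_⟩
    rcases a with _ | a <;> rcases b with _ | b
    · exact .nil i
    · have := Steps.cons h (H 0 b (Nat.zero_le _) (by omega))
      simpa [f0] using this
    · omega
    · have := H a b (by omega) (by omega)
      rw [show b + 1 - (a + 1) = b - a by omega]
      simpa using this

theorem Steps.split {a b : ℕ} {i l : Fin n} {z : ℤ} (h : G.Steps (a + b) i l z) :
    ∃ j x y, G.Steps a i j x ∧ G.Steps b j l y ∧ x + y = z := by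
  obtain ⟨v, f, rfl, rfl, f0, rfl, H⟩ := h.exists_path
  refine ⟨v a, f a, f (a + b) - f a, ?_, ?_, by ring⟩
  · simpa [f0] using H 0 a (Nat.zero_le _) (by omega)
  · simpa using H a (a + b) (by omega) le_rfl

theorem Steps.abs_le {B : ℤ} (hB : ∀ i j x, G i j = some x → |x| ≤ B) {k : ℕ} {i j : Fin n} {x : ℤ}
    (h : G.Steps k i j x) : |x| ≤ k * B := by
  induction h with
  | nil i => simp
  | cons h _ ih =>
    refine (abs_add_le _ _).trans ?_
    have := hB _ _ _ h
    push_cast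
    linarith

/-- Pigeonhole: among the first `n + 1` vertices of a longer walk one occurs twice. The closed walk
in between has nonnegative weight and can be removed. -/
theorem Steps.shorten (hG : ∀ i x, G.Walk i i x → 0 ≤ x) {k : ℕ} {i j : Fin n} {x : ℤ}
    (h : G.Steps k i j x) : ∃ k' ≤ n, ∃ y ≤ x, G.Steps k' i j y := by
  induction k using Nat.strong_induction_on generalizing x with
  | _ k ih =>
  by_cases hk : k ≤ n
  · exact ⟨k, hk, x, le_rfl, h⟩
  obtain ⟨v, f, rfl, rfl, f0, rfl, H⟩ := h.exists_path
  obtain ⟨a, b, hab, hv⟩ : ∃ a b : Fin (n + 1), a < b ∧ v a = v b := by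
    obtain ⟨a, b, hne, hv⟩ := Fintype.exists_ne_map_eq_of_card_lt
      (fun a : Fin (n + 1) => v a) (by simp)
    rcases lt_or_gt_of_ne hne with h | h
    · exact ⟨a, b, h, hv⟩
    · exact ⟨b, a, h, hv.symm⟩
  have hab' : (a : ℕ) < b := hab
  have hb := b.2
  have h1 := H 0 a (Nat.zero_le _) (by omega)
  have h2 := H a b (by omega) (by omega)
  have h3 := H b k (by omega) le_rfl
  rw [hv] at h1 h2
  have h4 := hG _ _ h2.walk
  obtain ⟨k', hk', y, hy, hS⟩ := ih _ (by omega) (h1.trans h3)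
  exact ⟨k', hk', y, by linarith, hS⟩

/-- The array contains the minimal weights of the walks with at most `len` edges, increased
by `E`; and `4 * E + 1` if there is no such walk. -/
def Dists (G : WGraph n) (E len : ℕ) (f : ℤ → ℤ) : Prop :=
  ∀ i j : Fin n, (∀ k ≤ len, ∀ x, G.Steps k i j x → f ((i : ℕ) * n + (j : ℕ)) ≤ x + E) ∧
    (f ((i : ℕ) * n + (j : ℕ)) = 4 * E + 1 ∨
      ∃ k ≤ len, ∃ x, G.Steps k i j x ∧ f ((i : ℕ) * n + (j : ℕ)) = x + E)

variable {E B len : ℕ} {f : ℤ → ℤ}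

theorem Steps.abs_le' (hB : ∀ i j x, G i j = some x → |x| ≤ (B : ℤ)) {k : ℕ} {i j : Fin n} {x : ℤ}
    (h : G.Steps k i j x) (hE : len * B ≤ E) (hk : k ≤ len) : |x| ≤ E := by
  refine (h.abs_le hB).trans ?_
  have : k * B ≤ E := (Nat.mul_le_mul_right B hk).trans hE
  exact_mod_cast this

theorem Dists.mem (h : G.Dists E len f) (hB : ∀ i j x, G i j = some x → |x| ≤ (B : ℤ))
    (hE : len * B ≤ E) (i j : Fin n) :
    0 ≤ f ((i : ℕ) * n + (j : ℕ)) ∧ f ((i : ℕ) * n + (j : ℕ)) ≤ 4 * E + 1 := by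
  rcases (h i j).2 with h | ⟨k, hk, x, hx, h⟩
  · rw [h]; exact ⟨by positivity, le_rfl⟩
  · have := abs_le.1 (hx.abs_le' hB hE hk)
    rw [h]; constructor <;> linarith

/-- A walk with at most `2 * len` edges splits into two halves. Finite entries carry the shift `E`,
so sums carry `2 * E`, and one `E` is subtracted again. Genuine sums stay at most `3 * E`, below the
value `4 * E + 1` for infinity, so truncation does no harm. -/
theorem Dists.square {W : ℕ → ℕ → ℕ} {g : ℤ → ℤ} (h : G.Dists E len f)
    (hB : ∀ i j x, G i j = some x → |x| ≤ (B : ℤ)) (hE : (2 * len) * B ≤ E)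
    (hW : ∀ i j : Fin n, (W i j : ℤ) = f ((i : ℕ) * n + (j : ℕ)))
    (hP : IsProduct n (4 * E + 1) W g) {f' : ℤ → ℤ}
    (hf' : ∀ i j : Fin n, f' ((i : ℕ) * n + (j : ℕ)) =
      if g ((i : ℕ) * n + (j : ℕ)) < 4 * E + 1 then g ((i : ℕ) * n + (j : ℕ)) - E
      else 4 * E + 1) : G.Dists E (2 * len) f' := by
  have hE' : len * B ≤ E := (Nat.mul_le_mul_right B (by omega)).trans hE
  intro i l
  obtain ⟨h1, h2⟩ := hP i i.2 l l.2
  rw [hf']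
  refine ⟨fun k hk z hz => ?_, ?_⟩
  · have hz' := abs_le.1 (hz.abs_le' hB hE hk)
    obtain ⟨a, b, rfl, ha, hb⟩ : ∃ a b, a + b = k ∧ a ≤ len ∧ b ≤ len :=
      ⟨min k len, k - min k len, by omega, by omega, by omega⟩
    obtain ⟨j, x, y, hx, hy, rfl⟩ := hz.split
    have h3 := h1 j j.2
    rw [hW, hW] at h3
    have h4 := (h i j).1 a ha x hx
    have h5 := (h j l).1 b hb y hy
    rw [if_pos (by linarith)]
    linarith
  · split_ifs with hlt
    · right
      rcases h2 with h2 | ⟨j, hj, h2⟩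
      · rw [h2] at hlt; push_cast at hlt; linarith
      · lift j to Fin n using hj
        rw [hW, hW] at h2
        -- Both entries are nonnegative, so an infinite one would already make the sum at least `4 *
        -- E + 1`.
        have m1 := (h.mem hB hE' i j).1
        have m2 := (h.mem hB hE' j l).1
        obtain ⟨k, hk, x, hx, e1⟩ := (h i j).2.resolve_left fun e => by linarith
        obtain ⟨k', hk', y, hy, e2⟩ := (h j l).2.resolve_left fun e => by linarith
        exact ⟨k + k', by omega, x + y, hx.trans hy, by rw [h2, e1, e2]; ring⟩
    · exact Or.inl rfl

/-- Loops may be ignored on the diagonal, as closed walks have nonnegative weight. -/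
theorem dists_one (hG : ∀ i x, G.Walk i i x → 0 ≤ x)
    (hf : ∀ i j : Fin n, f ((i : ℕ) * n + (j : ℕ)) =
      if i = j then (E : ℤ) else (G i j).elim (4 * E + 1) fun x => x + E) : G.Dists E 1 f := by
  intro i j
  rw [hf]
  refine ⟨fun k hk x hx => ?_, ?_⟩
  · split_ifs with hij
    · subst hij
      linarith [hG i x hx.walk]
    · cases hx with
      | nil => exact absurd rfl hij
      | cons h w =>
        cases w with
        | nil => simp [h]
        | cons => omega
  · split_ifs with hij
    · subst hij
      exact Or.inr ⟨0, by norm_num, 0, .nil i, by simp⟩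
    · rcases hg : G i j with _ | x
      · exact Or.inl rfl
      · refine Or.inr ⟨1, le_rfl, x, ?_, rfl⟩
        simpa using Steps.cons hg (.nil j)

/-- By `Steps.shorten`, walks with at most `n` edges suffice for the distances. -/
theorem Dists.isDistAnswer (h : G.Dists E len f) (hB : ∀ i j x, G i j = some x → |x| ≤ (B : ℤ))
    (hE : len * B ≤ E) (hlen : n ≤ len) (hG : ∀ i x, G.Walk i i x → 0 ≤ x) (i j : Fin n) :
    G.IsDistAnswer i j (if f ((i : ℕ) * n + (j : ℕ)) < 4 * E + 1 then 1 else 0)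
      (f ((i : ℕ) * n + (j : ℕ)) - E) := by
  have key : ∀ x, G.Walk i j x → f ((i : ℕ) * n + (j : ℕ)) ≤ x + E ∧
      f ((i : ℕ) * n + (j : ℕ)) < 4 * E + 1 := by
    intro x hx
    obtain ⟨k, hk⟩ := hx.steps
    obtain ⟨k', hk', y, hy, hS⟩ := hk.shorten hG
    have h1 := (h i j).1 k' (hk'.trans hlen) y hS
    have h2 := abs_le.1 (hS.abs_le' hB hE (hk'.trans hlen))
    constructor <;> linarith
  rcases (h i j).2 with he | ⟨k, hk, x, hx, he⟩
  · refine Or.inr ⟨if_neg (by linarith), fun x hx => ?_⟩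
    have := (key x hx).2
    linarith
  · refine Or.inl ⟨if_pos (key x hx.walk).2, ?_, fun y hy => ?_⟩
    · rw [he, add_sub_cancel_right]; exact hx.walk
    · linarith [(key y hy).1]

end WGraph

/-! ### The algorithm for APSP -/

/-- A bound for the absolute values of the distances. -/
def distBound (c n : ℕ) : ℕ := 2 * n ^ (c + 1)

/-- The number that represents infinite distances. -/
def infDist (c n : ℕ) : ℕ := 4 * distBound c n + 1

/-- The blocks have `2 ^ sideExp g n` entries. -/
def sideExp (g n : ℕ) : ℕ := Nat.log 2 n / g

/-- The number of bits of the entries. -/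
def numBits (c n : ℕ) : ℕ := Nat.log 2 (2 * infDist c n) + 1

/-- The number of vertices of the planar graphs. -/
def numVerts (c g n : ℕ) : ℕ := 2 * 2 ^ sideExp g n * (numBits c n + 5)

/-- The parameters for the products. -/
def problem (c g n : ℕ) (W : ℕ → ℕ → ℕ) : Prob :=
  ⟨n, infDist c n, 2 ^ sideExp g n, numBits c n, numVerts c g n, W⟩

section programs

open Term

/-- `reg r := e ^ g` -/
def powCode (r : ℕ) (e : Term) : ℕ → Cmd
  | 0 => .set r (lit 1)
  | g + 1 => .seq (powCode r e g) (.set r (reg r * e))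

def constsCode (c : ℕ) : Cmd :=
  .seq (powCode 2 (reg 0) (c + 1)) (.seq (.set 2 (lit 2 * reg 2))
    (.set 1 (lit 2 * (lit 2 * reg 2) + lit 1)))

/-- No logarithm is computed: `2 ^ j` is doubled in register `3` as long as `2 ^ (g * (j + 1)) ≤ n`.
-/
def sideCode (g : ℕ) : Cmd :=
  .seq (powCode 29 (lit 2) g) (.seq (.set 30 (lit 1)) (.seq (.set 3 (lit 1))
    (.whileDo (less (reg 29 * reg 30) (reg 0 + lit 1))
      (.seq (.set 30 (reg 29 * reg 30)) (.set 3 (lit 2 * reg 3))))))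

/-- On the way the powers of two are tabulated in array `6`, where the edge weights for the bits are
looked up later. -/
def numBitsCode : Cmd :=
  .seq (.set 4 (lit 0)) (.seq (.set 30 (lit 1))
    (.whileDo (less (reg 30) (lit 2 * reg 1 + lit 1))
      (.seq (.put 6 (reg 4) (reg 30)) (.seq (.set 30 (lit 2 * reg 30))
        (.set 4 (reg 4 + lit 1))))))

def edgeTerm : Term := cond (equal (reg 28 / reg 0) (reg 28 % reg 0)) (reg 2)
  (cond (get 0 (reg 28)) (get 1 (reg 28) + reg 2) (reg 1))

def setupCode (c g : ℕ) : Cmd :=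
  .seq (constsCode c) (.seq (sideCode g) (.seq numBitsCode
    (.seq (.set 5 ((lit 1 + lit 2) * (reg 4 + lit 1))) (.seq (.set 6 (lit 2 * (lit 2 * reg 1)))
      (.seq (.set 7 (lit 2 * reg 3 * (reg 4 + (lit 1 + (lit 2 + lit 2)))))
        (.seq (.set 8 (lit 1)) (mapCode 4 edgeTerm)))))))

def normalTerm : Term := cond (less (get 5 (reg 28)) (reg 1)) (get 5 (reg 28) - reg 2) (reg 1)

def squareCode (D : DynAlg) (k : UpdateKind) (R : ℕ) : Cmd :=
  .seq (productCode D k R) (.seq (mapCode 4 normalTerm) (.set 8 (lit 2 * reg 8)))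

def outputCode : Cmd := .seq (mapCode 2 (less (get 4 (reg 28)) (reg 1)))
  (mapCode 3 (get 4 (reg 28) - reg 2))

/-- The algorithm for APSP. -/
def apspCode (D : DynAlg) (k : UpdateKind) (R c g : ℕ) : Cmd :=
  .seq (setupCode c g) (.seq (.whileDo (less (reg 8) (reg 0)) (squareCode D k R)) outputCode)

end programs

/-! ### The initial computation of the parameters -/

section setup

variable {μ : Machine} {c g n : ℕ} {s : State}

theorem setReg_setReg (s : State) (r : ℕ) (x y : ℤ) :
    (s.setReg r x).setReg r y = s.setReg r y := by
  ext r' <;> simp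
  split_ifs <;> rfl

theorem runs_pow (hK : 20 ≤ μ.K) {r : ℕ} {e : Term} (hb : Bounded μ.Z s)
    (he : (Term.reg r * e).Fits = true) {b : ℤ} (hb1 : 1 ≤ b)
    (hev : ∀ v, e.eval (s.setReg r v) = b) (hZ : b ^ g ≤ μ.Z) :
    Runs μ (powCode r e g) s fun s' t => s' = s.setReg r (b ^ g) ∧
      t ≤ (g + 1) * (e.cost + 10) := by
  induction g with
  | zero =>
    refine Runs.assign hK (by decide) hb ⟨by simp, ?_⟩
    have : (Term.lit 1).cost = 1 := rfl
    rw [this]; omega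
  | succ g ih =>
    have hle : b ^ g ≤ b ^ (g + 1) := pow_le_pow_right₀ hb1 (by omega)
    refine Runs.seq ((ih (hle.trans hZ)).mono ?_)
    rintro s' t ⟨rfl, ht⟩
    have bz : |b ^ g| ≤ μ.Z := by
      rw [abs_of_nonneg (by positivity)]; exact hle.trans hZ
    refine Runs.assign hK he (hb.setReg r bz) ⟨?_, ?_⟩
    · rw [setReg_setReg, Term.eval_mul, hev, pow_succ]
      simp
    · have : (Term.reg r * e).cost = 2 + (e.cost + 1) := rfl
      rw [this, add_mul (g + 1)]
      omega

theorem runs_consts (hK : 20 ≤ μ.K) (hb : Bounded μ.Z s) (h0 : s.reg 0 = n) (hn : 1 ≤ n)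
    (hX : (infDist c n : ℤ) ≤ μ.Z) :
    Runs μ (constsCode c) s fun s' t =>
      s' = (s.setReg 2 (distBound c n)).setReg 1 (infDist c n) ∧
      Bounded μ.Z s' ∧ t ≤ 12 * c + 60 := by
  have hE : (distBound c n : ℤ) ≤ μ.Z := by
    refine le_trans ?_ hX
    unfold infDist
    push_cast
    linarith [Int.natCast_nonneg (distBound c n)]
  have hp : (n : ℤ) ^ (c + 1) ≤ μ.Z := by
    refine le_trans ?_ hE
    unfold distBound
    push_cast
    linarith [pow_nonneg (Int.natCast_nonneg n) (c + 1)]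
  refine Runs.seq ((runs_pow hK hb (by decide) (b := n) (by exact_mod_cast hn)
    (fun v => by simp [h0]) hp).mono ?_)
  rintro s' t ⟨rfl, ht⟩
  have b1 := hb.setReg 2 (v := (n : ℤ) ^ (c + 1)) (by rwa [abs_of_nonneg (by positivity)])
  refine Runs.seq (Runs.assign hK (by decide) b1 ?_)
  have e2 : (Term.lit 2 * Term.reg 2).eval (s.setReg 2 ((n : ℤ) ^ (c + 1))) = distBound c n := by
    simp [distBound]
  rw [e2, setReg_setReg]
  have b2 := hb.setReg 2 (abs_natCast_le hE)
  refine Runs.assign hK (by decide) b2 ?_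
  have e1 : (Term.lit 2 * (Term.lit 2 * Term.reg 2) + Term.lit 1).eval
      (s.setReg 2 (distBound c n)) = infDist c n := by
    simp [infDist]; ring
  rw [e1]
  refine ⟨rfl, b2.setReg 1 (abs_natCast_le hX), ?_⟩
  have c1 : (Term.reg 0).cost = 2 := rfl
  have c2 : (Term.lit 2 * Term.reg 2).cost = 4 := rfl
  have c3 : (Term.lit 2 * (Term.lit 2 * Term.reg 2) + Term.lit 1).cost = 8 := rfl
  rw [c1] at ht
  rw [c2, c3]
  omega

theorem le_sideExp_iff (hg : 0 < g) (hn : 1 ≤ n) {j : ℕ} :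
    j ≤ sideExp g n ↔ 2 ^ (g * j) ≤ n := by
  rw [sideExp, Nat.le_div_iff_mul_le hg, mul_comm, Nat.le_log_iff_pow_le (by norm_num) (by omega)]

theorem runs_side (hK : 20 ≤ μ.K) (hb : Bounded μ.Z s) (h0 : s.reg 0 = n) (hn : 1 ≤ n)
    (hg : 0 < g) (hgZ : (2 : ℤ) ^ g ≤ μ.Z) (hnZ : (n : ℤ) ≤ μ.Z) :
    Runs μ (sideCode g) s fun s' t => s'.reg 3 = (2 ^ sideExp g n : ℕ) ∧
      (∀ r, r ≠ 3 → r ≠ 29 → r ≠ 30 → s'.reg r = s.reg r) ∧ s'.arr = s.arr ∧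
      Bounded μ.Z s' ∧ t ≤ 11 * g + 30 * sideExp g n + 50 := by
  have b1 : |(1 : ℤ)| ≤ μ.Z := by simp; linarith [μ.two_le]
  refine Runs.seq ((runs_pow hK hb (by decide) (b := 2) (by norm_num) (fun v => rfl) hgZ).mono ?_)
  rintro s1 t1 ⟨rfl, ht⟩
  have b29 := hb.setReg 29 (v := (2 : ℤ) ^ g) (by rwa [abs_of_nonneg (by positivity)])
  refine Runs.seq (Runs.assign hK (by decide) b29 ?_)
  rw [Term.eval_lit]
  refine Runs.seq (Runs.assign hK (by decide) (b29.setReg _ b1) ?_)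
  rw [Term.eval_lit]
  have hpow : ∀ j, (2 : ℤ) ^ g * 2 ^ (g * j) = 2 ^ (g * (j + 1)) := fun j => by ring
  have hlt : ∀ (j : ℕ) (s' : State), s'.reg 29 = 2 ^ g → s'.reg 30 = 2 ^ (g * j) → s'.reg 0 = n →
      ((Term.less (Term.reg 29 * Term.reg 30) (Term.reg 0 + Term.lit 1)).eval s' = 0 ↔
        sideExp g n ≤ j) := by
    intro j s' h29 h30 h0
    have h : ((2 : ℤ) ^ (g * (j + 1)) < n + 1) ↔ 2 ^ (g * (j + 1)) ≤ n := by
      rw [Int.lt_add_one_iff]; norm_cast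
    rw [Term.eval_less, Term.eval_mul, Term.eval_add, Term.eval_reg, Term.eval_reg, Term.eval_reg,
      Term.eval_lit, h29, h30, h0, hpow]
    simp only [h, ← le_sideExp_iff hg hn]
    split_ifs <;> simp <;> omega
  refine Runs.whileDo (Term.Fits.good (by decide) hK) (fun k s' τ => ∃ j, j + k = sideExp g n ∧
    s'.reg 29 = 2 ^ g ∧ s'.reg 30 = 2 ^ (g * j) ∧ s'.reg 3 = (2 ^ j : ℕ) ∧
    (∀ r, r ≠ 3 → r ≠ 29 → r ≠ 30 → s'.reg r = s.reg r) ∧ s'.arr = s.arr ∧ Bounded μ.Z s' ∧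
    τ ≤ 30 * j + 10) (sideExp g n) ?_ ?_ ?_ ?_ ?_
  · rintro k s' τ ⟨j, _, _, _, _, _, _, h, _⟩
    exact Term.Fits.small (by decide) μ.two_le h
  · rintro s' τ ⟨j, hj, h29, h30, h3, hr, ha, h, _⟩
    rw [hlt j s' h29 h30 (by rw [hr 0 (by norm_num) (by norm_num) (by norm_num), h0])]
    omega
  · rintro k s' τ ⟨j, hj, h29, h30, h3, hr, ha, h, hτ⟩ hne
    have hle := (le_sideExp_iff hg hn).1 (show j + 1 ≤ sideExp g n by omega)
    have e30 : (Term.reg 29 * Term.reg 30).eval s' = (2 ^ (g * (j + 1)) : ℕ) := by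
      simp [h29, h30, hpow]
    have e3 : ∀ v, (Term.lit 2 * Term.reg 3).eval (s'.setReg 30 v) = (2 ^ (j + 1) : ℕ) := by
      intro v; simp [h3]; ring
    have bz : ∀ i ≤ g * (j + 1), |((2 ^ i : ℕ) : ℤ)| ≤ μ.Z := fun i hi =>
      abs_natCast_le (le_trans (by exact_mod_cast (Nat.pow_le_pow_right (by norm_num) hi).trans hle)
        hnZ)
    refine Runs.seq (Runs.assign hK (by decide) h ?_)
    rw [e30]
    have h' := h.setReg 30 (bz _ le_rfl)
    refine Runs.assign hK (by decide) h' ?_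
    rw [e3]
    refine ⟨k, le_rfl, j + 1, by omega, by simpa using h29, by simp, by simp,
      fun r h1 h2 h3 => ?_, ha, h'.setReg 3 (bz _ (Nat.le_mul_of_pos_left _ hg)), ?_⟩
    · simp [h1, h3, hr r h1 h2 h3]
    · have c1 : (Term.reg 29 * Term.reg 30).cost = 5 := rfl
      have c2 : (Term.lit 2 * Term.reg 3).cost = 4 := rfl
      have c3 : (Term.less (Term.reg 29 * Term.reg 30) (Term.reg 0 + Term.lit 1)).cost = 10 := rfl
      rw [c1, c2, c3]
      omega
  · refine ⟨0, by omega, by simp, by simp, by simp, fun r h1 h2 h3 => by simp [h1, h2, h3], rfl,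
      (b29.setReg _ b1).setReg _ b1, ?_⟩
    have c3 : (Term.less (Term.reg 29 * Term.reg 30) (Term.reg 0 + Term.lit 1)).cost = 10 := rfl
    rw [c3]
  · rintro k s' τ ⟨j, hj, h29, h30, h3, hr, ha, h, hτ⟩ hz
    rw [hlt j s' h29 h30 (by rw [hr 0 (by norm_num) (by norm_num) (by norm_num), h0])] at hz
    have hj' : j = sideExp g n := by omega
    refine ⟨by rw [h3, hj'], hr, ha, h, ?_⟩
    have c1 : (Term.lit 2).cost = 1 := rfl
    have c2 : (Term.lit 1).cost = 1 := rfl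
    rw [c1] at ht
    rw [c2]
    omega

theorem lt_two_pow_numBits (c n : ℕ) : 2 * infDist c n < 2 ^ numBits c n :=
  Nat.lt_pow_succ_log_self (by norm_num) _

theorem one_le_infDist (c n : ℕ) : 1 ≤ infDist c n := Nat.le_add_left 1 _

theorem two_pow_numBits_le (c n : ℕ) : 2 ^ numBits c n ≤ 4 * infDist c n := by
  have h := Nat.pow_log_le_self 2 (show 2 * infDist c n ≠ 0 by have := one_le_infDist c n; omega)
  unfold numBits
  rw [pow_succ]
  omega

theorem lt_numBits_iff {j : ℕ} : j < numBits c n ↔ 2 ^ j ≤ 2 * infDist c n := by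
  rw [numBits, Nat.lt_succ_iff, Nat.le_log_iff_pow_le (by norm_num)]
  have := one_le_infDist c n; omega

theorem runs_numBits (hK : 20 ≤ μ.K) (hb : Bounded μ.Z s) (h1 : s.reg 1 = infDist c n)
    (hX : 4 * (infDist c n : ℤ) ≤ μ.Z) :
    Runs μ numBitsCode s fun s' t => s'.reg 4 = numBits c n ∧
      (∀ b < numBits c n, s'.arr 6 b = 2 ^ b) ∧
      (∀ r, r ≠ 4 → r ≠ 30 → s'.reg r = s.reg r) ∧ (∀ i ≠ 6, s'.arr i = s.arr i) ∧
      Bounded μ.Z s' ∧ t ≤ 40 * numBits c n + 30 := by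
  have b1 : |(1 : ℤ)| ≤ μ.Z := by simp; linarith [μ.two_le]
  have b0 : |(0 : ℤ)| ≤ μ.Z := by simp; linarith [μ.two_le]
  refine Runs.seq (Runs.assign hK (by decide) hb ?_)
  rw [Term.eval_lit]
  refine Runs.seq (Runs.assign hK (by decide) (hb.setReg _ b0) ?_)
  rw [Term.eval_lit]
  have hlt : ∀ (j : ℕ) (s' : State), s'.reg 30 = (2 ^ j : ℕ) → s'.reg 1 = infDist c n →
      ((Term.less (Term.reg 30) (Term.lit 2 * Term.reg 1 + Term.lit 1)).eval s' = 0 ↔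
        numBits c n ≤ j) := by
    intro j s' h30 h1
    have h : (((2 ^ j : ℕ) : ℤ) < 2 * infDist c n + 1) ↔ 2 ^ j ≤ 2 * infDist c n := by
      rw [Int.lt_add_one_iff]; norm_cast
    rw [Term.eval_less, Term.eval_add, Term.eval_mul, Term.eval_reg, Term.eval_reg,
      Term.eval_lit, Term.eval_lit, h30, h1]
    simp only [h, ← lt_numBits_iff]
    split_ifs <;> simp <;> omega
  have bz : ∀ j ≤ numBits c n, |((2 ^ j : ℕ) : ℤ)| ≤ μ.Z := fun j hj => abs_natCast_le
    (by
      have h : 2 ^ j ≤ 4 * infDist c n :=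
        (Nat.pow_le_pow_right (by norm_num) hj).trans (two_pow_numBits_le c n)
      refine le_trans ?_ hX
      exact_mod_cast h)
  refine Runs.whileDo (Term.Fits.good (by decide) hK) (fun k s' τ => ∃ j, j + k = numBits c n ∧
    s'.reg 4 = j ∧ s'.reg 30 = (2 ^ j : ℕ) ∧ (∀ b < j, s'.arr 6 b = 2 ^ b) ∧
    (∀ r, r ≠ 4 → r ≠ 30 → s'.reg r = s.reg r) ∧ (∀ i ≠ 6, s'.arr i = s.arr i) ∧
    Bounded μ.Z s' ∧ τ ≤ 40 * j + 9) (numBits c n) ?_ ?_ ?_ ?_ ?_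
  · rintro k s' τ ⟨j, _, _, _, _, _, _, h, _⟩
    exact Term.Fits.small (by decide) μ.two_le h
  · rintro s' τ ⟨j, hj, h4, h30, h6, hr, ha, h, _⟩
    rw [hlt j s' h30 (by rw [hr 1 (by norm_num) (by norm_num), h1])]
    omega
  · rintro k s' τ ⟨j, hj, h4, h30, h6, hr, ha, h, hτ⟩ hne
    refine Runs.seq (Runs.write hK (by decide) (by decide) h ?_)
    have w1 : (Term.reg 4).eval s' = j := h4
    have w2 : (Term.reg 30).eval s' = (2 ^ j : ℕ) := h30
    rw [w1, w2]
    have h' := h.setArr 6 j (bz j (by omega))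
    refine Runs.seq (Runs.assign hK (by decide) h' ?_)
    have e30 : (Term.lit 2 * Term.reg 30).eval (s'.setArr 6 j (2 ^ j : ℕ)) =
        (2 ^ (j + 1) : ℕ) := by
      simp [h30]; ring
    rw [e30]
    have h'' := h'.setReg 30 (bz (j + 1) (by omega))
    refine Runs.assign hK (by decide) h'' ?_
    have e4 : ∀ v, (Term.reg 4 + Term.lit 1).eval ((s'.setArr 6 j (2 ^ j : ℕ)).setReg 30 v) =
        (j + 1 : ℕ) := by
      intro v; simp [h4]
    rw [e4]
    have hj4 : |((j + 1 : ℕ) : ℤ)| ≤ μ.Z := by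
      rw [abs_of_nonneg (by positivity)]
      refine le_trans ?_ ((le_abs_self _).trans (bz (j + 1) (by omega)))
      exact_mod_cast Nat.lt_two_pow_self.le
    refine ⟨k, le_rfl, j + 1, by omega, by simp, by simp, fun b hb => ?_,
      fun r h1 h2 => ?_, fun i hi => ?_, h''.setReg 4 hj4, ?_⟩
    · rw [State.setReg_arr, State.setReg_arr, State.setArr_arr]
      rcases Nat.lt_succ_iff_lt_or_eq.1 hb with hlt | rfl
      · rw [if_neg (fun h => by have := h.2; omega)]
        exact h6 b hlt
      · simp
    · simp [h1, h2, hr r h1 h2]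
    · funext a
      rw [State.setReg_arr, State.setReg_arr, State.setArr_arr, if_neg (fun h => hi h.1), ha i hi]
    · have c1 : (Term.reg 4).cost = 2 := rfl
      have c2 : (Term.reg 30).cost = 2 := rfl
      have c3 : (Term.lit 2 * Term.reg 30).cost = 4 := rfl
      have c4 : (Term.reg 4 + Term.lit 1).cost = 4 := rfl
      have c5 : (Term.less (Term.reg 30) (Term.lit 2 * Term.reg 1 + Term.lit 1)).cost = 9 := rfl
      rw [c1, c2, c3, c4, c5]
      omega
  · refine ⟨0, by omega, by simp, by simp, fun b hb => absurd hb (by omega),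
      fun r h1 h2 => by simp [h1, h2], fun _ _ => rfl, (hb.setReg _ b0).setReg _ b1, ?_⟩
    have c5 : (Term.less (Term.reg 30) (Term.lit 2 * Term.reg 1 + Term.lit 1)).cost = 9 := rfl
    rw [c5]
  · rintro k s' τ ⟨j, hj, h4, h30, h6, hr, ha, h, hτ⟩ hz
    rw [hlt j s' h30 (by rw [hr 1 (by norm_num) (by norm_num), h1])] at hz
    have hj' : j = numBits c n := by omega
    subst hj'
    refine ⟨h4, h6, hr, ha, h, ?_⟩
    have c1 : (Term.lit 0).cost = 1 := rfl
    have c2 : (Term.lit 1).cost = 1 := rfl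
    rw [c1, c2]
    omega

end setup

theorem WGraph.cell_natCast {n : ℕ} (G : WGraph n) (i j : Fin n) :
    G.cell ((i : ℕ) * n + (j : ℕ)) = G i j := by
  have hi := i.2
  have hj := j.2
  have h1 : ((i : ℤ) * n + (j : ℕ)).toNat = i * n + j := by
    have : (i : ℤ) * n + (j : ℕ) = ((i * n + j : ℕ) : ℤ) := by push_cast; rfl
    rw [this, Int.toNat_natCast]
  have h2 : (i : ℕ) * n + j < n * n := by nlinarith
  unfold WGraph.cell
  rw [dif_pos ⟨by positivity, by rw [h1]; exact h2⟩]
  congr 1 <;> apply Fin.ext <;> simp only [h1]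
  · rw [mul_comm, Nat.mul_add_div (by omega), Nat.div_eq_of_lt hj, add_zero]
  · rw [mul_comm, Nat.mul_add_mod, Nat.mod_eq_of_lt hj]

theorem natCast_index {n : ℕ} (i j : Fin n) :
    ((i : ℕ) : ℤ) * n + (j : ℕ) = ((i * n + j : ℕ) : ℤ) := by push_cast; rfl

theorem index_lt_mul {n : ℕ} (i j : Fin n) : (i * n + j : ℕ) < n * n := by
  have hi := i.2
  have hj := j.2
  nlinarith

theorem index_div {n : ℕ} (i j : Fin n) : (i * n + j : ℕ) / n = i := by
  rw [mul_comm, Nat.mul_add_div (by have := i.2; omega), Nat.div_eq_of_lt j.2, add_zero]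

theorem index_mod {n : ℕ} (i j : Fin n) : (i * n + j : ℕ) % n = j := by
  rw [mul_comm, Nat.mul_add_mod, Nat.mod_eq_of_lt j.2]

/-! ### Correctness and running time of the APSP program -/

section main

variable {μ : Machine} {D : DynAlg} {k : UpdateKind} {d R p u q c g n e a : ℕ} {G : WGraph n}
  {s : State}

theorem weight_le_distBound (hn : 1 ≤ n) : n ^ c ≤ distBound c n := by
  unfold distBound
  rw [pow_succ]
  nlinarith [Nat.pow_pos (n := c) hn]

theorem IsAPSPInstance.abs_le (hG : IsAPSPInstance c G) (i j : Fin n) (x : ℤ)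
    (h : G i j = some x) : |x| ≤ ((n ^ c : ℕ) : ℤ) := by
  exact_mod_cast hG.1 i j x h

theorem IsAPSPInstance.abs_cell_le (hG : IsAPSPInstance c G) (a : ℤ) (x : ℤ)
    (h : G.cell a = some x) : |x| ≤ ((n ^ c : ℕ) : ℤ) := by
  unfold WGraph.cell at h
  split_ifs at h
  exact hG.abs_le _ _ _ h

/-- What is needed for the products on the machine `μ`. -/
structure Feasible (μ : Machine) (D : DynAlg) (k : UpdateKind) (d R p u q c g n e a : ℕ) :
    Prop where
  ctx : ∀ W, (∀ i j, W i j ≤ infDist c n) → (problem c g n W).Ctx μ D k d R p u q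
  g_pos : 0 < g
  e_pos : 1 ≤ e
  a_le : a ≤ sideExp g n
  sufficient : (problem c g n 0).Sufficient u q (sideExp g n) (2 ^ e) a
  limit : ((2 ^ e + (problem c g n 0).maxRowTime u q : ℕ) : ℤ) ≤ μ.Z
  phases : ((numBits c n * (e * ((sideExp g n + 1) * ((problem c g n 0).numBlocks * (n + 1)))) :
    ℕ) : ℤ) ≤ μ.Z
  pow_le : (2 : ℤ) ^ g ≤ μ.Z
  numBits_le : ((3 * numBits c n + 3 : ℕ) : ℤ) ≤ μ.Z
  X_le : 4 * (infDist c n : ℤ) ≤ μ.Z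
  numVerts_le : (numVerts c g n : ℤ) ≤ μ.Z

/-- The state before a squaring. The distances for walks with at most `2 ^ j` edges are known. -/
structure Ready (μ : Machine) (c g : ℕ) {n : ℕ} (G : WGraph n) (j Φ : ℕ) (s : State) : Prop where
  r0 : s.reg 0 = n
  r1 : s.reg 1 = infDist c n
  r2 : s.reg 2 = distBound c n
  r3 : s.reg 3 = (2 ^ sideExp g n : ℕ)
  r4 : s.reg 4 = numBits c n
  r5 : s.reg 5 = 3 * numBits c n + 3
  r6 : s.reg 6 = 4 * infDist c n
  r7 : s.reg 7 = numVerts c g n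
  r8 : s.reg 8 = (2 ^ j : ℕ)
  a6 : ∀ b < numBits c n, s.arr 6 b = 2 ^ b
  dists : G.Dists (distBound c n) (2 ^ j) (s.arr 4)
  mem : ∀ a, 0 ≤ s.arr 5 a ∧ s.arr 5 a ≤ infDist c n
  bounded : Bounded μ.Z s
  stamps : Stamps μ.Z s
  phase : s.reg 25 ≤ (j * Φ : ℕ)

def setupTime (c g n : ℕ) : ℕ :=
  n * n * 60 + 12 * c + 11 * g + 30 * sideExp g n + 40 * numBits c n + 300

theorem runs_setup (hK : 20 ≤ μ.K) (hG : IsAPSPInstance c G) (hn : 1 ≤ n)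
    (F : Feasible μ D k d R p u q c g n e a) (Φ : ℕ) :
    Runs μ (setupCode c g) G.input fun s' t => Ready μ c g G 0 Φ s' ∧ t ≤ setupTime c g n := by
  have hX : (infDist c n : ℤ) ≤ μ.Z := by
    linarith [F.X_le, Int.natCast_nonneg (infDist c n)]
  have hEX : 4 * (distBound c n : ℤ) + 1 = infDist c n := by simp [infDist]
  have hcE : ((n ^ c : ℕ) : ℤ) ≤ distBound c n := by exact_mod_cast weight_le_distBound hn
  have hn2 := (F.ctx 0 fun _ _ => Nat.zero_le _).n_le
  change 2 * ((n : ℤ) * n) ≤ _ at hn2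
  have hn1 : (1 : ℤ) ≤ n := by exact_mod_cast hn
  have hnZ : (n : ℤ) ≤ μ.Z := by nlinarith
  have hZ := μ.two_le
  have hb : Bounded μ.Z G.input := by
    refine ⟨fun r _ => ?_, fun i _ a => ?_⟩
    · change |if r = 0 then (n : ℤ) else 0| ≤ _
      split_ifs
      · exact abs_natCast_le hnZ
      · simp; linarith
    · change |if i = 0 then (if (G.cell a).isSome then (1 : ℤ) else 0)
        else if i = 1 then (G.cell a).getD 0 else 0| ≤ _
      split_ifs
      · simp; linarith
      · simp; linarith
      · rcases hc : G.cell a with _ | x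
        · simp; linarith
        · have := hG.abs_cell_le a x hc
          simp only [Option.getD_some]
          linarith
      · simp; linarith
  have hz : ∀ i, 2 ≤ i → G.input.arr i = fun _ => 0 := by
    intro i hi
    funext a
    change (if i = 0 then (if (G.cell a).isSome then (1 : ℤ) else 0)
        else if i = 1 then (G.cell a).getD 0 else 0) = 0
    rw [if_neg (by omega), if_neg (by omega)]
  have hr0 : ∀ r, r ≠ 0 → G.input.reg r = 0 := fun r hr => if_neg hr
  refine Runs.seq ((runs_consts hK hb rfl hn hX).mono ?_)
  rintro s1 t1 ⟨rfl, b1, ht1⟩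
  refine Runs.seq ((runs_side hK b1 (by simp; rfl) hn F.g_pos F.pow_le hnZ).mono ?_)
  rintro s2 t2 ⟨e3, f2, a2, b2, ht2⟩
  refine Runs.seq ((runs_numBits hK b2 (by rw [f2 1 (by norm_num) (by norm_num) (by norm_num)]; simp)
    F.X_le).mono ?_)
  rintro s3 t3 ⟨e4, e6, f3, a3, b3, ht3⟩
  have g1 : s3.reg 1 = infDist c n := by
    rw [f3 1 (by norm_num) (by norm_num), f2 1 (by norm_num) (by norm_num) (by norm_num)]; simp
  have g2 : s3.reg 2 = distBound c n := by
    rw [f3 2 (by norm_num) (by norm_num), f2 2 (by norm_num) (by norm_num) (by norm_num)]; simp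
  have g3 : s3.reg 3 = (2 ^ sideExp g n : ℕ) := by
    rw [f3 3 (by norm_num) (by norm_num), e3]
  have g0 : s3.reg 0 = n := by
    rw [f3 0 (by norm_num) (by norm_num), f2 0 (by norm_num) (by norm_num) (by norm_num)]; simp; rfl
  have gz : ∀ r, 5 ≤ r → r < 29 → s3.reg r = 0 := fun r h1 h2 => by
    rw [f3 r (by omega) (by omega), f2 r (by omega) (by omega) (by omega), State.setReg_reg,
      if_neg (by omega), State.setReg_reg, if_neg (by omega)]
    exact hr0 r (by omega)
  have ga : ∀ i ≠ 6, s3.arr i = G.input.arr i := fun i hi => by rw [a3 i hi, a2]; rfl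
  have v5 : ((Term.lit 1 + Term.lit 2) * (Term.reg 4 + Term.lit 1)).eval s3 =
      (3 * numBits c n + 3 : ℕ) := by
    simp [e4]; ring
  refine Runs.seq (Runs.assign hK (by decide) b3 ?_)
  rw [v5]
  have b4 := b3.setReg 5 (abs_natCast_le F.numBits_le)
  refine Runs.seq (Runs.assign hK (by decide) b4 ?_)
  have v6 : ∀ v, (Term.lit 2 * (Term.lit 2 * Term.reg 1)).eval (s3.setReg 5 v) =
      (4 * infDist c n : ℕ) := by
    intro v; simp [g1]; ring
  rw [v6]
  have b5 := b4.setReg 6 (v := (4 * infDist c n : ℕ))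
    (abs_natCast_le (by push_cast; exact F.X_le))
  refine Runs.seq (Runs.assign hK (by decide) b5 ?_)
  have v7 : ∀ v v', (Term.lit 2 * Term.reg 3 *
      (Term.reg 4 + (Term.lit 1 + (Term.lit 2 + Term.lit 2)))).eval
      ((s3.setReg 5 v).setReg 6 v') = numVerts c g n := by
    intro v v'; simp [g3, e4, numVerts]
  rw [v7]
  have b6 := b5.setReg 7 (abs_natCast_le F.numVerts_le)
  refine Runs.seq (Runs.assign hK (by decide) b6 ?_)
  rw [Term.eval_lit]
  have b7 := b6.setReg 8 (v := 1) (by simp; linarith)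
  set s4 := (((s3.setReg 5 (3 * numBits c n + 3 : ℕ)).setReg 6 (4 * infDist c n : ℕ)).setReg 7
    (numVerts c g n)).setReg 8 1 with hs4
  have ha4 : s4.arr = s3.arr := rfl
  have c1 : ((Term.lit 1 + Term.lit 2) * (Term.reg 4 + Term.lit 1)).cost = 8 := rfl
  have c2 : (Term.lit 2 * (Term.lit 2 * Term.reg 1)).cost = 6 := rfl
  have c3 : (Term.lit 2 * Term.reg 3 *
    (Term.reg 4 + (Term.lit 1 + (Term.lit 2 + Term.lit 2)))).cost = 13 := rfl
  have c4 : (Term.lit 1).cost = 1 := rfl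
  have c5 : edgeTerm.cost ≤ 42 := by decide
  refine (runs_map hK (by norm_num) (by decide) (n := n) (by simpa [hs4] using g0)
    (by push_cast; nlinarith) b7 (f := fun v => if v / n = v % n then (distBound c n : ℤ)
      else (G.cell v).elim (infDist c n) fun x => x + distBound c n)
    (fun v hv => ?_) fun v hv s' h28 hr ha => ?_).mono ?_
  · split_ifs
    · exact abs_natCast_le (by linarith)
    · rcases hc : G.cell v with _ | x
      · exact abs_natCast_le hX
      · have := abs_le.1 (hG.abs_cell_le v x hc)
        simp only [Option.elim_some]
        rw [abs_le]
        constructor <;> linarith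
  · have q0 : s'.reg 0 = n := by
      rw [hr 0 (by norm_num) (by norm_num)]; simpa [hs4] using g0
    have q1 : s'.reg 1 = infDist c n := by
      rw [hr 1 (by norm_num) (by norm_num)]; simpa [hs4] using g1
    have q2 : s'.reg 2 = distBound c n := by
      rw [hr 2 (by norm_num) (by norm_num)]; simpa [hs4] using g2
    have q3 : s'.arr 0 v = if (G.cell v).isSome then 1 else 0 := by
      rw [ha 0 (by norm_num), ha4, ga 0 (by norm_num)]; rfl
    have q4 : s'.arr 1 v = (G.cell v).getD 0 := by
      rw [ha 1 (by norm_num), ha4, ga 1 (by norm_num)]; rfl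
    have q5 : ((v : ℤ) / n = v % n) ↔ v / n = v % n := by norm_cast
    simp only [edgeTerm, Term.eval_cond, Term.eval_equal, Term.eval_div, Term.eval_mod,
      Term.eval_reg, Term.eval_get, Term.eval_add, h28, q0, q1, q2, q3, q4, q5]
    rcases G.cell v with _ | x <;> by_cases h : v / n = v % n <;> simp [h]
  · rintro s5 t5 ⟨h1, h2, h3, h4, h5, h6⟩
    refine ⟨⟨?_, ?_, ?_, ?_, ?_, ?_, ?_, ?_, ?_, ?_, ?_, ?_, h5, ?_, ?_⟩, ?_⟩
    · rw [h3 _ (by norm_num) (by norm_num)]; simpa [hs4] using g0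
    · rw [h3 _ (by norm_num) (by norm_num)]; simpa [hs4] using g1
    · rw [h3 _ (by norm_num) (by norm_num)]; simpa [hs4] using g2
    · rw [h3 _ (by norm_num) (by norm_num)]; simpa [hs4] using g3
    · rw [h3 _ (by norm_num) (by norm_num)]; simpa [hs4] using e4
    · rw [h3 _ (by norm_num) (by norm_num)]; simp [hs4]
    · rw [h3 _ (by norm_num) (by norm_num)]; simp [hs4]
    · rw [h3 _ (by norm_num) (by norm_num)]; simp [hs4]
    · rw [h3 _ (by norm_num) (by norm_num)]; simp [hs4]
    · rw [h4 6 (by norm_num), ha4]; exact e6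
    · refine WGraph.dists_one hG.2 fun i j => ?_
      rw [natCast_index, h1 _ (index_lt_mul i j), index_div, index_mod, ← natCast_index,
        G.cell_natCast, hEX]
      simp only [Fin.ext_iff]
    · intro a
      rw [h4 5 (by norm_num), ha4, ga 5 (by norm_num), hz 5 (by norm_num)]
      exact ⟨le_rfl, by positivity⟩
    · have z24 : s5.reg 24 = 0 := by
        rw [h3 _ (by norm_num) (by norm_num)]; simpa [hs4] using gz 24 (by norm_num) (by norm_num)
      have z25 : s5.reg 25 = 0 := by
        rw [h3 _ (by norm_num) (by norm_num)]; simpa [hs4] using gz 25 (by norm_num) (by norm_num)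
      refine ⟨z24.ge, by rw [z24, z25], by rw [z25]; linarith, fun i a => ?_⟩
      rw [h4 _ (by omega), h4 _ (by omega), ha4, ga _ (by omega), ga _ (by omega), hz _ (by omega),
        hz _ (by omega), z25]
      simp
    · rw [h3 _ (by norm_num) (by norm_num)]
      have := gz 25 (by norm_num) (by norm_num)
      simp [hs4, this]
    · have : n * n * (edgeTerm.cost + 18) ≤ n * n * 60 := Nat.mul_le_mul_left _ (by omega)
      unfold setupTime
      rw [c1, c2, c3, c4]
      omega

theorem runs_square (hK : 20 ≤ μ.K) (hG : IsAPSPInstance c G) (hn : 1 ≤ n)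
    (F : Feasible μ D k d R p u q c g n e a) {j : ℕ} (hj : 2 ^ j < n)
    (hs : Ready μ c g G j (e * ((sideExp g n + 1) * ((problem c g n 0).numBlocks * (n + 1)))) s) :
    Runs μ (squareCode D k R) s fun s' t =>
      Ready μ c g G (j + 1) (e * ((sideExp g n + 1) * ((problem c g n 0).numBlocks * (n + 1)))) s' ∧
      t ≤ (problem c g n 0).productTime R p u q (sideExp g n) e + n * n * 60 + 30 := by
  set Φ := e * ((sideExp g n + 1) * ((problem c g n 0).numBlocks * (n + 1))) with hΦ
  have hX : (infDist c n : ℤ) ≤ μ.Z := by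
    linarith [F.X_le, Int.natCast_nonneg (infDist c n)]
  have hEX : 4 * (distBound c n : ℤ) + 1 = infDist c n := by simp [infDist]
  have hn2 := (F.ctx 0 fun _ _ => Nat.zero_le _).n_le
  change 2 * ((n : ℤ) * n) ≤ _ at hn2
  have hn1 : (1 : ℤ) ≤ n := by exact_mod_cast hn
  have hZ := μ.two_le
  have hB := hG.abs_le
  have hE : 2 * 2 ^ j * n ^ c ≤ distBound c n := by
    unfold distBound
    rw [pow_succ, mul_assoc, mul_comm (n ^ c)]
    exact Nat.mul_le_mul_left 2 (Nat.mul_le_mul_right _ hj.le)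
  have hE' : 2 ^ j * n ^ c ≤ distBound c n := (Nat.mul_le_mul_right _ (by omega)).trans hE
  have hm := hs.dists.mem hB hE'
  -- The context of a product demands entries at most `infDist` for all pairs of natural numbers.
  -- The minimum ensures this and changes nothing for indices inside the matrix.
  set W : ℕ → ℕ → ℕ := fun i l => min (s.arr 4 ((i : ℤ) * n + l)).toNat (infDist c n) with hW
  have hWeq : ∀ i l : Fin n, (W i l : ℤ) = s.arr 4 ((i : ℕ) * n + (l : ℕ)) := by
    intro i l
    obtain ⟨h1, h2⟩ := hm i l
    rw [hEX] at h2
    have h3 : (s.arr 4 ((i : ℕ) * n + (l : ℕ))).toNat ≤ infDist c n := by omega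
    rw [hW]
    dsimp only
    rw [min_eq_left h3, Int.toNat_of_nonneg h1]
  have C := F.ctx W fun i j => min_le_right _ _
  have hr : (problem c g n W).Regs s := by
    refine ⟨hs.r0, hs.r1, hs.r3, hs.r4, hs.r5, hs.r6, hs.r7, fun i hi l hl => ?_, hs.a6⟩
    exact (hWeq ⟨i, hi⟩ ⟨l, hl⟩).symm
  -- Stamps are never reused, so their total number over all the squarings must fit into a word.
  -- There are at most `numBits` squarings.
  have hjL : j < numBits c n := by
    rw [lt_numBits_iff]
    refine hj.le.trans ?_
    have h1 : n * 1 ≤ n * n ^ c := Nat.mul_le_mul_left _ (Nat.pow_pos hn)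
    unfold infDist distBound
    rw [pow_succ, mul_comm (n ^ c)]
    omega
  have hph : s.reg 25 + (Φ : ℕ) ≤ μ.Z := by
    have hF : ((numBits c n * Φ : ℕ) : ℤ) ≤ μ.Z := F.phases
    have h1 : (j + 1) * Φ ≤ numBits c n * Φ := Nat.mul_le_mul_right _ hjL
    have h2 : (((j + 1) * Φ : ℕ) : ℤ) ≤ (numBits c n * Φ : ℕ) := by exact_mod_cast h1
    have h3 := hs.phase
    rw [add_mul, one_mul] at h2
    push_cast at h2 h3 hF ⊢
    linarith
  refine Runs.seq ((Prob.runs_product C rfl hr F.e_pos F.a_le F.sufficient hs.bounded hs.stamps hs.mem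
    F.limit hph).mono ?_)
  rintro s1 t1 ⟨A, hprod, ht1⟩
  have q4 : s1.arr 4 = s.arr 4 := A.arrs 4 (by norm_num) (by norm_num)
  have q6 : s1.arr 6 = s.arr 6 := A.arrs 6 (by norm_num) (by norm_num)
  have c1 : normalTerm.cost ≤ 40 := by decide
  have c2 : (Term.lit 2 * Term.reg 8).cost = 4 := rfl
  refine Runs.seq ((runs_map hK (by norm_num) (by decide) (n := n)
    (by rw [A.regs 0 (by norm_num), hs.r0]) (by push_cast; nlinarith) A.bounded
    (f := fun v => if s1.arr 5 v < infDist c n then s1.arr 5 v - distBound c n else infDist c n)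
    (fun v hv => ?_) fun v hv s' h28 hr ha => ?_).mono ?_)
  · split_ifs with h
    · have := A.mem v
      change 0 ≤ s1.arr 5 v ∧ s1.arr 5 v ≤ infDist c n at this
      rw [abs_le]
      constructor <;> linarith
    · exact abs_natCast_le hX
  · have e1 : s'.reg 1 = infDist c n := by
      rw [hr 1 (by norm_num) (by norm_num), A.regs 1 (by norm_num), hs.r1]
    have e2 : s'.reg 2 = distBound c n := by
      rw [hr 2 (by norm_num) (by norm_num), A.regs 2 (by norm_num), hs.r2]
    simp only [normalTerm, Term.eval_cond, Term.eval_less, Term.eval_reg, Term.eval_get,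
      Term.eval_sub, h28, e1, e2, ha 5 (by norm_num)]
    by_cases h : s1.arr 5 v < infDist c n <;> simp [h]
  · rintro s2 t2 ⟨h1, h2, h3, h4, h5, h6⟩
    have g8 : (Term.lit 2 * Term.reg 8).eval s2 = (2 ^ (j + 1) : ℕ) := by
      rw [Term.eval_mul, Term.eval_lit, Term.eval_reg, h3 8 (by norm_num) (by norm_num),
        A.regs 8 (by norm_num), hs.r8]
      push_cast; ring
    refine Runs.assign hK (by decide) h5 ?_
    rw [g8]
    have bz : |((2 ^ (j + 1) : ℕ) : ℤ)| ≤ μ.Z := by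
      refine abs_natCast_le ?_
      have : 2 ^ (j + 1) ≤ 2 * (n * n) := by
        rw [pow_succ]
        nlinarith
      refine le_trans ?_ hn2
      exact_mod_cast this
    have hreg : ∀ r < 9, r ≠ 8 → (s2.setReg 8 (2 ^ (j + 1) : ℕ)).reg r = s.reg r := by
      intro r hr h8
      rw [State.setReg_reg, if_neg h8, h3 r (by omega) (by omega), A.regs r hr]
    refine ⟨⟨?_, ?_, ?_, ?_, ?_, ?_, ?_, ?_, by simp, ?_, ?_, ?_, h5.setReg 8 bz, ?_, ?_⟩, ?_⟩
    · rw [hreg 0 (by norm_num) (by norm_num), hs.r0]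
    · rw [hreg 1 (by norm_num) (by norm_num), hs.r1]
    · rw [hreg 2 (by norm_num) (by norm_num), hs.r2]
    · rw [hreg 3 (by norm_num) (by norm_num), hs.r3]
    · rw [hreg 4 (by norm_num) (by norm_num), hs.r4]
    · rw [hreg 5 (by norm_num) (by norm_num), hs.r5]
    · rw [hreg 6 (by norm_num) (by norm_num), hs.r6]
    · rw [hreg 7 (by norm_num) (by norm_num), hs.r7]
    · rw [State.setReg_arr, h4 6 (by norm_num), q6]; exact hs.a6
    · rw [State.setReg_arr, pow_succ, mul_comm]
      refine hs.dists.square hB hE hWeq hprod fun i l => ?_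
      rw [natCast_index, h1 _ (index_lt_mul i l), hEX]
    · rw [State.setReg_arr, h4 5 (by norm_num)]
      exact A.mem
    · refine A.stamps.congr ?_ ?_ fun i hi => ?_
      · rw [State.setReg_reg, if_neg (by norm_num), h3 _ (by norm_num) (by norm_num)]
      · rw [State.setReg_reg, if_neg (by norm_num), h3 _ (by norm_num) (by norm_num)]
      · rw [State.setReg_arr, h4 i (by omega)]
    · rw [State.setReg_reg, if_neg (by norm_num), h3 _ (by norm_num) (by norm_num)]
      refine A.phase.trans ?_
      have h3 := hs.phase
      change s.reg 25 + (Φ : ℕ) ≤ _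
      rw [add_mul, one_mul]
      push_cast at h3 ⊢
      linarith
    · have h7 : n * n * (normalTerm.cost + 18) ≤ n * n * 60 := Nat.mul_le_mul_left _ (by omega)
      have h8 : (problem c g n W).productTime R p u q (sideExp g n) e =
        (problem c g n 0).productTime R p u q (sideExp g n) e := rfl
      rw [c2]
      omega

/-- A bound for the running time of the algorithm. -/
def apspTime (R p u q c g n e : ℕ) : ℕ :=
  numBits c n * ((problem c g n 0).productTime R p u q (sideExp g n) e + n * n * 60 + 40) +
    setupTime c g n + n * n * 60 + 100

/-- The number of rounds is bounded by `numBits`, because `2 ^ numBits` exceeds `2 * infDist` and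
therefore `n`. -/
theorem runs_apsp (hK : 20 ≤ μ.K) (hG : IsAPSPInstance c G) (hn : 1 ≤ n)
    (F : Feasible μ D k d R p u q c g n e a) :
    Runs μ (apspCode D k R c g) G.input fun s' t =>
      (∀ i j : Fin n, G.IsDistAnswer i j (s'.arr 2 ((i : ℕ) * n + (j : ℕ)))
        (s'.arr 3 ((i : ℕ) * n + (j : ℕ)))) ∧ t ≤ apspTime R p u q c g n e := by
  set Φ := e * ((sideExp g n + 1) * ((problem c g n 0).numBlocks * (n + 1))) with hΦ
  have hX : (infDist c n : ℤ) ≤ μ.Z := by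
    linarith [F.X_le, Int.natCast_nonneg (infDist c n)]
  have hEX : 4 * (distBound c n : ℤ) + 1 = infDist c n := by simp [infDist]
  have hn2 := (F.ctx 0 fun _ _ => Nat.zero_le _).n_le
  change 2 * ((n : ℤ) * n) ≤ _ at hn2
  have hn1 : (1 : ℤ) ≤ n := by exact_mod_cast hn
  have hZ := μ.two_le
  have hB := hG.abs_le
  set τ := (problem c g n 0).productTime R p u q (sideExp g n) e + n * n * 60 + 40 with hτ
  -- The last length may be almost `2 * n`; this explains the factor 2 in `distBound`.
  have hlen : ∀ j, 2 ^ j < 2 * n → 2 ^ j * n ^ c ≤ distBound c n := by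
    intro j hj
    unfold distBound
    rw [pow_succ, mul_comm (n ^ c), ← mul_assoc]
    exact Nat.mul_le_mul_right _ hj.le
  have hev : ∀ (j : ℕ) (s' : State), s'.reg 8 = (2 ^ j : ℕ) → s'.reg 0 = n →
      ((Term.less (.reg 8) (.reg 0)).eval s' = 0 ↔ n ≤ 2 ^ j) := by
    intro j s' h1 h2
    have h3 : (((2 ^ j : ℕ) : ℤ) < n) ↔ 2 ^ j < n := by norm_cast
    rw [Term.eval_less, Term.eval_reg, Term.eval_reg, h1, h2]
    simp only [h3]
    split_ifs <;> simp <;> omega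
  have c0 : (Term.less (.reg 8) (.reg 0)).cost = 5 := rfl
  refine Runs.seq ((runs_setup hK hG hn F Φ).mono ?_)
  rintro s0 t0 ⟨R0, ht0⟩
  refine Runs.seq (Runs.whileDo (Term.Fits.good (by decide) hK) (fun k s' t =>
    ∃ j, j + k = numBits c n ∧ Ready μ c g G j Φ s' ∧ 2 ^ j < 2 * n ∧ t ≤ j * τ + 5)
    (numBits c n) ?_ ?_ ?_ ?_ ?_)
  · rintro k s' t ⟨j, -, H, -⟩
    exact Term.Fits.small (by decide) hZ H.bounded
  · rintro s' t ⟨j, hj, H, -⟩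
    rw [hev j s' H.r8 H.r0]
    have h1 := lt_two_pow_numBits c n
    have h2 : n * 1 ≤ n * n ^ c := Nat.mul_le_mul_left _ (Nat.pow_pos hn)
    rw [show j = numBits c n by omega]
    refine le_trans ?_ h1.le
    unfold infDist distBound
    rw [pow_succ, mul_comm (n ^ c)]
    omega
  · rintro k s' t ⟨j, hj, H, h2, ht⟩ hne
    have hlt : 2 ^ j < n := by
      by_contra hc
      exact hne ((hev j s' H.r8 H.r0).2 (by omega))
    refine (runs_square hK hG hn F hlt H).mono ?_
    rintro s2 t2 ⟨H2, ht2⟩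
    refine ⟨k, le_rfl, j + 1, by omega, H2, by rw [pow_succ]; omega, ?_⟩
    rw [c0, add_mul]
    omega
  · exact ⟨0, by omega, R0, by omega, by rw [c0]; omega⟩
  rintro k s1 t1 ⟨j, hj, H, h2j, ht1⟩ hz
  have hle := (hev j s1 H.r8 H.r0).1 hz
  have hm := H.dists.mem hB (hlen j h2j)
  have ha4 : ∀ v < n * n, 0 ≤ s1.arr 4 v ∧ s1.arr 4 v ≤ infDist c n := by
    intro v hv
    have hn' : 0 < n := hn
    have := hm ⟨v / n, Nat.div_lt_of_lt_mul hv⟩ ⟨v % n, Nat.mod_lt _ hn'⟩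
    rw [natCast_index, hEX] at this
    simpa only [mul_comm (v / n), Nat.div_add_mod] using this
  have hn2' : ((n * n : ℕ) : ℤ) ≤ μ.Z := by push_cast; nlinarith
  refine Runs.seq ((runs_map hK (by norm_num) (by decide) (n := n) H.r0 hn2' H.bounded
    (f := fun v => if s1.arr 4 v < infDist c n then 1 else 0)
    (fun v hv => ?_) fun v hv s' h28 hr ha => ?_).mono ?_)
  · split_ifs <;> simp <;> linarith
  · rw [Term.eval_less, Term.eval_get, Term.eval_reg, Term.eval_reg, h28, ha 4 (by norm_num),
      hr 1 (by norm_num) (by norm_num), H.r1]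
  rintro s2 t2 ⟨h1, -, h3, h4, h5, h6⟩
  refine (runs_map hK (by norm_num) (by decide) (n := n)
    (by rw [h3 0 (by norm_num) (by norm_num), H.r0]) hn2' h5
    (f := fun v => s1.arr 4 v - distBound c n)
    (fun v hv => ?_) fun v hv s' h28 hr ha => ?_).mono ?_
  · have := ha4 v hv
    rw [abs_le]
    constructor <;> linarith
  · rw [Term.eval_sub, Term.eval_get, Term.eval_reg, Term.eval_reg, h28, ha 4 (by norm_num),
      h4 4 (by norm_num), hr 2 (by norm_num) (by norm_num), h3 2 (by norm_num) (by norm_num), H.r2]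
  rintro s3 t3 ⟨e1, -, -, e4, -, e6⟩
  refine ⟨fun i l => ?_, ?_⟩
  · have := H.dists.isDistAnswer hB (hlen j h2j) hle hG.2 i l
    rw [natCast_index] at this ⊢
    rw [e1 _ (index_lt_mul i l), e4 2 (by norm_num), h1 _ (index_lt_mul i l), ← hEX]
    exact this
  · have q1 : j * τ ≤ numBits c n * τ := Nat.mul_le_mul_right _ (by omega)
    have q2 : (Term.less (.get 4 (.reg 28)) (.reg 1)).cost ≤ 10 := by decide
    have q3 : ((Term.get 4 (.reg 28)) - (.reg 2)).cost ≤ 10 := by decide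
    have q4 := Nat.mul_le_mul_left (n * n) (Nat.add_le_add_right q2 18)
    have q5 := Nat.mul_le_mul_left (n * n) (Nat.add_le_add_right q3 18)
    unfold apspTime
    rw [← hτ]
    omega

end main

/-! ### Running times of data structures -/

theorem Exec.one_le {B : ℤ} {c : Cmd} {s s' : State} {t : ℕ} (h : Exec B c s s' t) : 1 ≤ t := by
  induction h <;> omega

/-- Since programs take at least one step, a single admissible update and a query show `u N ≥ 1` and
`q N ≥ 1`. Without such bounds a bound for the product `q * u` would say nothing about the factors.
The weights 1 and 2 of the edge `{0, 1}` are the reason for `1 ≤ d` and `2 ≤ N`. -/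
theorem UpdateKind.exists_step (k : UpdateKind) {d N : ℕ} (hd : 1 ≤ d) (hN : 2 ≤ N) :
    ∃ (G G' : WGraph N) (a b : Fin N) (x : ℤ), IsPlanarInstance d G ∧ k.Initial G ∧
      k.Step G a b x G' ∧ IsPlanarInstance d G' := by
  have hpow : (2 : ℤ) ≤ (N : ℤ) ^ d := by
    calc (2 : ℤ) ≤ (N : ℤ) ^ 1 := by simpa using (by exact_mod_cast hN : (2 : ℤ) ≤ N)
      _ ≤ _ := pow_le_pow_right₀ (by exact_mod_cast (by omega : 1 ≤ N)) hd
  have hsc : ∀ e, 0 ≤ k.shortcut 1 e 0 ∧ k.shortcut 1 e 0 ≤ (N : ℤ) ^ d := by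
    intro e
    unfold shortcut inactive
    split_ifs
    · cases k <;> simp <;> linarith
    · constructor <;> linarith
  have hplanar : ∀ e, IsPlanarInstance d (gridG N 2
      (Function.update (fun _ => 0) 0 (k.shortcut 1 e 0)) fun _ => 0) := by
    refine fun e => gridG_isPlanarInstance le_rfl (fun v => ?_) (fun v => ⟨le_rfl, by positivity⟩) ?_
    · rw [Function.update_apply]
      split_ifs
      · exact hsc e
      · exact ⟨le_rfl, by positivity⟩
    · intro v hv
      rw [Function.update_apply] at hv
      split_ifs at hv with h
      · subst h; norm_num
      · exact absurd rfl hv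
  set a : Fin N := ⟨0, by omega⟩
  set b : Fin N := ⟨1, by omega⟩
  have hab : (b : ℕ) = a + 1 := rfl
  refine ⟨_, _, a, b, k.shortcut 1 k.bit 0, hplanar (1 - k.bit), ?_,
    k.step_shortcut le_rfl (by rw [gridG_horizontal hab]; simp [a]), ?_⟩
  · cases k
    · change ∀ i j, _ = none
      have : Function.update (fun _ => (0 : ℤ)) 0 (shortcut .insert 1 (1 - bit .insert) 0) =
          fun _ => 0 := by
        funext v
        simp [shortcut, bit, inactive, Function.update_apply]
      rw [this, gridG_zero]
      exact fun _ _ => rfl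
    all_goals trivial
  · rw [gridG_setEdge_horizontal le_rfl hab]
    change IsPlanarInstance d (gridG N 2 (Function.update (Function.update _ 0 _) 0 _) _)
    rw [Function.update_idem]
    exact hplanar _

theorem DynAlg.Solves.one_le {D : DynAlg} {k : UpdateKind} {d p N : ℕ} {q u : ℕ → ℝ}
    (h : D.Solves k d p q u) (hd : 1 ≤ d) (hN : 2 ≤ N) : 1 ≤ q N ∧ 1 ≤ u N := by
  obtain ⟨G, G', a, b, x, hG, hini, hstep, hG'⟩ := k.exists_step hd hN
  obtain ⟨⟨K, hprep⟩, hupd, hqry⟩ := h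
  obtain ⟨s, t, hE, -⟩ := hprep N (by omega) G hG hini
  have hs := DynAlg.Reach.init hG hini hE
  obtain ⟨_, t1, h1, h2, -⟩ := hqry N (by omega) G s hs a b
  obtain ⟨_, t2, h3, h4⟩ := hupd N (by omega) G s hs a b x G' hstep hG'
  exact ⟨le_trans (by exact_mod_cast h1.one_le) h2, le_trans (by exact_mod_cast h3.one_le) h4⟩

theorem DynAlg.Solves.exists_solvesAt {D : DynAlg} {k : UpdateKind} {d p : ℕ} {q u : ℕ → ℝ}
    (h : D.Solves k d p q u) : ∃ K : ℕ, ∀ N, 1 ≤ N →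
      D.SolvesAt k d N (K * N ^ p) ⌊u N⌋₊ ⌊q N⌋₊ := by
  obtain ⟨⟨K, hprep⟩, hupd, hqry⟩ := h
  refine ⟨⌈K⌉₊, fun N hN => ⟨fun G hG hini => ?_, fun G s hs a b x G' hst hG' => ?_,
    fun G s hs a b => ?_⟩⟩
  · obtain ⟨s, t, hE, ht⟩ := hprep N hN G hG hini
    refine ⟨s, t, hE, ?_⟩
    have : (t : ℝ) ≤ (⌈K⌉₊ * N ^ p : ℕ) := by
      refine ht.trans ?_
      push_cast
      exact mul_le_mul_of_nonneg_right (Nat.le_ceil K) (by positivity)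
    exact_mod_cast this
  · obtain ⟨s', t, hE, ht⟩ := hupd N hN G s hs a b x G' hst hG'
    exact ⟨s', t, hE, Nat.le_floor ht⟩
  · obtain ⟨s', t, hE, ht, hans⟩ := hqry N hN G s hs a b
    exact ⟨s', t, hE, Nat.le_floor ht, hans⟩

/-- A shape of the blocks for which updates and queries are balanced. -/
theorem exists_shape (ℓ u q : ℕ) : ∃ a ≤ ℓ, (2 ^ a * u + 2 ^ (ℓ - a) * q) ^ 2 ≤
    4 * u ^ 2 + 4 * q ^ 2 + 16 * (2 ^ ℓ * (u * q)) := by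
  have hsplit : ∀ a ≤ ℓ, 2 ^ ℓ = 2 ^ a * 2 ^ (ℓ - a) := fun a ha => by
    rw [← pow_add]; congr 1; omega
  -- Here updates dominate even for blocks of height 1, so only the term with `u ^ 2` is needed.
  by_cases h0 : 2 ^ ℓ * q < u
  · refine ⟨0, Nat.zero_le _, ?_⟩
    rw [pow_zero, one_mul, Nat.sub_zero]
    have : (u + 2 ^ ℓ * q) ^ 2 ≤ (2 * u) ^ 2 := Nat.pow_le_pow_left (by omega) 2
    nlinarith [Nat.zero_le (2 ^ ℓ * (u * q)), Nat.zero_le (q ^ 2)]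
  · have hP : 2 ^ 0 * u ≤ 2 ^ (ℓ - 0) * q := by simpa using not_lt.1 h0
    -- A point where the comparison of the two sides changes, or the end of the range.
    obtain ⟨a, ha, h1, h2⟩ : ∃ a ≤ ℓ, 2 ^ a * u ≤ 2 ^ (ℓ - a) * q ∧
        (a = ℓ ∨ 2 ^ (ℓ - (a + 1)) * q < 2 ^ (a + 1) * u) := by
      by_contra! hc
      have : ∀ a ≤ ℓ, 2 ^ a * u ≤ 2 ^ (ℓ - a) * q := by
        intro a
        induction a with
        | zero => exact fun _ => hP
        | succ a ih => exact fun ha => (hc a (by omega) (ih (by omega))).2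
      exact (hc ℓ le_rfl (this ℓ le_rfl)).1 rfl
    refine ⟨a, ha, ?_⟩
    have h3 : (2 ^ a * u + 2 ^ (ℓ - a) * q) ^ 2 ≤ (2 * (2 ^ (ℓ - a) * q)) ^ 2 :=
      Nat.pow_le_pow_left (by omega) 2
    rcases eq_or_ne a ℓ with rfl | hne
    · rw [Nat.sub_self, pow_zero, one_mul] at h3 ⊢
      nlinarith [Nat.zero_le (2 ^ a * (u * q)), Nat.zero_le (u ^ 2)]
    · have h4 := h2.resolve_left hne
      -- From `a` to `a + 1` both sides change by a factor of 2 and the inequality is reversed, so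
      -- the sides differ by at most a factor of 4 at `a`. Their product is independent of `a`.
      have h5 : 2 ^ (ℓ - a) * q ≤ 4 * (2 ^ a * u) := by
        have e : ℓ - a = ℓ - (a + 1) + 1 := by omega
        rw [e, pow_succ]
        rw [pow_succ] at h4
        nlinarith
      have h6 : (2 ^ (ℓ - a) * q) * (2 ^ (ℓ - a) * q) ≤
          4 * (2 ^ a * u) * (2 ^ (ℓ - a) * q) := Nat.mul_le_mul_right _ h5
      have h7 : 4 * (2 ^ a * u) * (2 ^ (ℓ - a) * q) = 4 * (2 ^ ℓ * (u * q)) := by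
        rw [hsplit a ha]; ring
      nlinarith [Nat.zero_le (u ^ 2), Nat.zero_le (q ^ 2)]

/-! ### Asymptotics -/

/-- `f n = O(n ^ a)`, for all `n ≥ 1` -/
def Grows (f : ℕ → ℕ) (a : ℝ) : Prop := ∃ C : ℝ, ∀ n, 1 ≤ n → (f n : ℝ) ≤ C * (n : ℝ) ^ a

namespace Grows

variable {f h : ℕ → ℕ} {a b : ℝ}

theorem one_le_rpow {n : ℕ} (hn : 1 ≤ n) (ha : 0 ≤ a) : 1 ≤ (n : ℝ) ^ a :=
  Real.one_le_rpow (by exact_mod_cast hn) ha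

theorem exists_pos (hf : Grows f a) :
    ∃ C : ℝ, 0 < C ∧ ∀ n, 1 ≤ n → (f n : ℝ) ≤ C * (n : ℝ) ^ a := by
  obtain ⟨C, hC⟩ := hf
  refine ⟨max C 1, by positivity, fun n hn => (hC n hn).trans ?_⟩
  gcongr
  exact le_max_left _ _

theorem mono (hf : Grows f a) (hh : ∀ n, 1 ≤ n → h n ≤ f n) : Grows h a := by
  obtain ⟨C, hC⟩ := hf
  exact ⟨C, fun n hn => le_trans (by exact_mod_cast hh n hn) (hC n hn)⟩

theorem le (hf : Grows f a) (hab : a ≤ b) : Grows f b := by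
  obtain ⟨C, h0, hC⟩ := hf.exists_pos
  refine ⟨C, fun n hn => (hC n hn).trans ?_⟩
  gcongr
  exact_mod_cast hn

theorem add (hf : Grows f a) (hh : Grows h a) : Grows (fun n => f n + h n) a := by
  obtain ⟨C, hC⟩ := hf
  obtain ⟨C', hC'⟩ := hh
  refine ⟨C + C', fun n hn => ?_⟩
  push_cast
  rw [add_mul]
  exact add_le_add (hC n hn) (hC' n hn)

theorem mul (hf : Grows f a) (hh : Grows h b) : Grows (fun n => f n * h n) (a + b) := by
  obtain ⟨C, h0, hC⟩ := hf.exists_pos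
  obtain ⟨C', h0', hC'⟩ := hh.exists_pos
  refine ⟨C * C', fun n hn => ?_⟩
  have hn' : (0 : ℝ) < n := by exact_mod_cast hn
  push_cast
  rw [Real.rpow_add hn', mul_mul_mul_comm]
  exact mul_le_mul (hC n hn) (hC' n hn) (by positivity) (by positivity)

theorem const (k : ℕ) (ha : 0 ≤ a) : Grows (fun _ => k) a :=
  ⟨k, fun n hn => le_mul_of_one_le_right (by positivity) (one_le_rpow hn ha)⟩

theorem const_mul (k : ℕ) (hf : Grows f a) : Grows (fun n => k * f n) a := by
  simpa using (const k le_rfl).mul hf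

theorem id : Grows (fun n => n) 1 := ⟨1, fun n _ => by simp⟩

theorem pow (hf : Grows f a) (k : ℕ) : Grows (fun n => f n ^ k) (k * a) := by
  induction k with
  | zero => simpa using const 1 le_rfl
  | succ k ih =>
    have := ih.mul hf
    simp only [pow_succ]
    exact this.le (by push_cast; linarith)

/-- The exponent of a polynomially growing power of two grows slowly. -/
theorem of_two_pow (hf : Grows (fun n => 2 ^ f n) a) {η : ℝ} (hη : 0 < η) : Grows f η := by
  obtain ⟨C, h0, hC⟩ := hf.exists_pos
  -- The exponent is chosen such that `a * s ≤ η`; then `f` is compared with `(2 ^ f) ^ s` by means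
  -- of `x + 1 ≤ exp x`.
  set s := η / (|a| + 1) with hs
  have ha : 0 < |a| + 1 := by positivity
  have hs0 : 0 < s := by positivity
  have hl : 0 < s * Real.log 2 := mul_pos hs0 (Real.log_pos (by norm_num))
  have has : a * s ≤ η := by
    rw [hs, mul_div_assoc', div_le_iff₀ ha, mul_comm]
    exact mul_le_mul_of_nonneg_left (by linarith [le_abs_self a]) hη.le
  refine ⟨(s * Real.log 2)⁻¹ * C ^ s, fun n hn => ?_⟩
  have hn' : (1 : ℝ) ≤ n := by exact_mod_cast hn
  have h1 : s * Real.log 2 * f n ≤ ((2 : ℝ) ^ f n) ^ s := by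
    rw [← Real.rpow_natCast, ← Real.rpow_mul (by norm_num), Real.rpow_def_of_pos (by norm_num)]
    have := Real.add_one_le_exp (Real.log 2 * (f n * s))
    linarith
  have h2 : ((2 : ℝ) ^ f n) ^ s ≤ C ^ s * (n : ℝ) ^ η := by
    have h3 := hC n hn
    push_cast at h3
    calc ((2 : ℝ) ^ f n) ^ s ≤ (C * (n : ℝ) ^ a) ^ s :=
          Real.rpow_le_rpow (by positivity) h3 hs0.le
      _ = C ^ s * (n : ℝ) ^ (a * s) := by
          rw [Real.mul_rpow h0.le (by positivity), ← Real.rpow_mul (by positivity)]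
      _ ≤ _ := by gcongr
  rw [mul_assoc, ← div_eq_inv_mul, le_div_iff₀ hl, mul_comm]
  exact h1.trans h2

theorem of_sq (hf : Grows (fun n => f n ^ 2) (2 * a)) : Grows f a := by
  obtain ⟨C, h0, hC⟩ := hf.exists_pos
  refine ⟨√C, fun n hn => ?_⟩
  refine le_of_sq_le_sq ?_ (by positivity)
  have := hC n hn
  push_cast at this
  rwa [mul_pow, Real.sq_sqrt h0.le, ← Real.rpow_mul_natCast (by positivity), mul_comm a,
    Nat.cast_ofNat]

theorem of_le_rpow (hf : Grows f a) {s C : ℝ} (hs : 0 ≤ s) (hC0 : 0 ≤ C)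
    (hh : ∀ n, 1 ≤ n → (h n : ℝ) ≤ C * (f n : ℝ) ^ s) : Grows h (a * s) := by
  obtain ⟨C', h0, hC'⟩ := hf.exists_pos
  refine ⟨C * C' ^ s, fun n hn => (hh n hn).trans ?_⟩
  rw [mul_assoc, Real.rpow_mul (by positivity), ← Real.mul_rpow h0.le (by positivity)]
  gcongr
  exact hC' n hn

end Grows

/-- The function is bounded by a polynomial. -/
def PolyBdd (f : ℕ → ℕ) : Prop := ∃ a, Grows f a

namespace PolyBdd

variable {f h : ℕ → ℕ}

theorem add (hf : PolyBdd f) (hh : PolyBdd h) : PolyBdd fun n => f n + h n := by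
  obtain ⟨a, ha⟩ := hf
  obtain ⟨b, hb⟩ := hh
  exact ⟨_, (ha.le (le_max_left a b)).add (hb.le (le_max_right a b))⟩

theorem mul (hf : PolyBdd f) (hh : PolyBdd h) : PolyBdd fun n => f n * h n :=
  ⟨_, hf.choose_spec.mul hh.choose_spec⟩

theorem pow (hf : PolyBdd f) (k : ℕ) : PolyBdd fun n => f n ^ k := ⟨_, hf.choose_spec.pow k⟩

theorem const (k : ℕ) : PolyBdd fun _ => k := ⟨_, Grows.const k le_rfl⟩

theorem exists_le_pow (hf : PolyBdd f) : ∃ κ, ∀ n, 1 ≤ n → f n ≤ (n + 2) ^ κ := by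
  obtain ⟨a, hf⟩ := hf
  obtain ⟨C, h0, hC⟩ := hf.exists_pos
  obtain ⟨i, hi⟩ := pow_unbounded_of_one_lt C (show (1 : ℝ) < 2 by norm_num)
  refine ⟨i + ⌈a⌉₊, fun n hn => ?_⟩
  have hn' : (1 : ℝ) ≤ n := by exact_mod_cast hn
  have h1 : (f n : ℝ) ≤ ((n : ℝ) + 2) ^ (i + ⌈a⌉₊) := by
    refine (hC n hn).trans ?_
    rw [pow_add]
    refine mul_le_mul (hi.le.trans ?_) ?_ (by positivity) (by positivity)
    · gcongr; linarith
    · rw [← Real.rpow_natCast]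
      refine (Real.rpow_le_rpow_of_exponent_le hn' (Nat.le_ceil a)).trans ?_
      gcongr; linarith
  exact_mod_cast h1

end PolyBdd

/-! ### Growth of the parameters and of the running time -/

section growth

variable {c g p K R : ℕ} {u q : ℕ → ℕ}

theorem grows_distBound (c : ℕ) : Grows (distBound c) (c + 1) := by
  have := (Grows.id.pow (c + 1)).const_mul 2
  exact this.le (by push_cast; linarith)

theorem grows_infDist (c : ℕ) : Grows (infDist c) (c + 1) :=
  ((grows_distBound c).const_mul 4).add (Grows.const 1 (by positivity))

theorem grows_numBits (c : ℕ) {η : ℝ} (hη : 0 < η) : Grows (numBits c) η :=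
  (((grows_infDist c).const_mul 4).mono fun n _ => two_pow_numBits_le c n).of_two_pow hη

theorem two_pow_sideExp_le (hg : 0 < g) {n : ℕ} (hn : 1 ≤ n) : (2 ^ sideExp g n) ^ g ≤ n := by
  rw [← pow_mul, mul_comm]
  exact (le_sideExp_iff hg hn).1 le_rfl

theorem lt_two_mul_two_pow_sideExp (hg : 0 < g) {n : ℕ} (hn : 1 ≤ n) :
    n < (2 * 2 ^ sideExp g n) ^ g := by
  rw [← pow_succ', ← pow_mul, mul_comm]
  exact not_le.1 fun h => absurd ((le_sideExp_iff hg hn).2 h) (by omega)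

theorem side_le (hg : 0 < g) {n : ℕ} (hn : 1 ≤ n) : 2 ^ sideExp g n ≤ n :=
  (Nat.le_self_pow (by omega) _).trans (two_pow_sideExp_le hg hn)

theorem grows_side (hg : 0 < g) : Grows (fun n => 2 ^ sideExp g n) (1 / g) := by
  have hg' : (0 : ℝ) < g := by exact_mod_cast hg
  refine ⟨1, fun n hn => ?_⟩
  rw [one_mul, one_div, Real.le_rpow_inv_iff_of_pos (by positivity) (by positivity) hg',
    Real.rpow_natCast]
  exact_mod_cast two_pow_sideExp_le hg hn

theorem rpow_le_side (hg : 0 < g) {n : ℕ} (hn : 1 ≤ n) :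
    (n : ℝ) ^ (1 / g : ℝ) ≤ 2 * 2 ^ sideExp g n := by
  have hg' : (0 : ℝ) < g := by exact_mod_cast hg
  rw [one_div, Real.rpow_inv_le_iff_of_pos (by positivity) (by positivity) hg', Real.rpow_natCast]
  exact_mod_cast (lt_two_mul_two_pow_sideExp hg hn).le

theorem grows_sideExp (hg : 0 < g) {η : ℝ} (hη : 0 < η) : Grows (fun n => sideExp g n + 1) η :=
  ((grows_side hg).of_two_pow hη).add (Grows.const 1 hη.le)

theorem grows_numVerts (hg : 0 < g) (c : ℕ) {η : ℝ} (hη : 0 < η) :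
    Grows (numVerts c g) (1 / g + η) :=
  ((grows_side hg).const_mul 2).mul ((grows_numBits c hη).add (Grows.const 5 hη.le))

/-- Rounding the side to a power of two costs at most a factor of 2, by `rpow_le_side`. -/
theorem grows_numBlocks (hg : 0 < g) (c : ℕ) :
    Grows (fun n => (problem c g n 0).numBlocks) (2 - 1 / g) := by
  refine ⟨8, fun n hn => ?_⟩
  have hn' : (0 : ℝ) < n := by exact_mod_cast hn
  have h1 := rpow_le_side hg hn
  have h2 : ((problem c g n 0).numBlocks : ℝ) ≤ 4 * (n * n) / 2 ^ sideExp g n := by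
    refine Nat.cast_div_le.trans ?_
    simp [problem]
  refine h2.trans ?_
  rw [Real.rpow_sub hn', mul_div_assoc', div_le_div_iff₀ (by positivity) (by positivity)]
  have h3 : (n : ℝ) ^ (2 : ℝ) = n * n := by rw [Real.rpow_two, sq]
  rw [h3]
  nlinarith [mul_pos hn' hn']

theorem numVerts_bounds (c g n : ℕ) : 12 ≤ numVerts c g n ∧ 2 * 2 ^ sideExp g n ≤ numVerts c g n ∧
    numBits c n + 5 ≤ numVerts c g n := by
  have h1 : 1 ≤ 2 ^ sideExp g n := Nat.one_le_two_pow
  have h2 : 1 ≤ numBits c n := Nat.le_add_left 1 _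
  unfold numVerts
  refine ⟨?_, ?_, ?_⟩ <;> nlinarith

/-- The edge weights of the grids are bounded by a power of the number of vertices. -/
theorem heavy_le (hg : 0 < g) {n m w j₀ k₀ : ℕ} (hn : 1 ≤ n) (hm : 1 ≤ m) (hw : 1 ≤ w)
    (hmw : m * w = 2 ^ sideExp g n) (W : ℕ → ℕ → ℕ) :
    ((problem c g n W).job m w j₀ k₀).gadget.heavy ≤ (numVerts c g n : ℤ) ^ (g * (c + 1) + 5) := by
  obtain ⟨hV, hY, hL⟩ := numVerts_bounds c g n
  set V := numVerts c g n
  set L := numBits c n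
  have hmV : 2 * m ≤ V := by
    have := Nat.le_mul_of_pos_right m hw
    omega
  have hwV : 2 * w ≤ V := by
    have := Nat.le_mul_of_pos_left w hm
    omega
  -- This inequality is what makes weights polynomial in `n` polynomial in the much smaller number
  -- of vertices.
  have hnV : n ≤ V ^ g := (lt_two_mul_two_pow_sideExp hg hn).le.trans (Nat.pow_le_pow_left hY g)
  have hX : infDist c n ≤ 9 * V ^ (g * (c + 1)) := by
    have h1 : n ^ (c + 1) ≤ V ^ (g * (c + 1)) := by
      rw [pow_mul]; exact Nat.pow_le_pow_left hnV _
    have h2 : 1 ≤ V ^ (g * (c + 1)) := Nat.one_le_pow _ _ (by omega)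
    unfold infDist distBound
    omega
  have h1 : (3 * L + 3) * (4 * infDist c n) * (4 * m + 3 * w + L + 4) + 1 ≤
      V ^ (g * (c + 1) + 5) := by
    calc (3 * L + 3) * (4 * infDist c n) * (4 * m + 3 * w + L + 4) + 1
        ≤ (3 * V) * (4 * (9 * V ^ (g * (c + 1)))) * (5 * V) + 1 := by
          gcongr
          · omega
          · omega
      _ = 540 * V ^ (g * (c + 1)) * V ^ 2 + 1 := by ring
      _ ≤ V ^ 3 * V ^ (g * (c + 1)) * V ^ 2 := by
          have h2 : 541 ≤ V ^ 3 := le_trans (by norm_num) (Nat.pow_le_pow_left hV 3)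
          have h3 : 1 ≤ V ^ (g * (c + 1)) * V ^ 2 :=
            Nat.one_le_iff_ne_zero.2 (by positivity)
          nlinarith
      _ = _ := by ring
  have e : ((problem c g n W).job m w j₀ k₀).gadget.heavy =
      (((3 * L + 3) * (4 * infDist c n) * (4 * m + 3 * w + L + 4) + 1 : ℕ) : ℤ) := by
    simp [Gadget.heavy, Job.gadget, Prob.job, problem, L]
  rw [e]
  exact_mod_cast h1

/-- The heights of the blocks are `2 ^ blockExp g u q n`. -/
noncomputable def blockExp (g : ℕ) (u q : ℕ → ℕ) (n : ℕ) : ℕ :=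
  (exists_shape (sideExp g n) (u n) (q n)).choose

theorem blockExp_le (g : ℕ) (u q : ℕ → ℕ) (n : ℕ) : blockExp g u q n ≤ sideExp g n :=
  (exists_shape (sideExp g n) (u n) (q n)).choose_spec.1

/-- The time limit that is sufficient for the product. -/
noncomputable def required (c g : ℕ) (u q : ℕ → ℕ) (n : ℕ) : ℕ :=
  (problem c g n 0).parts (2 ^ blockExp g u q n) *
    ((problem c g n 0).parts (2 ^ (sideExp g n - blockExp g u q n)) * n) *
    (problem c g n 0).rowTime (u n) (q n) (2 ^ blockExp g u q n)
      (2 ^ (sideExp g n - blockExp g u q n))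

noncomputable def limitExp (c g : ℕ) (u q : ℕ → ℕ) (n : ℕ) : ℕ := Nat.log 2 (required c g u q n) + 1

theorem required_le (c g : ℕ) (u q : ℕ → ℕ) (n : ℕ) :
    required c g u q n ≤ 2 ^ limitExp c g u q n := (Nat.lt_pow_succ_log_self (by norm_num) _).le

theorem two_pow_limitExp_le {n : ℕ} (hn : 1 ≤ n) :
    2 ^ limitExp c g u q n ≤ 2 * required c g u q n := by
  have h0 : required c g u q n ≠ 0 := by
    unfold required Prob.parts Prob.rowTime
    positivity
  have := Nat.pow_log_le_self 2 h0
  rw [limitExp, pow_succ]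
  omega

/-- The assumptions on the running times of the data structure. -/
structure Times (c g : ℕ) (δ : ℝ) (u q : ℕ → ℕ) : Prop where
  pos : 0 < δ
  le_one : δ ≤ 1
  u_pos : ∀ n, 1 ≤ n → 1 ≤ u n
  q_pos : ∀ n, 1 ≤ n → 1 ≤ q n
  mul_le : ∃ C : ℝ, ∀ n, 1 ≤ n → ((u n * q n : ℕ) : ℝ) ≤ C * (numVerts c g n : ℝ) ^ (1 - δ)

variable {δ : ℝ}

theorem Times.grows_mul (H : Times c g δ u q) (hg : 0 < g) {η : ℝ} (hη : 0 < η) :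
    Grows (fun n => u n * q n) ((1 / g + η) * (1 - δ)) := by
  obtain ⟨C, hC⟩ := H.mul_le
  refine (grows_numVerts hg c hη).of_le_rpow (C := max C 0) (by linarith [H.le_one])
    (le_max_right _ _) fun n hn => (hC n hn).trans ?_
  gcongr
  exact le_max_left _ _

/-- The square is estimated by `exists_shape`. Because `u` and `q` are at least 1, the terms `u ^ 2`
and `q ^ 2` are at most `(u * q) ^ 2`. The main term is `Y * u * q`, with exponent at most `(1 / g +
η) * (2 - δ)`. -/
theorem Times.grows_balanced (H : Times c g δ u q) (hg : 0 < g) {η : ℝ} (hη : 0 < η) :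
    Grows (fun n => 2 ^ blockExp g u q n * u n + 2 ^ (sideExp g n - blockExp g u q n) * q n)
      ((1 / g + η) * (1 - δ / 2)) := by
  have hg' : (0 : ℝ) < g := by exact_mod_cast hg
  have hpos : 0 < 1 / g + η := by positivity
  have h1 := H.grows_mul hg hη
  have h2 := ((h1.pow 2).const_mul 8).le (b := 2 * ((1 / g + η) * (1 - δ / 2))) (by
    push_cast
    nlinarith [H.pos])
  have h3 := (((grows_side hg).mul h1).const_mul 16).le (b := 2 * ((1 / g + η) * (1 - δ / 2))) (by
    nlinarith)
  refine ((h2.add h3).mono fun n hn => ?_).of_sq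
  refine (exists_shape (sideExp g n) (u n) (q n)).choose_spec.2.trans ?_
  have e1 : u n ≤ u n * q n := Nat.le_mul_of_pos_right _ (H.q_pos n hn)
  have e2 : q n ≤ u n * q n := Nat.le_mul_of_pos_left _ (H.u_pos n hn)
  have e3 := Nat.pow_le_pow_left e1 2
  have e4 := Nat.pow_le_pow_left e2 2
  omega

/-- The number of blocks, the `n` rows, the number of bits and the balanced sum have exponents `2 -
1 / g`, `1`, `η` and `(1 / g + η) * (1 - δ / 2)`. The terms `1 / g` cancel and `- δ / (2 * g)` is
the gain. -/
theorem Times.grows_required (H : Times c g δ u q) (hg : 0 < g) {η : ℝ} (hη : 0 < η) :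
    Grows (required c g u q) (3 - δ / (2 * g) + 2 * η) := by
  have h := (((grows_numBlocks hg c).mul Grows.id).mul
    (((grows_numBits c hη).add (Grows.const 1 hη.le)).mul (H.grows_balanced hg hη))).const_mul 2
  refine (h.mono fun n hn => ?_).le ?_
  · have ha := blockExp_le g u q n
    have hmw : 2 ^ blockExp g u q n * 2 ^ (sideExp g n - blockExp g u q n) = 2 ^ sideExp g n := by
      rw [← pow_add]; congr 1; omega
    have h1 := Prob.parts_mul_parts_le (P := problem c g n 0) (side_le hg hn) Nat.one_le_two_pow
      Nat.one_le_two_pow hmw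
    have hu := H.u_pos n hn
    have hq := H.q_pos n hn
    unfold required
    set m := 2 ^ blockExp g u q n
    set w := 2 ^ (sideExp g n - blockExp g u q n)
    have h2 : (problem c g n 0).rowTime (u n) (q n) m w ≤
        2 * ((numBits c n + 1) * (m * u n + w * q n)) := by
      change m * (numBits c n * (u n + 1) + 1) + w * (q n + 1) ≤ _
      have e1 : numBits c n * (u n + 1) + 1 ≤ (numBits c n + 1) * (2 * u n) := by nlinarith
      have e2 := Nat.mul_le_mul_left m e1
      have e3 : q n + 1 ≤ (numBits c n + 1) * (2 * q n) := by nlinarith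
      have e4 := Nat.mul_le_mul_left w e3
      calc _ ≤ m * ((numBits c n + 1) * (2 * u n)) + w * ((numBits c n + 1) * (2 * q n)) :=
            Nat.add_le_add e2 e4
        _ = _ := by ring
    calc _ = (problem c g n 0).parts m * (problem c g n 0).parts w * n *
          (problem c g n 0).rowTime (u n) (q n) m w := by ring
      _ ≤ (problem c g n 0).numBlocks * n * (2 * ((numBits c n + 1) * (m * u n + w * q n))) := by
          gcongr
      _ = _ := by ring
  · have e : δ / (2 * g) = 1 / g * (δ / 2) := by ring
    rw [e]
    nlinarith [H.pos]

/-- Either factor is at most the product, since the other one is at least 1. -/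
theorem Times.grows_u (H : Times c g δ u q) (hg : 0 < g) {η : ℝ} (hη : 0 < η) :
    Grows u (1 / g + η) ∧ Grows q (1 / g + η) := by
  have hg' : (0 : ℝ) < g := by exact_mod_cast hg
  have h := (H.grows_mul hg hη).le (b := 1 / g + η) (by
    have : 0 < 1 / g + η := by positivity
    nlinarith [H.pos])
  exact ⟨h.mono fun n hn => Nat.le_mul_of_pos_right _ (H.q_pos n hn),
    h.mono fun n hn => Nat.le_mul_of_pos_left _ (H.u_pos n hn)⟩

theorem Times.grows_maxRowTime (H : Times c g δ u q) (hg : 4 ≤ g) :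
    Grows (fun n => (problem c g n 0).maxRowTime (u n) (q n)) 2 := by
  have hg' : (4 : ℝ) ≤ g := by exact_mod_cast hg
  have hg1 : 1 / (g : ℝ) ≤ 1 / 4 := one_div_le_one_div_of_le (by norm_num) hg'
  have hg0 : 0 < 1 / (g : ℝ) := by positivity
  obtain ⟨hu, hq⟩ := H.grows_u (by omega) (η := 1 / 4) (by norm_num)
  have hu1 := hu.add (Grows.const 1 (by positivity))
  have hq1 := (hq.add (Grows.const 1 (by positivity))).le (b := 1) (by linarith)
  have h1 := (((grows_numBits c (η := 1 / 4) (by norm_num)).mul hu1).le (b := 1)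
    (by linarith)).add (Grows.const 1 zero_le_one)
  exact ((Grows.id.mul h1).add (Grows.id.mul hq1)).le (by norm_num)

/-- Since `g ≥ 4 * (p + 1)`, the power `N ^ p` grows more slowly than the square root of `n`, and
building the grid with `N` times two updates stays within `O(n)`. All the blocks together then need
only `O(n ^ (3 - 1 / g))`. -/
theorem Times.grows_blockTime (H : Times c g δ u q) (hg : 4 * (p + 1) ≤ g) (R K : ℕ) :
    Grows (fun n => (problem c g n 0).blockTime R (K * numVerts c g n ^ p) (u n)) 1 := by
  have hg' : (4 : ℝ) * (p + 1) ≤ g := by exact_mod_cast hg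
  have hp : (0 : ℝ) < p + 1 := by positivity
  have hg1 : 1 / (g : ℝ) ≤ 1 / (4 * (p + 1)) := one_div_le_one_div_of_le (by positivity) hg'
  have e : (1 : ℝ) / (4 * (p + 1)) * (p + 1) = 1 / 4 := by field_simp
  have hη : (0 : ℝ) < 1 / (4 * (p + 1)) := by positivity
  have hη4 : (1 : ℝ) / (4 * (p + 1)) ≤ 1 / 4 := by
    have : (0 : ℝ) ≤ 1 / (4 * (p + 1)) * p := by positivity
    linarith
  have hN := grows_numVerts (show 0 < g by omega) c hη
  have h1 := (((hN.pow p).const_mul K).const_mul 20).le (b := 1) (by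
    have h0 : (0 : ℝ) ≤ p := by positivity
    nlinarith)
  have hu := (((H.grows_u (by omega) hη).1.const_mul 40).add
    (Grows.const 1200 (by positivity)))
  have h2 := (hN.mul hu).le (b := 1) (by linarith)
  have h3 := (Grows.id.mul (Grows.const (4 * R + 60) le_rfl)).le (b := 1) (by norm_num)
  exact (((h1.add h2).add h3).add (Grows.const (8 * R) zero_le_one)).add
    (Grows.const 80 zero_le_one)

theorem Times.grows_apspTime (H : Times c g δ u q) (hg : 4 * (p + 1) ≤ g) (R K : ℕ) :
    Grows (fun n => apspTime R (K * numVerts c g n ^ p) (u n) (q n) c g n (limitExp c g u q n))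
      (3 - δ / (4 * g)) := by
  have hg0 : (0 : ℝ) < g := by exact_mod_cast (by omega : 0 < g)
  have hg1 : (1 : ℝ) ≤ g := by exact_mod_cast (by omega : 1 ≤ g)
  -- The gain is `10 * η`. Two units are lost in `grows_required`, and one each for the number of
  -- limits, of shapes and of squarings; `5 * η = δ / (4 * g)` is left.
  set η := δ / (20 * g) with hη
  have hδ := H.pos
  have hη0 : 0 < η := by positivity
  have e1 : δ / (2 * g) = 10 * η := by rw [hη]; field_simp; norm_num
  have e2 : δ / (4 * g) = 5 * η := by rw [hη]; field_simp; norm_num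
  have e3 : 10 * η ≤ 1 / g := by
    rw [← e1, div_le_div_iff₀ (by positivity) hg0]
    nlinarith [H.le_one]
  have e4 : (1 : ℝ) / g ≤ 1 := by rw [div_le_one hg0]; exact hg1
  have hreq := H.grows_required (by omega) hη0
  have hpow := (hreq.const_mul 2).mono fun n hn => two_pow_limitExp_le (c := c) (g := g) (u := u)
    (q := q) hn
  have hlim := hpow.of_two_pow hη0
  rw [e1] at hpow
  have hn2 := (Grows.id.mul Grows.id).le (b := 3 - 8 * η) (by linarith)
  have c0 : ∀ (k : ℕ), Grows (fun _ => k) (3 - 8 * η) := fun k => Grows.const k (by linarith)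
  have hatt := (((((hpow.le (b := 3 - 8 * η) (by linarith)).add
    ((H.grows_maxRowTime (by omega)).le (b := 3 - 8 * η) (by linarith))).const_mul 200).add
    (((grows_numBlocks (show 0 < g by omega) c).mul ((H.grows_blockTime hg R K).add
      (Grows.const 30 zero_le_one))).le (b := 3 - 8 * η) (by linarith))).add
    (hn2.mul (Grows.const 20 le_rfl) |>.le (b := 3 - 8 * η) (by linarith))).add (c0 100)
  have hprod := (hlim.mul (((grows_sideExp (show 0 < g by omega) hη0).mul
    (hatt.add (c0 30))).add (Grows.const 30 (by linarith)))).add (Grows.const 20 (by linarith))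
  have hn60 := Grows.id.mul Grows.id |>.mul (Grows.const 60 le_rfl)
  have hL := grows_numBits c hη0
  have hsq := hL.mul ((hprod.add (hn60.le (by linarith))).add (Grows.const 40 (by linarith)))
  have hsetup := ((((hn60.add (Grows.const (12 * c) (by norm_num))).add
    (Grows.const (11 * g) (by norm_num))).add ((((grows_sideExp (show 0 < g by omega) hη0).mono
      (h := sideExp g) fun n _ => Nat.le_succ _).const_mul 30).le (by linarith))).add
    ((hL.const_mul 40).le (by linarith))).add (Grows.const 300 (by norm_num))
  exact (((hsq.add (hsetup.le (by linarith))).add (hn60.le (by linarith))).add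
    (Grows.const 100 (by linarith))).le (by linarith)

end growth

/-! ### The word length -/

section feasible

variable {c g p K R : ℕ} {u q : ℕ → ℕ} {δ : ℝ} {D : DynAlg} {k : UpdateKind}

theorem le_of_sum_le {x1 x2 x3 x4 x5 x6 x7 x8 x9 x10 b : ℕ} (h : x1 + x2 + x3 + x4 + x5 + x6 + x7 + x8 + x9 + x10 ≤ b) :
    x1 ≤ b ∧ x2 ≤ b ∧ x3 ≤ b ∧ x4 ≤ b ∧ x5 ≤ b ∧
    x6 ≤ b ∧ x7 ≤ b ∧ x8 ≤ b ∧ x9 ≤ b ∧ x10 ≤ b := by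
  omega

/-- All the quantities that have to fit into a word are collected in one sum, so that a single
exponent serves for all of them. -/
theorem Times.polyBdd (H : Times c g δ u q) (hg : 4 * (p + 1) ≤ g) (D : DynAlg) (d K : ℕ) :
    PolyBdd fun n => (numVerts c g n + 2) ^ D.wordExp + numVerts c g n ^ d +
      numVerts c g n * numVerts c g n + 4 * infDist c n + 2 * (n * n) +
      (K * numVerts c g n ^ p + numVerts c g n * (2 * u n)) +
      (2 ^ limitExp c g u q n + (problem c g n 0).maxRowTime (u n) (q n)) +
      numBits c n * (limitExp c g u q n * ((sideExp g n + 1) *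
        ((problem c g n 0).numBlocks * (n + 1)))) + 2 ^ g + (3 * numBits c n + 3) := by
  have hg0 : 0 < g := by omega
  have hV : PolyBdd (numVerts c g) := ⟨_, grows_numVerts hg0 c one_pos⟩
  have hX : PolyBdd (infDist c) := ⟨_, grows_infDist c⟩
  have hL : PolyBdd (numBits c) := ⟨_, grows_numBits c one_pos⟩
  have hn : PolyBdd fun n => n := ⟨_, Grows.id⟩
  have hu : PolyBdd u := ⟨_, (H.grows_u hg0 one_pos).1⟩
  have hpow := ((H.grows_required hg0 one_pos).const_mul 2).mono fun n hn =>
    two_pow_limitExp_le (c := c) (g := g) (u := u) (q := q) hn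
  have he : PolyBdd (limitExp c g u q) := ⟨_, hpow.of_two_pow one_pos⟩
  have hm : PolyBdd _ := ⟨_, H.grows_maxRowTime (by omega)⟩
  have hs : PolyBdd _ := ⟨_, grows_sideExp hg0 one_pos⟩
  have hb : PolyBdd _ := ⟨_, grows_numBlocks hg0 c⟩
  have hc := PolyBdd.const
  exact ((((((((((hV.add (hc 2)).pow _).add (hV.pow d)).add (hV.mul hV)).add ((hc 4).mul hX)).add
    ((hc 2).mul (hn.mul hn))).add (((hc K).mul (hV.pow p)).add (hV.mul ((hc 2).mul hu)))).add
    (PolyBdd.add ⟨_, hpow⟩ hm)).add (hL.mul (he.mul (hs.mul (hb.mul (hn.add (hc 1))))))).add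
    (hc (2 ^ g))).add (((hc 3).mul hL).add (hc 3))

theorem Times.exists_feasible (H : Times c g δ u q) (hg : 4 * (p + 1) ≤ g)
    (hprep : D.prep.Below R) (hupd : D.upd.Below R) (hqry : D.qry.Below R) (hR : 3 ≤ R)
    (hsolves : ∀ n, 1 ≤ n → D.SolvesAt k (g * (c + 1) + 5) (numVerts c g n)
      (K * numVerts c g n ^ p) (u n) (q n)) :
    ∃ κ, 1 ≤ κ ∧ ∀ n : ℕ, 1 ≤ n → ∀ μ : Machine, μ.Z = ((n : ℤ) + 2) ^ κ → 20 ≤ μ.K →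
      Feasible μ D k (g * (c + 1) + 5) R (K * numVerts c g n ^ p) (u n) (q n) c g n
        (limitExp c g u q n) (blockExp g u q n) := by
  obtain ⟨κ, hκ⟩ := (H.polyBdd hg D (g * (c + 1) + 5) K).exists_le_pow
  refine ⟨κ + 1, by omega, fun n hn μ hZ hK => ?_⟩
  obtain ⟨l1, l2, l3, l4, l5, l6, l7, l8, l9, l10⟩ := le_of_sum_le (hκ n hn)
  have hb : ∀ x : ℕ, x ≤ (n + 2) ^ κ → (x : ℤ) ≤ μ.Z := by
    intro x hx
    have h : (n + 2) ^ κ ≤ (n + 2) ^ (κ + 1) := Nat.pow_le_pow_right (by omega) (by omega)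
    rw [hZ]
    exact_mod_cast hx.trans h
  have hg0 : 0 < g := by omega
  have hX : 4 * (infDist c n : ℤ) ≤ μ.Z := by
    have := hb _ l4
    exact_mod_cast this
  have hX1 : (infDist c n : ℤ) ≤ μ.Z := hb _ ((Nat.le_mul_of_pos_left _ (by norm_num)).trans l4)
  have hpow : ((numVerts c g n ^ (g * (c + 1) + 5) : ℕ) : ℤ) ≤ μ.Z := hb _ l2
  have hsq : ((numVerts c g n * numVerts c g n : ℕ) : ℤ) ≤ μ.Z := hb _ l3
  have hV : (numVerts c g n : ℤ) ≤ μ.Z := by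
    refine le_trans ?_ hsq
    exact_mod_cast Nat.le_mul_self _
  have hword : (((numVerts c g n + 2) ^ D.wordExp : ℕ) : ℤ) ≤ μ.Z := hb _ l1
  have hn2 : ((2 * (n * n) : ℕ) : ℤ) ≤ μ.Z := hb _ l5
  have h2g : ((2 ^ g : ℕ) : ℤ) ≤ μ.Z := hb _ l9
  refine ⟨fun W hW => ⟨fun m w j₀ k₀ hm hw hmw => ?_, hK, hb _ l6, hn, ?_, side_le hg0 hn, hW,
    hX1⟩, hg0, Nat.le_add_left 1 _, blockExp_le g u q n, required_le c g u q n, hb _ l7, hb _ l8,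
    by exact_mod_cast h2g, hb _ l10, hX, hV⟩
  · have hheavy := heavy_le (c := c) (j₀ := j₀) (k₀ := k₀) hg0 hn hm hw hmw W
    refine ⟨hK, hsolves n hn, hprep, hupd, hqry, hR, ?_, ⟨hn, one_le_infDist c n, hm, hw, hW,
      lt_two_pow_numBits c n, two_pow_numBits_le c n, ?_⟩, hheavy, hheavy.trans ?_, hV, ?_, hX⟩
    · change ((numVerts c g n : ℤ) + 2) ^ D.wordExp ≤ _
      exact_mod_cast hword
    · change 2 * m * (2 * w + numBits c n + 3) ≤ 2 * 2 ^ sideExp g n * (numBits c n + 5)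
      have hmw : m * w = 2 ^ sideExp g n := hmw
      have h1 : m * (numBits c n + 3) ≤ m * w * (numBits c n + 3) :=
        Nat.mul_le_mul_right _ (Nat.le_mul_of_pos_right m hw)
      rw [← hmw]
      calc 2 * m * (2 * w + numBits c n + 3) = 4 * (m * w) + 2 * (m * (numBits c n + 3)) := by ring
        _ ≤ 4 * (m * w) + 2 * (m * w * (numBits c n + 3)) := by omega
        _ = _ := by ring
    · exact_mod_cast hpow
    · change (numVerts c g n : ℤ) * numVerts c g n ≤ _
      exact_mod_cast hsq
  · change 2 * ((n : ℤ) * n) ≤ _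
    exact_mod_cast hn2

end feasible

/-- A data structure that is faster than allowed gives a fast algorithm for APSP. -/
theorem DynAlg.Solves.apspSolvableInTime {D : DynAlg} {k : UpdateKind} {c g p : ℕ} {q u : ℕ → ℝ}
    {ε : ℝ} (hg : 4 * (p + 1) ≤ g) (hε : 0 < ε)
    (hO : (fun N : ℕ => q N * u N) =O[Filter.atTop] (fun N : ℕ => (N : ℝ) ^ (1 - ε)))
    (h : D.Solves k (g * (c + 1) + 5) p q u) :
    APSPSolvableInTime c (3 - min ε 1 / (4 * g)) := by
  obtain ⟨K, hK⟩ := h.exists_solvesAt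
  obtain ⟨R₁, h₁⟩ := D.prep.exists_below
  obtain ⟨R₂, h₂⟩ := D.upd.exists_below
  obtain ⟨R₃, h₃⟩ := D.qry.exists_below
  set R := R₁ + R₂ + R₃ + 3
  have hV : ∀ n, 2 ≤ numVerts c g n := fun n => by
    have := (numVerts_bounds c g n).1
    omega
  have H : Times c g (min ε 1) (fun n => ⌊u (numVerts c g n)⌋₊)
      (fun n => ⌊q (numVerts c g n)⌋₊) := by
    refine ⟨by positivity, min_le_right _ _, fun n _ => ?_, fun n _ => ?_, ?_⟩
    · exact (Nat.one_le_floor_iff _).2 (h.one_le (by omega) (hV n)).2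
    · exact (Nat.one_le_floor_iff _).2 (h.one_le (by omega) (hV n)).1
    -- The finitely many exceptions of the asymptotic bound are absorbed by the constant, because
    -- the right-hand side never vanishes for `N ≥ 1`.
    · obtain ⟨C, hC0, hC⟩ := Asymptotics.bound_of_isBigO_nat_atTop hO
      refine ⟨C, fun n _ => ?_⟩
      set N := numVerts c g n
      have hN : (1 : ℝ) ≤ N := by exact_mod_cast (by have := hV n; omega : 1 ≤ N)
      obtain ⟨hq, hu⟩ := h.one_le (by omega) (hV n)
      have hN0 : 0 < (N : ℝ) ^ (1 - ε) := by positivity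
      have h1 := hC hN0.ne'
      rw [Real.norm_of_nonneg (by positivity), Real.norm_of_nonneg hN0.le] at h1
      push_cast
      calc (⌊u N⌋₊ : ℝ) * ⌊q N⌋₊ ≤ u N * q N :=
            mul_le_mul (Nat.floor_le (by linarith)) (Nat.floor_le (by linarith)) (by positivity)
              (by linarith)
        _ = q N * u N := mul_comm _ _
        _ ≤ C * (N : ℝ) ^ (1 - ε) := h1
        _ ≤ _ := by
            gcongr
            exact min_le_left _ _
  obtain ⟨κ, hκ1, hκ⟩ := H.exists_feasible (R := R) hg (h₁.mono (by omega)) (h₂.mono (by omega))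
    (h₃.mono (by omega)) (by omega) fun n _ => hK _ (by have := hV n; omega)
  obtain ⟨C, hC⟩ := H.grows_apspTime hg R K
  -- Stored numbers are at most `Z = (n + 2) ^ κ`, and terms have height at most 20, so words up to
  -- `Z ^ 20` are sufficient.
  refine ⟨apspCode D k R c g, κ * 20, C, fun n hn G hG => ?_⟩
  have h2 : (2 : ℤ) ≤ ((n : ℤ) + 2) ^ κ := by
    calc (2 : ℤ) ≤ ((n : ℤ) + 2) ^ 1 := by linarith [Int.natCast_nonneg n]
      _ ≤ _ := pow_le_pow_right₀ (by linarith [Int.natCast_nonneg n]) hκ1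
  obtain ⟨σ, s, T, t, hE, hT, hA, hans, ht⟩ := runs_apsp (μ := ⟨((n : ℤ) + 2) ^ κ, 20, h2⟩) le_rfl
    hG hn (hκ n hn _ rfl le_rfl) G.input ⟨fun _ _ => rfl, rfl⟩
  refine ⟨σ, T, ?_, le_trans ?_ (hC n hn), ?_⟩
  · rw [wordBound, pow_mul]; exact hE
  · exact_mod_cast hT.trans ht
  · rw [hA.2]; exact hans

end PlanarAPSP

theorem mainTheorem6 (hAPSP : PlanarAPSP.APSPConjecture) (k : PlanarAPSP.UpdateKind)
    (ε : ℝ) (hε : 0 < ε) (p : ℕ) :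
    ∃ d : ℕ, ¬ ∃ (q u : ℕ → ℝ) (D : PlanarAPSP.DynAlg),
      (fun N : ℕ => q N * u N) =O[Filter.atTop] (fun N : ℕ => (N : ℝ) ^ (1 - ε)) ∧
      D.Solves k d p q u := by
  -- The conjecture is applied with the saving that the reduction achieves for `g = 4 * (p + 1)`.
  -- This `g` does not depend on `c`, so `d = g * (c + 1) + 5` can be chosen afterwards.
  obtain ⟨c, hc⟩ := hAPSP (min ε 1 / (4 * (4 * (p + 1) : ℕ))) (by positivity)
  refine ⟨4 * (p + 1) * (c + 1) + 5, ?_⟩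
  rintro ⟨q, u, D, hO, h⟩
  exact hc (h.apspSolvableInTime le_rfl hε hO)
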